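/- **Setting.** Fix $0<\varepsilon\le\frac1{10}$, $0<\gamma<\frac1{150}$, $\kappa_0>0$, $\alpha>\frac14$, $B\ge 20$ with $B\varepsilon<\frac12$, $A\ge 60B$, $\beta\ge(4A+8)\varepsilon+\alpha$ and constants $C_0,K>0$. For $N\in\mathbb N$ let $n=2[N^{\varepsilon}/2]+1$, $\tau=N^\beta$, $t=\tau/N$, $\eta_m=2^mn^\gamma/N$, and $\varrho_{sc}(x)=\frac1{2\pi}\sqrt{(4-x^2)_+}$. Let $\hat H=(N^{-1/2}z_{jk})$ be an $N\times N$ Hermitian Wigner matrix (independent entries; real and imaginary parts of $z_{jk}$, $j<k$, i.i.d. with law $\nu_0$ of mean $0$ and variance $\frac12$; $z_{jj}$ real i.i.d. with law $\tilde\nu_0$ of mean $0$ and variance $1$), $V$ an independent GUE matrix with entries of variance $1/N$, and $H_t=e^{-t/2}\hat H+(1-e^{-t})^{1/2}V$. Let $\mu(d\lambda)=u(\lambda)d\lambda$ be the law of the ordered GUE eigenvalues on $\Xi^{(N)}=\{\lambda_1<\dots<\lambda_N\}$ and let $f$ be the smooth density with respect to $\mu$ of the law of the ordered eigenvalues of $H_t$.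 *Good configurations.* With $\mathcal N(I)=\#\{j:\lambda_j\in I\}$ and $I_m(E)=[E-\eta_m/2,E+\eta_m/2]$, $\Omega$ is the set of $\lambda$ such that $\big|\frac{\mathcal N(I_m(E))}{N\eta_m}-\varrho_{sc}(E)\big|\le (N\eta_m)^{-1/4}n^{\gamma/12}$ for all integers $0\le m\le\log N$ and all $|E|\le 2-\kappa_0/2$; $\big|\frac{\mathcal N(-\infty,0]}{N/2}-1\big|\le n^{-\gamma/6}$; $\mathcal N(I_0(E))\le KN\eta_0$ for all $E$; and $|\lambda_j|<K$ for all $j$. *Conditioning.* For an index $L$ write $\lambda=(y_-,x,y_+)$ with internal points $x=(\lambda_{L+1},\dots,\lambda_{L+n})$ and external points $y=(y_k)_{k\in J_L}$, $J_L=\{-L,\dots,-1,1,\dots,N-L-n\}$, in increasing order. Let $\mu_y(dx)$ be $\mu$ conditioned on $y$, $f_y=f(y,\cdot)/\int f(y,\cdot)\,d\mu_y$, $\Omega_y=\{x:(y_-,x,y_+)\in\Omega\}$, $I_y=[y_{-1},y_1]$, $\bar y=\frac12(y_{-1}+y_1)$, and $D_{L,y}=\int\frac1{2N}|\nabla_x\sqrt{f_y}|^2d\mu_y$.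 $\mathbb E_f$, $\mathbb E_{f_y}$, $\mathbb P_{f_y}$ refer to $f\mu$ and $f_y\mu_y$. *Good indices.* $L$ is good if $N\kappa_0^{3/2}\le L\le N(1-\kappa_0^{3/2})$, $L+n+1\le N$, $\mathbb E_fD_{L,y}\le C_0N^{1+\alpha}n^2\tau^{-1}$, and $\mathbb E_f\mathbf 1_\Omega\sum_{j\ne a}(N|\lambda_j-\lambda_a|)^{-q}\le C_0n^{3\gamma}$ for $a\in\{L,L+n+1\}$, $q\in\{1,2\}$. *Good external configurations.* $y$ is good if $\mathbb P_{f_y}(\Omega_y)\ge1-C_0e^{-n^{\gamma/12}}$; $|I_y|\le Kn/N$; $D_{L,y}\le C_0N^{1+\alpha}n^4\tau^{-1}$; $\sum_\pm\sum_{k\in J_L,k\ne\pm1}\frac1{N|y_{\pm1}-y_k|}\le C_0n^{3\gamma}$; $\mathbb E_{f_y}\mathbf 1_{\Omega_y}\sum_\pm\sum_{j=1}^n(N|x_j-y_{\pm1}|)^{-q}\le C_0n^{4\gamma}$ for $q=1,2$; and $\mathbb E_{f_y}\mathbf 1_{\Omega_y}\sup_{E}\big|n^{-\gamma}\#\{i:|x_i-E|\le\tfrac12\eta_0\}-\varrho_{sc}(E)\big|\le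 n^{-\gamma/12}$, the supremum over $E\in[y_{-1}+\eta_0/2,\,y_1-\eta_0/2]$. *Rescaling.* Let $\tilde y_k=2(y_k-\bar y)/|I_y|$, $U(x)=-\frac2n\sum_{k\in J_L,\,|k|<n^B}\log|x-\tilde y_k|$, and let $\varrho_n$ be the one-point density (a probability density on $[-1,1]$) of the probability measure on $[-1,1]^n$ proportional to $\exp\big[-n\sum_iU(x_i)+2\sum_{i<j}\log|x_i-x_j|\big]dx$. Let $p_j$ be the orthonormal polynomials on $[-1,1]$ for the weight $e^{-nU}$ and $\psi_j=p_je^{-nU/2}$. **Lemma (regularity of density).** For every $\kappa>0$ there are $C$ and $N_0$, depending only on $\kappa$ and the fixed parameters above, such that the following holds for all $N\ge N_0$. Let $L$ be a good index and $y$ a good external configuration satisfying $$\sum_{k\in J_L,\,1<|k|<n^B}\Big[\frac1{|\tilde y_k-1|}+\frac1{|\tilde y_k+1|}\Big]\le C_0n^{1+3\gamma},\qquad \int_{-1+n^{-A}}^{1-n^{-A}}\Big[\frac1{(x+1)^2}+\frac1{(1-x)^2}\Big]\varrho_n(x)\,dx\le C_0n^{1+4\gamma}.$$ Then $\varrho_n$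 is differentiable at every $x$ with $|x|\le1-\kappa$, and for all such $x$ $$|\varrho_n'(x)|\le Cn^{3\gamma}\big(\psi_{n-1}^2(x)+\psi_n^2(x)+1\big),\qquad n^{3\gamma}\big(\psi_{n-1}^2(x)+\psi_n^2(x)+1\big)\le Cn^{1-\frac18+14\gamma},\qquad |\varrho_n'(x)|\le Cn^{1-\frac18+14\gamma}.$$ Moreover the density in the original units is pointwise close to the semicircle value: $$\sup_{|x|\le1-2\kappa}\Big|\frac{2n}{N|I_y|}\,\varrho_n(x)-\varrho_{sc}(\bar y)\Big|\le Cn^{-\gamma/12}.$$ -/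

import Mathlib

open MeasureTheory ProbabilityTheory
open scoped ENNReal ContDiff Polynomial

noncomputable section

namespace LocalEq

/-! ### Parameters -/

/-- The numerical parameters of the setting: the exponents `eps, gam, alp, bet`, the spectral
cutoff `kap`, the cutoff exponents `A, B`, and the constants `C, K` that occur in the
definitions of the good sets (all these sets are increasing in `C` and in `K`). -/
structure Params where
  eps : ℝ
  gam : ℝ
  kap : ℝ
  alp : ℝ
  bet : ℝ
  A : ℝ
  B : ℝ
  C : ℝ
  K : ℝ

/-- The number `n = 2 [N^ε / 2] + 1` of internal points. -/
abbrev Params.n (p : Params) (N : ℕ) : ℕ := 2 * ⌊(N : ℝ) ^ p.eps / 2⌋₊ + 1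

/-- `τ = N^β`. -/
def Params.tau (p : Params) (N : ℕ) : ℝ := (N : ℝ) ^ p.bet

/-- The time `t = τ / N`. -/
def Params.time (p : Params) (N : ℕ) : ℝ := p.tau N / N

/-- The density of the semicircle law; `√` vanishes on negative numbers. -/
def rhoSC (x : ℝ) : ℝ := 1 / (2 * Real.pi) * √(4 - x ^ 2)

/-! ### The matrix ensemble and the law of its ordered eigenvalues -/

/-- The Hermitian matrix `N^{-1/2} (z_{ij})` with `z_{ij} = a_{ij} + √-1 a_{ji}` for `i < j` and
`z_{ii} = a_{ii}`, built from an array `a` of real numbers. -/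
def hermOf (N : ℕ) (a : Fin N → Fin N → ℝ) : Matrix (Fin N) (Fin N) ℂ :=
  Matrix.of fun i j =>
    ((1 / √(N : ℝ) : ℝ) : ℂ) *
      (if i < j then (a i j : ℂ) + (a j i : ℂ) * Complex.I
       else if j < i then (a j i : ℂ) - (a i j : ℂ) * Complex.I
       else (a i i : ℂ))

theorem hermOf_isHermitian (N : ℕ) (a : Fin N → Fin N → ℝ) : (hermOf N a).IsHermitian := by
  ext i j
  simp only [hermOf, Matrix.conjTranspose_apply, Matrix.of_apply, Complex.star_def, map_mul,
    Complex.conj_ofReal]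
  congr 1
  rcases lt_trichotomy i j with h | h | h
  · simp [h, not_lt_of_gt h]
  · subst h; simp
  · simp [h, not_lt_of_gt h, sub_eq_add_neg]

/-- Independent real entries: law `ν'` on the diagonal, law `ν` off the diagonal. -/
def entryLaw (N : ℕ) (ν ν' : Measure ℝ) : Measure (Fin N → Fin N → ℝ) :=
  Measure.pi fun i => Measure.pi fun j => if i = j then ν' else ν

/-- `H_t = e^{-t/2} Ĥ + (1 - e^{-t})^{1/2} V` (Ornstein-Uhlenbeck flow at time `t`). -/
def flowMatrix (N : ℕ) (t : ℝ) (a g : Fin N → Fin N → ℝ) : Matrix (Fin N) (Fin N) ℂ :=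
  Real.exp (-t / 2) • hermOf N a + √(1 - Real.exp (-t)) • hermOf N g

theorem flowMatrix_isHermitian (N : ℕ) (t : ℝ) (a g : Fin N → Fin N → ℝ) :
    (flowMatrix N t a g).IsHermitian := by
  have h1 := (hermOf_isHermitian N a).eq
  have h2 := (hermOf_isHermitian N g).eq
  unfold flowMatrix Matrix.IsHermitian
  rw [Matrix.conjTranspose_add, Matrix.conjTranspose_smul, Matrix.conjTranspose_smul, h1, h2]
  simp

/-- The eigenvalues of a Hermitian matrix in increasing order. -/
def ordEig {N : ℕ} {H : Matrix (Fin N) (Fin N) ℂ} (hH : H.IsHermitian) (i : Fin N) : ℝ :=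
  hH.eigenvalues₀ (Fin.cast (Fintype.card_fin N).symm i.rev)

/-- The law of the ordered eigenvalues of `H_t`, where `Ĥ` is the Wigner matrix with entry laws
`ν₀` (real and imaginary parts off the diagonal) and `ν₁` (diagonal), and `V` is an independent
GUE matrix whose elements have variance `1 / N`. -/
def eigLaw (N : ℕ) (t : ℝ) (ν₀ ν₁ : Measure ℝ) : Measure (Fin N → ℝ) :=
  ((entryLaw N ν₀ ν₁).prod (entryLaw N (gaussianReal 0 (1 / 2)) (gaussianReal 0 1))).map
    fun w => ordEig (flowMatrix_isHermitian N t w.1 w.2)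

/-- The configuration space of ordered points. -/
def Xi (N : ℕ) : Set (Fin N → ℝ) := {lam | StrictMono lam}

open Classical in
/-- The density `u` of the ordered eigenvalues of GUE. -/
def gueDensity (N : ℕ) (lam : Fin N → ℝ) : ℝ :=
  if lam ∈ Xi N then
    (N.factorial : ℝ) *
      ((N : ℝ) ^ ((N : ℝ) ^ 2 / 2) /
        ((2 * Real.pi) ^ ((N : ℝ) / 2) * ∏ j ∈ Finset.Icc 1 N, (j.factorial : ℝ))) *
      Real.exp (-((N : ℝ) / 2) * ∑ j, lam j ^ 2) *
      (∏ i, ∏ j ∈ Finset.Ioi i, (lam i - lam j)) ^ 2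
  else 0

/-- The equilibrium measure `μ(dλ) = u(λ) dλ`. -/
def gueMeasure (N : ℕ) : Measure (Fin N → ℝ) :=
  volume.withDensity fun lam => ENNReal.ofReal (gueDensity N lam)

/-- `f` is the smooth density, with respect to `μ`, of the law of the ordered eigenvalues of
`H_t`. This determines `f` on `Xi N`, and its values elsewhere are never used. -/
def IsEigenvalueDensity (N : ℕ) (t : ℝ) (ν₀ ν₁ : Measure ℝ) (f : (Fin N → ℝ) → ℝ) : Prop :=
  (∀ lam ∈ Xi N, 0 ≤ f lam) ∧ ContDiffOn ℝ ∞ f (Xi N) ∧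
    eigLaw N t ν₀ ν₁ = (gueMeasure N).withDensity fun lam => ENNReal.ofReal (f lam)

/-! ### Good global configurations -/

/-- The number of points in `[a, b]`. -/
def count {N : ℕ} (lam : Fin N → ℝ) (a b : ℝ) : ℕ :=
  (Finset.univ.filter fun j => a ≤ lam j ∧ lam j ≤ b).card

/-- The scales `η_m = 2^m n^γ / N`. -/
def eta (p : Params) (N m : ℕ) : ℝ := 2 ^ m * (p.n N : ℝ) ^ p.gam / N

/-- The set `Ω` of good global configurations. -/
def goodGlobal (p : Params) (N : ℕ) : Set (Fin N → ℝ) :=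
  {lam |
    (∀ m : ℕ, (m : ℝ) ≤ Real.log N → ∀ E : ℝ, |E| ≤ 2 - p.kap / 2 →
      |(count lam (E - eta p N m / 2) (E + eta p N m / 2) : ℝ) / (N * eta p N m) - rhoSC E|
        ≤ 1 / (N * eta p N m) ^ (1 / 4 : ℝ) * (p.n N : ℝ) ^ (p.gam / 12)) ∧
    |((Finset.univ.filter fun j => lam j ≤ 0).card : ℝ) / ((N : ℝ) / 2) - 1|
        ≤ (p.n N : ℝ) ^ (-(p.gam / 6)) ∧
    (∀ E : ℝ, (count lam (E - eta p N 0 / 2) (E + eta p N 0 / 2) : ℝ) ≤ p.K * N * eta p N 0) ∧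
    ∀ j, |lam j| < p.K}

/-! ### External and internal points

An external configuration is a family `y_k`, where `k` runs over
`J_L = {-L, …, -1, 1, …, N - L - n}`. It is written as a function on `ℤ`, of which only the
values on `J_L` are ever used. -/

/-- The index set `J_L`. -/
def JL (N n L : ℕ) : Finset ℤ := (Finset.Icc (-(L : ℤ)) ((N : ℤ) - L - n)).erase 0

/-- The configuration `(y_-, x, y_+)`. -/
def glue (N n L : ℕ) (y : ℤ → ℝ) (x : Fin n → ℝ) (i : Fin N) : ℝ :=
  if h : L ≤ i.val ∧ i.val < L + n then x ⟨i.val - L, by omega⟩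
  else if i.val < L then y ((i.val : ℤ) - L)
  else y ((i.val : ℤ) - L - n + 1)

/-- The external points of a configuration: `y_k = λ_{L+k+1}` for `k < 0` and `y_k = λ_{L+n+k}`
for `k > 0`, in terms of the numbering `λ_1 < … < λ_N`. -/
def ext (N n L : ℕ) (lam : Fin N → ℝ) (k : ℤ) : ℝ :=
  if h : k < 0 ∧ 0 ≤ k + L ∧ (k + L).toNat < N then lam ⟨(k + L).toNat, h.2.2⟩
  else if h : 0 < k ∧ (k + L + n - 1).toNat < N then lam ⟨(k + L + n - 1).toNat, h.2⟩
  else 0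

/-- The conditional equilibrium measure `μ_y(dx)`. -/
def condEq (N n L : ℕ) (y : ℤ → ℝ) : Measure (Fin n → ℝ) :=
  volume.withDensity fun x =>
    ENNReal.ofReal (gueDensity N (glue N n L y x) / ∫ x', gueDensity N (glue N n L y x'))

/-- The conditional density `f_y(x)` with respect to `μ_y`. -/
def condDens {N : ℕ} (n L : ℕ) (f : (Fin N → ℝ) → ℝ) (y : ℤ → ℝ) (x : Fin n → ℝ) : ℝ :=
  f (glue N n L y x) / ∫ x', f (glue N n L y x') ∂(condEq N n L y)

/-- The measure `f_y μ_y`. -/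
def condLaw {N : ℕ} (n L : ℕ) (f : (Fin N → ℝ) → ℝ) (y : ℤ → ℝ) : Measure (Fin n → ℝ) :=
  (condEq N n L y).withDensity fun x => ENNReal.ofReal (condDens n L f y x)

/-- The local Dirichlet form `D_{L,y}(g) = ∫ (1 / 2N) |∇g|² dμ_y`. -/
def dirichlet (N n L : ℕ) (y : ℤ → ℝ) (g : (Fin n → ℝ) → ℝ) : ℝ≥0∞ :=
  ∫⁻ x, ENNReal.ofReal (1 / (2 * N) * ∑ j, (fderiv ℝ g x (Pi.single j 1)) ^ 2)
    ∂(condEq N n L y)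

/-- `D_{L,y}(√f_y)`. -/
def localD {N : ℕ} (n L : ℕ) (f : (Fin N → ℝ) → ℝ) (y : ℤ → ℝ) : ℝ≥0∞ :=
  dirichlet N n L y fun x => √(condDens n L f y x)

/-! ### Good indices and good external configurations -/

/-- `∑_{j ≠ a} [N |λ_j - λ_a|]^{-q}`. -/
def invSum {N : ℕ} (q : ℕ) (a : Fin N) (lam : Fin N → ℝ) : ℝ :=
  ∑ j ∈ Finset.univ.erase a, 1 / (N * |lam j - lam a|) ^ q

/-- `L` is a good index. In the numbering `λ_1 < … < λ_N` the points with indices `a` and `b`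
below are `λ_L` and `λ_{L+n+1}`; expectations are with respect to `f μ`. -/
def GoodIndex (p : Params) (N : ℕ) (f : (Fin N → ℝ) → ℝ) (L : ℕ) : Prop :=
  N * p.kap ^ (3 / 2 : ℝ) ≤ L ∧ (L : ℝ) ≤ N * (1 - p.kap ^ (3 / 2 : ℝ)) ∧
  (∫⁻ lam, localD (p.n N) L f (ext N (p.n N) L lam)
      ∂((gueMeasure N).withDensity fun lam => ENNReal.ofReal (f lam)))
    ≤ ENNReal.ofReal (p.C * (N : ℝ) ^ (1 + p.alp) * (p.n N : ℝ) ^ 2 * (p.tau N)⁻¹) ∧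
  ∃ a b : Fin N, a.val + 1 = L ∧ b.val = L + p.n N ∧
    ∀ c ∈ ({a, b} : Set (Fin N)), ∀ q ∈ ({1, 2} : Set ℕ),
      (∫⁻ lam in goodGlobal p N, ENNReal.ofReal (invSum q c lam)
          ∂((gueMeasure N).withDensity fun lam => ENNReal.ofReal (f lam)))
        ≤ ENNReal.ofReal (p.C * (p.n N : ℝ) ^ (3 * p.gam))

/-- The section `Ω_y` of the set of good global configurations. -/
def goodSection (p : Params) (N L : ℕ) (y : ℤ → ℝ) : Set (Fin (p.n N) → ℝ) :=
  {x | glue N (p.n N) L y x ∈ goodGlobal p N}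

/-- The length of `I_y = [y_{-1}, y_1]`. -/
def len (y : ℤ → ℝ) : ℝ := y 1 - y (-1)

/-- The midpoint of `I_y`. -/
def mid (y : ℤ → ℝ) : ℝ := (y (-1) + y 1) / 2

/-- `y` is a good external configuration for the index `L`. -/
def GoodExternal (p : Params) (N : ℕ) (f : (Fin N → ℝ) → ℝ) (L : ℕ) (y : ℤ → ℝ) : Prop :=
  StrictMonoOn y (JL N (p.n N) L) ∧
  -- the good section has large conditional probability
  ENNReal.ofReal (1 - p.C * Real.exp (-(p.n N : ℝ) ^ (p.gam / 12)))
    ≤ condLaw (p.n N) L f y (goodSection p N L y) ∧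
  -- the interval is not too long
  len y ≤ p.K * p.n N / N ∧
  -- the local Dirichlet form is small
  localD (p.n N) L f y
    ≤ ENNReal.ofReal (p.C * (N : ℝ) ^ (1 + p.alp) * (p.n N : ℝ) ^ 4 * (p.tau N)⁻¹) ∧
  -- the external points do not accumulate at the ends of the interval
  (∑ k ∈ (JL N (p.n N) L).filter (fun k => k ≠ 1 ∧ k ≠ -1),
      (1 / |N * (y 1 - y k)| + 1 / |N * (y (-1) - y k)|))
    ≤ p.C * (p.n N : ℝ) ^ (3 * p.gam) ∧
  -- neither do the internal points, on average
  (∀ q ∈ ({1, 2} : Set ℕ),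
    (∫⁻ x in goodSection p N L y,
        ENNReal.ofReal (∑ j, (1 / (N * |x j - y 1|) ^ q + 1 / (N * |x j - y (-1)|) ^ q))
        ∂(condLaw (p.n N) L f y))
      ≤ ENNReal.ofReal (p.C * (p.n N : ℝ) ^ (4 * p.gam))) ∧
  -- the semicircle law holds on the scale `n^γ / N` inside the interval
  (∫⁻ x in goodSection p N L y,
      (⨆ E ∈ Set.Icc (y (-1) + eta p N 0 / 2) (y 1 - eta p N 0 / 2),
        ENNReal.ofReal
          |(p.n N : ℝ) ^ (-p.gam) * (count x (E - eta p N 0 / 2) (E + eta p N 0 / 2) : ℝ)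
            - rhoSC E|)
      ∂(condLaw (p.n N) L f y))
    ≤ ENNReal.ofReal ((p.n N : ℝ) ^ (-(p.gam / 12)))

/-! ### The rescaled local equilibrium measure on `[-1, 1]` -/

/-- The rescaled external points `2 (y_k - ȳ) / |I_y|`. -/
def resc (y : ℤ → ℝ) (k : ℤ) : ℝ := 2 * (y k - mid y) / len y

/-- The indices `k` in `J_L` with `|k| < n^B`. -/
def nearIdx (p : Params) (N L : ℕ) : Finset ℤ :=
  (JL N (p.n N) L).filter fun k => |(k : ℝ)| < (p.n N : ℝ) ^ p.B

/-- The potential `U(x) = -(2/n) ∑_{|k| < n^B} log |x - y_k|` (rescaled points). -/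
def potU (p : Params) (N L : ℕ) (y : ℤ → ℝ) (x : ℝ) : ℝ :=
  -(2 / (p.n N : ℝ)) * ∑ k ∈ nearIdx p N L, Real.log |x - resc y k|

/-- The unnormalized density `exp [-n ∑ V(x_i) + 2 ∑_{i<j} log |x_i - x_j|]`. -/
def jointWeight (n : ℕ) (V : ℝ → ℝ) (x : Fin n → ℝ) : ℝ :=
  Real.exp (-(n : ℝ) * ∑ i, V (x i) + 2 * ∑ i, ∑ j ∈ Finset.Ioi i, Real.log |x i - x j|)

/-- The cube `[-1, 1]^n`. -/
def cube (n : ℕ) : Set (Fin n → ℝ) := Set.univ.pi fun _ => Set.Icc (-1) 1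

/-- The one-point density of the probability measure on `[-1, 1]^{m+1}` with the above density:
one variable is fixed, the other `m` are integrated out. -/
def onePoint (m : ℕ) (V : ℝ → ℝ) (x : ℝ) : ℝ :=
  (∫ z in cube m, jointWeight (m + 1) V (Fin.cons x z)) / ∫ z in cube (m + 1), jointWeight (m + 1) V z

/-- The one-point density `ϱ_n` of the rescaled local equilibrium measure. -/
def rho (p : Params) (N L : ℕ) (y : ℤ → ℝ) : ℝ → ℝ :=
  onePoint (p.n N - 1) (potU p N L y)

/-- The weight `e^{-nU}` on `[-1, 1]`. -/
def wgt (p : Params) (N L : ℕ) (y : ℤ → ℝ) (x : ℝ) : ℝ :=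
  Real.exp (-(p.n N : ℝ) * potU p N L y x)

/-- `P 0, P 1, …` are the orthonormal polynomials on `[-1, 1]` with weight `w`
(unique up to signs). -/
def IsOrthonormalPolys (w : ℝ → ℝ) (P : ℕ → ℝ[X]) : Prop :=
  (∀ j, (P j).natDegree = j) ∧
  ∀ j k, ∫ x in (-1 : ℝ)..1, (P j).eval x * (P k).eval x * w x = if j = k then 1 else 0

/-- `ψ_j² = P_j² w`. -/
def psiSq (w : ℝ → ℝ) (P : ℕ → ℝ[X]) (j : ℕ) (x : ℝ) : ℝ := ((P j).eval x) ^ 2 * w x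

/-- The bound on the rescaled external points. -/
def ExternalBound (p : Params) (N L : ℕ) (y : ℤ → ℝ) : Prop :=
  (∑ k ∈ (nearIdx p N L).filter (fun k => 1 < |k|),
      (1 / |resc y k - resc y 1| + 1 / |resc y k - resc y (-1)|))
    ≤ p.C * (p.n N : ℝ) ^ (1 + 3 * p.gam)

/-- The bound on the density `ϱ_n` close to the ends of `[-1, 1]`. -/
def EdgeBound (p : Params) (N L : ℕ) (y : ℤ → ℝ) : Prop :=
  (∫ x in (-1 + (p.n N : ℝ) ^ (-p.A))..(1 - (p.n N : ℝ) ^ (-p.A)),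
      (1 / (x + 1) ^ 2 + 1 / (1 - x) ^ 2) * rho p N L y x)
    ≤ p.C * (p.n N : ℝ) ^ (1 + 4 * p.gam)

end LocalEq

end

noncomputable section

namespace LocalEq

section

/-! ### The polynomial weight -/

/-! Off its zeros, `e^{-nU}` is the polynomial weight `∏ (x - u)²`, where `u` runs over the rescaled
near external points. These all satisfy `|u| ≥ 1`, and `±1` are among them. The gas is
determinantal, so `n ϱ_n(x)` is the diagonal `K_n(x, x)` of the weighted reproducing kernel
(`onePoint_eq`). The proof bounds the derivative of this diagonal by the two functions `ψ_{n-1}`,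
`ψ_n`, then bounds these pointwise, and compares the density with that of an equidistant lattice.

Derivative. The weight vanishes at `±1`, so integration by parts has no boundary terms, and its
logarithmic derivative is `∑ 2 / (z - u)`. Expanding `1 / (z - u)` about the bulk point `x` produces
factors `x - z`, and the Christoffel–Darboux formula turns `(x - z) K_n(x, z)` into a combination of
`ψ_{n-1}` and `ψ_n` alone. The zeroth order terms cancel, which gives `|∂ K_n(x, x)| ≤ c T (ψ_{n-1}²
+ ψ_n²)` (`exists_hasDerivAt_kern_self`). The same method gives `|F'| ≤ c T F` for `F = ψ_{n-1}² +
ψ_n²` (`exists_hasDerivAt_pairSq`). Here `T` controls `∑ 1 / |x - u|` and `∑ ∫ ψ_j² / |z - u|` for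
`j = n - 1, n`. It is of order `n^{1+3γ}`: the points other than `±1` are covered by the assumption
on external points, and the singular moments at `±1` by a virial identity (`sum_extMoment_le`).

Size of `F`. By its differential inequality, `F(x)` is at most a multiple of `T` times the mass of
`F` in a window of half-width `η = n^{-1/8}`. A loop equation for the resolvent matrix elements of a
single `ψ_m` (`loop_equation`) shows that `ψ_m²` has little mass where the gas has many particles:
`M` particles in the window leave at most `32 η² T / (δ M)` for `F` (`integral_sq_mul_pois_le`,
`integral_pairSq_le`). With `M` of order `n^{7/8}` this yields `F ≤ C n^{7/8+6γ}`.

Particles in the window. Integrating by parts against the displacement of each particle from the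
lattice site of its rank, and using that the forces are monotone, bounds the mean square
displacement by the convexity of the external potential and the force on the ideal lattice
(`integral_dev_sq_le`). This force is small because the external points are nearly equidistant
(`sum_latForce_sq_le`), which follows by counting the points of one good global configuration at
dyadic scales (`Window.abs_count_sub_le_scale`, `exists_countBound`). Hence a window holds its share
of `n + 1` lattice cells up to `O(n^{7/8-γ/3})` (`ExtBound.abs_integral_dens_sub_le`).

Semicircle. The derivative bound and the bound on the mass of `F` limit the oscillation of the
density over the window, so `K_n(x, x)` is pointwise close to `(n + 1) / 2` (`exists_bulk_const`).
Counting the points of `I_y` gives `ϱ_sc(ȳ) N |I_y| ≈ n + 1`, and the two relations combine to the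
last estimate (`abs_density_sub_le`). -/

/-- The weight `∏ (x - u)²` with double zeros at the points of `S`. -/
def wt (S : Finset ℝ) (x : ℝ) : ℝ := ∏ u ∈ S, (x - u) ^ 2

theorem wt_nonneg (S : Finset ℝ) (x : ℝ) : 0 ≤ wt S x :=
  Finset.prod_nonneg fun _ _ => sq_nonneg _

theorem wt_pos {S : Finset ℝ} {x : ℝ} (h : x ∉ S) : 0 < wt S x :=
  Finset.prod_pos fun u hu => by
    have : x - u ≠ 0 := fun h' => h (by rwa [sub_eq_zero.1 h'])
    positivity

theorem wt_eq_zero {S : Finset ℝ} {x : ℝ} (h : x ∈ S) : wt S x = 0 :=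
  Finset.prod_eq_zero h (by simp)

@[fun_prop]
theorem continuous_wt (S : Finset ℝ) : Continuous (wt S) := by
  unfold wt; fun_prop

/-- The zero at `u` is double, so the quotient is still a polynomial. At `x = u` both sides are zero
because division by zero gives zero, hence no exception is needed. -/
theorem wt_div (S : Finset ℝ) {u : ℝ} (hu : u ∈ S) (x : ℝ) :
    wt S x / (x - u) = (x - u) * ∏ v ∈ S.erase u, (x - v) ^ 2 := by
  unfold wt
  rw [← Finset.mul_prod_erase S _ hu]
  by_cases h : x - u = 0
  · simp [h]
  · field_simp

theorem continuous_wt_div (S : Finset ℝ) {u : ℝ} (hu : u ∈ S) :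
    Continuous fun x => wt S x / (x - u) := by
  simp_rw [wt_div S hu]; fun_prop

/-- The derivative of the weight. -/
def wtDeriv (S : Finset ℝ) (x : ℝ) : ℝ := ∑ u ∈ S, 2 * (wt S x / (x - u))

theorem hasDerivAt_wt (S : Finset ℝ) (x : ℝ) : HasDerivAt (wt S) (wtDeriv S x) x := by
  have := HasDerivAt.fun_finsetProd (u := S) (f := fun u x : ℝ => (x - u) ^ 2)
    (f' := fun u => 2 * (x - u)) (x := x) (fun u _ => by
      simpa using ((hasDerivAt_id x).sub_const u).fun_pow 2)
  refine this.congr_deriv (Finset.sum_congr rfl fun u hu => ?_)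
  rw [wt_div S hu, smul_eq_mul]; ring

@[fun_prop]
theorem continuous_wtDeriv (S : Finset ℝ) : Continuous (wtDeriv S) := by
  unfold wtDeriv
  exact continuous_finsetSum _ fun u hu => (continuous_wt_div S hu).const_mul 2

/-- Integration by parts against a weight that vanishes at the ends of the interval. -/
theorem integral_deriv_mul_wt {𝕜 : Type*} [RCLike 𝕜] {S : Finset ℝ} (h1 : (1 : ℝ) ∈ S)
    (h2 : (-1 : ℝ) ∈ S) {f f' : ℝ → 𝕜} (hf : ∀ x, HasDerivAt f (f' x) x) (hc : Continuous f') :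
    ∫ x in (-1 : ℝ)..1, f' x * (wt S x : 𝕜) = -∫ x in (-1 : ℝ)..1, f x * (wtDeriv S x : 𝕜) := by
  have hfc : Continuous f := continuous_iff_continuousAt.2 fun x => (hf x).continuousAt
  have hw : ∀ x, HasDerivAt (fun x => (wt S x : 𝕜)) (wtDeriv S x : 𝕜) x := fun x => by
    have := (RCLike.ofRealCLM (K := 𝕜)).hasFDerivAt.comp_hasDerivAt x (hasDerivAt_wt S x)
    simpa [Function.comp_def] using this
  have hc1 : Continuous fun x => (wt S x : 𝕜) := by fun_prop
  have hc2 : Continuous fun x => (wtDeriv S x : 𝕜) := by fun_prop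
  have := intervalIntegral.integral_mul_deriv_eq_deriv_mul (a := -1) (b := 1)
    (fun x _ => hf x) (fun x _ => hw x) (hc.intervalIntegrable _ _) (hc2.intervalIntegrable _ _)
  rw [this, wt_eq_zero h1, wt_eq_zero h2]
  simp

/-! ### Expansions in orthonormal polynomials -/

/-- Induction on the degree: a multiple of `P n` removes the top coefficient. The coefficient field
is kept general because the resolvent argument expands polynomials with complex coefficients. -/
theorem exists_expansion {K : Type*} [Field K] [Algebra ℝ K] {P : ℕ → ℝ[X]}
    (hdeg : ∀ j, (P j).natDegree = j) (hne : ∀ j, P j ≠ 0) (n : ℕ) :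
    ∀ f : K[X], f.degree < n →
      ∃ c : ℕ → K, f = ∑ j ∈ Finset.range n, Polynomial.C (c j) * (P j).map (algebraMap ℝ K) := by
  induction n with
  | zero =>
    intro f hf
    exact ⟨0, by simpa using hf⟩
  | succ n ih =>
    intro f hf
    set Q := (P n).map (algebraMap ℝ K) with hQ
    have hQ0 : Q ≠ 0 := by
      simpa [hQ, Polynomial.map_eq_zero] using hne n
    have hQd : Q.natDegree = n := by rw [hQ, Polynomial.natDegree_map, hdeg]
    have hQc : Q.coeff n ≠ 0 := by
      have := Polynomial.leadingCoeff_ne_zero.2 hQ0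
      rwa [Polynomial.leadingCoeff, hQd] at this
    obtain ⟨c, hc⟩ := ih (f - Polynomial.C (f.coeff n / Q.coeff n) * Q) (by
      rw [Polynomial.degree_lt_iff_coeff_zero]
      intro m hm
      rcases Nat.eq_or_lt_of_le hm with rfl | hm
      · rw [Polynomial.coeff_sub, Polynomial.coeff_C_mul]; field_simp; simp
      · rw [Polynomial.coeff_sub, Polynomial.coeff_C_mul,
          Polynomial.coeff_eq_zero_of_natDegree_lt (by omega : Q.natDegree < m)]
        rw [Polynomial.degree_lt_iff_coeff_zero] at hf
        simp [hf m (by omega)])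
    refine ⟨Function.update c n (f.coeff n / Q.coeff n), ?_⟩
    rw [Finset.sum_range_succ, Function.update_self]
    have : ∑ j ∈ Finset.range n, Polynomial.C (Function.update c n (f.coeff n / Q.coeff n) j) *
        (P j).map (algebraMap ℝ K) =
        ∑ j ∈ Finset.range n, Polynomial.C (c j) * (P j).map (algebraMap ℝ K) :=
      Finset.sum_congr rfl fun j hj => by
        rw [Function.update_of_ne (Finset.mem_range.1 hj).ne]
    rw [this, ← hc]
    ring

section Orthonormal

variable {w : ℝ → ℝ} {P : ℕ → ℝ[X]}

theorem IsOrthonormalPolys.ne_zero (hP : IsOrthonormalPolys w P) (j : ℕ) : P j ≠ 0 := by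
  intro h
  have := hP.2 j j
  simp [h] at this

variable {𝕜 : Type*} [RCLike 𝕜]

theorem continuous_eval_ofReal (f : 𝕜[X]) : Continuous fun x : ℝ => f.eval (x : 𝕜) :=
  f.continuous.comp RCLike.continuous_ofReal

theorem eval_map_ofReal (f : ℝ[X]) (x : ℝ) :
    (f.map (algebraMap ℝ 𝕜)).eval (x : 𝕜) = ((f.eval x : ℝ) : 𝕜) := by
  rw [← RCLike.algebraMap_eq_ofReal, Polynomial.eval_map_algebraMap,
    Polynomial.aeval_algebraMap_apply_eq_algebraMap_eval]

/-- Polynomials of degree less than `n` are recovered from their first `n` coefficients. -/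
theorem expansion_eq (hP : IsOrthonormalPolys w P) (hw : Continuous w) {n : ℕ} {f : 𝕜[X]}
    (hf : f.degree < n) (z : 𝕜) :
    ∑ j ∈ Finset.range n, (∫ x in (-1 : ℝ)..1, f.eval (x : 𝕜) * (((P j).eval x : ℝ) : 𝕜) * (w x : 𝕜)) *
      ((P j).map (algebraMap ℝ 𝕜)).eval z = f.eval z := by
  obtain ⟨c, hc⟩ := exists_expansion (K := 𝕜) hP.1 hP.ne_zero n f hf
  -- Orthonormality identifies the abstract coefficients with the integrals against `P j`.
  have key : ∀ j ∈ Finset.range n,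
      (∫ x in (-1 : ℝ)..1, f.eval (x : 𝕜) * (((P j).eval x : ℝ) : 𝕜) * (w x : 𝕜)) = c j := by
    intro j hj
    have : ∀ x : ℝ, f.eval (x : 𝕜) * (((P j).eval x : ℝ) : 𝕜) * (w x : 𝕜) =
        ∑ i ∈ Finset.range n, c i * ((((P i).eval x * (P j).eval x * w x : ℝ)) : 𝕜) := by
      intro x
      rw [hc, Polynomial.eval_finsetSum, Finset.sum_mul, Finset.sum_mul]
      refine Finset.sum_congr rfl fun i _ => ?_
      rw [Polynomial.eval_mul, Polynomial.eval_C, eval_map_ofReal]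
      push_cast; ring
    simp_rw [this]
    rw [intervalIntegral.integral_finsetSum]
    · have h2 : ∀ i ∈ Finset.range n, ∫ x in (-1 : ℝ)..1, c i *
          ((((P i).eval x * (P j).eval x * w x : ℝ)) : 𝕜) = if i = j then c i else 0 := by
        intro i _
        rw [intervalIntegral.integral_const_mul, RCLike.intervalIntegral_ofReal, hP.2 i j]
        split_ifs <;> simp
      rw [Finset.sum_congr rfl h2, Finset.sum_ite_eq' _ _ c, if_pos hj]
    · intro i _
      refine Continuous.intervalIntegrable ?_ _ _
      exact continuous_const.mul (RCLike.continuous_ofReal.comp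
        (((P i).continuous.mul (P j).continuous).mul hw))
  rw [Finset.sum_congr rfl fun j hj => by rw [key j hj]]
  conv_rhs => rw [hc]
  simp [Polynomial.eval_finsetSum]

/-- The expansions of length `n` and `n + 1` both recover `f`, so the additional term vanishes at
every `z`. As `P n` is not the zero polynomial, its coefficient is zero. -/
theorem integral_low_degree (hP : IsOrthonormalPolys w P) (hw : Continuous w) {n : ℕ} {f : 𝕜[X]}
    (hf : f.degree < n) :
    ∫ x in (-1 : ℝ)..1, f.eval (x : 𝕜) * (((P n).eval x : ℝ) : 𝕜) * (w x : 𝕜) = 0 := by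
  have hf' : f.degree < (n + 1 : ℕ) := hf.trans (by exact_mod_cast Nat.lt_succ_self n)
  have h : ∀ z : 𝕜, (∫ x in (-1 : ℝ)..1, f.eval (x : 𝕜) * (((P n).eval x : ℝ) : 𝕜) * (w x : 𝕜)) *
      ((P n).map (algebraMap ℝ 𝕜)).eval z = 0 := by
    intro z
    have h1 := expansion_eq hP hw hf z
    have h2 := expansion_eq hP hw hf' z
    rw [Finset.sum_range_succ, h1] at h2
    simpa using h2
  by_contra hne
  refine hP.ne_zero n ?_
  have : (P n).map (algebraMap ℝ 𝕜) = 0 :=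
    Polynomial.funext fun z => by simpa [hne] using h z
  simpa [Polynomial.map_eq_zero] using this

theorem integral_low_degree_real (hP : IsOrthonormalPolys w P) (hw : Continuous w) {n : ℕ}
    {f : ℝ[X]} (hf : f.degree < n) : ∫ x in (-1 : ℝ)..1, f.eval x * (P n).eval x * w x = 0 := by
  simpa using integral_low_degree (𝕜 := ℝ) hP hw hf

theorem expansion_eq_real (hP : IsOrthonormalPolys w P) (hw : Continuous w) {n : ℕ} {f : ℝ[X]}
    (hf : f.degree < n) (z : ℝ) :
    ∑ j ∈ Finset.range n, (∫ x in (-1 : ℝ)..1, f.eval x * (P j).eval x * w x) * (P j).eval z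
      = f.eval z := by
  simpa using expansion_eq (𝕜 := ℝ) hP hw hf z

end Orthonormal

end

section

/-! ### The reproducing kernel -/

/-- The kernel `∑_{j < n} P_j(x) P_j(z)` as a polynomial in `z`. -/
def kernPoly (P : ℕ → ℝ[X]) (n : ℕ) (x : ℝ) : ℝ[X] :=
  ∑ j ∈ Finset.range n, Polynomial.C ((P j).eval x) * P j

/-- The kernel `∑_{j < n} P_j(x) P_j(z)`. -/
def kern (P : ℕ → ℝ[X]) (n : ℕ) (x z : ℝ) : ℝ := (kernPoly P n x).eval z

theorem kern_eq (P : ℕ → ℝ[X]) (n : ℕ) (x z : ℝ) :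
    kern P n x z = ∑ j ∈ Finset.range n, (P j).eval x * (P j).eval z := by
  simp [kern, kernPoly, Polynomial.eval_finsetSum]

theorem kern_self (P : ℕ → ℝ[X]) (n : ℕ) (x : ℝ) :
    kern P n x x = ∑ j ∈ Finset.range n, (P j).eval x ^ 2 := by
  rw [kern_eq]; exact Finset.sum_congr rfl fun j _ => (sq _).symm

@[fun_prop]
theorem continuous_kern (P : ℕ → ℝ[X]) (n : ℕ) (x : ℝ) : Continuous (kern P n x) :=
  (kernPoly P n x).continuous

theorem degree_derivative_lt_pred {f : ℝ[X]} {n : ℕ} (hf : f.degree < (n + 1 : ℕ)) :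
    f.derivative.degree < n := by
  rw [Polynomial.degree_lt_iff_coeff_zero] at hf ⊢
  intro m hm
  rw [Polynomial.coeff_derivative, hf (m + 1) (by omega), zero_mul]

theorem degree_derivative_lt_of_lt {f : ℝ[X]} {n : ℕ} (hf : f.degree < n) :
    f.derivative.degree < n :=
  (Polynomial.degree_derivative_le).trans_lt hf

section Orthonormal

variable {w : ℝ → ℝ} {P : ℕ → ℝ[X]}

theorem IsOrthonormalPolys.degree_eq (hP : IsOrthonormalPolys w P) (j : ℕ) :
    (P j).degree = j := by
  rw [Polynomial.degree_eq_natDegree (hP.ne_zero j), hP.1]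

theorem degree_kernPoly_lt (hP : IsOrthonormalPolys w P) (n : ℕ) (x : ℝ) :
    (kernPoly P n x).degree < n := by
  unfold kernPoly
  rw [Polynomial.degree_lt_iff_coeff_zero]
  intro m hm
  rw [Polynomial.finsetSum_coeff]
  refine Finset.sum_eq_zero fun j hj => ?_
  rw [Polynomial.coeff_C_mul, Polynomial.coeff_eq_zero_of_natDegree_lt, mul_zero]
  rw [hP.1]
  exact (Finset.mem_range.1 hj).trans_le hm

theorem integral_kern_mul (hw : Continuous w) (n : ℕ) (f : ℝ → ℝ)
    (hf : Continuous f) (x : ℝ) :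
    ∫ z in (-1 : ℝ)..1, kern P n x z * f z * w z =
      ∑ j ∈ Finset.range n, (∫ z in (-1 : ℝ)..1, f z * (P j).eval z * w z) * (P j).eval x := by
  have : ∀ z, kern P n x z * f z * w z =
      ∑ j ∈ Finset.range n, (P j).eval x * (f z * (P j).eval z * w z) := by
    intro z
    rw [kern_eq, Finset.sum_mul, Finset.sum_mul]
    exact Finset.sum_congr rfl fun j _ => by ring
  simp_rw [this]
  rw [intervalIntegral.integral_finsetSum]
  · refine Finset.sum_congr rfl fun j _ => ?_
    rw [intervalIntegral.integral_const_mul, mul_comm]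
  · intro j _
    exact Continuous.intervalIntegrable (by fun_prop) _ _

/-- The reproducing property. -/
theorem integral_kern (hP : IsOrthonormalPolys w P) (hw : Continuous w) {n : ℕ} {f : ℝ[X]}
    (hf : f.degree < n) (x : ℝ) :
    ∫ z in (-1 : ℝ)..1, kern P n x z * f.eval z * w z = f.eval x := by
  rw [integral_kern_mul hw n _ f.continuous, expansion_eq_real hP hw hf]

/-- The off-diagonal recurrence coefficient. -/
def recCoeff (w : ℝ → ℝ) (P : ℕ → ℝ[X]) (n : ℕ) : ℝ :=
  ∫ z in (-1 : ℝ)..1, z * (P n).eval z * (P (n + 1)).eval z * w z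

theorem degree_X_mul_lt {f : ℝ[X]} {n : ℕ} (hf : f.degree < n) :
    (Polynomial.X * f : ℝ[X]).degree < (n + 1 : ℕ) := by
  rw [Polynomial.degree_lt_iff_coeff_zero] at hf ⊢
  intro m hm
  obtain ⟨k, rfl⟩ : ∃ k, m = k + 1 := ⟨m - 1, by omega⟩
  rw [Polynomial.coeff_X_mul, hf k (by omega)]

/-- The Christoffel–Darboux formula. -/
theorem christoffel_darboux (hP : IsOrthonormalPolys w P) (hw : Continuous w) (n : ℕ) (x z : ℝ) :
    (x - z) * kern P (n + 1) x z =
      recCoeff w P n * ((P (n + 1)).eval x * (P n).eval z - (P n).eval x * (P (n + 1)).eval z) := by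
  set k := kernPoly P (n + 1) x with hk
  have hkd : k.degree < (n + 1 : ℕ) := degree_kernPoly_lt hP _ x
  -- Expand `(x - t) K(x, t)` in the orthonormal polynomials of `t`. Multiplication by `t` raises
  -- degrees by one, so the reproducing property kills the coefficients of index below `n`, and only
  -- the indices `n` and `n + 1` survive.
  set f : ℝ[X] := Polynomial.C x * k - Polynomial.X * k with hf
  have hfd : f.degree < (n + 2 : ℕ) := by
    refine (Polynomial.degree_sub_le _ _).trans_lt (max_lt ?_ (degree_X_mul_lt hkd))
    rw [← Polynomial.smul_eq_C_mul]
    exact (Polynomial.degree_smul_le x k).trans_lt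
      (hkd.trans (by exact_mod_cast Nat.lt_succ_self (n + 1)))
  have hfe : ∀ t, f.eval t = (x - t) * kern P (n + 1) x t := by
    intro t; simp [hf, kern, hk]; ring
  have hco : ∀ j, ∫ t in (-1 : ℝ)..1, f.eval t * (P j).eval t * w t =
      x * (∫ t in (-1 : ℝ)..1, kern P (n + 1) x t * (P j).eval t * w t) -
        ∫ t in (-1 : ℝ)..1, kern P (n + 1) x t * (Polynomial.X * P j).eval t * w t := by
    intro j
    rw [← intervalIntegral.integral_const_mul, ← intervalIntegral.integral_sub]
    · refine intervalIntegral.integral_congr fun t _ => ?_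
      simp only [hfe, Polynomial.eval_mul, Polynomial.eval_X]; ring
    · exact Continuous.intervalIntegrable (by fun_prop) _ _
    · exact Continuous.intervalIntegrable (by fun_prop) _ _
  have hlt : ∀ j m : ℕ, j < m → (P j).degree < m := fun j m h => by
    rw [hP.degree_eq]; exact_mod_cast h
  have h1 : ∀ j ∈ Finset.range n,
      (∫ t in (-1 : ℝ)..1, f.eval t * (P j).eval t * w t) * (P j).eval z = 0 := by
    intro j hj
    have hj := Finset.mem_range.1 hj
    rw [hco, integral_kern hP hw (hlt j _ (by omega)), integral_kern hP hw
      ((degree_X_mul_lt (hlt j n hj)))]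
    simp
  have h2 : ∫ t in (-1 : ℝ)..1, f.eval t * (P n).eval t * w t
      = recCoeff w P n * (P (n + 1)).eval x := by
    have e := expansion_eq_real hP hw (degree_X_mul_lt (hlt n (n + 1) (by omega))) x
    rw [Finset.sum_range_succ, ← integral_kern_mul hw _ _ (by fun_prop)] at e
    rw [hco, integral_kern hP hw (hlt n _ (by omega)), recCoeff]
    simp only [Polynomial.eval_mul, Polynomial.eval_X] at e ⊢
    linarith
  have h3 : ∫ t in (-1 : ℝ)..1, f.eval t * (P (n + 1)).eval t * w t
      = - (recCoeff w P n * (P n).eval x) := by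
    have e : ∫ t in (-1 : ℝ)..1, kern P (n + 1) x t * (P (n + 1)).eval t * w t = 0 :=
      integral_low_degree_real hP hw hkd
    rw [hco, e, integral_kern_mul hw _ _ (by fun_prop), Finset.sum_range_succ]
    have e1 : ∀ j ∈ Finset.range n, (∫ t in (-1 : ℝ)..1,
        (Polynomial.X * P (n + 1)).eval t * (P j).eval t * w t) * (P j).eval x = 0 := by
      intro j hj
      have e2 : ∫ t in (-1 : ℝ)..1, (Polynomial.X * P j).eval t * (P (n + 1)).eval t * w t = 0 :=
        integral_low_degree_real hP hw (degree_X_mul_lt (hlt j n (Finset.mem_range.1 hj)))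
      have e3 : ∫ t in (-1 : ℝ)..1, (Polynomial.X * P (n + 1)).eval t * (P j).eval t * w t = 0 := by
        rw [← e2]
        refine intervalIntegral.integral_congr fun t _ => ?_
        simp only [Polynomial.eval_mul, Polynomial.eval_X]; ring
      rw [e3, zero_mul]
    rw [Finset.sum_eq_zero e1, recCoeff]
    have e4 : ∫ t in (-1 : ℝ)..1, (Polynomial.X * P (n + 1)).eval t * (P n).eval t * w t =
        ∫ t in (-1 : ℝ)..1, t * (P n).eval t * (P (n + 1)).eval t * w t := by
      refine intervalIntegral.integral_congr fun t _ => ?_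
      simp only [Polynomial.eval_mul, Polynomial.eval_X]; ring
    rw [e4]; ring
  have e := expansion_eq_real hP hw hfd z
  rw [Finset.sum_range_succ, Finset.sum_range_succ, Finset.sum_eq_zero h1, h2, h3, hfe] at e
  rw [← e]; ring

/-- `|∫ f g v| ≤ (∫ f² v + ∫ g² v) / 2` for a nonnegative weight `v`. -/
theorem abs_integral_mul_le {f g v : ℝ → ℝ} (hf : Continuous f) (hg : Continuous g)
    (hv : Continuous v) (c : ℝ → ℝ) (hc : Continuous c)
    (h : ∀ x ∈ Set.Icc (-1 : ℝ) 1, |v x| ≤ c x) :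
    |∫ x in (-1 : ℝ)..1, f x * g x * v x| ≤
      ((∫ x in (-1 : ℝ)..1, f x ^ 2 * c x) + ∫ x in (-1 : ℝ)..1, g x ^ 2 * c x) / 2 := by
  rw [← intervalIntegral.integral_add (Continuous.intervalIntegrable (by fun_prop) _ _)
    (Continuous.intervalIntegrable (by fun_prop) _ _), ← intervalIntegral.integral_div]
  refine (intervalIntegral.abs_integral_le_integral_abs (by norm_num)).trans ?_
  refine intervalIntegral.integral_mono_on (by norm_num)
    (Continuous.intervalIntegrable (by fun_prop) _ _)
    (Continuous.intervalIntegrable (by fun_prop) _ _) fun x hx => ?_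
  rw [abs_mul, abs_mul]
  have h1 : |f x| * |g x| ≤ (f x ^ 2 + g x ^ 2) / 2 := by
    rw [← sq_abs (f x), ← sq_abs (g x)]; nlinarith [sq_nonneg (|f x| - |g x|)]
  calc |f x| * |g x| * |v x| ≤ (f x ^ 2 + g x ^ 2) / 2 * c x :=
        mul_le_mul h1 (h x hx) (abs_nonneg _) (by positivity)
    _ = _ := by ring

theorem integral_sq_eq_one (hP : IsOrthonormalPolys w P) (j : ℕ) :
    ∫ x in (-1 : ℝ)..1, (P j).eval x ^ 2 * w x = 1 := by
  have := hP.2 j j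
  simpa [sq] using this

/-- Multiplication by `z` is a contraction on `[-1, 1]`, and both polynomials have norm one. -/
theorem abs_recCoeff_le (hP : IsOrthonormalPolys w P) (hw : Continuous w) (h0 : ∀ x, 0 ≤ w x)
    (n : ℕ) : |recCoeff w P n| ≤ 1 := by
  have := abs_integral_mul_le (P n).continuous (P (n + 1)).continuous
    (v := fun z => z * w z) (by fun_prop) w hw (fun x hx => by
      rw [abs_mul, abs_of_nonneg (h0 x)]
      exact mul_le_of_le_one_left (h0 x) (abs_le.2 hx))
  rw [integral_sq_eq_one hP, integral_sq_eq_one hP] at this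
  unfold recCoeff
  convert this using 3
  · congr 1; ext z; ring
  · norm_num

end Orthonormal

end

/-! ### Moments of the orthonormal functions at the external points -/

section

/-- The hypotheses on the set of external points. -/
structure IsExt (S : Finset ℝ) : Prop where
  one_mem : (1 : ℝ) ∈ S
  neg_one_mem : (-1 : ℝ) ∈ S
  one_le : ∀ u ∈ S, 1 ≤ |u|

theorem continuous_wt_div_abs (S : Finset ℝ) {u : ℝ} (hu : u ∈ S) :
    Continuous fun x => wt S x / |x - u| := by
  have : (fun x => wt S x / |x - u|) = fun x => |wt S x / (x - u)| := by
    ext x; rw [abs_div, abs_of_nonneg (wt_nonneg S x)]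
  rw [this]
  exact (continuous_wt_div S hu).abs

/-- `∫ p² w / |x - u|`. -/
def extMoment (S : Finset ℝ) (p : ℝ[X]) (u : ℝ) : ℝ :=
  ∫ x in (-1 : ℝ)..1, p.eval x ^ 2 * (wt S x / |x - u|)

theorem extMoment_nonneg (S : Finset ℝ) (p : ℝ[X]) (u : ℝ) : 0 ≤ extMoment S p u :=
  intervalIntegral.integral_nonneg (by norm_num) fun x _ =>
    mul_nonneg (sq_nonneg _) (div_nonneg (wt_nonneg S x) (abs_nonneg _))

theorem abs_integral_wt_div_le {S : Finset ℝ} {u : ℝ} (hu : u ∈ S) (p q : ℝ[X]) :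
    |∫ x in (-1 : ℝ)..1, p.eval x * q.eval x * (wt S x / (x - u))| ≤
      (extMoment S p u + extMoment S q u) / 2 :=
  abs_integral_mul_le p.continuous q.continuous (continuous_wt_div S hu) _
    (continuous_wt_div_abs S hu) fun x _ => by
      rw [abs_div, abs_of_nonneg (wt_nonneg S x)]

theorem integral_mul_wtDeriv (S : Finset ℝ) {f : ℝ → ℝ} (hf : Continuous f) :
    ∫ x in (-1 : ℝ)..1, f x * wtDeriv S x =
      ∑ u ∈ S, 2 * ∫ x in (-1 : ℝ)..1, f x * (wt S x / (x - u)) := by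
  have : ∀ x, f x * wtDeriv S x = ∑ u ∈ S, 2 * (f x * (wt S x / (x - u))) := fun x => by
    rw [wtDeriv, Finset.mul_sum]; exact Finset.sum_congr rfl fun u _ => by ring
  simp_rw [this]
  rw [intervalIntegral.integral_finsetSum]
  · simp_rw [intervalIntegral.integral_const_mul]
  · intro u hu
    exact ((hf.mul (continuous_wt_div S hu)).const_mul 2).intervalIntegrable _ _

theorem integral_deriv_mul_wt_real {S : Finset ℝ} (hS : IsExt S) {f f' : ℝ → ℝ}
    (hf : ∀ x, HasDerivAt f (f' x) x) (hc : Continuous f') :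
    ∫ x in (-1 : ℝ)..1, f' x * wt S x = -∫ x in (-1 : ℝ)..1, f x * wtDeriv S x := by
  simpa using integral_deriv_mul_wt (𝕜 := ℝ) hS.one_mem hS.neg_one_mem hf hc

section

variable {S : Finset ℝ} {P : ℕ → ℝ[X]}

/-- The virial identity for an orthonormal polynomial. -/
theorem integral_mul_sq_wtDeriv (hS : IsExt S) (hP : IsOrthonormalPolys (wt S) P) (j : ℕ) :
    ∫ x in (-1 : ℝ)..1, x * (P j).eval x ^ 2 * wtDeriv S x = -(2 * j + 1) := by
  have hd : ∀ x : ℝ, HasDerivAt (fun x => x * (P j).eval x ^ 2)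
      ((P j).eval x ^ 2 + 2 * ((Polynomial.X * (P j).derivative).eval x * (P j).eval x)) x := by
    intro x
    have := (hasDerivAt_id x).mul (((P j).hasDerivAt x).fun_pow 2)
    refine this.congr_deriv ?_
    simp; ring
  have h := integral_deriv_mul_wt_real hS hd (by fun_prop)
  have hj : ∫ x in (-1 : ℝ)..1,
      (Polynomial.X * (P j).derivative).eval x * (P j).eval x * wt S x = (j : ℝ) := by
    -- The operator `x d/dx` multiplies the leading coefficient by `j`, so this difference has lower
    -- degree and is orthogonal to `P j`.
    have hlow : (Polynomial.X * (P j).derivative - Polynomial.C (j : ℝ) * P j : ℝ[X]).degree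
        < (j : ℕ) := by
      rw [Polynomial.degree_lt_iff_coeff_zero]
      intro m hm
      have hX : (Polynomial.X * (P j).derivative).coeff m = (P j).coeff m * m := by
        rcases m with _ | m
        · simp
        · rw [Polynomial.coeff_X_mul, Polynomial.coeff_derivative]; push_cast; ring
      rw [Polynomial.coeff_sub, hX, Polynomial.coeff_C_mul]
      rcases Nat.eq_or_lt_of_le hm with rfl | hm
      · ring
      · rw [Polynomial.coeff_eq_zero_of_natDegree_lt (by rw [hP.1]; exact hm)]; ring
    have h0 := integral_low_degree_real hP (continuous_wt S) hlow
    have h1 : ∫ x in (-1 : ℝ)..1,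
      ((Polynomial.X * (P j).derivative).eval x * (P j).eval x * wt S x
        - j * ((P j).eval x ^ 2 * wt S x)) = 0 := by
      rw [← h0]
      refine intervalIntegral.integral_congr fun x _ => ?_
      simp; ring
    rw [intervalIntegral.integral_sub (Continuous.intervalIntegrable (by fun_prop) _ _)
      (Continuous.intervalIntegrable (by fun_prop) _ _), intervalIntegral.integral_const_mul,
      integral_sq_eq_one hP] at h1
    linarith
  have h2 : ∫ x in (-1 : ℝ)..1, ((P j).eval x ^ 2 +
      2 * ((Polynomial.X * (P j).derivative).eval x * (P j).eval x)) * wt S x = 1 + 2 * (j : ℝ) := by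
    have h1 := integral_sq_eq_one hP j
    conv_rhs => arg 1; rw [← h1]
    rw [← hj, ← intervalIntegral.integral_const_mul,
      ← intervalIntegral.integral_add (Continuous.intervalIntegrable (by fun_prop) _ _)
      (Continuous.intervalIntegrable (by fun_prop) _ _)]
    refine intervalIntegral.integral_congr fun x _ => ?_
    ring
  rw [h2] at h
  linarith

/-- On `[-1, 1]` the distance to `u` is at least `|u| - 1`, and `P j` has norm one. This is useless
for `u = ±1`, which need the virial identity. -/
theorem extMoment_le (hP : IsOrthonormalPolys (wt S) P) (j : ℕ) {u : ℝ} (hu : u ∈ S)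
    (hu1 : 1 < |u|) : extMoment S (P j) u ≤ 1 / (|u| - 1) := by
  have h : extMoment S (P j) u ≤ ∫ x in (-1 : ℝ)..1, (1 / (|u| - 1)) * ((P j).eval x ^ 2 * wt S x) := by
    refine intervalIntegral.integral_mono_on (by norm_num)
      (Continuous.intervalIntegrable
        (((P j).continuous.pow 2).mul (continuous_wt_div_abs S hu)) _ _)
      (Continuous.intervalIntegrable (by fun_prop) _ _) fun x hx => ?_
    have hx' : |u| - 1 ≤ |x - u| := by
      have := abs_sub_abs_le_abs_sub u x
      rw [abs_sub_comm x u]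
      linarith [abs_le.2 hx]
    have := one_div_le_one_div_of_le (by linarith) hx'
    calc (P j).eval x ^ 2 * (wt S x / |x - u|) = (1 / |x - u|) * ((P j).eval x ^ 2 * wt S x) := by ring
      _ ≤ _ := mul_le_mul_of_nonneg_right this (mul_nonneg (sq_nonneg _) (wt_nonneg S x))
  rwa [intervalIntegral.integral_const_mul, integral_sq_eq_one hP, mul_one] at h

/-- The moments at all external points are controlled by the distances of the points other
than `±1`. -/
theorem sum_extMoment_le (hS : IsExt S) (hP : IsOrthonormalPolys (wt S) P) (j : ℕ) {D : ℝ}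
    (hD : ∑ u ∈ S.filter (fun u => 1 < |u|), 1 / (|u| - 1) ≤ D) :
    ∑ u ∈ S, extMoment S (P j) u ≤ 2 * D + j + 5 / 2 := by
  set R := S.filter (fun u => 1 < |u|) with hR
  have hRS : ∀ u ∈ R, u ∈ S ∧ 1 < |u| := fun u hu => Finset.mem_filter.1 hu
  have hsplit : ∀ f : ℝ → ℝ, ∑ u ∈ S, f u = f 1 + f (-1) + ∑ u ∈ R, f u := by
    intro f
    rw [← Finset.sum_filter_not_add_sum_filter S (fun u => 1 < |u|)]
    congr 1
    have : S.filter (fun u => ¬ 1 < |u|) = {1, -1} := by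
      ext u
      simp only [Finset.mem_filter, Finset.mem_insert, Finset.mem_singleton, not_lt]
      constructor
      · rintro ⟨hu, h⟩
        exact (abs_eq zero_le_one).1 (le_antisymm h (hS.one_le u hu))
      · rintro (rfl | rfl)
        · exact ⟨hS.one_mem, by simp⟩
        · exact ⟨hS.neg_one_mem, by simp⟩
    rw [this, Finset.sum_pair (by norm_num)]
  have hrest : ∑ u ∈ R, extMoment S (P j) u ≤ D :=
    (Finset.sum_le_sum fun u hu => extMoment_le hP j (hRS u hu).1 (hRS u hu).2).trans hD
  have hvir := integral_mul_sq_wtDeriv hS hP j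
  rw [integral_mul_wtDeriv S (by fun_prop), hsplit] at hvir
  have hone : ∀ u ∈ R, |∫ x in (-1 : ℝ)..1, x * (P j).eval x ^ 2 * (wt S x / (x - u))| ≤
      extMoment S (P j) u := by
    intro u hu
    have := abs_integral_mul_le (P j).continuous (P j).continuous
      (v := fun x => x * (wt S x / (x - u)))
      (continuous_id.mul (continuous_wt_div S (hRS u hu).1)) _
      (continuous_wt_div_abs S (hRS u hu).1) (fun x hx => by
        rw [abs_mul, abs_div, abs_of_nonneg (wt_nonneg S x)]
        exact mul_le_of_le_one_left (div_nonneg (wt_nonneg S x) (abs_nonneg _)) (abs_le.2 hx))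
    rw [add_self_div_two] at this
    refine le_trans (le_of_eq ?_) this
    congr 1
    exact intervalIntegral.integral_congr fun x _ => by ring
  have hrest2 : |∑ u ∈ R, 2 * ∫ x in (-1 : ℝ)..1, x * (P j).eval x ^ 2 * (wt S x / (x - u))| ≤
      2 * D := by
    refine (Finset.abs_sum_le_sum_abs _ _).trans ?_
    refine le_trans (Finset.sum_le_sum fun u hu => ?_)
      ((Finset.mul_sum _ _ _).symm.le.trans (mul_le_mul_of_nonneg_left hrest zero_le_two))
    rw [abs_mul, abs_two]
    exact mul_le_mul_of_nonneg_left (hone u hu) zero_le_two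
  -- In the interval `1 / (1 - x) = 1 - x / (x - 1)` and `1 / (1 + x) = 1 - x / (x + 1)`. Thus the
  -- two edge moments are, up to constants, the terms `u = ±1` of the virial identity, whose other
  -- terms are already bounded.
  have hedge : extMoment S (P j) 1 + extMoment S (P j) (-1) =
      2 - ((∫ x in (-1 : ℝ)..1, x * (P j).eval x ^ 2 * (wt S x / (x - 1))) +
        ∫ x in (-1 : ℝ)..1, x * (P j).eval x ^ 2 * (wt S x / (x - -1))) := by
    have c1 := continuous_wt_div S hS.one_mem
    have c2 := continuous_wt_div S hS.neg_one_mem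
    have c3 := continuous_wt_div_abs S hS.one_mem
    have c4 := continuous_wt_div_abs S hS.neg_one_mem
    have h2 : (2 : ℝ) = 2 * ∫ x in (-1 : ℝ)..1, (P j).eval x ^ 2 * wt S x := by
      rw [integral_sq_eq_one hP, mul_one]
    conv_rhs => arg 1; rw [h2]
    rw [extMoment, extMoment,
      ← intervalIntegral.integral_add (Continuous.intervalIntegrable (by fun_prop) _ _)
        (Continuous.intervalIntegrable (by fun_prop) _ _),
      ← intervalIntegral.integral_const_mul,
      ← intervalIntegral.integral_add (Continuous.intervalIntegrable (by fun_prop) _ _)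
        (Continuous.intervalIntegrable (by fun_prop) _ _),
      ← intervalIntegral.integral_sub (Continuous.intervalIntegrable (by fun_prop) _ _)
        (Continuous.intervalIntegrable (by fun_prop) _ _)]
    refine intervalIntegral.integral_congr fun x hx => ?_
    rw [Set.uIcc_of_le (by norm_num)] at hx
    beta_reduce
    rcases eq_or_lt_of_le hx.2 with rfl | h1
    · simp [wt_eq_zero hS.one_mem]
    rcases eq_or_lt_of_le hx.1 with rfl | h2
    · simp [wt_eq_zero hS.neg_one_mem]
    rw [abs_of_neg (by linarith : x - 1 < 0), abs_of_pos (by linarith : 0 < x - -1)]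
    have e1 : -(x - 1) ≠ 0 := by linarith
    have e2 : x - -1 ≠ 0 := by linarith
    have e3 : x - 1 ≠ 0 := by linarith
    field_simp
    ring
  rw [hsplit, hedge]
  have := abs_le.1 hrest2
  linarith

/-- Expanding `1 / (z - u)` around `x`. -/
theorem integral_wt_div_expand (S : Finset ℝ) {u x : ℝ} (hu : u ∈ S) (hx : x ≠ u) {h : ℝ → ℝ}
    (hc : Continuous h) :
    ∫ z in (-1 : ℝ)..1, h z * (wt S z / (z - u)) =
      1 / (x - u) * ((∫ z in (-1 : ℝ)..1, h z * wt S z) +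
        ∫ z in (-1 : ℝ)..1, ((x - z) * h z) * (wt S z / (z - u))) := by
  have c1 := continuous_wt_div S hu
  rw [← intervalIntegral.integral_add (Continuous.intervalIntegrable (by fun_prop) _ _)
    (Continuous.intervalIntegrable (by fun_prop) _ _), ← intervalIntegral.integral_const_mul]
  refine intervalIntegral.integral_congr fun z _ => ?_
  by_cases hz : z = u
  · subst hz; simp [wt_eq_zero hu]
  · have h1 : z - u ≠ 0 := sub_ne_zero.2 hz
    have h2 : x - u ≠ 0 := sub_ne_zero.2 hx
    field_simp
    ring

end

end

/-! ### Differential inequalities for the top functions and for the kernel -/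

section

section

variable {S : Finset ℝ} {P : ℕ → ℝ[X]}

/-- `(ψ_n² + ψ_{n+1}²)(x)`. -/
def pairSq (S : Finset ℝ) (P : ℕ → ℝ[X]) (n : ℕ) (x : ℝ) : ℝ :=
  ((P n).eval x ^ 2 + (P (n + 1)).eval x ^ 2) * wt S x

theorem pairSq_nonneg (S : Finset ℝ) (P : ℕ → ℝ[X]) (n : ℕ) (x : ℝ) : 0 ≤ pairSq S P n x :=
  mul_nonneg (by positivity) (wt_nonneg S x)

@[fun_prop]
theorem continuous_pairSq (S : Finset ℝ) (P : ℕ → ℝ[X]) (n : ℕ) : Continuous (pairSq S P n) := by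
  unfold pairSq; fun_prop

/-- The derivative of `P j` has degree at most `n`, so `kern P (n + 1)` reproduces it. After
integration by parts the term with the derivative of the kernel drops out: that derivative has
degree below `n ≤ j` and is orthogonal to `P j`. -/
theorem derivative_eval_eq (hS : IsExt S) (hP : IsOrthonormalPolys (wt S) P) {n j : ℕ}
    (hj : j = n ∨ j = n + 1) (x : ℝ) :
    (P j).derivative.eval x =
      -∫ z in (-1 : ℝ)..1, ((P j).eval z * kern P (n + 1) x z) * wtDeriv S z := by
  have hkd := degree_kernPoly_lt hP (n + 1) x
  have hd : ∀ z : ℝ, HasDerivAt (fun z => (P j).eval z * kern P (n + 1) x z)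
      ((P j).derivative.eval z * kern P (n + 1) x z +
        (P j).eval z * (kernPoly P (n + 1) x).derivative.eval z) z := fun z =>
    ((P j).hasDerivAt z).mul ((kernPoly P (n + 1) x).hasDerivAt z)
  rw [← integral_deriv_mul_wt_real hS hd (by fun_prop)]
  have h1 : ∫ z in (-1 : ℝ)..1, kern P (n + 1) x z * (P j).derivative.eval z * wt S z =
      (P j).derivative.eval x := by
    refine integral_kern hP (continuous_wt S) ?_ x
    have h0 : (P j).degree < (n + 1 + 1 : ℕ) := by
      rw [hP.degree_eq]; norm_cast; omega
    exact degree_derivative_lt_pred h0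
  have h2 : ∫ z in (-1 : ℝ)..1,
      (kernPoly P (n + 1) x).derivative.eval z * (P j).eval z * wt S z = 0 := by
    refine integral_low_degree_real hP (continuous_wt S) ?_
    refine (degree_derivative_lt_pred hkd).trans_le ?_
    norm_cast; omega
  rw [← h1, ← add_zero (∫ z in (-1 : ℝ)..1, kern P (n + 1) x z * _ * _), ← h2,
    ← intervalIntegral.integral_add (Continuous.intervalIntegrable (by fun_prop) _ _)
      (Continuous.intervalIntegrable (by fun_prop) _ _)]
  exact intervalIntegral.integral_congr fun z _ => by ring

/-- The Christoffel–Darboux formula absorbs the factor `x - z` and leaves only the polynomials of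
index `n` and `n + 1`. -/
theorem integral_shift_kern (hP : IsOrthonormalPolys (wt S) P) {u : ℝ} (hu : u ∈ S)
    (q : ℝ[X]) (n : ℕ) (x : ℝ) :
    ∫ z in (-1 : ℝ)..1, ((x - z) * (q.eval z * kern P (n + 1) x z)) * (wt S z / (z - u)) =
      recCoeff (wt S) P n *
        ((P (n + 1)).eval x * (∫ z in (-1 : ℝ)..1, q.eval z * (P n).eval z * (wt S z / (z - u))) -
        (P n).eval x *
          ∫ z in (-1 : ℝ)..1, q.eval z * (P (n + 1)).eval z * (wt S z / (z - u))) := by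
  have c1 := continuous_wt_div S hu
  rw [← intervalIntegral.integral_const_mul, ← intervalIntegral.integral_const_mul,
    ← intervalIntegral.integral_sub (Continuous.intervalIntegrable (by fun_prop) _ _)
      (Continuous.intervalIntegrable (by fun_prop) _ _), ← intervalIntegral.integral_const_mul]
  refine intervalIntegral.integral_congr fun z _ => ?_
  have := christoffel_darboux hP (continuous_wt S) n x z
  calc ((x - z) * (q.eval z * kern P (n + 1) x z)) * (wt S z / (z - u))
      = ((x - z) * kern P (n + 1) x z) * q.eval z * (wt S z / (z - u)) := by ring
    _ = _ := by rw [this]; ring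

/-- Write `1 / (z - u) = (1 / (x - u)) (1 + (x - z) / (z - u))`. The first part is a projection of
`P j` evaluated at `x`; the second is handled by Christoffel–Darboux with a recurrence coefficient
of modulus at most one. -/
theorem abs_integral_kern_div_le (hP : IsOrthonormalPolys (wt S) P) {u x : ℝ}
    (hu : u ∈ S) (hx : x ≠ u) {n j : ℕ} (hj : j = n ∨ j = n + 1) :
    |∫ z in (-1 : ℝ)..1, ((P j).eval z * kern P (n + 1) x z) * (wt S z / (z - u))| ≤
      1 / |x - u| * (|(P j).eval x| + (|(P n).eval x| + |(P (n + 1)).eval x|) *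
        (extMoment S (P n) u + extMoment S (P (n + 1)) u)) := by
  rw [integral_wt_div_expand S hu hx (by fun_prop), integral_shift_kern hP hu, abs_mul, abs_div,
    abs_one]
  refine mul_le_mul_of_nonneg_left ((abs_add_le _ _).trans (add_le_add ?_ ?_)) (by positivity)
  · have h1 : ∫ z in (-1 : ℝ)..1, (P j).eval z * kern P (n + 1) x z * wt S z =
        if j = n then (P j).eval x else 0 := by
      have e : ∫ z in (-1 : ℝ)..1, (P j).eval z * kern P (n + 1) x z * wt S z =
          ∫ z in (-1 : ℝ)..1, kern P (n + 1) x z * (P j).eval z * wt S z :=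
        intervalIntegral.integral_congr fun z _ => by ring
      rw [e]
      rcases hj with rfl | rfl
      · rw [if_pos rfl]
        refine integral_kern hP (continuous_wt S) ?_ x
        rw [hP.degree_eq]; exact_mod_cast Nat.lt_succ_self j
      · rw [if_neg (by omega)]
        exact integral_low_degree_real hP (continuous_wt S) (degree_kernPoly_lt hP _ x)
    rw [h1]
    split_ifs
    · exact le_rfl
    · simp
  · rw [abs_mul]
    have ha := abs_recCoeff_le hP (continuous_wt S) (wt_nonneg S) n
    have m1 := extMoment_nonneg S (P n) u
    have m2 := extMoment_nonneg S (P (n + 1)) u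
    have hb : ∀ i, i = n ∨ i = n + 1 →
        |∫ z in (-1 : ℝ)..1, (P j).eval z * (P i).eval z * (wt S z / (z - u))| ≤
          extMoment S (P n) u + extMoment S (P (n + 1)) u := by
      intro i hi
      refine (abs_integral_wt_div_le hu (P j) (P i)).trans ?_
      rcases hi with rfl | rfl <;> rcases hj with rfl | rfl <;> linarith
    have h1 := hb n (Or.inl rfl)
    have h2 := hb (n + 1) (Or.inr rfl)
    refine (mul_le_of_le_one_left (abs_nonneg _) ha).trans ((abs_sub _ _).trans ?_)
    rw [abs_mul, abs_mul, add_mul, add_comm]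
    exact add_le_add (mul_le_mul_of_nonneg_left h2 (abs_nonneg _))
      (mul_le_mul_of_nonneg_left h1 (abs_nonneg _))

/-- The data of the bulk estimates: a point `x` at distance `δ` from the external points, and a
bound `T` on the sums over external points. -/
structure BulkBound (S : Finset ℝ) (P : ℕ → ℝ[X]) (n : ℕ) (T δ x : ℝ) : Prop where
  delta_pos : 0 < δ
  dist_le : ∀ u ∈ S, δ ≤ |x - u|
  sum_inv_le : ∑ u ∈ S, 1 / |x - u| ≤ T
  moment_le : ∑ u ∈ S, (extMoment S (P n) u + extMoment S (P (n + 1)) u) ≤ T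

theorem BulkBound.ne {n : ℕ} {T δ x : ℝ} (h : BulkBound S P n T δ x) {u : ℝ} (hu : u ∈ S) :
    x ≠ u := fun e => by
  have h1 := h.dist_le u hu
  have h2 := h.delta_pos
  rw [e, sub_self, abs_zero] at h1
  linarith

theorem BulkBound.nonneg {n : ℕ} {T δ x : ℝ} (h : BulkBound S P n T δ x) : 0 ≤ T :=
  (Finset.sum_nonneg fun _ _ => by positivity).trans h.sum_inv_le

theorem BulkBound.inv_le {n : ℕ} {T δ x : ℝ} (h : BulkBound S P n T δ x) {u : ℝ} (hu : u ∈ S) :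
    1 / |x - u| ≤ 1 / δ :=
  one_div_le_one_div_of_le h.delta_pos (h.dist_le u hu)

/-- Summing over external points, the projection part uses the bound on `∑ 1 / |x - u|`. In the part
with moments `1 / |x - u|` is replaced by `1 / δ`, so that the sum of moments suffices. -/
theorem abs_derivative_eval_le (hS : IsExt S) (hP : IsOrthonormalPolys (wt S) P) {n j : ℕ}
    (hj : j = n ∨ j = n + 1) {T δ x : ℝ} (hb : BulkBound S P n T δ x) :
    |(P j).derivative.eval x| ≤
      2 * T * (1 + 1 / δ) * (|(P n).eval x| + |(P (n + 1)).eval x|) := by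
  set s := |(P n).eval x| + |(P (n + 1)).eval x| with hs
  have hs0 : 0 ≤ s := by positivity
  have hjs : |(P j).eval x| ≤ s := by
    rcases hj with rfl | rfl
    · exact le_add_of_nonneg_right (abs_nonneg _)
    · exact le_add_of_nonneg_left (abs_nonneg _)
  have hδ := hb.delta_pos
  rw [derivative_eval_eq hS hP hj, abs_neg, integral_mul_wtDeriv S (by fun_prop)]
  refine (Finset.abs_sum_le_sum_abs _ _).trans ?_
  have h1 : ∀ u ∈ S, |2 * ∫ z in (-1 : ℝ)..1, ((P j).eval z * kern P (n + 1) x z) *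
      (wt S z / (z - u))| ≤ 2 * s * (1 / |x - u|) +
        2 * s * (1 / δ) * (extMoment S (P n) u + extMoment S (P (n + 1)) u) := by
    intro u hu
    rw [abs_mul, abs_two]
    have h2 := abs_integral_kern_div_le hP hu (hb.ne hu) hj
    have m1 := extMoment_nonneg S (P n) u
    have m2 := extMoment_nonneg S (P (n + 1)) u
    have h3 := hb.inv_le hu
    have h4 : 0 ≤ 1 / |x - u| := by positivity
    calc _ ≤ 2 * (1 / |x - u| * (|(P j).eval x| + s *
            (extMoment S (P n) u + extMoment S (P (n + 1)) u))) := by gcongr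
      _ ≤ 2 * (1 / |x - u| * s + 1 / δ * (s *
            (extMoment S (P n) u + extMoment S (P (n + 1)) u))) := by
          rw [mul_add]; gcongr
      _ = _ := by ring
  refine (Finset.sum_le_sum h1).trans ?_
  rw [Finset.sum_add_distrib, ← Finset.mul_sum, ← Finset.mul_sum]
  calc _ ≤ 2 * s * T + 2 * s * (1 / δ) * T := by
        gcongr
        · exact hb.sum_inv_le
        · exact hb.moment_le
    _ = _ := by ring

theorem abs_wtDeriv_le {n : ℕ} {T δ x : ℝ} (hb : BulkBound S P n T δ x) :
    |wtDeriv S x| ≤ 2 * T * wt S x := by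
  unfold wtDeriv
  refine (Finset.abs_sum_le_sum_abs _ _).trans ?_
  have : ∀ u ∈ S, |2 * (wt S x / (x - u))| = 2 * wt S x * (1 / |x - u|) := fun u _ => by
    rw [abs_mul, abs_two, abs_div, abs_of_nonneg (wt_nonneg S x)]; ring
  rw [Finset.sum_congr rfl this, ← Finset.mul_sum]
  have := mul_le_mul_of_nonneg_left hb.sum_inv_le
    (mul_nonneg zero_le_two (wt_nonneg S x) : (0 : ℝ) ≤ 2 * wt S x)
  linarith

/-- The differential inequality for `ψ_n² + ψ_{n+1}²`. -/
theorem exists_hasDerivAt_pairSq (hS : IsExt S) (hP : IsOrthonormalPolys (wt S) P) {n : ℕ}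
    {T δ x : ℝ} (hb : BulkBound S P n T δ x) :
    ∃ D, HasDerivAt (pairSq S P n) D x ∧ |D| ≤ 10 * T * (1 + 1 / δ) * pairSq S P n x := by
  have hd := ((((P n).hasDerivAt x).fun_pow 2).add (((P (n + 1)).hasDerivAt x).fun_pow 2)).mul
    (hasDerivAt_wt S x)
  refine ⟨_, hd, ?_⟩
  have hT := hb.nonneg
  have hδ := hb.delta_pos
  have d1 := abs_derivative_eval_le hS hP (Or.inl rfl) hb
  have d2 := abs_derivative_eval_le hS hP (Or.inr rfl) hb
  have d3 := abs_wtDeriv_le hb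
  have hw := wt_nonneg S x
  set c := 2 * T * (1 + 1 / δ) with hc
  have hc0 : 0 ≤ c := by positivity
  have hcT : 2 * T ≤ c := by
    rw [hc]; exact le_mul_of_one_le_right (by positivity) (by simp; positivity)
  set a := (P n).eval x
  set b := (P (n + 1)).eval x
  simp only [Pi.add_apply]
  unfold pairSq
  refine (abs_add_le _ _).trans ?_
  rw [abs_mul, abs_mul, abs_of_nonneg hw, abs_of_nonneg (by positivity : 0 ≤ a ^ 2 + b ^ 2)]
  have e1 : |((2 : ℕ) : ℝ) * a ^ (2 - 1) * (P n).derivative.eval x +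
      ((2 : ℕ) : ℝ) * b ^ (2 - 1) * (P (n + 1)).derivative.eval x| ≤
        4 * c * (a ^ 2 + b ^ 2) := by
    refine (abs_add_le _ _).trans ?_
    simp only [Nat.add_one_sub_one, pow_one, Nat.cast_ofNat, abs_mul, abs_two]
    have q1 : |a| * |(P n).derivative.eval x| ≤ |a| * (c * (|a| + |b|)) :=
      mul_le_mul_of_nonneg_left d1 (abs_nonneg _)
    have q2 : |b| * |(P (n + 1)).derivative.eval x| ≤ |b| * (c * (|a| + |b|)) :=
      mul_le_mul_of_nonneg_left d2 (abs_nonneg _)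
    have q3 : (|a| + |b|) ^ 2 ≤ 2 * (a ^ 2 + b ^ 2) := by
      rw [← sq_abs a, ← sq_abs b]; nlinarith [sq_nonneg (|a| - |b|)]
    have q4 := mul_le_mul_of_nonneg_left q3 hc0
    nlinarith
  have e2 : |wtDeriv S x| ≤ c * wt S x :=
    d3.trans (mul_le_mul_of_nonneg_right hcT hw)
  -- The squares of the polynomials contribute `4 c` and the logarithmic derivative of the weight
  -- contributes `c`.
  calc _ ≤ 4 * c * (a ^ 2 + b ^ 2) * wt S x + (a ^ 2 + b ^ 2) * (c * wt S x) := by gcongr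
    _ = 5 * c * ((a ^ 2 + b ^ 2) * wt S x) := by ring
    _ = _ := by rw [hc]; ring

/-- The derivative of `K(x, x)`, where `K` is the reproducing kernel including the weight. -/
theorem exists_hasDerivAt_kern_self (hS : IsExt S) (hP : IsOrthonormalPolys (wt S) P) {n : ℕ}
    {T δ x : ℝ} (hb : BulkBound S P n T δ x) :
    ∃ D, HasDerivAt (fun t => kern P (n + 1) t t * wt S t) D x ∧
      |D| ≤ T * (1 / δ + 2 / δ ^ 2) * pairSq S P n x := by
  have hkd := degree_kernPoly_lt hP (n + 1) x
  set k := kernPoly P (n + 1) x with hk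
  have hke : ∀ z, k.eval z = kern P (n + 1) x z := fun z => rfl
  have hdk : HasDerivAt (fun t => kern P (n + 1) t t) (2 * k.derivative.eval x) x := by
    simp_rw [kern_self]
    refine (HasDerivAt.fun_sum fun j _ => ((P j).hasDerivAt x).fun_pow 2).congr_deriv ?_
    simp only [hk, kernPoly, Polynomial.derivative_sum, Polynomial.eval_finsetSum, Finset.mul_sum,
      Polynomial.derivative_C_mul, Polynomial.eval_mul, Polynomial.eval_C]
    refine Finset.sum_congr rfl fun j _ => ?_
    norm_num; ring
  refine ⟨_, hdk.mul (hasDerivAt_wt S x), ?_⟩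
  have hibp := integral_deriv_mul_wt_real hS
    (fun z => (k.hasDerivAt z).mul (k.hasDerivAt z)) (by fun_prop)
  have hrep : ∫ z in (-1 : ℝ)..1, (k.derivative.eval z * k.eval z + k.eval z * k.derivative.eval z)
      * wt S z = 2 * k.derivative.eval x := by
    rw [← integral_kern hP (continuous_wt S) (degree_derivative_lt_of_lt hkd) x,
      ← intervalIntegral.integral_const_mul]
    exact intervalIntegral.integral_congr fun z _ => by rw [← hke]; ring
  have hrep2 : ∫ z in (-1 : ℝ)..1, (k.eval z * kern P (n + 1) x z) * wt S z = kern P (n + 1) x x := by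
    rw [← hke x, ← integral_kern hP (continuous_wt S) hkd x]
    exact intervalIntegral.integral_congr fun z _ => by ring
  -- One factor `x - z` removes one kernel by Christoffel–Darboux; the other kernel then reproduces
  -- `P n` and annihilates `P (n + 1)`.
  have hCD : ∫ z in (-1 : ℝ)..1, ((x - z) * (k.eval z * kern P (n + 1) x z)) * wt S z =
      recCoeff (wt S) P n * (P (n + 1)).eval x * (P n).eval x := by
    have h1 : ∫ z in (-1 : ℝ)..1, kern P (n + 1) x z * (P n).eval z * wt S z = (P n).eval x :=
      integral_kern hP (continuous_wt S)
        (by rw [hP.degree_eq]; exact_mod_cast Nat.lt_succ_self n) x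
    have h2 : ∫ z in (-1 : ℝ)..1, kern P (n + 1) x z * (P (n + 1)).eval z * wt S z = 0 :=
      integral_low_degree_real hP (continuous_wt S) hkd
    have h3 : recCoeff (wt S) P n * (P (n + 1)).eval x * (P n).eval x =
        recCoeff (wt S) P n * (P (n + 1)).eval x *
          (∫ z in (-1 : ℝ)..1, kern P (n + 1) x z * (P n).eval z * wt S z) -
        recCoeff (wt S) P n * (P n).eval x *
          ∫ z in (-1 : ℝ)..1, kern P (n + 1) x z * (P (n + 1)).eval z * wt S z := by
      rw [h1, h2]; ring
    rw [h3, ← intervalIntegral.integral_const_mul, ← intervalIntegral.integral_const_mul,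
      ← intervalIntegral.integral_sub (Continuous.intervalIntegrable (by fun_prop) _ _)
        (Continuous.intervalIntegrable (by fun_prop) _ _)]
    refine intervalIntegral.integral_congr fun z _ => ?_
    have := christoffel_darboux hP (continuous_wt S) n x z
    rw [hke]
    calc (x - z) * (kern P (n + 1) x z * kern P (n + 1) x z) * wt S z
        = ((x - z) * kern P (n + 1) x z) * kern P (n + 1) x z * wt S z := by ring
      _ = _ := by rw [this]; ring
  have hδ := hb.delta_pos
  have hw := wt_nonneg S x
  set a := (P n).eval x with ha
  set b := (P (n + 1)).eval x with hb'
  have hrc := abs_recCoeff_le hP (continuous_wt S) (wt_nonneg S) n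
  set r := recCoeff (wt S) P n with hr
  -- the contribution of a single external point
  have hterm : ∀ u ∈ S, |kern P (n + 1) x x * (1 / (x - u)) -
      ∫ z in (-1 : ℝ)..1, (k.eval z * kern P (n + 1) x z) * (wt S z / (z - u))| ≤
        (1 / δ * (1 / |x - u|) / 2 + 1 / δ ^ 2 *
          (extMoment S (P n) u + extMoment S (P (n + 1)) u)) * (a ^ 2 + b ^ 2) := by
    intro u hu
    have hxu := hb.ne hu
    have hxu0 : x - u ≠ 0 := sub_ne_zero.2 hxu
    have m1 := extMoment_nonneg S (P n) u
    have m2 := extMoment_nonneg S (P (n + 1)) u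
    rw [integral_wt_div_expand S hu hxu (by fun_prop), hrep2,
      integral_wt_div_expand S hu hxu (by fun_prop), hCD]
    -- Two factors `x - z` remove both kernels and leave `r² (b P_n - a P_{n+1})²`, so only the
    -- moments of the two top functions enter.
    have hQ : |∫ z in (-1 : ℝ)..1, ((x - z) * ((x - z) * (k.eval z * kern P (n + 1) x z))) *
        (wt S z / (z - u))| ≤
          2 * (a ^ 2 + b ^ 2) * (extMoment S (P n) u + extMoment S (P (n + 1)) u) / 2 := by
      have c1 := continuous_wt_div S hu
      set Q : ℝ[X] := Polynomial.C b * P n - Polynomial.C a * P (n + 1) with hQ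
      have e1 : ∫ z in (-1 : ℝ)..1, ((x - z) * ((x - z) * (k.eval z * kern P (n + 1) x z))) *
          (wt S z / (z - u)) = r ^ 2 * ∫ z in (-1 : ℝ)..1, Q.eval z * Q.eval z *
            (wt S z / (z - u)) := by
        rw [← intervalIntegral.integral_const_mul]
        refine intervalIntegral.integral_congr fun z _ => ?_
        have := christoffel_darboux hP (continuous_wt S) n x z
        rw [hke]
        calc _ = ((x - z) * kern P (n + 1) x z) ^ 2 * (wt S z / (z - u)) := by ring
          _ = _ := by
            rw [this]; simp only [hQ, Polynomial.eval_sub, Polynomial.eval_mul,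
              Polynomial.eval_C]; ring
      have e2 := abs_integral_wt_div_le hu Q Q
      rw [add_self_div_two] at e2
      have e3 : extMoment S Q u ≤
          (a ^ 2 + b ^ 2) * (extMoment S (P n) u + extMoment S (P (n + 1)) u) := by
        have c2 := continuous_wt_div_abs S hu
        unfold extMoment
        rw [← intervalIntegral.integral_add (Continuous.intervalIntegrable (by fun_prop) _ _)
          (Continuous.intervalIntegrable (by fun_prop) _ _), ← intervalIntegral.integral_const_mul]
        refine intervalIntegral.integral_mono_on (by norm_num)
          (Continuous.intervalIntegrable (by fun_prop) _ _)
          (Continuous.intervalIntegrable (by fun_prop) _ _) fun z _ => ?_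
        rw [← add_mul, ← mul_assoc]
        refine mul_le_mul_of_nonneg_right ?_ (div_nonneg (wt_nonneg S z) (abs_nonneg _))
        simp only [hQ, Polynomial.eval_sub, Polynomial.eval_mul, Polynomial.eval_C]
        nlinarith [sq_nonneg (b * (P (n + 1)).eval z + a * (P n).eval z)]
      rw [e1, abs_mul, abs_of_nonneg (sq_nonneg r)]
      have e4 : r ^ 2 ≤ 1 := by rw [← sq_abs]; exact pow_le_one₀ (abs_nonneg _) hrc
      calc _ ≤ 1 * extMoment S Q u := by gcongr
        _ ≤ _ := by linarith
    set I := ∫ z in (-1 : ℝ)..1, ((x - z) * ((x - z) * (k.eval z * kern P (n + 1) x z))) *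
        (wt S z / (z - u))
    -- The decisive cancellation: the zeroth order term of the expansion is exactly `K(x, x) / (x -
    -- u)`. No multiple of the large quantity `K(x, x)` remains, only `a`, `b` and their moments.
    have e : kern P (n + 1) x x * (1 / (x - u)) - 1 / (x - u) * (kern P (n + 1) x x +
        1 / (x - u) * (r * b * a + I)) = -(1 / (x - u) * (1 / (x - u)) * (r * b * a + I)) := by
      ring
    rw [e, abs_neg, abs_mul, abs_mul, abs_div, abs_one]
    have h3 := hb.inv_le hu
    have h4 : 0 ≤ 1 / |x - u| := by positivity
    have h5 : |r * b * a| ≤ (a ^ 2 + b ^ 2) / 2 := by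
      rw [mul_assoc, abs_mul]
      have : |b * a| ≤ (a ^ 2 + b ^ 2) / 2 := by
        rw [abs_le]; constructor <;> nlinarith [sq_nonneg (a + b), sq_nonneg (a - b)]
      exact (mul_le_of_le_one_left (abs_nonneg _) hrc).trans this
    calc 1 / |x - u| * (1 / |x - u|) * |r * b * a + I|
        ≤ 1 / |x - u| * (1 / |x - u|) * ((a ^ 2 + b ^ 2) / 2 + 2 * (a ^ 2 + b ^ 2) *
            (extMoment S (P n) u + extMoment S (P (n + 1)) u) / 2) := by
          gcongr; exact (abs_add_le _ _).trans (add_le_add h5 hQ)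
      _ = 1 / |x - u| * (1 / |x - u|) * ((a ^ 2 + b ^ 2) / 2) +
          1 / |x - u| * (1 / |x - u|) * ((a ^ 2 + b ^ 2) *
            (extMoment S (P n) u + extMoment S (P (n + 1)) u)) := by ring
      _ ≤ 1 / δ * (1 / |x - u|) * ((a ^ 2 + b ^ 2) / 2) +
          1 / δ * (1 / δ) * ((a ^ 2 + b ^ 2) *
            (extMoment S (P n) u + extMoment S (P (n + 1)) u)) := by gcongr
      _ = _ := by field_simp
  -- Integrating the `z`-derivative of `K(x, z)²` by parts expresses the derivative of the diagonal
  -- through the same sum over external points as the derivative of the weight.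
  have hD : 2 * k.derivative.eval x * wt S x + kern P (n + 1) x x * wtDeriv S x =
      wt S x * ∑ u ∈ S, 2 * (kern P (n + 1) x x * (1 / (x - u)) -
      ∫ z in (-1 : ℝ)..1, (k.eval z * kern P (n + 1) x z) * (wt S z / (z - u))) := by
    have h1 : 2 * k.derivative.eval x =
        -∑ u ∈ S, 2 * ∫ z in (-1 : ℝ)..1, (k.eval z * kern P (n + 1) x z) * (wt S z / (z - u)) := by
      rw [← integral_mul_wtDeriv S (by fun_prop), ← hrep]
      exact hibp
    rw [h1, wtDeriv, Finset.mul_sum, Finset.mul_sum, ← Finset.sum_neg_distrib, Finset.sum_mul,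
      ← Finset.sum_add_distrib]
    exact Finset.sum_congr rfl fun u _ => by ring
  rw [hD, abs_mul, abs_of_nonneg hw]
  have hab : 0 ≤ a ^ 2 + b ^ 2 := by positivity
  have hsum : |∑ u ∈ S, 2 * (kern P (n + 1) x x * (1 / (x - u)) -
      ∫ z in (-1 : ℝ)..1, (k.eval z * kern P (n + 1) x z) * (wt S z / (z - u)))| ≤
      T * (1 / δ + 2 / δ ^ 2) * (a ^ 2 + b ^ 2) := by
    refine (Finset.abs_sum_le_sum_abs _ _).trans ?_
    have : ∀ u ∈ S, |2 * (kern P (n + 1) x x * (1 / (x - u)) -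
      ∫ z in (-1 : ℝ)..1, (k.eval z * kern P (n + 1) x z) * (wt S z / (z - u)))| ≤
        (1 / δ * (a ^ 2 + b ^ 2)) * (1 / |x - u|) + (2 / δ ^ 2 * (a ^ 2 + b ^ 2)) *
          (extMoment S (P n) u + extMoment S (P (n + 1)) u) := fun u hu => by
      rw [abs_mul, abs_two]
      refine (mul_le_mul_of_nonneg_left (hterm u hu) zero_le_two).trans (le_of_eq ?_)
      ring
    refine (Finset.sum_le_sum this).trans ?_
    rw [Finset.sum_add_distrib, ← Finset.mul_sum, ← Finset.mul_sum]
    calc _ ≤ (1 / δ * (a ^ 2 + b ^ 2)) * T + (2 / δ ^ 2 * (a ^ 2 + b ^ 2)) * T := by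
          gcongr
          · exact hb.sum_inv_le
          · exact hb.moment_le
      _ = _ := by ring
  calc _ ≤ wt S x * (T * (1 / δ + 2 / δ ^ 2) * (a ^ 2 + b ^ 2)) := by gcongr
    _ = _ := by unfold pairSq; ring

end

end

/-! ### Resolvent matrix elements of orthonormal polynomials -/

section

section

variable {w : ℝ → ℝ} {P : ℕ → ℝ[X]}

theorem integral_low_degree_complex (hP : IsOrthonormalPolys w P) (hw : Continuous w) {n : ℕ}
    {f : ℂ[X]} (hf : f.degree < n) :
    ∫ x in (-1 : ℝ)..1, f.eval (x : ℂ) * (((P n).eval x : ℝ) : ℂ) * (w x : ℂ) = 0 :=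
  integral_low_degree (𝕜 := ℂ) hP hw hf

theorem expansion_eq_complex (hP : IsOrthonormalPolys w P) (hw : Continuous w) {n : ℕ} {f : ℂ[X]}
    (hf : f.degree < n) (z : ℂ) :
    ∑ j ∈ Finset.range n,
      (∫ x in (-1 : ℝ)..1, f.eval (x : ℂ) * (((P j).eval x : ℝ) : ℂ) * (w x : ℂ)) *
      ((P j).map (algebraMap ℝ ℂ)).eval z = f.eval z :=
  expansion_eq (𝕜 := ℂ) hP hw hf z

theorem eval_map_complex (f : ℝ[X]) (x : ℝ) :
    (f.map (algebraMap ℝ ℂ)).eval (x : ℂ) = ((f.eval x : ℝ) : ℂ) :=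
  eval_map_ofReal (𝕜 := ℂ) f x

theorem integral_deriv_mul_wt_complex {S : Finset ℝ} (hS : IsExt S) {f f' : ℝ → ℂ}
    (hf : ∀ x, HasDerivAt f (f' x) x) (hc : Continuous f') :
    ∫ x in (-1 : ℝ)..1, f' x * (wt S x : ℂ) = -∫ x in (-1 : ℝ)..1, f x * (wtDeriv S x : ℂ) :=
  integral_deriv_mul_wt (𝕜 := ℂ) hS.one_mem hS.neg_one_mem hf hc

theorem sub_ofReal_ne {z : ℂ} (hz : z.im ≠ 0) (x : ℝ) : z - x ≠ 0 := fun h => by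
  have := congrArg Complex.im h
  simp at this
  exact hz this

theorem continuous_resolvent {z : ℂ} (hz : z.im ≠ 0) :
    Continuous fun x : ℝ => (z - (x : ℂ))⁻¹ :=
  Continuous.inv₀ (by fun_prop) (sub_ofReal_ne hz)

/-- The transform `∫ f w / (z - x)`. -/
def stieltjes (w : ℝ → ℝ) (f : ℝ → ℂ) (z : ℂ) : ℂ :=
  ∫ x in (-1 : ℝ)..1, f x * (w x : ℂ) * (z - (x : ℂ))⁻¹

/-- The quotient is `(f(z) - f(x)) / (z - x)`: this is how a resolvent is exchanged for a polynomial
of lower degree. -/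
theorem divX_sub_C (f : ℂ[X]) (z : ℂ) :
    f = (Polynomial.X - Polynomial.C z) * (f /ₘ (Polynomial.X - Polynomial.C z)) +
      Polynomial.C (f.eval z) := by
  have := Polynomial.modByMonic_add_div f (Polynomial.X - Polynomial.C z)
  rw [Polynomial.modByMonic_X_sub_C_eq_C_eval] at this
  rw [add_comm]; exact this.symm

theorem eval_divX_sub_C {z : ℂ} (hz : z.im ≠ 0) (f : ℂ[X]) (x : ℝ) :
    (f /ₘ (Polynomial.X - Polynomial.C z)).eval (x : ℂ) =
      (f.eval z - f.eval (x : ℂ)) * (z - (x : ℂ))⁻¹ := by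
  have h := congrArg (Polynomial.eval (x : ℂ)) (divX_sub_C f z)
  simp only [Polynomial.eval_add, Polynomial.eval_mul, Polynomial.eval_sub, Polynomial.eval_X,
    Polynomial.eval_C] at h
  have hne := sub_ofReal_ne hz x
  rw [h]
  field_simp
  ring

theorem degree_divX_sub_C_lt {f : ℂ[X]} {n : ℕ} (hf : f.degree ≤ n) (z : ℂ) :
    (f /ₘ (Polynomial.X - Polynomial.C z)).degree < n := by
  by_cases h : f = 0
  · simp [h]
  · exact (Polynomial.degree_divByMonic_lt f _ h (by
      rw [Polynomial.degree_X_sub_C]; exact zero_lt_one)).trans_le hf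

/-- Replacing `f(x)` by `f(z)` costs `z - x` times a polynomial of degree below `n`. The factor
cancels the resolvent, and the polynomial is orthogonal to `P n`. -/
theorem stieltjes_mul (hP : IsOrthonormalPolys w P) (hw : Continuous w) {n : ℕ} {f : ℂ[X]}
    (hf : f.degree ≤ n) {z : ℂ} (hz : z.im ≠ 0) :
    stieltjes w (fun x => f.eval (x : ℂ) * (((P n).eval x : ℝ) : ℂ)) z =
      f.eval z * stieltjes w (fun x => (((P n).eval x : ℝ) : ℂ)) z := by
  have c1 := continuous_resolvent hz
  have c2 := continuous_eval_ofReal (𝕜 := ℂ) (f /ₘ (Polynomial.X - Polynomial.C z))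
  have h0 := integral_low_degree_complex hP hw (degree_divX_sub_C_lt hf z)
  unfold stieltjes
  rw [← add_zero (∫ x in (-1 : ℝ)..1, f.eval (x : ℂ) * _ * _ * _), ← h0,
    ← intervalIntegral.integral_const_mul, ← intervalIntegral.integral_add]
  · refine intervalIntegral.integral_congr fun x _ => ?_
    simp only [eval_divX_sub_C hz]
    ring
  · refine Continuous.intervalIntegrable ?_ _ _
    exact (((continuous_eval_ofReal (𝕜 := ℂ) f).mul (by fun_prop)).mul (by fun_prop)).mul c1
  · refine Continuous.intervalIntegrable ?_ _ _
    exact (c2.mul (by fun_prop)).mul (by fun_prop)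

/-- The matrix elements of the resolvent. -/
def resolv (w : ℝ → ℝ) (P : ℕ → ℝ[X]) (z : ℂ) (i j : ℕ) : ℂ :=
  stieltjes w (fun x => (((P i).eval x : ℝ) : ℂ) * (((P j).eval x : ℝ) : ℂ)) z

/-- Matrix elements factor into the polynomial of the smaller index and the function of the second
kind of the larger one, evaluated at the same `z`. -/
theorem resolv_eq (hP : IsOrthonormalPolys w P) (hw : Continuous w) {i j : ℕ} (hij : i ≤ j)
    {z : ℂ} (hz : z.im ≠ 0) :
    resolv w P z i j = ((P i).map (algebraMap ℝ ℂ)).eval z *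
      stieltjes w (fun x => (((P j).eval x : ℝ) : ℂ)) z := by
  rw [← stieltjes_mul hP hw (f := (P i).map (algebraMap ℝ ℂ)) (n := j) ?_ hz]
  · unfold resolv
    simp_rw [eval_map_complex]
  · refine Polynomial.degree_map_le.trans ?_
    rw [hP.degree_eq]; exact_mod_cast hij

/-- The derivative of `P m` can be pulled out at `z`, where it is the value of the difference
quotient of `P m`. Expanding that quotient in the `P j`, `j < m`, and using the factorization of
matrix elements gives the two-by-two minors. The products `G_jj G_mm` of these minors give the
coupling of `P m` to the density of the first `m` functions. -/
theorem stieltjes_derivative (hP : IsOrthonormalPolys w P) (hw : Continuous w) (m : ℕ)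
    {z : ℂ} (hz : z.im ≠ 0) :
    stieltjes w (fun x => (((P m).derivative.eval x : ℝ) : ℂ) * (((P m).eval x : ℝ) : ℂ)) z =
      ∑ j ∈ Finset.range m,
        (resolv w P z j j * resolv w P z m m - resolv w P z j m ^ 2) := by
  set p := (P m).map (algebraMap ℝ ℂ) with hp
  set c := fun j => stieltjes w (fun x => (((P j).eval x : ℝ) : ℂ)) z with hc
  have hpd : p.degree ≤ m := by
    refine Polynomial.degree_map_le.trans ?_
    rw [hP.degree_eq]
  have h1 := stieltjes_mul hP hw (f := p.derivative) (n := m)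
    (Polynomial.degree_derivative_le.trans hpd) hz
  have h1' : stieltjes w (fun x => (((P m).derivative.eval x : ℝ) : ℂ) *
      (((P m).eval x : ℝ) : ℂ)) z = p.derivative.eval z * c m := by
    rw [← h1]
    simp_rw [hp, Polynomial.derivative_map, eval_map_complex]
  have c1 := continuous_resolvent hz
  have h2 := expansion_eq_complex hP hw (degree_divX_sub_C_lt hpd z) z
  have h3 : (p /ₘ (Polynomial.X - Polynomial.C z)).eval z = p.derivative.eval z := by
    have h := congrArg (fun f => (Polynomial.derivative f).eval z) (divX_sub_C p z)
    simp only [Polynomial.derivative_add, Polynomial.derivative_mul, Polynomial.derivative_C,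
      Polynomial.derivative_sub, Polynomial.derivative_X] at h
    simpa using h.symm
  have h4 : ∀ j ∈ Finset.range m, (∫ x in (-1 : ℝ)..1,
      (p /ₘ (Polynomial.X - Polynomial.C z)).eval (x : ℂ) * (((P j).eval x : ℝ) : ℂ) * (w x : ℂ))
      = p.eval z * c j - resolv w P z j m := by
    intro j _
    unfold resolv
    simp only [hc, stieltjes]
    rw [← intervalIntegral.integral_const_mul, ← intervalIntegral.integral_sub]
    · refine intervalIntegral.integral_congr fun x _ => ?_
      simp only [eval_divX_sub_C hz, hp, eval_map_complex]
      ring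
    · exact Continuous.intervalIntegrable (by fun_prop) _ _
    · exact Continuous.intervalIntegrable (by fun_prop) _ _
  rw [h1', ← h3, ← h2, Finset.sum_mul]
  refine Finset.sum_congr rfl fun j hj => ?_
  rw [h4 j hj, resolv_eq hP hw le_rfl hz, resolv_eq hP hw le_rfl hz,
    resolv_eq hP hw (Finset.mem_range.1 hj).le hz]
  ring

end

end

/-! ### The loop equation and the resulting bound for Poisson averages -/

section

/-- The Poisson-type kernel `η / ((x - a)² + η²)`. -/
def pois (a η x : ℝ) : ℝ := η / ((x - a) ^ 2 + η ^ 2)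

/-- The real part of `1 / (a + iη - x)`. -/
def coPois (a η x : ℝ) : ℝ := (a - x) / ((x - a) ^ 2 + η ^ 2)

theorem pois_nonneg {a η : ℝ} (hη : 0 < η) (x : ℝ) : 0 ≤ pois a η x := by
  unfold pois; positivity

theorem continuous_pois {a η : ℝ} (hη : 0 < η) : Continuous (pois a η) :=
  Continuous.div (by fun_prop) (by fun_prop) fun x => by positivity

theorem continuous_coPois {a η : ℝ} (hη : 0 < η) : Continuous (coPois a η) :=
  Continuous.div (by fun_prop) (by fun_prop) fun x => by positivity

/-- Both sides equal `|z - x|^{-2}` with `z = a + iη`. This Ward identity turns second moments of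
the resolvent into a Poisson average divided by `η`. -/
theorem coPois_sq_add {a η : ℝ} (hη : 0 < η) (x : ℝ) :
    coPois a η x ^ 2 + pois a η x ^ 2 = pois a η x / η := by
  unfold pois coPois
  have : (x - a) ^ 2 + η ^ 2 ≠ 0 := by positivity
  field_simp
  ring

theorem resolvent_eq {a η : ℝ} (hη : 0 < η) (x : ℝ) :
    ((⟨a, η⟩ : ℂ) - x)⁻¹ = (coPois a η x : ℂ) - (pois a η x : ℂ) * Complex.I := by
  have hne : (x - a) ^ 2 + η ^ 2 ≠ 0 := by positivity
  have h1 : Complex.normSq ((⟨a, η⟩ : ℂ) - x) = (x - a) ^ 2 + η ^ 2 := by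
    rw [Complex.normSq_apply]; simp; ring
  apply Complex.ext
  · rw [Complex.inv_re, h1]; simp only [Complex.sub_re, Complex.mul_re, Complex.ofReal_re, Complex.ofReal_im, Complex.I_re,
      Complex.I_im, coPois]; ring
  · rw [Complex.inv_im, h1]; simp only [Complex.sub_im, Complex.mul_im, Complex.ofReal_re, Complex.ofReal_im, Complex.I_re,
      Complex.I_im, pois]; ring

theorem stieltjes_ofReal {w f : ℝ → ℝ} (hw : Continuous w) (hf : Continuous f) {a η : ℝ}
    (hη : 0 < η) :
    stieltjes w (fun x => (f x : ℂ)) ⟨a, η⟩ =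
      ((∫ x in (-1 : ℝ)..1, f x * coPois a η x * w x : ℝ) : ℂ) -
        ((∫ x in (-1 : ℝ)..1, f x * pois a η x * w x : ℝ) : ℂ) * Complex.I := by
  have c1 := continuous_pois (a := a) hη
  have c2 := continuous_coPois (a := a) hη
  unfold stieltjes
  rw [← intervalIntegral.integral_ofReal, ← intervalIntegral.integral_ofReal,
    ← intervalIntegral.integral_mul_const, ← intervalIntegral.integral_sub]
  · refine intervalIntegral.integral_congr fun x _ => ?_
    simp only [resolvent_eq hη]
    push_cast; ring
  · exact Continuous.intervalIntegrable (by fun_prop) _ _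
  · exact Continuous.intervalIntegrable (by fun_prop) _ _

section

variable {w : ℝ → ℝ} {P : ℕ → ℝ[X]}

/-- Bessel's inequality. -/
theorem bessel (hP : IsOrthonormalPolys w P) (hw : Continuous w) (h0 : ∀ x, 0 ≤ w x) (m : ℕ)
    {h : ℝ → ℝ} (hh : Continuous h) :
    ∑ j ∈ Finset.range m, (∫ x in (-1 : ℝ)..1, h x * (P j).eval x * w x) ^ 2 ≤
      ∫ x in (-1 : ℝ)..1, h x ^ 2 * w x := by
  set c := fun j => ∫ x in (-1 : ℝ)..1, h x * (P j).eval x * w x with hc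
  set q : ℝ[X] := ∑ j ∈ Finset.range m, Polynomial.C (c j) * P j with hq
  have hqe : ∀ x, q.eval x = ∑ j ∈ Finset.range m, c j * (P j).eval x := fun x => by
    simp [hq, Polynomial.eval_finsetSum]
  have hlin : ∀ f : ℝ → ℝ, Continuous f → ∫ x in (-1 : ℝ)..1, f x * q.eval x * w x =
      ∑ j ∈ Finset.range m, c j * ∫ x in (-1 : ℝ)..1, f x * (P j).eval x * w x := by
    intro f hf
    have : ∀ x, f x * q.eval x * w x =
        ∑ j ∈ Finset.range m, c j * (f x * (P j).eval x * w x) := fun x => by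
      rw [hqe, Finset.mul_sum, Finset.sum_mul]
      exact Finset.sum_congr rfl fun j _ => by ring
    simp_rw [this]
    rw [intervalIntegral.integral_finsetSum]
    · simp_rw [intervalIntegral.integral_const_mul]
    · intro j _; exact Continuous.intervalIntegrable (by fun_prop) _ _
  have h1 : ∫ x in (-1 : ℝ)..1, h x * q.eval x * w x = ∑ j ∈ Finset.range m, c j ^ 2 := by
    rw [hlin h hh]; exact Finset.sum_congr rfl fun j _ => by rw [sq]
  have h2 : ∫ x in (-1 : ℝ)..1, q.eval x * q.eval x * w x = ∑ j ∈ Finset.range m, c j ^ 2 := by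
    rw [hlin _ q.continuous]
    refine Finset.sum_congr rfl fun j hj => ?_
    have : ∫ x in (-1 : ℝ)..1, q.eval x * (P j).eval x * w x = c j := by
      have e : ∫ x in (-1 : ℝ)..1, q.eval x * (P j).eval x * w x =
          ∫ x in (-1 : ℝ)..1, (P j).eval x * q.eval x * w x :=
        intervalIntegral.integral_congr fun x _ => by ring
      rw [e, hlin _ (P j).continuous]
      simp_rw [hP.2 j]
      rw [Finset.sum_eq_single_of_mem j hj]
      · simp
      · intro b _ hb; simp [hb.symm]
    rw [this, sq]
  have h3 : 0 ≤ ∫ x in (-1 : ℝ)..1, (h x - q.eval x) ^ 2 * w x :=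
    intervalIntegral.integral_nonneg (by norm_num) fun x _ => mul_nonneg (sq_nonneg _) (h0 x)
  have h4 : ∫ x in (-1 : ℝ)..1, (h x - q.eval x) ^ 2 * w x =
      (∫ x in (-1 : ℝ)..1, h x ^ 2 * w x) - 2 * (∫ x in (-1 : ℝ)..1, h x * q.eval x * w x) +
        ∫ x in (-1 : ℝ)..1, q.eval x * q.eval x * w x := by
    rw [← intervalIntegral.integral_const_mul,
      ← intervalIntegral.integral_sub (Continuous.intervalIntegrable (by fun_prop) _ _)
        (Continuous.intervalIntegrable (by fun_prop) _ _),
      ← intervalIntegral.integral_add (Continuous.intervalIntegrable (by fun_prop) _ _)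
        (Continuous.intervalIntegrable (by fun_prop) _ _)]
    exact intervalIntegral.integral_congr fun x _ => by ring
  rw [h4, h1, h2] at h3
  linarith

end

section

variable {S : Finset ℝ} {P : ℕ → ℝ[X]}

/-- The loop equation for a single orthonormal polynomial. -/
theorem loop_equation (hS : IsExt S) (hP : IsOrthonormalPolys (wt S) P) (m : ℕ) {z : ℂ}
    (hz : z.im ≠ 0) :
    2 * resolv (wt S) P z m m * (∑ j ∈ Finset.range m, resolv (wt S) P z j j +
        ∑ u ∈ S, (z - (u : ℂ))⁻¹) =
      2 * ∑ j ∈ Finset.range m, resolv (wt S) P z j m ^ 2 -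
        (∫ x in (-1 : ℝ)..1, (((P m).eval x : ℝ) : ℂ) ^ 2 * (z - (x : ℂ))⁻¹ ^ 2 * (wt S x : ℂ)) -
        ∑ u ∈ S, 2 * (z - (u : ℂ))⁻¹ *
          ((∫ x in (-1 : ℝ)..1, (P m).eval x * (P m).eval x * (wt S x / (x - u)) : ℝ) : ℂ) := by
  have c1 := continuous_resolvent hz
  have hpd : ∀ (f : ℝ[X]) (x : ℝ), HasDerivAt (fun x : ℝ => ((f.eval x : ℝ) : ℂ))
      ((f.derivative.eval x : ℝ) : ℂ) x := fun f x => (f.hasDerivAt x).ofReal_comp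
  have hrd : ∀ x : ℝ, HasDerivAt (fun x : ℝ => (z - (x : ℂ))⁻¹) ((z - (x : ℂ))⁻¹ ^ 2) x := by
    intro x
    have h1 : HasDerivAt (fun x : ℝ => z - (x : ℂ)) (-1) x := by
      simpa using ((hasDerivAt_id x).ofReal_comp).const_sub z
    refine (h1.fun_inv (sub_ofReal_ne hz x)).congr_deriv ?_
    rw [neg_neg, one_div, inv_pow]
  -- The loop equation is the integration by parts of `P_m(x)² / (z - x)` against the weight.
  have hibp := integral_deriv_mul_wt_complex hS
    (fun x => ((hpd (P m) x).fun_pow 2).fun_mul (hrd x)) (by fun_prop)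
  have hL : ∫ x in (-1 : ℝ)..1,
      (((2 : ℕ) : ℂ) * (((P m).eval x : ℝ) : ℂ) ^ (2 - 1) * (((P m).derivative.eval x : ℝ) : ℂ) *
        (z - (x : ℂ))⁻¹ + (((P m).eval x : ℝ) : ℂ) ^ 2 * (z - (x : ℂ))⁻¹ ^ 2) * (wt S x : ℂ) =
      2 * stieltjes (wt S) (fun x => (((P m).derivative.eval x : ℝ) : ℂ) *
        (((P m).eval x : ℝ) : ℂ)) z +
      ∫ x in (-1 : ℝ)..1, (((P m).eval x : ℝ) : ℂ) ^ 2 * (z - (x : ℂ))⁻¹ ^ 2 * (wt S x : ℂ) := by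
    unfold stieltjes
    rw [← intervalIntegral.integral_const_mul,
      ← intervalIntegral.integral_add (Continuous.intervalIntegrable (by fun_prop) _ _)
        (Continuous.intervalIntegrable (by fun_prop) _ _)]
    refine intervalIntegral.integral_congr fun x _ => ?_
    norm_num; ring
  -- Partial fractions: `1 / ((z - x) (x - u)) = (1 / (z - u)) (1 / (z - x) + 1 / (x - u))`.
  have hR : ∫ x in (-1 : ℝ)..1, ((((P m).eval x : ℝ) : ℂ) ^ 2 * (z - (x : ℂ))⁻¹) *
      (wtDeriv S x : ℂ) = ∑ u ∈ S, 2 * (z - (u : ℂ))⁻¹ * (resolv (wt S) P z m m +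
        ((∫ x in (-1 : ℝ)..1, (P m).eval x * (P m).eval x * (wt S x / (x - u)) : ℝ) : ℂ)) := by
    have h1 : ∀ x : ℝ, ((((P m).eval x : ℝ) : ℂ) ^ 2 * (z - (x : ℂ))⁻¹) * (wtDeriv S x : ℂ) =
        ∑ u ∈ S, 2 * (z - (u : ℂ))⁻¹ * ((((P m).eval x : ℝ) : ℂ) * (((P m).eval x : ℝ) : ℂ) *
          (wt S x : ℂ) * (z - (x : ℂ))⁻¹ +
          (((P m).eval x * (P m).eval x * (wt S x / (x - u)) : ℝ) : ℂ)) := by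
      intro x
      rw [wtDeriv, Complex.ofReal_sum, Finset.mul_sum]
      refine Finset.sum_congr rfl fun u hu => ?_
      have n1 := sub_ofReal_ne hz x
      have n2 := sub_ofReal_ne hz u
      by_cases hxu : x = u
      · subst hxu; simp [wt_eq_zero hu]
      · have n3 : (x : ℂ) - u ≠ 0 := by
          rw [sub_ne_zero]; exact_mod_cast hxu
        push_cast
        field_simp
        ring
    simp_rw [h1]
    rw [intervalIntegral.integral_finsetSum]
    · refine Finset.sum_congr rfl fun u hu => ?_
      have c2 := continuous_wt_div S hu
      rw [intervalIntegral.integral_const_mul, intervalIntegral.integral_add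
        (Continuous.intervalIntegrable (by fun_prop) _ _)
        (Continuous.intervalIntegrable (by fun_prop) _ _), intervalIntegral.integral_ofReal]
      rfl
    · intro u hu
      have c2 := continuous_wt_div S hu
      exact Continuous.intervalIntegrable (by fun_prop) _ _
  rw [hL, hR, stieltjes_derivative hP (continuous_wt S) m hz] at hibp
  simp only [mul_add, Finset.sum_add_distrib, Finset.sum_sub_distrib, ← Finset.sum_mul] at hibp
  have e : ∑ u ∈ S, 2 * (z - (u : ℂ))⁻¹ = 2 * ∑ u ∈ S, (z - (u : ℂ))⁻¹ := by
    rw [Finset.mul_sum]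
  rw [e] at hibp
  linear_combination hibp

/-- If the Poisson average of the density of the first `m` functions is large, then the one of
`ψ_m²` is small. -/
theorem integral_sq_mul_pois_le (hS : IsExt S) (hP : IsOrthonormalPolys (wt S) P) (m : ℕ)
    {a η δ A T : ℝ} (hη : 0 < η) (hδ : 0 < δ) (hdist : ∀ u ∈ S, δ ≤ |a - u|)
    (hT : ∑ u ∈ S, extMoment S (P m) u ≤ T) (hA : 3 / η ≤ A)
    (hmass : A ≤ ∫ x in (-1 : ℝ)..1, kern P m x x * pois a η x * wt S x) :
    ∫ x in (-1 : ℝ)..1, (P m).eval x ^ 2 * pois a η x * wt S x ≤ 2 * T / (δ * A) := by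
  have hA0 : 0 < A := lt_of_lt_of_le (by positivity) hA
  have c1 := continuous_pois (a := a) hη
  have c2 := continuous_coPois (a := a) hη
  set z : ℂ := ⟨a, η⟩ with hz
  have hzi : z.im ≠ 0 := hη.ne'
  have hres : ∀ i j, resolv (wt S) P z i j =
      ((∫ x in (-1 : ℝ)..1, ((P i).eval x * (P j).eval x) * coPois a η x * wt S x : ℝ) : ℂ) -
      ((∫ x in (-1 : ℝ)..1, ((P i).eval x * (P j).eval x) * pois a η x * wt S x : ℝ) : ℂ) *
        Complex.I := by
    intro i j
    rw [← stieltjes_ofReal (continuous_wt S) (by fun_prop) hη]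
    unfold resolv; simp only [Complex.ofReal_mul]; rfl
  set J := ∫ x in (-1 : ℝ)..1, (P m).eval x ^ 2 * pois a η x * wt S x with hJ
  have hJ0 : 0 ≤ J := intervalIntegral.integral_nonneg (by norm_num) fun x _ =>
    mul_nonneg (mul_nonneg (sq_nonneg _) (pois_nonneg hη x)) (wt_nonneg S x)
  set g := resolv (wt S) P z m m with hg
  have hgJ : J ≤ ‖g‖ := by
    have h1 : g.im = -J := by
      rw [hg, hres]
      simp [hJ, sq]
    rw [← abs_of_nonneg hJ0, ← abs_neg, ← h1]
    exact Complex.abs_im_le_norm g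
  -- the second moment of the resolvent
  have hsq : ∫ x in (-1 : ℝ)..1, (P m).eval x ^ 2 * (coPois a η x ^ 2 + pois a η x ^ 2) * wt S x =
      J / η := by
    rw [hJ, ← intervalIntegral.integral_div]
    refine intervalIntegral.integral_congr fun x _ => ?_
    simp only [coPois_sq_add hη]; ring
  -- Bessel's inequality is applied separately to the real and imaginary parts of `P_m / (z - x)`;
  -- their squares add up to the Ward identity.
  have hbes : ‖∑ j ∈ Finset.range m, resolv (wt S) P z j m ^ 2‖ ≤ J / η := by
    refine (norm_sum_le _ _).trans ?_
    have b1 := bessel hP (continuous_wt S) (wt_nonneg S) m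
      (h := fun x => (P m).eval x * coPois a η x) (by fun_prop)
    have b2 := bessel hP (continuous_wt S) (wt_nonneg S) m
      (h := fun x => (P m).eval x * pois a η x) (by fun_prop)
    have e : ∀ j ∈ Finset.range m, ‖resolv (wt S) P z j m ^ 2‖ =
        (∫ x in (-1 : ℝ)..1, (P m).eval x * coPois a η x * (P j).eval x * wt S x) ^ 2 +
        (∫ x in (-1 : ℝ)..1, (P m).eval x * pois a η x * (P j).eval x * wt S x) ^ 2 := by
      intro j _
      rw [norm_pow, ← Complex.normSq_eq_norm_sq, hres, Complex.normSq_apply]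
      simp only [Complex.sub_re, Complex.sub_im, Complex.mul_re, Complex.mul_im,
        Complex.ofReal_re, Complex.ofReal_im, Complex.I_re, Complex.I_im]
      have e1 : ∫ x in (-1 : ℝ)..1, ((P j).eval x * (P m).eval x) * coPois a η x * wt S x =
          ∫ x in (-1 : ℝ)..1, (P m).eval x * coPois a η x * (P j).eval x * wt S x :=
        intervalIntegral.integral_congr fun x _ => by ring
      have e2 : ∫ x in (-1 : ℝ)..1, ((P j).eval x * (P m).eval x) * pois a η x * wt S x =
          ∫ x in (-1 : ℝ)..1, (P m).eval x * pois a η x * (P j).eval x * wt S x :=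
        intervalIntegral.integral_congr fun x _ => by ring
      rw [e1, e2]; ring
    rw [Finset.sum_congr rfl e, Finset.sum_add_distrib]
    refine (add_le_add b1 b2).trans (le_of_eq ?_)
    rw [← hsq, ← intervalIntegral.integral_add (Continuous.intervalIntegrable (by fun_prop) _ _)
      (Continuous.intervalIntegrable (by fun_prop) _ _)]
    exact intervalIntegral.integral_congr fun x _ => by ring
  have hnsq : ∀ x : ℝ, ‖(z - (x : ℂ))⁻¹‖ ^ 2 = coPois a η x ^ 2 + pois a η x ^ 2 := by
    intro x
    rw [hz, resolvent_eq hη, ← Complex.normSq_eq_norm_sq, Complex.normSq_apply]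
    simp; ring
  have hsecond : ‖∫ x in (-1 : ℝ)..1,
      (((P m).eval x : ℝ) : ℂ) ^ 2 * (z - (x : ℂ))⁻¹ ^ 2 * (wt S x : ℂ)‖ ≤ J / η := by
    rw [← hsq]
    refine (intervalIntegral.norm_integral_le_integral_norm (by norm_num)).trans (le_of_eq ?_)
    refine intervalIntegral.integral_congr fun x _ => ?_
    simp only [norm_mul, norm_pow, Complex.norm_real, Real.norm_eq_abs, sq_abs,
      abs_of_nonneg (wt_nonneg S x), hnsq]
  have hext : ‖∑ u ∈ S, 2 * (z - (u : ℂ))⁻¹ *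
      ((∫ x in (-1 : ℝ)..1, (P m).eval x * (P m).eval x * (wt S x / (x - u)) : ℝ) : ℂ)‖ ≤
      2 * T / δ := by
    refine (norm_sum_le _ _).trans ?_
    have : ∀ u ∈ S, ‖2 * (z - (u : ℂ))⁻¹ *
      ((∫ x in (-1 : ℝ)..1, (P m).eval x * (P m).eval x * (wt S x / (x - u)) : ℝ) : ℂ)‖ ≤
        2 / δ * extMoment S (P m) u := by
      intro u hu
      have h1 := abs_integral_wt_div_le hu (P m) (P m)
      rw [add_self_div_two] at h1
      have h2 : ‖(z - (u : ℂ))⁻¹‖ ≤ δ⁻¹ := by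
        rw [norm_inv]
        refine inv_anti₀ hδ ((hdist u hu).trans ?_)
        have := Complex.abs_re_le_norm (z - (u : ℂ))
        simpa [hz] using this
      rw [norm_mul, norm_mul, Complex.norm_real, Real.norm_eq_abs, div_eq_mul_inv]
      simp only [Complex.norm_ofNat]
      gcongr
    refine (Finset.sum_le_sum this).trans ?_
    rw [← Finset.mul_sum]
    calc _ ≤ 2 / δ * T := by gcongr
      _ = _ := by ring
  -- In the upper half plane all imaginary parts are nonpositive, so the external points can only
  -- increase the modulus.
  have hM : A ≤ ‖∑ j ∈ Finset.range m, resolv (wt S) P z j j + ∑ u ∈ S, (z - (u : ℂ))⁻¹‖ := by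
    refine le_trans ?_ (Complex.abs_im_le_norm _)
    rw [← abs_neg]
    refine le_trans ?_ (le_abs_self _)
    have e1 : ∀ j ∈ Finset.range m, (resolv (wt S) P z j j).im =
        -∫ x in (-1 : ℝ)..1, (P j).eval x ^ 2 * pois a η x * wt S x := fun j _ => by
      rw [hres]; simp [sq]
    have e2 : ∀ u ∈ S, ((z - (u : ℂ))⁻¹).im = -pois a η u := fun u _ => by
      rw [hz, resolvent_eq hη]; simp
    rw [Complex.add_im, Complex.im_sum, Complex.im_sum, Finset.sum_congr rfl e1,
      Finset.sum_congr rfl e2, Finset.sum_neg_distrib, Finset.sum_neg_distrib]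
    have e3 : ∫ x in (-1 : ℝ)..1, kern P m x x * pois a η x * wt S x =
        ∑ j ∈ Finset.range m, ∫ x in (-1 : ℝ)..1, (P j).eval x ^ 2 * pois a η x * wt S x := by
      rw [← intervalIntegral.integral_finsetSum]
      · refine intervalIntegral.integral_congr fun x _ => ?_
        simp only [kern_self, Finset.sum_mul]
      · intro j _; exact Continuous.intervalIntegrable (by fun_prop) _ _
    rw [e3] at hmass
    have : 0 ≤ ∑ u ∈ S, pois a η u := Finset.sum_nonneg fun u _ => pois_nonneg hη u
    linarith
  have hloop := congrArg (fun t => ‖t‖) (loop_equation hS hP m hzi)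
  simp only [← hg] at hloop
  have h5 : 2 * ‖g‖ * A ≤ 2 * (J / η) + J / η + 2 * T / δ := by
    calc 2 * ‖g‖ * A ≤ 2 * ‖g‖ * ‖∑ j ∈ Finset.range m, resolv (wt S) P z j j +
          ∑ u ∈ S, (z - (u : ℂ))⁻¹‖ := by gcongr
      _ = ‖2 * g * (∑ j ∈ Finset.range m, resolv (wt S) P z j j +
          ∑ u ∈ S, (z - (u : ℂ))⁻¹)‖ := by rw [norm_mul, norm_mul, Complex.norm_ofNat]
      _ ≤ _ := by
        rw [hloop]
        refine (norm_sub_le _ _).trans (add_le_add ((norm_sub_le _ _).trans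
          (add_le_add ?_ hsecond)) hext)
        rw [norm_mul, Complex.norm_ofNat]
        exact mul_le_mul_of_nonneg_left hbes zero_le_two
  -- The quadratic error terms cost `3 J / η`, which the assumption `3 / η ≤ A` absorbs into the
  -- left side. Only the force of the external points survives.
  have h6 : 3 / η * J ≤ A * ‖g‖ := by gcongr
  have h7 : 2 * (J / η) + J / η = 3 / η * J := by ring
  have h8 : ‖g‖ * A ≤ 2 * T / δ := by nlinarith
  have h9 : J * A ≤ 2 * T / δ := (mul_le_mul_of_nonneg_right hgJ hA0.le).trans h8
  rw [← div_div, le_div_iff₀ hA0]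
  exact h9

end

end

section

/-! ### Existence of orthonormal polynomials -/

/-- Gram–Schmidt orthonormalization of the monomials with respect to `w` on `[-1, 1]`. -/
def gsPoly (w : ℝ → ℝ) : ℕ → ℝ[X]
  | n =>
    let r : ℝ[X] := Polynomial.X ^ n - ∑ j : Fin n, Polynomial.C
      (∫ x in (-1 : ℝ)..1, x ^ n * (gsPoly w j).eval x * w x) * gsPoly w j
    Polynomial.C (√(∫ x in (-1 : ℝ)..1, r.eval x ^ 2 * w x))⁻¹ * r
  decreasing_by all_goals exact j.2

/-- The unnormalized polynomials of the Gram–Schmidt process. -/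
def gsAux (w : ℝ → ℝ) (n : ℕ) : ℝ[X] := Polynomial.X ^ n - ∑ j : Fin n, Polynomial.C
      (∫ x in (-1 : ℝ)..1, x ^ n * (gsPoly w j).eval x * w x) * gsPoly w j

theorem gsPoly_eq (w : ℝ → ℝ) (n : ℕ) :
    gsPoly w n = Polynomial.C (√(∫ x in (-1 : ℝ)..1, (gsAux w n).eval x ^ 2 * w x))⁻¹ *
      gsAux w n := by
  rw [gsPoly]; rfl

/-- The integrand is nonnegative and vanishes only at finitely many points. -/
theorem integral_sq_mul_wt_pos (S : Finset ℝ) {p : ℝ[X]} (hp : p ≠ 0) :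
    0 < ∫ x in (-1 : ℝ)..1, p.eval x ^ 2 * wt S x := by
  have hfin : ((S : Set ℝ) ∪ (p.roots.toFinset : Set ℝ)).Finite :=
    S.finite_toSet.union (Finset.finite_toSet _)
  obtain ⟨c, hc, hcn⟩ := ((Set.Icc_infinite (by norm_num : (-1 : ℝ) < 1)).sdiff hfin).nonempty
  refine intervalIntegral.integral_pos (by norm_num) (by fun_prop)
    (fun x _ => mul_nonneg (sq_nonneg _) (wt_nonneg S x)) ⟨c, hc, ?_⟩
  simp only [Set.mem_union, Finset.mem_coe, Multiset.mem_toFinset, not_or] at hcn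
  have h1 : p.eval c ≠ 0 := fun h => hcn.2 ((Polynomial.mem_roots hp).2 h)
  have := wt_pos hcn.1
  positivity

/-- Some orthonormal family is needed because the bounds on the density itself do not mention one.
-/
theorem isOrthonormalPolys_gsPoly (S : Finset ℝ) : IsOrthonormalPolys (wt S) (gsPoly (wt S)) := by
  set w := wt S with hw
  have hwc : Continuous w := continuous_wt S
  have key : ∀ n, (gsPoly w n).natDegree = n ∧
      ∀ k ≤ n, ∫ x in (-1 : ℝ)..1, (gsPoly w n).eval x * (gsPoly w k).eval x * w x =
        if n = k then 1 else 0 := by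
    intro n
    induction n using Nat.strong_induction_on with
    | _ n ih =>
      set c : Fin n → ℝ := fun j => ∫ x in (-1 : ℝ)..1, x ^ n * (gsPoly w j).eval x * w x with hc
      have hlow : (∑ j : Fin n, Polynomial.C (c j) * gsPoly w j).degree < (n : ℕ) := by
        rw [Polynomial.degree_lt_iff_coeff_zero]
        intro m hm
        rw [Polynomial.finsetSum_coeff]
        refine Finset.sum_eq_zero fun j _ => ?_
        rw [Polynomial.coeff_C_mul, Polynomial.coeff_eq_zero_of_natDegree_lt, mul_zero]
        rw [(ih j j.2).1]; omega
      have hdeg : (gsAux w n).degree = n := by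
        unfold gsAux
        rw [Polynomial.degree_sub_eq_left_of_degree_lt, Polynomial.degree_X_pow]
        rwa [Polynomial.degree_X_pow]
      have hne : gsAux w n ≠ 0 := fun h => by simp [h] at hdeg
      have hpos := integral_sq_mul_wt_pos S hne
      set I := ∫ x in (-1 : ℝ)..1, (gsAux w n).eval x ^ 2 * wt S x with hI
      have hsq : 0 < √I := Real.sqrt_pos.2 hpos
      have heq : gsPoly w n = Polynomial.C (√I)⁻¹ * gsAux w n := gsPoly_eq w n
      have hnat : (gsPoly w n).natDegree = n := by
        rw [heq, Polynomial.natDegree_C_mul (inv_ne_zero hsq.ne')]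
        exact Polynomial.natDegree_eq_of_degree_eq_some hdeg
      refine ⟨hnat, fun k hk => ?_⟩
      rcases Nat.eq_or_lt_of_le hk with rfl | hk
      · rw [if_pos rfl]
        have : ∀ x, (gsPoly w k).eval x * (gsPoly w k).eval x * w x =
            I⁻¹ * ((gsAux w k).eval x ^ 2 * wt S x) := by
          intro x
          rw [heq, Polynomial.eval_mul, Polynomial.eval_C]
          have : (√I)⁻¹ * (√I)⁻¹ = I⁻¹ := by rw [← mul_inv, Real.mul_self_sqrt hpos.le]
          rw [← this]; ring
        simp_rw [this]
        rw [intervalIntegral.integral_const_mul, ← hI, inv_mul_cancel₀ hpos.ne']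
      · rw [if_neg hk.ne']
        have h1 : ∀ x, (gsPoly w n).eval x * (gsPoly w k).eval x * w x =
            (√I)⁻¹ * (x ^ n * (gsPoly w k).eval x * w x -
              ∑ j : Fin n, c j * ((gsPoly w j).eval x * (gsPoly w k).eval x * w x)) := by
          intro x
          rw [heq, Polynomial.eval_mul, Polynomial.eval_C, gsAux, Polynomial.eval_sub,
            Polynomial.eval_pow, Polynomial.eval_X, Polynomial.eval_finsetSum]
          simp only [Polynomial.eval_mul, Polynomial.eval_C]
          rw [show ∑ j : Fin n, c j * ((gsPoly w j).eval x * (gsPoly w k).eval x * w x) =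
            (∑ j : Fin n, c j * (gsPoly w j).eval x) * (gsPoly w k).eval x * w x by
              rw [Finset.sum_mul, Finset.sum_mul]
              exact Finset.sum_congr rfl fun j _ => by ring]
          change (√I)⁻¹ * (x ^ n - ∑ j : Fin n, c j * (gsPoly w j).eval x) * _ * _ = _
          ring
        have h2 : ∀ j : Fin n, ∫ x in (-1 : ℝ)..1,
            (gsPoly w j).eval x * (gsPoly w k).eval x * w x = if (j : ℕ) = k then 1 else 0 := by
          intro j
          rcases le_total k j with h | h
          · exact (ih j j.2).2 k h
          · have := (ih k hk).2 j h
            rw [show (if (j : ℕ) = k then (1 : ℝ) else 0) = if k = j then 1 else 0 by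
              simp only [eq_comm], ← this]
            exact intervalIntegral.integral_congr fun x _ => by ring
        simp_rw [h1]
        rw [intervalIntegral.integral_const_mul, intervalIntegral.integral_sub,
          intervalIntegral.integral_finsetSum]
        · simp_rw [intervalIntegral.integral_const_mul, h2]
          rw [Finset.sum_eq_single_of_mem (⟨k, hk⟩ : Fin n) (Finset.mem_univ _)]
          · simp [hc]
          · intro b _ hb
            rw [if_neg, mul_zero]
            intro h; exact hb (Fin.ext h)
        · intro j _; exact Continuous.intervalIntegrable (by fun_prop) _ _
        · exact Continuous.intervalIntegrable (by fun_prop) _ _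
        · exact Continuous.intervalIntegrable (by fun_prop) _ _
  refine ⟨fun j => (key j).1, fun j k => ?_⟩
  rcases le_total k j with h | h
  · exact (key j).2 k h
  · have := (key k).2 j h
    rw [show (if j = k then (1 : ℝ) else 0) = if k = j then 1 else 0 by
      simp only [eq_comm], ← this]
    exact intervalIntegral.integral_congr fun x _ => by ring

end

section

/-! ### The determinantal structure -/

/-- Lebesgue measure on `[-1, 1]`. -/
def leb : Measure ℝ := volume.restrict (Set.Icc (-1) 1)

instance : IsFiniteMeasure leb := by unfold leb; infer_instance

instance : NullSingletonClass leb := by unfold leb; infer_instance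

theorem volume_restrict_cube (n : ℕ) :
    (volume : Measure (Fin n → ℝ)).restrict (cube n) = Measure.pi fun _ => leb :=
  Measure.restrict_pi_pi (fun _ : Fin n => (volume : Measure ℝ)) fun _ => Set.Icc (-1) 1

theorem integral_leb {E : Type*} [NormedAddCommGroup E] [NormedSpace ℝ E] (f : ℝ → E) :
    ∫ x, f x ∂leb = ∫ x in (-1 : ℝ)..1, f x := by
  rw [leb, integral_Icc_eq_integral_Ioc, intervalIntegral.integral_of_le (by norm_num)]

theorem integrable_leb_of_continuous {f : ℝ → ℝ} (hf : Continuous f) : Integrable f leb :=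
  hf.continuousOn.integrableOn_compact isCompact_Icc

/-- The Slater determinant of the first `n` polynomials. -/
def slater (P : ℕ → ℝ[X]) (n : ℕ) (x : Fin n → ℝ) : ℝ :=
  (Matrix.of fun i j : Fin n => (P j).eval (x i)).det

theorem slater_eq (P : ℕ → ℝ[X]) (n : ℕ) (x : Fin n → ℝ) :
    slater P n x = ∑ σ : Equiv.Perm (Fin n), ((Equiv.Perm.sign σ : ℤ) : ℝ) *
      ∏ i, (P (σ i)).eval (x i) := by
  rw [slater, ← Matrix.det_transpose, Matrix.det_apply']
  rfl

/-- The last value of a permutation is determined by the others. This keeps the sum over pairs of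
permutations diagonal even when one coordinate carries a test function. -/
theorem perm_eq_of_forall_ne {n : ℕ} {σ τ : Equiv.Perm (Fin n)} (i : Fin n)
    (h : ∀ l, l ≠ i → σ l = τ l) : σ = τ := by
  ext l
  by_cases hl : l = i
  · subst hl
    obtain ⟨k, hk⟩ := σ.surjective (τ l)
    by_cases hkl : k = l
    · rw [← hk, hkl]
    · exact absurd (τ.injective ((h k hkl).symm.trans hk)) hkl
  · rw [h l hl]

/-- Each index is the image of `i` under exactly `m!` permutations; composing with a transposition
reduces to `i = 0`. -/
theorem sum_perm_apply {m : ℕ} (i : Fin (m + 1)) (F : Fin (m + 1) → ℝ) :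
    ∑ σ : Equiv.Perm (Fin (m + 1)), F (σ i) = (m.factorial : ℝ) * ∑ j, F j := by
  rw [← Equiv.sum_comp (Equiv.mulRight (Equiv.swap 0 i))]
  simp only [Equiv.coe_mulRight, Equiv.Perm.mul_apply, Equiv.swap_apply_right]
  rw [← Equiv.sum_comp Equiv.Perm.decomposeFin.symm, Fintype.sum_prod_type]
  simp only [Equiv.Perm.decomposeFin_symm_apply_zero, Finset.sum_const, Finset.card_univ,
    Fintype.card_perm, Fintype.card_fin, nsmul_eq_mul, Finset.mul_sum]

variable {S : Finset ℝ} {P : ℕ → ℝ[X]}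

/-- The unnormalized joint density in determinantal form. -/
def jointDet (S : Finset ℝ) (P : ℕ → ℝ[X]) (n : ℕ) (x : Fin n → ℝ) : ℝ :=
  (∏ i, wt S (x i)) * slater P n x ^ 2

/-- Expanding both determinants gives products of functions of one variable, so integrals over the
cube factorize. -/
theorem jointDet_eq (n : ℕ) (x : Fin n → ℝ) :
    jointDet S P n x = ∑ σ : Equiv.Perm (Fin n), ∑ τ : Equiv.Perm (Fin n),
      (((Equiv.Perm.sign σ : ℤ) : ℝ) * ((Equiv.Perm.sign τ : ℤ) : ℝ)) *
        ∏ i, ((P (σ i)).eval (x i) * (P (τ i)).eval (x i) * wt S (x i)) := by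
  rw [jointDet, sq, slater_eq, Finset.sum_mul_sum, Finset.mul_sum]
  refine Finset.sum_congr rfl fun σ _ => ?_
  rw [Finset.mul_sum]
  refine Finset.sum_congr rfl fun τ _ => ?_
  simp only [Finset.prod_mul_distrib]
  ring

/-- One-body expectations of the determinantal ensemble. -/
theorem integral_mul_jointDet (hP : IsOrthonormalPolys (wt S) P) {m : ℕ} (i : Fin (m + 1))
    {φ : ℝ → ℝ} (hφ : ∀ f : ℝ → ℝ, Continuous f → Integrable (fun t => φ t * f t) leb) :
    ∫ x, φ (x i) * jointDet S P (m + 1) x ∂(Measure.pi fun _ => leb) =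
      (m.factorial : ℝ) * ∫ t in (-1 : ℝ)..1, φ t * (kern P (m + 1) t t * wt S t) := by
  set h : Equiv.Perm (Fin (m + 1)) → Equiv.Perm (Fin (m + 1)) → Fin (m + 1) → ℝ → ℝ :=
    fun σ τ l t => (if l = i then φ t else 1) *
      ((P (σ l)).eval t * (P (τ l)).eval t * wt S t) with hh
  have hint : ∀ σ τ l, Integrable (h σ τ l) leb := by
    intro σ τ l
    by_cases hl : l = i
    · simp only [hh, hl, if_true]
      exact hφ _ (by fun_prop)
    · simp only [hh, hl, if_false, one_mul]
      exact integrable_leb_of_continuous (by fun_prop)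
  have hex : ∀ x : Fin (m + 1) → ℝ, φ (x i) * jointDet S P (m + 1) x =
      ∑ σ : Equiv.Perm (Fin (m + 1)), ∑ τ : Equiv.Perm (Fin (m + 1)),
      (((Equiv.Perm.sign σ : ℤ) : ℝ) * ((Equiv.Perm.sign τ : ℤ) : ℝ)) * ∏ l, h σ τ l (x l) := by
    intro x
    rw [jointDet_eq, Finset.mul_sum]
    refine Finset.sum_congr rfl fun σ _ => ?_
    rw [Finset.mul_sum]
    refine Finset.sum_congr rfl fun τ _ => ?_
    simp only [hh]
    have e : ∏ l, (if l = i then φ (x l) else 1) = φ (x i) := by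
      rw [Finset.prod_ite_eq' Finset.univ i fun l => φ (x l), if_pos (Finset.mem_univ i)]
    simp only [Finset.prod_mul_distrib, e]
    ring
  simp_rw [hex]
  have hprod : ∀ σ τ : Equiv.Perm (Fin (m + 1)),
      Integrable (fun x : Fin (m + 1) → ℝ => ∏ l, h σ τ l (x l)) (Measure.pi fun _ => leb) :=
    fun σ τ => Integrable.fintype_prod fun l => hint σ τ l
  rw [integral_finsetSum _ fun σ _ => integrable_finsetSum _ fun τ _ => (hprod σ τ).const_mul _]
  -- Every coordinate other than `i` integrates to a Kronecker delta, which forces the two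
  -- permutations to agree off `i` and hence everywhere.
  have hval : ∀ σ τ : Equiv.Perm (Fin (m + 1)),
      ∫ x : Fin (m + 1) → ℝ, ∏ l, h σ τ l (x l) ∂(Measure.pi fun _ => leb) =
        if τ = σ then ∫ t in (-1 : ℝ)..1, φ t * ((P (σ i)).eval t ^ 2 * wt S t) else 0 := by
    intro σ τ
    rw [integral_fintype_prod_eq_prod]
    have hne : ∀ l, l ≠ i → ∫ t, h σ τ l t ∂leb = if σ l = τ l then 1 else 0 := by
      intro l hl
      simp only [hh, if_neg hl, one_mul]
      rw [integral_leb, hP.2]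
      simp only [Fin.val_inj]
    split_ifs with hστ
    · subst hστ
      rw [← Finset.mul_prod_erase _ _ (Finset.mem_univ i), Finset.prod_eq_one, mul_one]
      · simp only [hh, if_true]
        rw [integral_leb]
        exact intervalIntegral.integral_congr fun t _ => by ring
      · intro l hl
        rw [hne l (Finset.ne_of_mem_erase hl), if_pos rfl]
    · have : ∃ l, l ≠ i ∧ σ l ≠ τ l := by
        by_contra hcon
        push Not at hcon
        exact hστ (perm_eq_of_forall_ne i hcon).symm
      obtain ⟨l, hl, hl2⟩ := this
      exact Finset.prod_eq_zero (Finset.mem_univ l) (by rw [hne l hl, if_neg hl2])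
  have hsum : ∀ σ ∈ (Finset.univ : Finset (Equiv.Perm (Fin (m + 1)))),
      ∫ x : Fin (m + 1) → ℝ, ∑ τ : Equiv.Perm (Fin (m + 1)),
      (((Equiv.Perm.sign σ : ℤ) : ℝ) * ((Equiv.Perm.sign τ : ℤ) : ℝ)) * ∏ l, h σ τ l (x l)
        ∂(Measure.pi fun _ => leb) =
      ∫ t in (-1 : ℝ)..1, φ t * ((P (σ i)).eval t ^ 2 * wt S t) := by
    intro σ _
    rw [integral_finsetSum _ fun τ _ => (hprod σ τ).const_mul _]
    simp_rw [integral_const_mul, hval]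
    rw [Finset.sum_eq_single_of_mem σ (Finset.mem_univ _)]
    · rw [if_pos rfl]
      have : ((Equiv.Perm.sign σ : ℤ) : ℝ) * ((Equiv.Perm.sign σ : ℤ) : ℝ) = 1 := by
        rw [← Int.cast_mul, ← Units.val_mul, Int.units_mul_self]; simp
      rw [this, one_mul]
    · intro τ _ hτ; rw [if_neg hτ, mul_zero]
  rw [Finset.sum_congr rfl hsum,
    sum_perm_apply i fun j => ∫ t in (-1 : ℝ)..1, φ t * ((P j).eval t ^ 2 * wt S t)]
  congr 1
  rw [← intervalIntegral.integral_finsetSum]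
  · refine intervalIntegral.integral_congr fun t _ => ?_
    simp only [kern_self]
    rw [Finset.sum_range, Finset.sum_mul, Finset.mul_sum]
  · intro j _
    have := hφ (fun t => (P j).eval t ^ 2 * wt S t) (by fun_prop)
    rw [intervalIntegrable_iff_integrableOn_Icc_of_le (by norm_num)]
    exact this

/-- The normalization of the determinantal ensemble. -/
theorem integral_jointDet (hP : IsOrthonormalPolys (wt S) P) (m : ℕ) :
    ∫ x, jointDet S P (m + 1) x ∂(Measure.pi fun _ => leb) = ((m + 1).factorial : ℝ) := by
  have := integral_mul_jointDet hP (0 : Fin (m + 1)) (φ := fun _ => 1)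
    (fun f hf => by simpa using integrable_leb_of_continuous hf)
  simp only [one_mul] at this
  rw [this, Nat.factorial_succ]
  have h2 : ∫ t in (-1 : ℝ)..1, kern P (m + 1) t t * wt S t = m + 1 := by
    simp_rw [kern_self, Finset.sum_mul]
    rw [intervalIntegral.integral_finsetSum]
    · simp_rw [integral_sq_eq_one hP]; simp
    · intro j _; exact Continuous.intervalIntegrable (by fun_prop) _ _
  rw [h2]; push_cast; ring

/-- Integrating out all variables but one. -/
theorem integral_jointDet_cons (hP : IsOrthonormalPolys (wt S) P) (m : ℕ) (t : ℝ) :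
    ∫ z, jointDet S P (m + 1) (Fin.cons t z) ∂(Measure.pi fun _ : Fin m => leb) =
      (m.factorial : ℝ) * (kern P (m + 1) t t * wt S t) := by
  have hex : ∀ z : Fin m → ℝ, jointDet S P (m + 1) (Fin.cons t z) =
      ∑ σ : Equiv.Perm (Fin (m + 1)), ∑ τ : Equiv.Perm (Fin (m + 1)),
      ((((Equiv.Perm.sign σ : ℤ) : ℝ) * ((Equiv.Perm.sign τ : ℤ) : ℝ)) *
        ((P (σ 0)).eval t * (P (τ 0)).eval t * wt S t)) *
        ∏ l : Fin m, ((P (σ l.succ)).eval (z l) * (P (τ l.succ)).eval (z l) * wt S (z l)) := by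
    intro z
    rw [jointDet_eq]
    refine Finset.sum_congr rfl fun σ _ => Finset.sum_congr rfl fun τ _ => ?_
    rw [Fin.prod_univ_succ]
    simp only [Fin.cons_zero, Fin.cons_succ]
    ring
  simp_rw [hex]
  have hprod : ∀ σ τ : Equiv.Perm (Fin (m + 1)), Integrable (fun z : Fin m → ℝ =>
      ∏ l : Fin m, ((P (σ l.succ)).eval (z l) * (P (τ l.succ)).eval (z l) * wt S (z l)))
      (Measure.pi fun _ => leb) := fun σ τ =>
    Integrable.fintype_prod (f := fun (l : Fin m) (s : ℝ) =>
      (P (σ l.succ)).eval s * (P (τ l.succ)).eval s * wt S s)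
      fun l => integrable_leb_of_continuous (by fun_prop)
  have hval : ∀ σ τ : Equiv.Perm (Fin (m + 1)), ∫ z : Fin m → ℝ,
      ∏ l : Fin m, ((P (σ l.succ)).eval (z l) * (P (τ l.succ)).eval (z l) * wt S (z l))
        ∂(Measure.pi fun _ => leb) = if τ = σ then 1 else 0 := by
    intro σ τ
    rw [integral_fintype_prod_eq_prod (f := fun (l : Fin m) (s : ℝ) =>
      (P (σ l.succ)).eval s * (P (τ l.succ)).eval s * wt S s)]
    simp_rw [integral_leb, hP.2, Fin.val_inj]
    split_ifs with hστ
    · subst hστ; simp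
    · have : ∃ l : Fin m, σ l.succ ≠ τ l.succ := by
        by_contra hcon
        push Not at hcon
        refine hστ (perm_eq_of_forall_ne 0 fun l hl => ?_).symm
        obtain ⟨k, rfl⟩ := Fin.exists_succ_eq.2 hl
        exact hcon k
      obtain ⟨l, hl⟩ := this
      exact Finset.prod_eq_zero (Finset.mem_univ l) (if_neg hl)
  rw [integral_finsetSum _ fun σ _ => integrable_finsetSum _ fun τ _ => (hprod σ τ).const_mul _]
  have hsum : ∀ σ ∈ (Finset.univ : Finset (Equiv.Perm (Fin (m + 1)))),
      ∫ z : Fin m → ℝ, ∑ τ : Equiv.Perm (Fin (m + 1)),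
      ((((Equiv.Perm.sign σ : ℤ) : ℝ) * ((Equiv.Perm.sign τ : ℤ) : ℝ)) *
        ((P (σ 0)).eval t * (P (τ 0)).eval t * wt S t)) *
        ∏ l : Fin m, ((P (σ l.succ)).eval (z l) * (P (τ l.succ)).eval (z l) * wt S (z l))
        ∂(Measure.pi fun _ => leb) = (P (σ 0)).eval t ^ 2 * wt S t := by
    intro σ _
    rw [integral_finsetSum _ fun τ _ => (hprod σ τ).const_mul _]
    simp_rw [integral_const_mul, hval]
    rw [Finset.sum_eq_single_of_mem σ (Finset.mem_univ _)]
    · rw [if_pos rfl]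
      have : ((Equiv.Perm.sign σ : ℤ) : ℝ) * ((Equiv.Perm.sign σ : ℤ) : ℝ) = 1 := by
        rw [← Int.cast_mul, ← Units.val_mul, Int.units_mul_self]; simp
      rw [this]; ring
    · intro τ _ hτ; rw [if_neg hτ, mul_zero]
  rw [Finset.sum_congr rfl hsum, sum_perm_apply 0 fun j : Fin (m + 1) => (P j).eval t ^ 2 * wt S t,
    kern_self, Finset.sum_range, Finset.sum_mul]

end

/-! ### The log-gas density and its one-point function -/

section

/-- The unnormalized density of the log-gas, written symmetrically. -/
def gasDens (S : Finset ℝ) (n : ℕ) (x : Fin n → ℝ) : ℝ :=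
  (∏ i, wt S (x i)) * ∏ i, ∏ j, if i = j then 1 else |x i - x j|

theorem gasDens_nonneg (S : Finset ℝ) (n : ℕ) (x : Fin n → ℝ) : 0 ≤ gasDens S n x := by
  refine mul_nonneg (Finset.prod_nonneg fun i _ => wt_nonneg S _)
    (Finset.prod_nonneg fun i _ => Finset.prod_nonneg fun j _ => ?_)
  split_ifs
  · exact zero_le_one
  · exact abs_nonneg _

/-- Each unordered pair occurs twice in the full product, which produces the square. -/
theorem prod_off_diag_eq {n : ℕ} (x : Fin n → ℝ) :
    ∏ i, ∏ j, (if i = j then 1 else |x i - x j|) =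
      ∏ i, ∏ j ∈ Finset.Ioi i, |x i - x j| ^ 2 := by
  have h := Finset.prod_prod_Ioi_mul_eq_prod_prod_off_diag (fun i j : Fin n => |x i - x j|)
  have h1 : ∀ i : Fin n, ∏ j, (if i = j then 1 else |x i - x j|) =
      ∏ j ∈ ({i}ᶜ : Finset (Fin n)), |x j - x i| := by
    intro i
    rw [← Finset.prod_subset (Finset.subset_univ ({i}ᶜ : Finset (Fin n)))]
    · refine Finset.prod_congr rfl fun j hj => ?_
      have : j ≠ i := by simpa using hj
      rw [if_neg this.symm, abs_sub_comm]
    · intro j _ hj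
      have : j = i := by simpa using hj
      rw [if_pos this.symm]
  simp_rw [h1]
  rw [← h]
  refine Finset.prod_congr rfl fun i _ => Finset.prod_congr rfl fun j _ => ?_
  rw [abs_sub_comm (x j), sq]

variable {S : Finset ℝ} {P : ℕ → ℝ[X]}

/-- Dividing each column by its leading coefficient turns the Slater determinant into a Vandermonde
determinant. -/
theorem jointDet_eq_gasDens (hP : IsOrthonormalPolys (wt S) P) (n : ℕ) (x : Fin n → ℝ) :
    jointDet S P n x = (∏ j : Fin n, (P j).leadingCoeff) ^ 2 * gasDens S n x := by
  have hl : ∀ j, (P j).leadingCoeff ≠ 0 := fun j =>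
    Polynomial.leadingCoeff_ne_zero.2 (hP.ne_zero j)
  have hv := Matrix.det_eval_matrixOfPolynomials_eq_det_vandermonde x
    (fun j : Fin n => Polynomial.C (P j).leadingCoeff⁻¹ * P j)
    (fun j => by rw [Polynomial.natDegree_C_mul (inv_ne_zero (hl j)), hP.1])
    (fun j => by
      rw [mul_comm]; exact Polynomial.monic_mul_leadingCoeff_inv (hP.ne_zero j))
  have hs : slater P n x = (∏ j : Fin n, (P j).leadingCoeff) * (Matrix.vandermonde x).det := by
    rw [hv, ← Matrix.det_mul_row]
    unfold slater
    congr 1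
    ext i j
    simp only [Matrix.of_apply, Polynomial.eval_mul, Polynomial.eval_C]
    rw [mul_inv_cancel_left₀ (hl j)]
  rw [jointDet, hs, gasDens, prod_off_diag_eq, Matrix.det_vandermonde, mul_pow]
  have : (∏ i, ∏ j ∈ Finset.Ioi i, (x j - x i)) ^ 2 = ∏ i, ∏ j ∈ Finset.Ioi i, |x i - x j| ^ 2 := by
    rw [← Finset.prod_pow]
    refine Finset.prod_congr rfl fun i _ => ?_
    rw [← Finset.prod_pow]
    exact Finset.prod_congr rfl fun j _ => by rw [sq_abs]; ring
  rw [this]; ring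

/-- The hypotheses exclude the points where `log 0 = 0` would make a factor of `jointWeight` equal
to one, although the true density vanishes there. Such points form a null set. -/
theorem jointWeight_eq_gasDens {n : ℕ} {V : ℝ → ℝ}
    (hV : ∀ t, t ∉ S → Real.exp (-(n : ℝ) * V t) = wt S t) {x : Fin n → ℝ}
    (hx : ∀ i, x i ∉ S) (hinj : Function.Injective x) : jointWeight n V x = gasDens S n x := by
  rw [jointWeight, gasDens, prod_off_diag_eq, Real.exp_add, Finset.mul_sum, Real.exp_sum,
    Finset.mul_sum, Real.exp_sum]
  congr 1
  · exact Finset.prod_congr rfl fun i _ => hV _ (hx i)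
  · refine Finset.prod_congr rfl fun i _ => ?_
    rw [Finset.mul_sum, Real.exp_sum]
    refine Finset.prod_congr rfl fun j hj => ?_
    have hij : x i ≠ x j := fun h => (Finset.mem_Ioi.1 hj).ne (hinj h)
    rw [mul_comm, Real.exp_mul, Real.exp_log (abs_pos.2 (sub_ne_zero.2 hij))]
    norm_num

theorem ae_pi_leb_ne_of_mem (n : ℕ) (S : Finset ℝ) :
    ∀ᵐ x : Fin n → ℝ ∂(Measure.pi fun _ => leb), ∀ i, x i ∉ S := by
  rw [ae_all_iff]
  intro i
  have : ∀ u ∈ S, ∀ᵐ x : Fin n → ℝ ∂(Measure.pi fun _ => leb), x i ≠ u := fun u _ =>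
    Measure.ae_eval_ne (fun _ => leb) i u
  have h2 := (ae_ball_iff S.countable_toSet).2 this
  filter_upwards [h2] with x hx hmem
  exact hx _ hmem rfl

/-- Each diagonal `x i = x j` is a proper linear subspace, hence null. -/
theorem ae_pi_leb_injective (n : ℕ) :
    ∀ᵐ x : Fin n → ℝ ∂(Measure.pi fun _ => leb), Function.Injective x := by
  have h : ∀ i j : Fin n, i ≠ j →
      ∀ᵐ x : Fin n → ℝ ∂(Measure.pi fun _ => leb), x i ≠ x j := by
    intro i j hij
    rw [← volume_restrict_cube]
    refine ae_restrict_of_ae ?_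
    let W : Submodule ℝ (Fin n → ℝ) :=
      LinearMap.ker ((LinearMap.proj i : (Fin n → ℝ) →ₗ[ℝ] ℝ) - LinearMap.proj j)
    have hW : W ≠ ⊤ := by
      intro h
      have : Pi.single i (1 : ℝ) ∈ W := h ▸ Submodule.mem_top
      simp [W, LinearMap.mem_ker, hij.symm] at this
    have h0 := Measure.addHaar_submodule (volume : Measure (Fin n → ℝ)) W hW
    refine measure_mono_null (fun x hx => ?_) h0
    simp only [ne_eq, not_not, Set.mem_compl_iff, Set.mem_ofPred_eq] at hx
    simp [W, LinearMap.mem_ker, hx]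
  have h2 : ∀ᵐ x : Fin n → ℝ ∂(Measure.pi fun _ => leb), ∀ i j, i ≠ j → x i ≠ x j := by
    rw [ae_all_iff]; intro i
    rw [ae_all_iff]; intro j
    by_cases hij : i = j
    · exact Filter.Eventually.of_forall fun x h => absurd hij h
    · filter_upwards [h i j hij] with x hx _ using hx
  filter_upwards [h2] with x hx i j hxij
  by_contra hne
  exact hx i j hne hxij

theorem leadingCoeff_prod_sq_pos (hP : IsOrthonormalPolys (wt S) P) (n : ℕ) :
    0 < (∏ j : Fin n, (P j).leadingCoeff) ^ 2 := by
  have : ∏ j : Fin n, (P j).leadingCoeff ≠ 0 := Finset.prod_ne_zero_iff.2 fun j _ =>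
    Polynomial.leadingCoeff_ne_zero.2 (hP.ne_zero j)
  positivity

/-- The one-point density is the diagonal of the reproducing kernel. -/
theorem onePoint_eq (hP : IsOrthonormalPolys (wt S) P) {m : ℕ} {V : ℝ → ℝ}
    (hV : ∀ t, t ∉ S → Real.exp (-((m + 1 : ℕ) : ℝ) * V t) = wt S t) {t : ℝ} (ht : t ∉ S) :
    onePoint m V t = kern P (m + 1) t t * wt S t / (m + 1) := by
  set c := (∏ j : Fin (m + 1), (P j).leadingCoeff) ^ 2 with hc
  have hc0 : 0 < c := leadingCoeff_prod_sq_pos hP (m + 1)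
  have hg : ∀ x, gasDens S (m + 1) x = c⁻¹ * jointDet S P (m + 1) x := fun x => by
    rw [jointDet_eq_gasDens hP, inv_mul_cancel_left₀ hc0.ne']
  have h1 : ∫ z in cube m, jointWeight (m + 1) V (Fin.cons t z) =
      c⁻¹ * ((m.factorial : ℝ) * (kern P (m + 1) t t * wt S t)) := by
    rw [volume_restrict_cube, ← integral_jointDet_cons hP, ← integral_const_mul]
    refine integral_congr_ae ?_
    have h3 : ∀ᵐ z : Fin m → ℝ ∂(Measure.pi fun _ => leb), ∀ i, z i ≠ t := by
      rw [ae_all_iff]; intro i; exact Measure.ae_eval_ne (fun _ => leb) i t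
    filter_upwards [ae_pi_leb_ne_of_mem m S, ae_pi_leb_injective m, h3] with z hz1 hz2 hz3
    rw [← hg]
    refine jointWeight_eq_gasDens hV (fun i => ?_) ?_
    · refine Fin.cases ?_ (fun j => ?_) i
      · simpa using ht
      · simpa using hz1 j
    · rw [Fin.cons_injective_iff]
      exact ⟨fun ⟨i, hi⟩ => hz3 i hi, hz2⟩
  have h2 : ∫ z in cube (m + 1), jointWeight (m + 1) V z = c⁻¹ * ((m + 1).factorial : ℝ) := by
    rw [volume_restrict_cube, ← integral_jointDet hP, ← integral_const_mul]
    refine integral_congr_ae ?_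
    filter_upwards [ae_pi_leb_ne_of_mem (m + 1) S, ae_pi_leb_injective (m + 1)] with z hz1 hz2
    rw [← hg]
    exact jointWeight_eq_gasDens hV hz1 hz2
  rw [onePoint, h1, h2, Nat.factorial_succ]
  have : (m.factorial : ℝ) ≠ 0 := by positivity
  push_cast
  field_simp

end

section

/-! ### Integration by parts for the log-gas -/

variable {S : Finset ℝ}

/-- The logarithmic derivative formula holds even at the zeros: they are double, and division by
zero gives zero. -/
theorem hasDerivAt_prod_sq {ι : Type*} (s : Finset ι) (c : ι → ℝ) (t : ℝ) :
    HasDerivAt (fun t => ∏ a ∈ s, (t - c a) ^ 2)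
      ((∏ a ∈ s, (t - c a) ^ 2) * ∑ a ∈ s, 2 / (t - c a)) t := by
  classical
  induction s using Finset.induction_on with
  | empty => simpa using hasDerivAt_const t (1 : ℝ)
  | insert a s ha ih =>
    simp only [Finset.prod_insert ha, Finset.sum_insert ha]
    have h1 : HasDerivAt (fun t => (t - c a) ^ 2) (2 * (t - c a)) t := by
      simpa using ((hasDerivAt_id t).sub_const (c a)).fun_pow 2
    refine (h1.fun_mul ih).congr_deriv ?_
    by_cases h : t - c a = 0
    · simp [h]
    · field_simp

theorem gasDens_eq (n : ℕ) (x : Fin n → ℝ) :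
    gasDens S n x = (∏ i, wt S (x i)) * ∏ i, ∏ j ∈ Finset.Ioi i, (x i - x j) ^ 2 := by
  rw [gasDens, prod_off_diag_eq]; simp_rw [sq_abs]

theorem contDiff_gasDens (S : Finset ℝ) (n : ℕ) : ContDiff ℝ 1 (gasDens S n) := by
  have : gasDens S n = fun x =>
      (∏ i, wt S (x i)) * ∏ i, ∏ j ∈ Finset.Ioi i, (x i - x j) ^ 2 := funext (gasDens_eq n)
  rw [this]
  refine ContDiff.mul (contDiff_prod fun i _ => contDiff_prod fun u _ => ?_)
    (contDiff_prod fun i _ => contDiff_prod fun j _ => ?_) <;> fun_prop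

theorem continuous_gasDens (S : Finset ℝ) (n : ℕ) : Continuous (gasDens S n) :=
  (contDiff_gasDens S n).continuous

/-- The partial derivatives of the density. -/
def gasDeriv (S : Finset ℝ) (n : ℕ) (i : Fin n) (x : Fin n → ℝ) : ℝ :=
  fderiv ℝ (gasDens S n) x (Pi.single i 1)

theorem continuous_gasDeriv (S : Finset ℝ) (n : ℕ) (i : Fin n) : Continuous (gasDeriv S n i) :=
  ((contDiff_gasDens S n).continuous_fderiv (by norm_num)).clm_apply continuous_const

/-- Isolates the dependence on the coordinate `i`, a product of double zeros at the points of `S`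
and at the other particles. -/
theorem gasDens_insertNth {m : ℕ} (i : Fin (m + 1)) (t : ℝ) (z : Fin m → ℝ) :
    gasDens S (m + 1) (i.insertNth t z) = wt S t * (∏ j, (t - z j) ^ 2) * gasDens S m z := by
  unfold gasDens
  rw [Fin.prod_univ_succAbove _ i, Fin.prod_univ_succAbove _ i, Fin.prod_univ_succAbove _ i]
  simp only [Fin.insertNth_apply_same, Fin.insertNth_apply_succAbove, if_true, one_mul,
    (Fin.succAbove_ne i _).symm, if_false]
  have : ∀ j : Fin m, ∏ k : Fin (m + 1), (if i.succAbove j = k then (1 : ℝ) else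
      |z j - i.insertNth (α := fun _ => ℝ) t z k|) =
      |t - z j| * ∏ l, if j = l then 1 else |z j - z l| := by
    intro j
    rw [Fin.prod_univ_succAbove _ i, if_neg (Fin.succAbove_ne i j), Fin.insertNth_apply_same,
      abs_sub_comm]
    congr 1
    refine Finset.prod_congr rfl fun l _ => ?_
    rw [Fin.insertNth_apply_succAbove]
    simp only [Fin.succAbove_right_inj]
  simp_rw [this, Finset.prod_mul_distrib]
  have h2 : ∏ j, (t - z j) ^ 2 = (∏ j, |t - z j|) * ∏ j, |t - z j| := by
    rw [← Finset.prod_mul_distrib]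
    exact Finset.prod_congr rfl fun j _ => by rw [← sq, sq_abs]
  rw [h2]; ring

theorem hasDerivAt_gasDens {m : ℕ} (i : Fin (m + 1)) (z : Fin m → ℝ) (t : ℝ) :
    HasDerivAt (fun t => gasDens S (m + 1) (i.insertNth t z))
      (gasDeriv S (m + 1) i (i.insertNth t z)) t := by
  have h1 := (((contDiff_gasDens S (m + 1)).differentiable (by norm_num))
    (Function.update (i.insertNth t z) i t)).hasFDerivAt
  have h2 := h1.comp_hasDerivAt t (hasDerivAt_update (i.insertNth t z : Fin (m + 1) → ℝ) i t)
  simp only [Fin.update_insertNth] at h2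
  have e : (fun t => gasDens S (m + 1) (i.insertNth t z)) =
      gasDens S (m + 1) ∘ Function.update (i.insertNth t z) i := by ext s; simp
  rw [e]
  exact h2

theorem gasDeriv_insertNth {m : ℕ} (i : Fin (m + 1)) (z : Fin m → ℝ) (t : ℝ) :
    gasDeriv S (m + 1) i (i.insertNth t z) = gasDens S (m + 1) (i.insertNth t z) *
      ((∑ u ∈ S, 2 / (t - u)) + ∑ j, 2 / (t - z j)) := by
  refine (hasDerivAt_gasDens i z t).unique ?_
  have h := (((hasDerivAt_prod_sq S id t).fun_mul
    (hasDerivAt_prod_sq Finset.univ z t)).mul_const (gasDens S m z))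
  have e : (fun t => gasDens S (m + 1) (i.insertNth t z)) = fun t =>
      (∏ a ∈ S, (t - id a) ^ 2) * (∏ a, (t - z a) ^ 2) * gasDens S m z := by
    ext t; rw [gasDens_insertNth]; rfl
  rw [e, gasDens_insertNth]
  refine h.congr_deriv ?_
  simp only [wt, id]
  ring

/-- The sum over `j` contains `j = i`, where `2 / 0 = 0`. -/
theorem gasDeriv_eq {n : ℕ} (i : Fin n) (x : Fin n → ℝ) :
    gasDeriv S n i x = gasDens S n x *
      ((∑ u ∈ S, 2 / (x i - u)) + ∑ j, 2 / (x i - x j)) := by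
  obtain ⟨m, rfl⟩ : ∃ m, n = m + 1 := ⟨n - 1, by have := i.pos; omega⟩
  have h := gasDeriv_insertNth (S := S) i (i.removeNth x) (x i)
  rw [Fin.insertNth_self_removeNth] at h
  rw [h, Fin.sum_univ_succAbove _ i, sub_self, div_zero, zero_add]
  rfl

theorem integrable_pi_leb {n : ℕ} {f : (Fin n → ℝ) → ℝ} (hf : Continuous f) :
    Integrable f (Measure.pi fun _ => leb) := by
  rw [← volume_restrict_cube]
  exact hf.continuousOn.integrableOn_compact (isCompact_univ_pi fun _ => isCompact_Icc)

theorem integrable_mul_pi_leb {n : ℕ} {f g : (Fin n → ℝ) → ℝ} (hf : Continuous f)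
    (hg : Measurable g) {C : ℝ} (hC : ∀ x, |g x| ≤ C) :
    Integrable (fun x => g x * f x) (Measure.pi fun _ => leb) :=
  (integrable_pi_leb hf).bdd_mul (c := C) hg.aestronglyMeasurable
    (Filter.Eventually.of_forall fun x => by simpa using hC x)

theorem ae_mem_cube (n : ℕ) :
    ∀ᵐ z : Fin n → ℝ ∂(Measure.pi fun _ => leb), ∀ i, z i ∈ Set.Icc (-1 : ℝ) 1 := by
  rw [← volume_restrict_cube]
  refine (ae_restrict_mem (MeasurableSet.univ_pi fun _ => measurableSet_Icc)).mono fun z hz i => ?_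
  exact hz i (Set.mem_univ i)

/-- Fubini with respect to the `i`-th coordinate, for a vanishing inner integral. -/
theorem integral_pi_leb_eq_zero {m : ℕ} (i : Fin (m + 1)) {F : (Fin (m + 1) → ℝ) → ℝ}
    (hF : Integrable F (Measure.pi fun _ => leb))
    (h0 : ∀ z : Fin m → ℝ, (∀ j, z j ∈ Set.Icc (-1 : ℝ) 1) →
      ∫ t in (-1 : ℝ)..1, F (i.insertNth t z) = 0) :
    ∫ x, F x ∂(Measure.pi fun _ => leb) = 0 := by
  have hmp := (measurePreserving_piFinSuccAbove (α := fun _ : Fin (m + 1) => ℝ)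
    (fun _ => leb) i).symm
  have hF' := hmp.integrable_comp_of_integrable hF
  rw [← hmp.integral_comp']
  rw [integral_prod_symm (fun q => F ((MeasurableEquiv.piFinSuccAbove
    (fun _ : Fin (m + 1) => ℝ) i).symm q)) hF']
  refine integral_eq_zero_of_ae ?_
  filter_upwards [ae_mem_cube m] with z hz
  have := h0 z hz
  rw [← integral_leb] at this
  exact this

variable {m : ℕ}

theorem gasDens_insertNth_of_mem (i : Fin (m + 1)) {t : ℝ} (ht : t ∈ S) (z : Fin m → ℝ) :
    gasDens S (m + 1) (i.insertNth t z) = 0 := by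
  rw [gasDens_insertNth, wt_eq_zero ht]; simp

theorem gasDens_insertNth_of_eq (i : Fin (m + 1)) (z : Fin m → ℝ) (j : Fin m) :
    gasDens S (m + 1) (i.insertNth (z j) z) = 0 := by
  rw [gasDens_insertNth, Finset.prod_eq_zero (Finset.mem_univ j) (by simp)]; simp

theorem continuous_insertNth_left (i : Fin (m + 1)) (z : Fin m → ℝ) :
    Continuous fun t : ℝ => (i.insertNth t z : Fin (m + 1) → ℝ) := by
  refine continuous_pi fun j => ?_
  refine Fin.succAboveCases i ?_ (fun l => ?_) j
  · simpa using continuous_id'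
  · simpa using continuous_const

theorem continuous_gasDeriv_insertNth (i : Fin (m + 1)) (z : Fin m → ℝ) :
    Continuous fun t : ℝ => gasDeriv S (m + 1) i (i.insertNth t z) :=
  (continuous_gasDeriv S (m + 1) i).comp (continuous_insertNth_left i z)

/-- There are no boundary terms because `±1` belong to `S`, where the density vanishes. -/
theorem integral_gasDeriv (hS : IsExt S) (i : Fin (m + 1)) :
    ∫ x, gasDeriv S (m + 1) i x ∂(Measure.pi fun _ => leb) = 0 := by
  refine integral_pi_leb_eq_zero i (integrable_pi_leb (continuous_gasDeriv _ _ _)) fun z _ => ?_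
  rw [intervalIntegral.integral_eq_sub_of_hasDerivAt (fun t _ => hasDerivAt_gasDens i z t)
    ((continuous_gasDeriv_insertNth i z).intervalIntegrable _ _),
    gasDens_insertNth_of_mem i hS.one_mem, gasDens_insertNth_of_mem i hS.neg_one_mem, sub_zero]

theorem integral_coord_mul_gasDeriv (hS : IsExt S) (i : Fin (m + 1)) :
    ∫ x, x i * gasDeriv S (m + 1) i x ∂(Measure.pi fun _ => leb) =
      -∫ x, gasDens S (m + 1) x ∂(Measure.pi fun _ => leb) := by
  have c1 : Continuous fun x : Fin (m + 1) → ℝ => x i * gasDeriv S (m + 1) i x :=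
    (continuous_apply i).mul (continuous_gasDeriv _ _ _)
  have c2 := continuous_gasDens S (m + 1)
  have h : ∫ x, (gasDens S (m + 1) x + x i * gasDeriv S (m + 1) i x)
      ∂(Measure.pi fun _ => leb) = 0 := by
    refine integral_pi_leb_eq_zero i (integrable_pi_leb (c2.add c1)) fun z _ => ?_
    have hd : ∀ t : ℝ, HasDerivAt (fun t => t * gasDens S (m + 1) (i.insertNth t z))
        (gasDens S (m + 1) (i.insertNth t z) + (i.insertNth t z : Fin (m + 1) → ℝ) i *
          gasDeriv S (m + 1) i (i.insertNth t z)) t := fun t => by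
      have := (hasDerivAt_id t).fun_mul (hasDerivAt_gasDens (S := S) i z t)
      simpa using this
    rw [intervalIntegral.integral_eq_sub_of_hasDerivAt (fun t _ => hd t)
      (((c2.add c1).comp (continuous_insertNth_left i z)).intervalIntegrable _ _),
      gasDens_insertNth_of_mem i hS.one_mem, gasDens_insertNth_of_mem i hS.neg_one_mem]
    simp
  rw [integral_add (integrable_pi_leb c2) (integrable_pi_leb c1)] at h
  linarith

/-- Cutting the integral at `x i = x j` creates no boundary term, since the density vanishes there
as well. This allows test functions that jump when two particles change their order, such as the
rank. -/
theorem integral_indicator_mul_gasDeriv (hS : IsExt S) (i j : Fin (m + 1)) :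
    ∫ x, (if x j < x i then 1 else 0) * gasDeriv S (m + 1) i x ∂(Measure.pi fun _ => leb) = 0 := by
  by_cases hij : j = i
  · subst hij; simp
  obtain ⟨l, rfl⟩ := Fin.exists_succAbove_eq hij
  have hm : Measurable fun x : Fin (m + 1) → ℝ =>
      if x (i.succAbove l) < x i then (1 : ℝ) else 0 :=
    Measurable.ite (measurableSet_lt (measurable_pi_apply _) (measurable_pi_apply _))
      measurable_const measurable_const
  refine integral_pi_leb_eq_zero i (integrable_mul_pi_leb (C := 1)
    (continuous_gasDeriv _ _ _) hm (fun x => by split_ifs <;> simp)) fun z hz => ?_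
  simp only [Fin.insertNth_apply_same, Fin.insertNth_apply_succAbove]
  have hc := continuous_gasDeriv_insertNth (S := S) i z
  have e : ∀ t : ℝ, (if z l < t then 1 else 0) * gasDeriv S (m + 1) i (i.insertNth t z) =
      (Set.Ioi (z l)).indicator (fun t => gasDeriv S (m + 1) i (i.insertNth t z)) t := by
    intro t
    by_cases ht : z l < t
    · simp [ht]
    · simp [ht]
  simp_rw [e]
  rw [intervalIntegral.integral_of_le (by norm_num), setIntegral_indicator measurableSet_Ioi]
  have hs : Set.Ioc (-1 : ℝ) 1 ∩ Set.Ioi (z l) = Set.Ioc (z l) 1 := by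
    ext t
    simp only [Set.mem_inter_iff, Set.mem_Ioc, Set.mem_Ioi]
    have := (hz l).1
    constructor
    · rintro ⟨⟨_, h2⟩, h3⟩; exact ⟨h3, h2⟩
    · rintro ⟨h1, h2⟩; exact ⟨⟨by linarith, h2⟩, h1⟩
  rw [hs, ← intervalIntegral.integral_of_le (hz l).2,
    intervalIntegral.integral_eq_sub_of_hasDerivAt (fun t _ => hasDerivAt_gasDens i z t)
    (hc.intervalIntegrable _ _), gasDens_insertNth_of_mem i hS.one_mem,
    gasDens_insertNth_of_eq, sub_zero]

end

section

/-! ### Rigidity of the log-gas with respect to an equidistant lattice -/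

variable {S : Finset ℝ}

/-- The equidistant lattice with `n` points in `(-1, 1)`. -/
def lat (n : ℕ) (r : ℝ) : ℝ := -1 + 2 / ((n : ℝ) + 1) * (1 + r)

theorem lat_sub (n : ℕ) (r s : ℝ) : lat n r - lat n s = 2 / ((n : ℝ) + 1) * (r - s) := by
  unfold lat; ring

theorem lat_mem {n : ℕ} (r : Fin n) : lat n (r : ℕ) ∈ Set.Ioo (-1 : ℝ) 1 := by
  have h1 : ((r : ℕ) : ℝ) + 1 ≤ n := by exact_mod_cast r.isLt
  have hn : (0 : ℝ) < n + 1 := by positivity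
  unfold lat
  constructor
  · have : (0 : ℝ) < 2 / ((n : ℝ) + 1) * (1 + (r : ℕ)) := by positivity
    linarith
  · have : 2 / ((n : ℝ) + 1) * (1 + (r : ℕ)) < 2 := by
      rw [div_mul_eq_mul_div, div_lt_iff₀ hn]; linarith
    linarith

/-- The number of points to the left of the `i`-th one. -/
def rank {n : ℕ} (x : Fin n → ℝ) (i : Fin n) : ℕ := (Finset.univ.filter fun j => x j < x i).card

theorem rank_lt {n : ℕ} (x : Fin n → ℝ) (i : Fin n) : rank x i < n := by
  have : rank x i < (Finset.univ : Finset (Fin n)).card :=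
    Finset.card_lt_card (Finset.filter_ssubset.2 ⟨i, Finset.mem_univ i, lt_irrefl _⟩)
  simpa using this

theorem rank_lt_rank {n : ℕ} {x : Fin n → ℝ} {i j : Fin n} (h : x i < x j) :
    rank x i < rank x j := by
  refine Finset.card_lt_card ⟨fun k hk => ?_, fun hk => ?_⟩
  · simp only [Finset.mem_filter, Finset.mem_univ, true_and] at hk ⊢
    exact hk.trans h
  · have := hk (Finset.mem_filter.2 ⟨Finset.mem_univ i, h⟩)
    simp at this

/-- The ranking permutation of a configuration of distinct points. -/
def rankEquiv {n : ℕ} (x : Fin n → ℝ) (hx : Function.Injective x) : Fin n ≃ Fin n :=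
  Equiv.ofBijective (fun i => ⟨rank x i, rank_lt x i⟩) <| by
    refine (Finite.injective_iff_bijective).1 fun i j h => ?_
    have h' : rank x i = rank x j := by simpa using h
    by_contra hij
    rcases lt_or_gt_of_ne (fun e => hij (hx e)) with h1 | h1
    · exact (rank_lt_rank h1).ne h'
    · exact (rank_lt_rank h1).ne' h'

theorem rankEquiv_apply {n : ℕ} (x : Fin n → ℝ) (hx : Function.Injective x) (i : Fin n) :
    ((rankEquiv x hx i : Fin n) : ℕ) = rank x i := rfl

/-- The displacement of the `i`-th point from its lattice site. -/
def dev {n : ℕ} (x : Fin n → ℝ) (i : Fin n) : ℝ := x i - lat n (rank x i)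

/-- The force at a lattice site. -/
def latForce (S : Finset ℝ) (n : ℕ) (r : Fin n) : ℝ :=
  (∑ u ∈ S, 2 / (lat n (r : ℕ) - u)) + ∑ s : Fin n, 2 / (lat n (r : ℕ) - lat n (s : ℕ))

/-- A lower bound for the convexity of the external potential. -/
def convexity (S : Finset ℝ) : ℝ := ∑ u ∈ S, 2 / (1 + |u|) ^ 2

theorem convexity_pos (hS : IsExt S) : 0 < convexity S :=
  Finset.sum_pos (fun u _ => by positivity) ⟨1, hS.one_mem⟩

/-- Symmetrization: exchanging `i` and `j` turns twice the sum into a sum of `(d i - d j) a i j`. -/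
theorem sum_antisymm_le {n : ℕ} (d : Fin n → ℝ) (a : Fin n → Fin n → ℝ)
    (ha : ∀ i j, a i j = -a j i) (h : ∀ i j, (d i - d j) * a i j ≤ 0) :
    ∑ i, d i * ∑ j, a i j ≤ 0 := by
  have e1 : ∑ i, d i * ∑ j, a i j = ∑ i, ∑ j, d i * a i j := by simp_rw [Finset.mul_sum]
  have e2 : ∑ i, ∑ j, d i * a i j = ∑ i, ∑ j, -(d j * a i j) := by
    rw [Finset.sum_comm]
    refine Finset.sum_congr rfl fun i _ => Finset.sum_congr rfl fun j _ => ?_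
    rw [ha j i]; ring
  have e3 : ∑ i, ∑ j, d i * a i j + ∑ i, ∑ j, -(d j * a i j) ≤ 0 := by
    rw [← Finset.sum_add_distrib]
    refine Finset.sum_nonpos fun i _ => ?_
    rw [← Finset.sum_add_distrib]
    refine Finset.sum_nonpos fun j _ => ?_
    have := h i j
    linarith
  linarith

/-- The force `2 / (x - u)` decreases on the interval, with slope controlled by `(x - u) (X - u) ≤
(1 + |u|)²`. -/
theorem mul_inv_sub_le {x X u : ℝ} (hx : x ∈ Set.Ioo (-1 : ℝ) 1) (hX : X ∈ Set.Ioo (-1 : ℝ) 1)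
    (hu : 1 ≤ |u|) :
    (x - X) * (2 / (x - u) - 2 / (X - u)) ≤ -((x - X) ^ 2 * (2 / (1 + |u|) ^ 2)) := by
  have key : 0 < (x - u) * (X - u) ∧ (x - u) * (X - u) ≤ (1 + |u|) ^ 2 := by
    obtain ⟨h1, h2⟩ := hx
    obtain ⟨h3, h4⟩ := hX
    rcases le_or_gt 0 u with h | h
    · rw [abs_of_nonneg h] at hu ⊢
      constructor <;> nlinarith
    · rw [abs_of_neg h] at hu ⊢
      constructor <;> nlinarith
  have hx0 : x - u ≠ 0 := fun h => by simp [h] at key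
  have hX0 : X - u ≠ 0 := fun h => by simp [h] at key
  have e : (x - X) * (2 / (x - u) - 2 / (X - u)) = -((x - X) ^ 2 * (2 / ((x - u) * (X - u)))) := by
    field_simp; ring
  rw [e]
  have : 2 / (1 + |u|) ^ 2 ≤ 2 / ((x - u) * (X - u)) :=
    div_le_div_of_nonneg_left (by norm_num) key.1 key.2
  nlinarith [sq_nonneg (x - X)]

/-- Compare the force at `x` with the force at the lattice sites assigned by rank. Ranks preserve
the order, so the mutual repulsion is monotone and its contribution has a good sign; the external
points give the convexity term. -/
theorem sum_dev_mul_le (hS : IsExt S) {n : ℕ} {x : Fin n → ℝ} (hx : Function.Injective x)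
    (hx1 : ∀ i, x i ∈ Set.Ioo (-1 : ℝ) 1) :
    ∑ i, dev x i * ((∑ u ∈ S, 2 / (x i - u)) + ∑ j, 2 / (x i - x j)) ≤
      ∑ i, dev x i * latForce S n (rankEquiv x hx i) - convexity S * ∑ i, dev x i ^ 2 := by
  set X : Fin n → ℝ := fun i => lat n (rank x i) with hX
  have hd : ∀ i, dev x i = x i - X i := fun i => rfl
  have hX1 : ∀ i, X i ∈ Set.Ioo (-1 : ℝ) 1 := fun i => lat_mem (rankEquiv x hx i)
  have hF : ∀ i, latForce S n (rankEquiv x hx i) =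
      (∑ u ∈ S, 2 / (X i - u)) + ∑ j, 2 / (X i - X j) := by
    intro i
    unfold latForce
    congr 1
    exact (Equiv.sum_comp (rankEquiv x hx)
      (fun s : Fin n => 2 / (lat n ((rankEquiv x hx i : Fin n) : ℕ) - lat n (s : ℕ)))).symm
  have h1 : ∑ i, dev x i * ∑ j, (2 / (x i - x j) - 2 / (X i - X j)) ≤ 0 := by
    refine sum_antisymm_le _ _ (fun i j => ?_) fun i j => ?_
    · rw [← neg_sub (x j) (x i), ← neg_sub (X j) (X i), div_neg, div_neg]; ring
    · have hh : (0 : ℝ) < 2 / ((n : ℝ) + 1) := by positivity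
      rcases lt_trichotomy (x i) (x j) with h | h | h
      · have h2 : X i < X j := by
          have := lat_sub n (rank x i) (rank x j)
          have h3 : (rank x i : ℝ) < rank x j := by exact_mod_cast rank_lt_rank h
          have : X i - X j < 0 := by
            rw [hX]; simp only; rw [this]; exact mul_neg_of_pos_of_neg hh (by linarith)
          linarith
        have a1 : x i - x j ≠ 0 := by linarith
        have a2 : X i - X j ≠ 0 := by linarith
        have e : (dev x i - dev x j) * (2 / (x i - x j) - 2 / (X i - X j)) =
            -(2 * (dev x i - dev x j) ^ 2 / ((x i - x j) * (X i - X j))) := by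
          rw [hd, hd]; field_simp; ring
        rw [e]
        have : 0 ≤ 2 * (dev x i - dev x j) ^ 2 / ((x i - x j) * (X i - X j)) :=
          div_nonneg (by positivity) (mul_nonneg_of_nonpos_of_nonpos (by linarith) (by linarith))
        linarith
      · obtain rfl := hx h
        simp
      · have h2 : X j < X i := by
          have := lat_sub n (rank x i) (rank x j)
          have h3 : (rank x j : ℝ) < rank x i := by exact_mod_cast rank_lt_rank h
          have : 0 < X i - X j := by
            rw [hX]; simp only; rw [this]; exact mul_pos hh (by linarith)
          linarith
        have a1 : x i - x j ≠ 0 := by linarith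
        have a2 : X i - X j ≠ 0 := by linarith
        have e : (dev x i - dev x j) * (2 / (x i - x j) - 2 / (X i - X j)) =
            -(2 * (dev x i - dev x j) ^ 2 / ((x i - x j) * (X i - X j))) := by
          rw [hd, hd]; field_simp; ring
        rw [e]
        have : 0 ≤ 2 * (dev x i - dev x j) ^ 2 / ((x i - x j) * (X i - X j)) :=
          div_nonneg (by positivity) (mul_nonneg (by linarith) (by linarith))
        linarith
  have h2 : ∑ i, dev x i * ∑ u ∈ S, (2 / (x i - u) - 2 / (X i - u)) ≤
      -(convexity S * ∑ i, dev x i ^ 2) := by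
    rw [Finset.mul_sum, ← Finset.sum_neg_distrib]
    refine Finset.sum_le_sum fun i _ => ?_
    rw [Finset.mul_sum, convexity, Finset.sum_mul, ← Finset.sum_neg_distrib]
    refine Finset.sum_le_sum fun u hu => ?_
    have := mul_inv_sub_le (hx1 i) (hX1 i) (hS.one_le u hu)
    rw [hd, mul_comm (2 / (1 + |u|) ^ 2)]
    exact this
  have e : ∑ i, dev x i * ((∑ u ∈ S, 2 / (x i - u)) + ∑ j, 2 / (x i - x j)) -
      ∑ i, dev x i * latForce S n (rankEquiv x hx i) =
      ∑ i, dev x i * ∑ j, (2 / (x i - x j) - 2 / (X i - X j)) +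
      ∑ i, dev x i * ∑ u ∈ S, (2 / (x i - u) - 2 / (X i - u)) := by
    rw [← Finset.sum_sub_distrib, ← Finset.sum_add_distrib]
    refine Finset.sum_congr rfl fun i _ => ?_
    rw [hF, Finset.sum_sub_distrib, Finset.sum_sub_distrib]; ring
  linarith

/-- Young's inequality absorbs half of the convexity term; since the ranking is a bijection, the
remaining sum over forces no longer depends on `x`. -/
theorem sum_dev_mul_le' (hS : IsExt S) {n : ℕ} {x : Fin n → ℝ} (hx : Function.Injective x)
    (hx1 : ∀ i, x i ∈ Set.Ioo (-1 : ℝ) 1) :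
    ∑ i, dev x i * ((∑ u ∈ S, 2 / (x i - u)) + ∑ j, 2 / (x i - x j)) ≤
      (∑ r, latForce S n r ^ 2) / (2 * convexity S) - convexity S / 2 * ∑ i, dev x i ^ 2 := by
  have hc := convexity_pos hS
  have h := sum_dev_mul_le hS hx hx1
  have h2 : ∑ i, dev x i * latForce S n (rankEquiv x hx i) ≤
      convexity S / 2 * ∑ i, dev x i ^ 2 + (∑ r, latForce S n r ^ 2) / (2 * convexity S) := by
    rw [← Equiv.sum_comp (rankEquiv x hx) (fun r => latForce S n r ^ 2), Finset.mul_sum,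
      Finset.sum_div, ← Finset.sum_add_distrib]
    refine Finset.sum_le_sum fun i _ => ?_
    set d := dev x i
    set F := latForce S n (rankEquiv x hx i)
    have : convexity S / 2 * d ^ 2 + F ^ 2 / (2 * convexity S) - d * F =
        (convexity S * d - F) ^ 2 / (2 * convexity S) := by field_simp; ring
    have h3 : 0 ≤ (convexity S * d - F) ^ 2 / (2 * convexity S) := by positivity
    linarith
  linarith

theorem rank_eq_sum {n : ℕ} (x : Fin n → ℝ) (i : Fin n) :
    (rank x i : ℝ) = ∑ j, if x j < x i then (1 : ℝ) else 0 := by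
  simp [rank]

theorem measurable_rank {n : ℕ} (i : Fin n) : Measurable fun x : Fin n → ℝ => (rank x i : ℝ) := by
  simp_rw [rank_eq_sum]
  exact Finset.measurable_sum _ fun j _ => Measurable.ite
    (measurableSet_lt (measurable_pi_apply _) (measurable_pi_apply _))
    measurable_const measurable_const

theorem measurable_dev {n : ℕ} (i : Fin n) : Measurable fun x : Fin n → ℝ => dev x i := by
  have := measurable_rank i
  unfold dev lat
  exact (measurable_pi_apply i).sub ((this.const_add 1).const_mul _ |>.const_add _)

/-- The displacement is `x i` plus a constant plus a combination of order indicators, and only `x i`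
contributes to the integration by parts. -/
theorem integral_dev_mul_gasDeriv (hS : IsExt S) {m : ℕ} (i : Fin (m + 1)) :
    Integrable (fun x => dev x i * gasDeriv S (m + 1) i x) (Measure.pi fun _ => leb) ∧
    ∫ x, dev x i * gasDeriv S (m + 1) i x ∂(Measure.pi fun _ => leb) =
      -∫ x, gasDens S (m + 1) x ∂(Measure.pi fun _ => leb) := by
  set h : ℝ := 2 / (((m + 1 : ℕ) : ℝ) + 1) with hh
  have cg := continuous_gasDeriv S (m + 1) i
  have i1 : Integrable (fun x : Fin (m + 1) → ℝ => x i * gasDeriv S (m + 1) i x)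
    (Measure.pi fun _ => leb) := integrable_pi_leb ((continuous_apply i).mul cg)
  have i2 : Integrable (fun x : Fin (m + 1) → ℝ => gasDeriv S (m + 1) i x)
    (Measure.pi fun _ => leb) := integrable_pi_leb cg
  have i3 : ∀ j, Integrable (fun x : Fin (m + 1) → ℝ =>
      (if x j < x i then 1 else 0) * gasDeriv S (m + 1) i x) (Measure.pi fun _ => leb) := fun j =>
    integrable_mul_pi_leb (C := 1) cg (Measurable.ite
      (measurableSet_lt (measurable_pi_apply _) (measurable_pi_apply _))
      measurable_const measurable_const) (fun x => by split_ifs <;> simp)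
  have e : (fun x => dev x i * gasDeriv S (m + 1) i x) = fun x =>
      x i * gasDeriv S (m + 1) i x + (1 - h) * gasDeriv S (m + 1) i x -
        h * ∑ j, (if x j < x i then 1 else 0) * gasDeriv S (m + 1) i x := by
    ext x
    rw [← Finset.sum_mul, ← rank_eq_sum, dev, lat]
    ring
  have i4 : Integrable (fun x : Fin (m + 1) → ℝ => h * ∑ j,
      (if x j < x i then 1 else 0) * gasDeriv S (m + 1) i x) (Measure.pi fun _ => leb) :=
    (integrable_finsetSum _ fun j _ => i3 j).const_mul h
  rw [e]
  refine ⟨(i1.fun_add (i2.const_mul _)).sub i4, ?_⟩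
  rw [integral_sub (i1.fun_add (i2.const_mul _)) i4, integral_add i1 (i2.const_mul _),
    integral_const_mul, integral_const_mul, integral_finsetSum _ fun j _ => i3 j,
    integral_gasDeriv hS, integral_coord_mul_gasDeriv hS,
    Finset.sum_eq_zero fun j _ => integral_indicator_mul_gasDeriv hS i j]
  ring

theorem ae_mem_Ioo (n : ℕ) :
    ∀ᵐ x : Fin n → ℝ ∂(Measure.pi fun _ => leb), ∀ i, x i ∈ Set.Ioo (-1 : ℝ) 1 := by
  have h1 : ∀ᵐ x : Fin n → ℝ ∂(Measure.pi fun _ => leb), ∀ i, x i ≠ 1 :=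
    (ae_all_iff.2 fun i => Measure.ae_eval_ne (fun _ => leb) i 1)
  have h2 : ∀ᵐ x : Fin n → ℝ ∂(Measure.pi fun _ => leb), ∀ i, x i ≠ -1 :=
    (ae_all_iff.2 fun i => Measure.ae_eval_ne (fun _ => leb) i (-1))
  filter_upwards [ae_mem_cube n, h1, h2] with x h h1 h2 i
  exact ⟨lt_of_le_of_ne (h i).1 (h2 i).symm, lt_of_le_of_ne (h i).2 (h1 i)⟩

theorem abs_dev_le {n : ℕ} {x : Fin n → ℝ} (hx : ∀ i, x i ∈ Set.Icc (-1 : ℝ) 1) (i : Fin n) :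
    |dev x i| ≤ 2 := by
  have h1 := hx i
  have h2 := lat_mem ⟨rank x i, rank_lt x i⟩
  simp only [Set.mem_Icc, Set.mem_Ioo] at h1 h2
  rw [dev, abs_le]; constructor <;> linarith [h2.1, h2.2, h1.1, h1.2]

theorem integrable_dev_sq {m : ℕ} :
    Integrable (fun x => gasDens S (m + 1) x * ∑ i, dev x i ^ 2) (Measure.pi fun _ => leb) := by
  simp_rw [Finset.mul_sum]
  refine integrable_finsetSum _ fun i _ => ?_
  have h := integrable_pi_leb (continuous_gasDens S (m + 1))
  have := h.bdd_mul (c := 4) (((measurable_dev i).pow_const 2).aestronglyMeasurable) (by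
    filter_upwards [ae_mem_cube (m + 1)] with x hx
    have := abs_dev_le hx i
    rw [Real.norm_eq_abs, abs_pow]
    nlinarith [abs_nonneg (dev x i)])
  simpa [mul_comm] using this

/-- Integrating the divergence of the displacement field times the density gives `-(m + 1)` times
the normalization; monotonicity of the forces bounds the same quantity from above by minus the mean
square displacement. -/
theorem integral_dev_sq_le (hS : IsExt S) (m : ℕ) :
    ∫ x, gasDens S (m + 1) x * ∑ i, dev x i ^ 2 ∂(Measure.pi fun _ => leb) ≤
      (2 * ((m : ℝ) + 1) / convexity S + (∑ r, latForce S (m + 1) r ^ 2) / convexity S ^ 2) *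
        ∫ x, gasDens S (m + 1) x ∂(Measure.pi fun _ => leb) := by
  have hc := convexity_pos hS
  set c := convexity S
  set Φ := ∑ r, latForce S (m + 1) r ^ 2
  have iG := integrable_pi_leb (continuous_gasDens S (m + 1))
  have iD := integrable_dev_sq (S := S) (m := m)
  have h1 : ∫ x, ∑ i, dev x i * gasDeriv S (m + 1) i x ∂(Measure.pi fun _ => leb) ≤
      ∫ x, (Φ / (2 * c) * gasDens S (m + 1) x - c / 2 * (gasDens S (m + 1) x * ∑ i, dev x i ^ 2))
        ∂(Measure.pi fun _ => leb) := by
    refine integral_mono_ae (integrable_finsetSum _ fun i _ => (integral_dev_mul_gasDeriv hS i).1)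
      ((iG.const_mul _).sub (iD.const_mul _)) ?_
    filter_upwards [ae_mem_Ioo (m + 1), ae_pi_leb_injective (m + 1)] with x hx hi
    have := mul_le_mul_of_nonneg_left (sum_dev_mul_le' hS hi hx) (gasDens_nonneg S (m + 1) x)
    simp_rw [gasDeriv_eq]
    calc _ = gasDens S (m + 1) x *
        ∑ i, dev x i * ((∑ u ∈ S, 2 / (x i - u)) + ∑ j, 2 / (x i - x j)) := by
          rw [Finset.mul_sum]; exact Finset.sum_congr rfl fun i _ => by ring
      _ ≤ _ := this
      _ = _ := by ring
  rw [integral_finsetSum _ fun i _ => (integral_dev_mul_gasDeriv hS i).1,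
    Finset.sum_congr rfl fun i _ => (integral_dev_mul_gasDeriv hS i).2,
    integral_sub (iG.const_mul _) (iD.const_mul _), integral_const_mul, integral_const_mul] at h1
  simp only [Finset.sum_const, Finset.card_univ, Fintype.card_fin, nsmul_eq_mul] at h1
  push_cast at h1
  set I := ∫ x, gasDens S (m + 1) x ∂(Measure.pi fun _ => leb)
  set D := ∫ x, gasDens S (m + 1) x * ∑ i, dev x i ^ 2 ∂(Measure.pi fun _ => leb)
  have h2 : c / 2 * D ≤ (Φ / (2 * c) + (m + 1)) * I := by linarith
  have h3 : D = 2 / c * (c / 2 * D) := by field_simp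
  rw [h3]
  refine (mul_le_mul_of_nonneg_left h2 (by positivity)).trans (le_of_eq ?_)
  field_simp
  ring

end

section

/-! ### The number of points in an interval -/

variable {S : Finset ℝ} {P : ℕ → ℝ[X]}

theorem card_lat_le {n : ℕ} {p q : ℝ} (hpq : p ≤ q) :
    ((Finset.univ.filter fun r : Fin n => p ≤ lat n (r : ℕ) ∧ lat n (r : ℕ) ≤ q).card : ℝ) ≤
      (q - p) / (2 / ((n : ℝ) + 1)) + 1 := by
  set h : ℝ := 2 / ((n : ℝ) + 1) with hh
  have hpos : 0 < h := by positivity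
  set I := Finset.Icc ⌈(p + 1) / h - 1⌉ ⌊(q + 1) / h - 1⌋
  have h1 : (Finset.univ.filter fun r : Fin n => p ≤ lat n (r : ℕ) ∧ lat n (r : ℕ) ≤ q).card ≤
      I.card := by
    refine Finset.card_le_card_of_injOn (fun r => ((r : ℕ) : ℤ)) (fun r hr => ?_) ?_
    · have hr := (Finset.mem_filter.1 (Finset.mem_coe.1 hr)).2
      simp only [lat] at hr
      simp only [I, Finset.coe_Icc, Set.mem_Icc, Int.ceil_le, Int.le_floor]
      push_cast
      rw [sub_le_iff_le_add, le_sub_iff_add_le, div_le_iff₀ hpos, le_div_iff₀ hpos]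
      constructor <;> nlinarith [hr.1, hr.2]
    · intro a _ b _ hab
      exact Fin.ext (by simpa using hab)
  have h2 : (I.card : ℝ) ≤ (q - p) / h + 1 := by
    have h4 : (p + 1) / h - 1 ≤ (q + 1) / h - 1 := by gcongr
    have h3 : (I.card : ℝ) = max ((⌊(q + 1) / h - 1⌋ : ℝ) + 1 - ⌈(p + 1) / h - 1⌉) 0 := by
      simp only [I, Int.card_Icc]
      have := Int.toNat_eq_max (⌊(q + 1) / h - 1⌋ + 1 - ⌈(p + 1) / h - 1⌉)
      have e : (((⌊(q + 1) / h - 1⌋ + 1 - ⌈(p + 1) / h - 1⌉).toNat : ℤ) : ℝ) =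
        ((max (⌊(q + 1) / h - 1⌋ + 1 - ⌈(p + 1) / h - 1⌉) 0 : ℤ) : ℝ) := by rw [this]
      push_cast at e
      exact e
    rw [h3]
    have := Int.floor_le ((q + 1) / h - 1)
    have := Int.le_ceil ((p + 1) / h - 1)
    have e : (q - p) / h = (q + 1) / h - (p + 1) / h := by ring
    refine max_le (by linarith) ?_
    have : 0 ≤ (q - p) / h := div_nonneg (by linarith) hpos.le
    linarith
  exact (by exact_mod_cast h1 : (_ : ℝ) ≤ _).trans h2

theorem le_card_lat {n : ℕ} {p q : ℝ} (hp : -1 < p) (hq : q < 1) :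
    (q - p) / (2 / ((n : ℝ) + 1)) - 1 ≤
    ((Finset.univ.filter fun r : Fin n => p ≤ lat n (r : ℕ) ∧ lat n (r : ℕ) ≤ q).card : ℝ) := by
  set h : ℝ := 2 / ((n : ℝ) + 1) with hh
  have hpos : 0 < h := by positivity
  have hn : h * ((n : ℝ) + 1) = 2 := by rw [hh]; field_simp
  set I := Finset.Icc ⌈(p + 1) / h - 1⌉ ⌊(q + 1) / h - 1⌋
  have hI : ∀ k ∈ I, 0 ≤ k ∧ k < n := by
    intro k hk
    simp only [I, Finset.mem_Icc, Int.ceil_le, Int.le_floor] at hk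
    rw [sub_le_iff_le_add, le_sub_iff_add_le, div_le_iff₀ hpos, le_div_iff₀ hpos] at hk
    constructor
    · have : (0 : ℝ) < (k : ℝ) + 1 := by
        by_contra! hc
        nlinarith [hk.1]
      have : (0 : ℤ) < k + 1 := by exact_mod_cast this
      omega
    · have : (k : ℝ) < n := by
        by_contra! hc
        nlinarith [hk.2]
      exact_mod_cast this
  have h1 : I.card ≤
      (Finset.univ.filter fun r : Fin n => p ≤ lat n (r : ℕ) ∧ lat n (r : ℕ) ≤ q).card := by
    rw [← Finset.card_image_of_injective (Finset.univ.filter fun r : Fin n =>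
      p ≤ lat n (r : ℕ) ∧ lat n (r : ℕ) ≤ q) (f := fun r : Fin n => ((r : ℕ) : ℤ))
      (fun a b hab => Fin.ext (by simpa using hab))]
    refine Finset.card_le_card fun k hk => ?_
    have hk' := hI k hk
    refine Finset.mem_image.2 ⟨⟨k.toNat, by omega⟩, ?_, by simpa using hk'.1⟩
    have e : ((k.toNat : ℕ) : ℝ) = k := by
      have : ((k.toNat : ℤ) : ℝ) = k := by rw [Int.toNat_of_nonneg hk'.1]
      exact_mod_cast this
    simp only [I, Finset.mem_Icc, Int.ceil_le, Int.le_floor] at hk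
    rw [sub_le_iff_le_add, le_sub_iff_add_le, div_le_iff₀ hpos, le_div_iff₀ hpos] at hk
    refine Finset.mem_filter.2 ⟨Finset.mem_univ _, ?_⟩
    simp only [lat, e]
    constructor <;> nlinarith [hk.1, hk.2]
  refine le_trans ?_ (by exact_mod_cast h1 : (I.card : ℝ) ≤ _)
  simp only [I, Int.card_Icc]
  have e : (((⌊(q + 1) / h - 1⌋ + 1 - ⌈(p + 1) / h - 1⌉ : ℤ)) : ℝ) ≤
      (((⌊(q + 1) / h - 1⌋ + 1 - ⌈(p + 1) / h - 1⌉).toNat : ℤ) : ℝ) := by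
    exact_mod_cast Int.self_le_toNat _
  push_cast at e
  refine le_trans ?_ e
  have := Int.lt_floor_add_one ((q + 1) / h - 1)
  have := Int.ceil_lt_add_one ((p + 1) / h - 1)
  have e : (q - p) / h = (q + 1) / h - (p + 1) / h := by ring
  rw [e]
  linarith

/-- The number of points of a configuration in an interval. -/
def numIn {n : ℕ} (a b : ℝ) (x : Fin n → ℝ) : ℝ :=
  ∑ i, (Set.Icc a b).indicator (fun _ => (1 : ℝ)) (x i)

theorem numIn_eq {n : ℕ} (a b : ℝ) (x : Fin n → ℝ) :
    numIn a b x = ((Finset.univ.filter fun i => a ≤ x i ∧ x i ≤ b).card : ℝ) := by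
  simp [numIn, Set.indicator_apply]

/-- Chebyshev's inequality for the counting measure. -/
theorem card_far_le {n : ℕ} (x : Fin n → ℝ) {s : ℝ} (hs : 0 < s) :
    ((Finset.univ.filter fun i => s < |dev x i|).card : ℝ) ≤ (∑ i, dev x i ^ 2) / s ^ 2 := by
  rw [le_div_iff₀ (by positivity), ← nsmul_eq_mul]
  refine (Finset.card_nsmul_le_sum _ _ _ fun i hi => ?_).trans
    (Finset.sum_le_sum_of_subset_of_nonneg (Finset.subset_univ _) fun i _ _ => sq_nonneg _)
  rw [← sq_abs (dev x i)]
  have := (Finset.mem_filter.1 hi).2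
  gcongr

/-- Distinct particles occupy every lattice site exactly once. -/
theorem card_filter_rankEquiv {n : ℕ} {x : Fin n → ℝ} (hx : Function.Injective x) (p q : ℝ) :
    (Finset.univ.filter fun i => p ≤ lat n (rank x i) ∧ lat n (rank x i) ≤ q).card =
      (Finset.univ.filter fun r : Fin n => p ≤ lat n (r : ℕ) ∧ lat n (r : ℕ) ≤ q).card := by
  refine Finset.card_bij (fun i _ => rankEquiv x hx i) (fun i hi => ?_)
    (fun i _ j _ h => (rankEquiv x hx).injective h)
    (fun r hr => ⟨(rankEquiv x hx).symm r, ?_, by simp⟩)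
  · simpa [rankEquiv_apply] using hi
  · have : rank x ((rankEquiv x hx).symm r) = (r : ℕ) := by
      rw [← rankEquiv_apply x hx, Equiv.apply_symm_apply]
    simpa [this] using hr

/-- Particles displaced by at most `s` are counted by lattice sites after shrinking or enlarging the
interval by `s`; the others are few by Chebyshev's inequality. -/
theorem abs_numIn_sub_le {n : ℕ} {x : Fin n → ℝ} (hx : Function.Injective x) {a b s : ℝ}
    (ha : -1 ≤ a) (hab : a ≤ b) (hb : b ≤ 1) (hs : 0 < s) :
    |numIn a b x - (b - a) / (2 / ((n : ℝ) + 1))| ≤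
      2 * s / (2 / ((n : ℝ) + 1)) + 1 + (∑ i, dev x i ^ 2) / s ^ 2 := by
  set h : ℝ := 2 / ((n : ℝ) + 1) with hh
  have hpos : 0 < h := by positivity
  have hfar := card_far_le x hs
  rw [numIn_eq, abs_le]
  constructor
  · have h1 := le_card_lat (n := n) (p := a + s) (q := b - s) (by linarith) (by linarith)
    rw [← card_filter_rankEquiv hx, ← hh] at h1
    have h2 : (Finset.univ.filter fun i =>
        a + s ≤ lat n (rank x i) ∧ lat n (rank x i) ≤ b - s).card ≤
        (Finset.univ.filter fun i => a ≤ x i ∧ x i ≤ b).card +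
        (Finset.univ.filter fun i => s < |dev x i|).card := by
      refine le_trans (Finset.card_le_card fun i hi => ?_) (Finset.card_union_le _ _)
      simp only [Finset.mem_filter, Finset.mem_univ, true_and, Finset.mem_union] at hi ⊢
      by_cases hd : s < |dev x i|
      · exact Or.inr hd
      · have := abs_le.1 (not_lt.1 hd)
        rw [dev] at this
        exact Or.inl ⟨by linarith [this.1], by linarith [this.2]⟩
    have h3 : ((Finset.univ.filter fun i =>
        a + s ≤ lat n (rank x i) ∧ lat n (rank x i) ≤ b - s).card : ℝ) ≤
        (Finset.univ.filter fun i => a ≤ x i ∧ x i ≤ b).card +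
        (Finset.univ.filter fun i => s < |dev x i|).card := by exact_mod_cast h2
    have e : (b - s - (a + s)) / h = (b - a) / h - 2 * s / h := by ring
    rw [e] at h1
    linarith
  · have h1 := card_lat_le (n := n) (p := a - s) (q := b + s) (by linarith)
    rw [← card_filter_rankEquiv hx, ← hh] at h1
    have h2 : (Finset.univ.filter fun i => a ≤ x i ∧ x i ≤ b).card ≤
        (Finset.univ.filter fun i =>
        a - s ≤ lat n (rank x i) ∧ lat n (rank x i) ≤ b + s).card +
        (Finset.univ.filter fun i => s < |dev x i|).card := by
      refine le_trans (Finset.card_le_card fun i hi => ?_) (Finset.card_union_le _ _)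
      simp only [Finset.mem_filter, Finset.mem_univ, true_and, Finset.mem_union] at hi ⊢
      by_cases hd : s < |dev x i|
      · exact Or.inr hd
      · have := abs_le.1 (not_lt.1 hd)
        rw [dev] at this
        exact Or.inl ⟨by linarith [this.2], by linarith [this.1]⟩
    have h3 : ((Finset.univ.filter fun i => a ≤ x i ∧ x i ≤ b).card : ℝ) ≤
        (Finset.univ.filter fun i =>
        a - s ≤ lat n (rank x i) ∧ lat n (rank x i) ≤ b + s).card +
        (Finset.univ.filter fun i => s < |dev x i|).card := by exact_mod_cast h2
    have e : (b + s - (a - s)) / h = (b - a) / h + 2 * s / h := by ring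
    rw [e] at h1
    linarith

theorem continuous_kern_diag (P : ℕ → ℝ[X]) (n : ℕ) : Continuous fun t => kern P n t t := by
  simp_rw [kern_self]
  exact continuous_finsetSum _ fun j _ => ((P j).continuous).pow 2

theorem integrable_indicator_mul {a b : ℝ} {f : ℝ → ℝ} (hf : Continuous f) :
    Integrable (fun t => (Set.Icc a b).indicator (fun _ => (1 : ℝ)) t * f t) leb := by
  refine (integrable_leb_of_continuous hf).bdd_mul (c := 1)
    (measurable_const.indicator measurableSet_Icc).aestronglyMeasurable
    (Filter.Eventually.of_forall fun t => ?_)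
  by_cases ht : t ∈ Set.Icc a b <;> simp [ht]

theorem integral_numIn_mul_jointDet (hP : IsOrthonormalPolys (wt S) P) {m : ℕ} {a b : ℝ}
    (ha : -1 ≤ a) (hab : a ≤ b) (hb : b ≤ 1) :
    ∫ x, numIn a b x * jointDet S P (m + 1) x ∂(Measure.pi fun _ => leb) =
      ((m + 1).factorial : ℝ) * ∫ t in a..b, kern P (m + 1) t t * wt S t := by
  have hkc : Continuous fun t => kern P (m + 1) t t * wt S t :=
    (continuous_kern_diag P (m + 1)).mul (continuous_wt S)
  have h1 : ∫ t in (-1 : ℝ)..1, (Set.Icc a b).indicator (fun _ => (1 : ℝ)) t *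
      (kern P (m + 1) t t * wt S t) = ∫ t in a..b, kern P (m + 1) t t * wt S t := by
    rw [← integral_leb, intervalIntegral.integral_of_le hab, ← integral_Icc_eq_integral_Ioc, leb,
      ← integral_indicator measurableSet_Icc, ← integral_indicator measurableSet_Icc]
    congr 1
    ext t
    by_cases ht : t ∈ Set.Icc a b
    · have : t ∈ Set.Icc (-1 : ℝ) 1 := ⟨ha.trans ht.1, ht.2.trans hb⟩
      simp [ht, this]
    · simp [ht]
  have hi : ∀ i : Fin (m + 1), Integrable (fun x : Fin (m + 1) → ℝ =>
      (Set.Icc a b).indicator (fun _ => (1 : ℝ)) (x i) * jointDet S P (m + 1) x)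
      (Measure.pi fun _ => leb) := fun i => by
    have e : jointDet S P (m + 1) = fun x => (∏ j : Fin (m + 1), (P j).leadingCoeff) ^ 2 *
        gasDens S (m + 1) x := funext (jointDet_eq_gasDens hP (m + 1))
    rw [e]
    refine integrable_mul_pi_leb (C := 1) (continuous_const.mul (continuous_gasDens _ _))
      ((measurable_const.indicator measurableSet_Icc).comp (measurable_pi_apply i)) fun x => ?_
    by_cases ht : x i ∈ Set.Icc a b <;> simp [ht]
  simp only [numIn, Finset.sum_mul]
  rw [integral_finsetSum _ fun i _ => hi i, Finset.sum_congr rfl fun i _ =>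
    integral_mul_jointDet hP i (fun f hf => integrable_indicator_mul hf), h1]
  simp [Nat.factorial_succ, mul_assoc]

/-- The number of particles in an interval is close to the number of lattice sites there. -/
theorem abs_integral_kern_sub_le (hS : IsExt S) (hP : IsOrthonormalPolys (wt S) P) (m : ℕ)
    {a b s : ℝ} (ha : -1 ≤ a) (hab : a ≤ b) (hb : b ≤ 1) (hs : 0 < s) :
    |(∫ t in a..b, kern P (m + 1) t t * wt S t) - (b - a) * ((m : ℝ) + 2) / 2| ≤
      s * ((m : ℝ) + 2) + 1 + (2 * ((m : ℝ) + 1) / convexity S +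
        (∑ r, latForce S (m + 1) r ^ 2) / convexity S ^ 2) / s ^ 2 := by
  set c := (∏ j : Fin (m + 1), (P j).leadingCoeff) ^ 2 with hc
  have hc0 : 0 < c := leadingCoeff_prod_sq_pos hP (m + 1)
  have hJ : jointDet S P (m + 1) = fun x => c * gasDens S (m + 1) x :=
    funext (jointDet_eq_gasDens hP (m + 1))
  set Δ := 2 * ((m : ℝ) + 1) / convexity S + (∑ r, latForce S (m + 1) r ^ 2) / convexity S ^ 2
  set J := ∫ t in a..b, kern P (m + 1) t t * wt S t
  have hf : (0 : ℝ) < ((m + 1).factorial : ℝ) := by positivity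
  have h1 := integral_numIn_mul_jointDet hP (m := m) ha hab hb
  have h2 := integral_jointDet hP m
  have iJ : Integrable (jointDet S P (m + 1)) (Measure.pi fun _ => leb) := by
    rw [hJ]; exact integrable_pi_leb (continuous_const.mul (continuous_gasDens _ _))
  have iD : Integrable (fun x => jointDet S P (m + 1) x * ∑ i, dev x i ^ 2)
      (Measure.pi fun _ => leb) := by
    rw [hJ]; simp_rw [mul_assoc]; exact integrable_dev_sq.const_mul c
  have hD : ∫ x, jointDet S P (m + 1) x * ∑ i, dev x i ^ 2 ∂(Measure.pi fun _ => leb) ≤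
      Δ * ((m + 1).factorial : ℝ) := by
    rw [← h2, hJ]
    simp_rw [mul_assoc]
    rw [integral_const_mul, integral_const_mul]
    have := mul_le_mul_of_nonneg_left (integral_dev_sq_le hS m) hc0.le
    refine this.trans (le_of_eq ?_)
    ring
  have iN : Integrable (fun x => numIn a b x * jointDet S P (m + 1) x)
      (Measure.pi fun _ => leb) := by
    refine iJ.bdd_mul (c := (m : ℝ) + 1) (Measurable.aestronglyMeasurable ?_)
      (Filter.Eventually.of_forall fun x => ?_)
    · exact Finset.measurable_sum _ fun i _ =>
        (measurable_const.indicator measurableSet_Icc).comp (measurable_pi_apply i)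
    · rw [numIn_eq, Real.norm_eq_abs, abs_of_nonneg (by positivity)]
      have := Finset.card_filter_le (Finset.univ : Finset (Fin (m + 1)))
        fun i => a ≤ x i ∧ x i ≤ b
      rw [Finset.card_univ, Fintype.card_fin] at this
      exact_mod_cast this
  set R : ℝ := (b - a) / (2 / (((m + 1 : ℕ) : ℝ) + 1)) with hR
  have h3 : |∫ x, (numIn a b x * jointDet S P (m + 1) x - R * jointDet S P (m + 1) x)
      ∂(Measure.pi fun _ => leb)| ≤
      ∫ x, ((2 * s / (2 / (((m + 1 : ℕ) : ℝ) + 1)) + 1) * jointDet S P (m + 1) x +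
        1 / s ^ 2 * (jointDet S P (m + 1) x * ∑ i, dev x i ^ 2)) ∂(Measure.pi fun _ => leb) := by
    refine (abs_integral_le_integral_abs).trans (integral_mono_ae
      (iN.sub (iJ.const_mul _)).abs ((iJ.const_mul _).add (iD.const_mul _)) ?_)
    filter_upwards [ae_pi_leb_injective (m + 1)] with x hx
    have hj : 0 ≤ jointDet S P (m + 1) x := by
      rw [hJ]; exact mul_nonneg hc0.le (gasDens_nonneg _ _ _)
    have := mul_le_mul_of_nonneg_right (abs_numIn_sub_le hx ha hab hb hs) hj
    rw [← sub_mul, abs_mul, abs_of_nonneg hj]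
    refine this.trans (le_of_eq ?_)
    ring
  rw [integral_sub iN (iJ.const_mul _), integral_add (iJ.const_mul _) (iD.const_mul _),
    integral_const_mul, integral_const_mul, integral_const_mul, h1, h2, mul_comm R,
    ← mul_sub, abs_mul, abs_of_pos hf] at h3
  have h4 : 1 / s ^ 2 * ∫ x, jointDet S P (m + 1) x * ∑ i, dev x i ^ 2
      ∂(Measure.pi fun _ => leb) ≤ 1 / s ^ 2 * (Δ * ((m + 1).factorial : ℝ)) :=
    mul_le_mul_of_nonneg_left hD (by positivity)
  have h5 : ((m + 1).factorial : ℝ) * |J - R| ≤ ((m + 1).factorial : ℝ) *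
      (2 * s / (2 / (((m + 1 : ℕ) : ℝ) + 1)) + 1 + Δ / s ^ 2) := by
    refine (h3.trans (add_le_add_right h4 _)).trans (le_of_eq ?_)
    ring
  have h6 := le_of_mul_le_mul_left h5 hf
  have e1 : R = (b - a) * ((m : ℝ) + 2) / 2 := by rw [hR]; push_cast; field_simp; ring
  have e2 : 2 * s / (2 / (((m + 1 : ℕ) : ℝ) + 1)) = s * ((m : ℝ) + 2) := by
    push_cast; field_simp; ring
  rw [e1, e2] at h6
  exact h6

end

section

/-! ### Pointwise bounds in the bulk -/

variable {S : Finset ℝ} {P : ℕ → ℝ[X]}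

/-- The number density of the log-gas with `n` particles. -/
def dens (S : Finset ℝ) (P : ℕ → ℝ[X]) (n : ℕ) (t : ℝ) : ℝ := kern P n t t * wt S t

@[fun_prop]
theorem continuous_dens (S : Finset ℝ) (P : ℕ → ℝ[X]) (n : ℕ) : Continuous (dens S P n) :=
  (continuous_kern_diag P n).mul (continuous_wt S)

theorem dens_nonneg (S : Finset ℝ) (P : ℕ → ℝ[X]) (n : ℕ) (t : ℝ) : 0 ≤ dens S P n t := by
  rw [dens, kern_self]
  exact mul_nonneg (Finset.sum_nonneg fun j _ => sq_nonneg _) (wt_nonneg S t)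

theorem contDiff_dens (S : Finset ℝ) (P : ℕ → ℝ[X]) (n : ℕ) : ContDiff ℝ 1 (dens S P n) := by
  have e : dens S P n = fun t => (∑ j ∈ Finset.range n, (P j).eval t ^ 2) * ∏ u ∈ S, (t - u) ^ 2 := by
    ext t; rw [dens, kern_self, wt]
  rw [e]
  refine (ContDiff.sum fun j _ => ?_).mul (contDiff_prod fun u _ => ?_)
  · exact (by simpa [Polynomial.aeval_def, Polynomial.eval₂_eq_eval_map] using
      (P j).contDiff_aeval (𝕜 := ℝ) 1 : ContDiff ℝ 1 fun t => (P j).eval t).pow 2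
  · fun_prop

theorem continuous_pois' {η : ℝ} (hη : 0 < η) (a : ℝ) : Continuous (pois a η) := by
  unfold pois
  refine continuous_const.div (by fun_prop) fun x => ?_
  positivity

theorem pois_le {η : ℝ} (hη : 0 < η) (a x : ℝ) : pois a η x ≤ 1 / η := by
  rw [pois, div_le_div_iff₀ (by positivity) hη]
  nlinarith [sq_nonneg (x - a)]

theorem le_pois {η : ℝ} (hη : 0 < η) {a x : ℝ} (hx : |x - a| ≤ η) : 1 / (2 * η) ≤ pois a η x := by
  rw [pois, div_le_div_iff₀ (by positivity) (by positivity)]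
  have : (x - a) ^ 2 ≤ η ^ 2 := by rw [← sq_abs]; gcongr
  nlinarith

/-- On the window `2 η` times the Poisson kernel is at least one. -/
theorem integral_window_le {f : ℝ → ℝ} (hf : Continuous f) (hf0 : ∀ x, 0 ≤ f x) {a η : ℝ}
    (hη : 0 < η) (h1 : -1 ≤ a - η) (h2 : a + η ≤ 1) :
    ∫ x in (a - η)..(a + η), f x ≤ 2 * η * ∫ x in (-1 : ℝ)..1, f x * pois a η x := by
  have hp := continuous_pois' hη a
  have hnn : ∀ x, 0 ≤ 2 * η * (f x * pois a η x) := fun x =>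
    mul_nonneg (by positivity) (mul_nonneg (hf0 x) (pois_nonneg hη x))
  rw [← intervalIntegral.integral_const_mul]
  calc ∫ x in (a - η)..(a + η), f x ≤ ∫ x in (a - η)..(a + η), 2 * η * (f x * pois a η x) := by
        refine intervalIntegral.integral_mono_on (by linarith) (hf.intervalIntegrable _ _)
          ((continuous_const.mul (hf.mul hp)).intervalIntegrable _ _) fun x hx => ?_
        have h3 := le_pois hη (a := a) (x := x) (abs_le.2 ⟨by linarith [hx.1], by linarith [hx.2]⟩)
        have h4 : 1 ≤ 2 * η * pois a η x := by
          rw [div_le_iff₀ (by positivity)] at h3; linarith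
        nlinarith [hf0 x]
    _ ≤ _ := intervalIntegral.integral_mono_interval h1 (by linarith) h2
        (Filter.Eventually.of_forall hnn)
        ((continuous_const.mul (hf.mul hp)).intervalIntegrable _ _)

/-- The mass of the two highest orthonormal functions in a window with many particles. -/
theorem integral_pairSq_le (hS : IsExt S) (hP : IsOrthonormalPolys (wt S) P) (m : ℕ)
    {a η δ T M : ℝ} (hη : 0 < η) (hδ : 0 < δ) (hdist : ∀ u ∈ S, δ ≤ |a - u|)
    (h1 : -1 ≤ a - η) (h2 : a + η ≤ 1)
    (hT : ∑ u ∈ S, (extMoment S (P m) u + extMoment S (P (m + 1)) u) ≤ T) (hM : 12 ≤ M)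
    (hmass : M ≤ ∫ t in (a - η)..(a + η), dens S P (m + 1) t) :
    ∫ x in (a - η)..(a + η), pairSq S P m x ≤ 32 * η ^ 2 * T / (δ * M) := by
  have hp := continuous_pois' hη a
  have hw := continuous_wt S
  have hk : ∀ n, Continuous fun t => kern P n t t := continuous_kern_diag P
  rw [Finset.sum_add_distrib] at hT
  have e1 : 0 ≤ ∑ u ∈ S, extMoment S (P m) u := Finset.sum_nonneg fun u _ => extMoment_nonneg _ _ _
  have e2 : 0 ≤ ∑ u ∈ S, extMoment S (P (m + 1)) u :=
    Finset.sum_nonneg fun u _ => extMoment_nonneg _ _ _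
  have g1 : M / (2 * η) ≤ ∫ x in (-1 : ℝ)..1, kern P (m + 1) x x * pois a η x * wt S x := by
    have := hmass.trans (integral_window_le (continuous_dens S P (m + 1))
      (dens_nonneg S P (m + 1)) hη h1 h2)
    rw [div_le_iff₀' (by positivity)]
    refine this.trans (le_of_eq ?_)
    congr 1
    exact intervalIntegral.integral_congr fun x _ => by simp only [dens]; ring
  have c1 : ∀ j, Continuous fun x => (P j).eval x ^ 2 * pois a η x * wt S x := fun j =>
    ((((P j).continuous).pow 2).mul hp).mul hw
  have g2 : ∫ x in (-1 : ℝ)..1, (P m).eval x ^ 2 * pois a η x * wt S x ≤ 1 / η := by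
    have h := integral_sq_eq_one hP m
    calc _ ≤ ∫ x in (-1 : ℝ)..1, 1 / η * ((P m).eval x ^ 2 * wt S x) := by
          refine intervalIntegral.integral_mono_on (by norm_num) ((c1 m).intervalIntegrable _ _)
            ((continuous_const.mul ((((P m).continuous).pow 2).mul hw)).intervalIntegrable _ _)
            fun x _ => ?_
          have := mul_le_mul_of_nonneg_right (pois_le hη a x)
            (mul_nonneg (sq_nonneg ((P m).eval x)) (wt_nonneg S x))
          linarith
      _ = 1 / η := by rw [intervalIntegral.integral_const_mul, h, mul_one]
  have g3 : M / (2 * η) - 1 / η ≤ ∫ x in (-1 : ℝ)..1, kern P m x x * pois a η x * wt S x := by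
    have e : ∫ x in (-1 : ℝ)..1, kern P (m + 1) x x * pois a η x * wt S x =
        (∫ x in (-1 : ℝ)..1, kern P m x x * pois a η x * wt S x) +
        ∫ x in (-1 : ℝ)..1, (P m).eval x ^ 2 * pois a η x * wt S x := by
      have c2 : Continuous fun x => kern P m x x * pois a η x * wt S x := ((hk m).mul hp).mul hw
      rw [← intervalIntegral.integral_add
        (c2.intervalIntegrable _ _) ((c1 m).intervalIntegrable _ _)]
      refine intervalIntegral.integral_congr fun x _ => ?_
      simp only [kern_self, Finset.sum_range_succ]; ring
    linarith
  -- The mass hypothesis concerns the first `m + 1` functions, while the bound for `P m` needs the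
  -- first `m`. Removing `P m` costs at most `1 / η`, which `M ≥ 12` absorbs.
  have hA : M / (4 * η) ≤ M / (2 * η) - 1 / η := by
    have : M / (2 * η) - 1 / η - M / (4 * η) = (M - 4) / (4 * η) := by field_simp; ring
    have : 0 ≤ (M - 4) / (4 * η) := div_nonneg (by linarith) (by positivity)
    linarith
  have hA3 : 3 / η ≤ M / (4 * η) := by
    rw [div_le_div_iff₀ hη (by positivity)]; nlinarith
  have hA2 : M / (4 * η) ≤ M / (2 * η) := by
    have : M / (2 * η) - M / (4 * η) = M / (4 * η) := by field_simp; ring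
    have : 0 ≤ M / (4 * η) := by positivity
    linarith
  have b1 := integral_sq_mul_pois_le hS hP m hη hδ hdist (T := T) (by linarith) hA3 (hA.trans g3)
  have b2 := integral_sq_mul_pois_le hS hP (m + 1) hη hδ hdist (T := T) (by linarith) hA3
    (hA2.trans g1)
  refine (integral_window_le (continuous_pairSq S P m) (pairSq_nonneg S P m) hη h1 h2).trans ?_
  have e : ∫ x in (-1 : ℝ)..1, pairSq S P m x * pois a η x =
      (∫ x in (-1 : ℝ)..1, (P m).eval x ^ 2 * pois a η x * wt S x) +
      ∫ x in (-1 : ℝ)..1, (P (m + 1)).eval x ^ 2 * pois a η x * wt S x := by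
    rw [← intervalIntegral.integral_add ((c1 m).intervalIntegrable _ _)
      ((c1 (m + 1)).intervalIntegrable _ _)]
    refine intervalIntegral.integral_congr fun x _ => ?_
    simp only [pairSq]; ring
  rw [e]
  refine (mul_le_mul_of_nonneg_left (add_le_add b1 b2) (by positivity)).trans (le_of_eq ?_)
  field_simp
  ring

/-- A nonnegative function with bounded logarithmic derivative is bounded by its mean. -/
theorem le_integral_of_abs_deriv_le {F : ℝ → ℝ} (hF : Continuous F) (hF0 : ∀ x, 0 ≤ F x)
    {x l L : ℝ} (hL : 0 < L) (hl : 1 / L ≤ l)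
    (hd : ∀ t, |t - x| ≤ l → ∃ D, HasDerivAt F D t ∧ |D| ≤ L * F t) :
    F x ≤ 3 * L * ∫ t in (x - l)..(x + l), F t := by
  have hl0 : 0 < 1 / L := by positivity
  have key : ∀ t ∈ Set.Icc x (x + 1 / L), F x * Real.exp (-1) ≤ F t := by
    intro t ht
    -- By this monotonicity `F` loses at most a factor `e < 3` over the distance `1 / L` to the
    -- right of `x`.
    have hmono : MonotoneOn (fun t => F t * Real.exp (L * t)) (Set.Icc x (x + 1 / L)) := by
      refine monotoneOn_of_deriv_nonneg (convex_Icc _ _)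
        (hF.mul (by fun_prop)).continuousOn ?_ ?_
      · intro s hs
        rw [interior_Icc] at hs
        obtain ⟨D, hD, _⟩ := hd s (abs_le.2 ⟨by linarith [hs.1], by linarith [hs.2]⟩)
        exact (hD.differentiableAt.mul (by fun_prop)).differentiableWithinAt
      · intro s hs
        rw [interior_Icc] at hs
        obtain ⟨D, hD, hb⟩ := hd s (abs_le.2 ⟨by linarith [hs.1], by linarith [hs.2]⟩)
        have h1 : HasDerivAt (fun t => Real.exp (L * t)) (Real.exp (L * s) * L) s := by
          simpa using ((hasDerivAt_id s).const_mul L).exp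
        rw [(hD.fun_mul h1).deriv]
        have := (abs_le.1 hb).1
        have h2 := Real.exp_pos (L * s)
        nlinarith
    have h1 := hmono (Set.left_mem_Icc.2 (by linarith)) ht ht.1
    simp only at h1
    have h2 : L * t ≤ L * x + 1 := by
      have : L * (t - x) ≤ L * (1 / L) := mul_le_mul_of_nonneg_left (by linarith [ht.2]) hL.le
      rw [mul_one_div_cancel hL.ne'] at this
      linarith
    have h3 : F t * Real.exp (L * t) ≤ F t * Real.exp (L * x + 1) :=
      mul_le_mul_of_nonneg_left (Real.exp_le_exp.2 h2) (hF0 t)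
    have h4 := h1.trans h3
    rw [Real.exp_add, ← mul_assoc, mul_right_comm] at h4
    have h5 := le_of_mul_le_mul_right h4 (Real.exp_pos _)
    rw [Real.exp_neg, ← div_eq_mul_inv, div_le_iff₀ (Real.exp_pos _)]
    exact h5
  have h1 : ∫ t in x..(x + 1 / L), F x * Real.exp (-1) ≤ ∫ t in x..(x + 1 / L), F t :=
    intervalIntegral.integral_mono_on (by linarith) (by simp) (hF.intervalIntegrable _ _) key
  have h2 : ∫ t in x..(x + 1 / L), F t ≤ ∫ t in (x - l)..(x + l), F t :=
    intervalIntegral.integral_mono_interval (by linarith) (by linarith) (by linarith)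
      (Filter.Eventually.of_forall hF0) (hF.intervalIntegrable _ _)
  have h3 := h1.trans h2
  rw [intervalIntegral.integral_const, smul_eq_mul, add_sub_cancel_left] at h3
  set J := ∫ t in (x - l)..(x + l), F t
  have h4 : F x = L * Real.exp 1 * (1 / L * (F x * Real.exp (-1))) := by
    rw [Real.exp_neg]
    have := Real.exp_pos 1
    field_simp
  have hJ : 0 ≤ J := intervalIntegral.integral_nonneg (by linarith) fun t _ => hF0 t
  rw [h4]
  refine (mul_le_mul_of_nonneg_left h3 (by positivity)).trans ?_
  have := Real.exp_one_lt_d9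
  have h5 : L * Real.exp 1 ≤ 3 * L := by nlinarith
  exact mul_le_mul_of_nonneg_right h5 hJ

theorem abs_dens_sub_le (hS : IsExt S) (hP : IsOrthonormalPolys (wt S) P) {m : ℕ}
    {T δ a b : ℝ} (hab : a ≤ b) (hb : ∀ t ∈ Set.Icc a b, BulkBound S P m T δ t) :
    |dens S P (m + 1) b - dens S P (m + 1) a| ≤
      T * (1 / δ + 2 / δ ^ 2) * ∫ t in a..b, pairSq S P m t := by
  have hc := contDiff_dens S P (m + 1)
  rw [← intervalIntegral.integral_deriv_eq_sub (fun t _ => hc.differentiable (by norm_num) t)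
    ((hc.continuous_deriv (by norm_num)).intervalIntegrable _ _),
    ← intervalIntegral.integral_const_mul]
  refine (intervalIntegral.abs_integral_le_integral_abs hab).trans
    (intervalIntegral.integral_mono_on hab
    ((hc.continuous_deriv (by norm_num)).abs.intervalIntegrable _ _)
    ((continuous_const.mul (continuous_pairSq S P m)).intervalIntegrable _ _) fun t ht => ?_)
  obtain ⟨D, hD, hle⟩ := exists_hasDerivAt_kern_self hS hP (hb t ht)
  have : deriv (dens S P (m + 1)) t = D := hD.deriv
  rw [this]
  exact hle

/-- The oscillation of the density over the window is at most the integral of its derivative, hence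
a multiple of the mass of the two top functions. -/
theorem abs_dens_sub_mean_le (hS : IsExt S) (hP : IsOrthonormalPolys (wt S) P) {m : ℕ}
    {T δ x η : ℝ} (hη : 0 < η) (hb : ∀ t, |t - x| ≤ η → BulkBound S P m T δ t) :
    |2 * η * dens S P (m + 1) x - ∫ t in (x - η)..(x + η), dens S P (m + 1) t| ≤
      2 * η * (T * (1 / δ + 2 / δ ^ 2) * ∫ t in (x - η)..(x + η), pairSq S P m t) := by
  set V := T * (1 / δ + 2 / δ ^ 2) * ∫ t in (x - η)..(x + η), pairSq S P m t
  have hbx := hb x (by simpa using hη.le)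
  have hc0 : 0 ≤ T * (1 / δ + 2 / δ ^ 2) :=
    mul_nonneg hbx.nonneg (by have := hbx.delta_pos; positivity)
  have hcp := continuous_pairSq S P m
  have hV : ∀ t ∈ Set.Icc (x - η) (x + η), |dens S P (m + 1) x - dens S P (m + 1) t| ≤ V := by
    intro t ht
    rcases le_total t x with h | h
    · refine (abs_dens_sub_le hS hP h fun s hs => hb s (abs_le.2
        ⟨by linarith [hs.1, ht.1], by linarith [hs.2]⟩)).trans (mul_le_mul_of_nonneg_left ?_ hc0)
      exact intervalIntegral.integral_mono_interval ht.1 h (by linarith)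
        (Filter.Eventually.of_forall (pairSq_nonneg S P m)) (hcp.intervalIntegrable _ _)
    · rw [abs_sub_comm]
      refine (abs_dens_sub_le hS hP h fun s hs => hb s (abs_le.2
        ⟨by linarith [hs.1], by linarith [hs.2, ht.2]⟩)).trans (mul_le_mul_of_nonneg_left ?_ hc0)
      exact intervalIntegral.integral_mono_interval (by linarith) h ht.2
        (Filter.Eventually.of_forall (pairSq_nonneg S P m)) (hcp.intervalIntegrable _ _)
  have hd := continuous_dens S P (m + 1)
  have e : 2 * η * dens S P (m + 1) x - ∫ t in (x - η)..(x + η), dens S P (m + 1) t =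
      ∫ t in (x - η)..(x + η), (dens S P (m + 1) x - dens S P (m + 1) t) := by
    rw [intervalIntegral.integral_sub (by simp) (hd.intervalIntegrable _ _),
      intervalIntegral.integral_const, smul_eq_mul]
    ring
  rw [e]
  calc _ ≤ ∫ t in (x - η)..(x + η), |dens S P (m + 1) x - dens S P (m + 1) t| :=
        intervalIntegral.abs_integral_le_integral_abs (by linarith)
    _ ≤ ∫ t in (x - η)..(x + η), V :=
        intervalIntegral.integral_mono_on (by linarith)
          ((continuous_const.sub hd).abs.intervalIntegrable _ _) (by simp) hV
    _ = 2 * η * V := by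
        rw [intervalIntegral.integral_const, smul_eq_mul]; ring

end

section

/-! ### The force exerted by nearly equidistant external points on the lattice -/

/-- The harmonic sum `∑_{k ≤ M} 1 / k`. -/
def harm (M : ℕ) : ℝ := ∑ k ∈ Finset.range M, 1 / ((k : ℝ) + 1)

theorem abs_harm_sub_le {a b m : ℕ} (hm : 0 < m) (ha : m ≤ a) (hb : m ≤ b) :
    |harm a - harm b| ≤ |(a : ℝ) - b| / m := by
  have key : ∀ {a b : ℕ}, m ≤ a → a ≤ b → 0 ≤ harm b - harm a ∧
      harm b - harm a ≤ ((b : ℝ) - a) / m := by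
    intro a b ha hab
    have e : harm b - harm a = ∑ k ∈ Finset.Ico a b, 1 / ((k : ℝ) + 1) := by
      rw [Finset.sum_Ico_eq_sub _ hab]; rfl
    rw [e]
    refine ⟨Finset.sum_nonneg fun k _ => by positivity, ?_⟩
    have : ∑ k ∈ Finset.Ico a b, 1 / ((k : ℝ) + 1) ≤ ∑ k ∈ Finset.Ico a b, 1 / (m : ℝ) := by
      refine Finset.sum_le_sum fun k hk => ?_
      have h1 : (m : ℝ) ≤ k := by exact_mod_cast ha.trans (Finset.mem_Ico.1 hk).1
      have h2 : (0 : ℝ) < m := by exact_mod_cast hm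
      exact one_div_le_one_div_of_le h2 (by linarith)
    refine this.trans (le_of_eq ?_)
    rw [Finset.sum_const, Nat.card_Ico, nsmul_eq_mul, Nat.cast_sub hab]
    ring
  rcases le_total a b with h | h
  · obtain ⟨h1, h2⟩ := key ha h
    have : (a : ℝ) ≤ b := by exact_mod_cast h
    rw [abs_sub_comm, abs_of_nonneg h1, abs_sub_comm, abs_of_nonneg (by linarith)]
    exact h2
  · obtain ⟨h1, h2⟩ := key hb h
    have : (b : ℝ) ≤ a := by exact_mod_cast h
    rw [abs_of_nonneg h1, abs_of_nonneg (by linarith)]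
    exact h2

theorem one_le_harm {M : ℕ} (hM : 0 < M) : 1 ≤ harm M := by
  have : (1 : ℝ) / ((0 : ℕ) + 1) ≤ harm M :=
    Finset.single_le_sum (f := fun k : ℕ => 1 / ((k : ℝ) + 1)) (fun k _ => by positivity)
      (Finset.mem_range.2 hM)
  simpa using this

/-- The distances `v 0, v 1, …, v (M - 1)` of the external points from the nearer edge are close
to multiples of the lattice constant. -/
structure Profile (n M : ℕ) (D : ℝ) (v : ℕ → ℝ) : Prop where
  nonneg : ∀ k < M, 0 ≤ v k
  close : ∀ k < M, |v k - 2 / ((n : ℝ) + 1) * k| ≤ D * (2 / ((n : ℝ) + 1)) *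
    (((k : ℝ) + 1) ^ (3 / 4 : ℝ) + ((k : ℝ) + 1) * (n : ℝ) ^ (-(1 / 4) : ℝ))
  le : ∀ k < M, 2 / ((n : ℝ) + 1) * ((k : ℝ) + 1) ≤ D * (v k + 2 / ((n : ℝ) + 1))

/-- Both denominators are at least of order `h (l + k + 1)`, so each term is at most the position
error over the square of this. Part of the square compensates the powers of `k + 1` in the error and
leaves `l^{-1/4} / (k + 1)`, summing to a harmonic number. -/
theorem Profile.abs_sum_sub_le {n M : ℕ} {D : ℝ} {v : ℕ → ℝ} (hv : Profile n M D v)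
    (hD : 1 ≤ D) {l : ℕ} (hl : 0 < l) (hln : l ≤ n) :
    |∑ k ∈ Finset.range M, 1 / (2 / ((n : ℝ) + 1) * l + v k) -
      ∑ k ∈ Finset.range M, 1 / (2 / ((n : ℝ) + 1) * l + 2 / ((n : ℝ) + 1) * k)| ≤
      4 * D ^ 2 * ((n : ℝ) + 1) * (l : ℝ) ^ (-(1 / 4) : ℝ) * harm M := by
  set h : ℝ := 2 / ((n : ℝ) + 1) with hh
  have hpos : 0 < h := by positivity
  have hl1 : (1 : ℝ) ≤ l := by exact_mod_cast hl
  rw [← Finset.sum_sub_distrib, harm, Finset.mul_sum]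
  refine (Finset.abs_sum_le_sum_abs _ _).trans (Finset.sum_le_sum fun k hk => ?_)
  have hkM := Finset.mem_range.1 hk
  have h0 := hv.nonneg k hkM
  have h1 := hv.close k hkM
  have h2 := hv.le k hkM
  rw [← hh] at h1 h2
  set q : ℝ := (l : ℝ) ^ (-(1 / 4) : ℝ) with hq
  have hq0 : 0 < q := Real.rpow_pos_of_pos (by linarith) _
  set K : ℝ := (k : ℝ) + 1 with hK
  have hK1 : 1 ≤ K := by have : (0 : ℝ) ≤ k := by positivity
                         linarith
  have hnq : (n : ℝ) ^ (-(1 / 4) : ℝ) ≤ q :=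
    Real.rpow_le_rpow_of_nonpos (by linarith) (by exact_mod_cast hln) (by norm_num)
  have p1 : 0 < h * l + v k := by positivity
  have p2 : 0 < h * l + h * k := by positivity
  have b1 : h * (l + K) ≤ 2 * D * (h * l + v k) := by
    have : h * l ≤ D * (h * l) := le_mul_of_one_le_left (by positivity) hD
    have : D * h ≤ D * (h * l) := mul_le_mul_of_nonneg_left
      (le_mul_of_one_le_right hpos.le hl1) (by linarith)
    have : 0 ≤ D * v k := mul_nonneg (by linarith) h0
    nlinarith
  have b2 : h * (l + K) ≤ 2 * (h * l + h * k) := by nlinarith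
  have e : 1 / (h * l + v k) - 1 / (h * l + h * k) =
      (h * k - v k) / ((h * l + v k) * (h * l + h * k)) := by field_simp; ring
  rw [e, abs_div, abs_of_pos (mul_pos p1 p2), abs_sub_comm, div_le_iff₀ (mul_pos p1 p2)]
  refine h1.trans ?_
  have b3 : (h * (l + K)) ^ 2 ≤ 4 * D * ((h * l + v k) * (h * l + h * k)) := by
    calc (h * (l + K)) ^ 2 = (h * (l + K)) * (h * (l + K)) := sq _
      _ ≤ (2 * D * (h * l + v k)) * (2 * (h * l + h * k)) :=
          mul_le_mul b1 b2 (by positivity) (by positivity)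
      _ = _ := by ring
  -- This is `l^{1/4} K^{7/4} ≤ (l + K)²`.
  have b4 : K ^ (3 / 4 : ℝ) ≤ q / K * (l + K) ^ 2 := by
    have e1 : K ^ (3 / 4 : ℝ) = q / K * ((l : ℝ) ^ (1 / 4 : ℝ) * K ^ (7 / 4 : ℝ)) := by
      have f1 : q * (l : ℝ) ^ (1 / 4 : ℝ) = 1 := by
        rw [hq, ← Real.rpow_add (by linarith)]; norm_num
      have f2 : K ^ (7 / 4 : ℝ) = K ^ (3 / 4 : ℝ) * K := by
        nth_rw 3 [← Real.rpow_one K]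
        rw [← Real.rpow_add (by linarith)]; norm_num
      rw [f2]
      field_simp
      linear_combination -f1
    have e2 : ((l : ℝ) + K) ^ 2 = (l + K) ^ (1 / 4 : ℝ) * (l + K) ^ (7 / 4 : ℝ) := by
      rw [← Real.rpow_add (by linarith)]; norm_num
    rw [e1, e2]
    gcongr
    · linarith
    · linarith
  have b5 : K * (n : ℝ) ^ (-(1 / 4) : ℝ) ≤ q / K * (l + K) ^ 2 := by
    calc K * (n : ℝ) ^ (-(1 / 4) : ℝ) ≤ K * q := by gcongr
      _ = q / K * K ^ 2 := by field_simp
      _ ≤ q / K * (l + K) ^ 2 := by gcongr; linarith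
  have e3 : h * ((n : ℝ) + 1) = 2 := by rw [hh]; field_simp
  calc D * h * (K ^ (3 / 4 : ℝ) + K * (n : ℝ) ^ (-(1 / 4) : ℝ))
      ≤ D * h * (2 * (q / K * (l + K) ^ 2)) := by gcongr; linarith
    _ = D * ((n : ℝ) + 1) * (q / K) * (h * (l + K)) ^ 2 := by
        have : ((n : ℝ) + 1) = 2 / h := by rw [hh]; field_simp
        rw [this]; field_simp
    _ ≤ D * ((n : ℝ) + 1) * (q / K) * (4 * D * ((h * l + v k) * (h * l + h * k))) := by gcongr
    _ = _ := by ring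

/-- The sum over the ideal lattice telescopes. -/
theorem lattice_sum {n M : ℕ} (r : Fin n) :
    -(∑ k ∈ Finset.range M, 1 / (((n - (r : ℕ) : ℕ) : ℝ) + k)) +
      ∑ k ∈ Finset.range M, 1 / ((((r : ℕ) + 1 : ℕ) : ℝ) + k) +
      ∑ s : Fin n, 1 / (((r : ℕ) : ℝ) - (s : ℕ)) = harm (r + M) - harm (n - 1 - r + M) := by
  obtain ⟨j, hj⟩ : ∃ j, n = r + 1 + j := ⟨n - (r + 1), by omega⟩
  have e1 : ∑ s : Fin n, 1 / (((r : ℕ) : ℝ) - (s : ℕ)) = harm r - harm j := by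
    rw [Finset.sum_range (fun s => 1 / (((r : ℕ) : ℝ) - (s : ℕ))) |>.symm]
    nth_rw 1 [hj]
    rw [Finset.sum_range_add, Finset.sum_range_succ, sub_self, div_zero, add_zero,
      ← Finset.sum_range_reflect, harm, harm, sub_eq_add_neg, ← Finset.sum_neg_distrib]
    congr 1
    · refine Finset.sum_congr rfl fun k hk => ?_
      have := Finset.mem_range.1 hk
      have e : (((r : ℕ) - 1 - k : ℕ) : ℝ) = (r : ℕ) - 1 - k := by
        rw [Nat.cast_sub (by omega), Nat.cast_sub (by omega)]; simp
      rw [e]; congr 1; ring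
    · refine Finset.sum_congr rfl fun k hk => ?_
      push_cast
      rw [← div_neg]; congr 1; ring
  have e2 : harm (r + M) = harm r + ∑ k ∈ Finset.range M, 1 / ((((r : ℕ) + 1 : ℕ) : ℝ) + k) := by
    rw [harm, Finset.sum_range_add, harm]
    congr 1
    refine Finset.sum_congr rfl fun k _ => ?_
    push_cast; congr 1; ring
  have e3 : harm (n - 1 - r + M) = harm j +
      ∑ k ∈ Finset.range M, 1 / (((n - (r : ℕ) : ℕ) : ℝ) + k) := by
    have : n - 1 - r = j := by omega
    rw [this, harm, Finset.sum_range_add, harm]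
    congr 1
    refine Finset.sum_congr rfl fun k _ => ?_
    have : n - (r : ℕ) = j + 1 := by omega
    rw [this]
    push_cast; congr 1; ring
  rw [e1, e2, e3]; ring

theorem one_sub_lat {n : ℕ} (r : Fin n) :
    1 - lat n (r : ℕ) = 2 / ((n : ℝ) + 1) * ((n - (r : ℕ) : ℕ) : ℝ) := by
  rw [lat, Nat.cast_sub r.isLt.le]; field_simp; ring

theorem lat_add_one {n : ℕ} (r : Fin n) :
    lat n (r : ℕ) + 1 = 2 / ((n : ℝ) + 1) * (((r : ℕ) + 1 : ℕ) : ℝ) := by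
  rw [lat]; push_cast; ring

/-- For external points at the sites that continue the lattice, the force telescopes to a difference
of harmonic numbers, which is small because `M ≥ n²` points are kept on each side. The deviation of
the true points adds errors that decay with the distances of the site from the two edges. -/
theorem abs_latForce_le {S : Finset ℝ} {n M : ℕ} {D : ℝ} {v w : ℕ → ℝ} (hv : Profile n M D v)
    (hw : Profile n M D w) (hD : 1 ≤ D) (hM : n ^ 2 ≤ M)
    (hS : ∀ φ : ℝ → ℝ, ∑ u ∈ S, φ u = ∑ k ∈ Finset.range M, (φ (1 + v k) + φ (-1 - w k)))
    (r : Fin n) :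
    |latForce S n r| ≤ 9 * D ^ 2 * ((n : ℝ) + 1) * harm M *
      (((n - (r : ℕ) : ℕ) : ℝ) ^ (-(1 / 4) : ℝ) + (((r : ℕ) + 1 : ℕ) : ℝ) ^ (-(1 / 4) : ℝ)) := by
  have hn : 0 < n := r.pos
  have hnR : (1 : ℝ) ≤ n := by exact_mod_cast hn
  set h : ℝ := 2 / ((n : ℝ) + 1) with hh
  have hpos : 0 < h := by positivity
  have hrn := r.isLt
  set l : ℕ := n - (r : ℕ) with hl
  set i : ℕ := (r : ℕ) + 1 with hi
  have a1 := hv.abs_sum_sub_le hD (l := l) (by omega) (by omega)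
  have a2 := hw.abs_sum_sub_le hD (l := i) (by omega) (by omega)
  rw [← hh] at a1 a2
  have a3 := lattice_sum (M := M) r
  rw [← hl, ← hi] at a3
  have hMpos : 0 < M := lt_of_lt_of_le (by positivity) hM
  have a4 : |harm (r + M) - harm (n - 1 - r + M)| ≤ (l : ℝ) ^ (-(1 / 4) : ℝ) := by
    refine (abs_harm_sub_le hMpos (by omega) (by omega)).trans ?_
    have hl1 : (1 : ℝ) ≤ l := by exact_mod_cast (by omega : 1 ≤ l)
    have b1 : (n : ℝ) ^ (-(1 / 4) : ℝ) ≤ (l : ℝ) ^ (-(1 / 4) : ℝ) :=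
      Real.rpow_le_rpow_of_nonpos (by linarith) (by exact_mod_cast (by omega : l ≤ n))
        (by norm_num)
    refine le_trans ?_ b1
    have b2 : |(((r : ℕ) + M : ℕ) : ℝ) - ((n - 1 - r + M : ℕ) : ℝ)| ≤ n := by
      rw [abs_le]
      constructor
      · have : (n - 1 - r + M : ℕ) ≤ ((r : ℕ) + M) + n := by omega
        have : ((n - 1 - r + M : ℕ) : ℝ) ≤ (((r : ℕ) + M : ℕ) : ℝ) + n := by exact_mod_cast this
        linarith
      · have : ((r : ℕ) + M) ≤ (n - 1 - r + M : ℕ) + n := by omega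
        have : (((r : ℕ) + M : ℕ) : ℝ) ≤ ((n - 1 - r + M : ℕ) : ℝ) + n := by exact_mod_cast this
        linarith
    have b3 : ((n : ℝ)) ^ 2 ≤ M := by exact_mod_cast hM
    calc _ ≤ (n : ℝ) / (n : ℝ) ^ 2 := by gcongr
      _ = (n : ℝ) ^ (-1 : ℝ) := by rw [Real.rpow_neg_one]; field_simp
      _ ≤ _ := Real.rpow_le_rpow_of_exponent_le hnR (by norm_num)
  have e1 := one_sub_lat r
  have e2 := lat_add_one r
  rw [← hh, ← hl] at e1
  rw [← hh, ← hi] at e2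
  have f1 : ∀ k, 2 / (lat n (r : ℕ) - (1 + v k)) = -2 * (1 / (h * l + v k)) := fun k => by
    rw [← e1, ← neg_sub (1 + v k), div_neg, mul_one_div, neg_div]; congr 2; ring
  have f2 : ∀ k, 2 / (lat n (r : ℕ) - (-1 - w k)) = 2 * (1 / (h * i + w k)) := fun k => by
    rw [← e2, mul_one_div]; congr 1; ring
  have f3 : ∀ x : ℝ, 1 / (h * x) = ((n : ℝ) + 1) / 2 * (1 / x) := fun x => by
    rw [hh, one_div, mul_inv, inv_div, one_div]
  have f4 : ∀ s : Fin n, 2 / (lat n (r : ℕ) - lat n (s : ℕ)) =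
      ((n : ℝ) + 1) * (1 / (((r : ℕ) : ℝ) - (s : ℕ))) := fun s => by
    rw [lat_sub, ← hh, ← mul_one_div, f3]; ring
  simp only [← mul_add, f3, ← Finset.mul_sum] at a1 a2
  set A := ∑ k ∈ Finset.range M, 1 / (h * l + v k)
  set B := ∑ k ∈ Finset.range M, 1 / (h * i + w k)
  set A' := ∑ k ∈ Finset.range M, 1 / ((l : ℝ) + k)
  set B' := ∑ k ∈ Finset.range M, 1 / ((i : ℝ) + k)
  have e : latForce S n r = -2 * (A - ((n : ℝ) + 1) / 2 * A') + 2 * (B - ((n : ℝ) + 1) / 2 * B') +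
      ((n : ℝ) + 1) * (harm (r + M) - harm (n - 1 - r + M)) := by
    rw [← a3, latForce, hS (fun u => 2 / (lat n (r : ℕ) - u)), Finset.sum_add_distrib]
    simp only [f1, f2, f4, ← Finset.mul_sum]
    ring
  have hH := one_le_harm hMpos
  set ql : ℝ := (l : ℝ) ^ (-(1 / 4) : ℝ)
  set qi : ℝ := (i : ℝ) ^ (-(1 / 4) : ℝ)
  have hql : 0 ≤ ql := Real.rpow_nonneg (by positivity) _
  have hqi : 0 ≤ qi := Real.rpow_nonneg (by positivity) _
  rw [e]
  have t1 : |-2 * (A - ((n : ℝ) + 1) / 2 * A') + 2 * (B - ((n : ℝ) + 1) / 2 * B') +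
      ((n : ℝ) + 1) * (harm (r + M) - harm (n - 1 - r + M))| ≤
      2 * |A - ((n : ℝ) + 1) / 2 * A'| + 2 * |B - ((n : ℝ) + 1) / 2 * B'| +
      ((n : ℝ) + 1) * |harm (r + M) - harm (n - 1 - r + M)| := by
    refine (abs_add_three _ _ _).trans (le_of_eq ?_)
    rw [abs_mul, abs_mul, abs_mul, abs_of_pos (by positivity : (0 : ℝ) < (n : ℝ) + 1)]
    norm_num
  have t2 : ((n : ℝ) + 1) * ql ≤ D ^ 2 * ((n : ℝ) + 1) * harm M * ql := by
    have : (1 : ℝ) ≤ D ^ 2 * harm M := one_le_mul_of_one_le_of_one_le (one_le_pow₀ hD) hH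
    have h3 : 0 ≤ ((n : ℝ) + 1) * ql := by positivity
    nlinarith
  have t3 : ((n : ℝ) + 1) * |harm (r + M) - harm (n - 1 - r + M)| ≤ ((n : ℝ) + 1) * ql := by gcongr
  have t4 : 0 ≤ D ^ 2 * ((n : ℝ) + 1) * harm M * qi := by positivity
  nlinarith

theorem sum_rpow_le (n : ℕ) :
    ∑ k ∈ Finset.range n, (((k : ℝ) + 1) ^ (-(1 / 4) : ℝ)) ^ 2 ≤ 2 * √n := by
  induction n with
  | zero => simp
  | succ n ih =>
    rw [Finset.sum_range_succ]
    have h0 : (0 : ℝ) < (n : ℝ) + 1 := by positivity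
    have e : (((n : ℝ) + 1) ^ (-(1 / 4) : ℝ)) ^ 2 = 1 / √((n : ℝ) + 1) := by
      rw [← Real.rpow_natCast, ← Real.rpow_mul h0.le, Real.sqrt_eq_rpow, one_div (_ ^ _),
        ← Real.rpow_neg h0.le]
      congr 1
      norm_num
    rw [e]
    have s1 := Real.sq_sqrt h0.le
    have s2 := Real.sq_sqrt (Nat.cast_nonneg (α := ℝ) n)
    have s3 := Real.sqrt_pos.2 h0
    have s4 := Real.sqrt_nonneg (n : ℝ)
    have : 1 / √((n : ℝ) + 1) ≤ 2 * √((n : ℝ) + 1) - 2 * √n := by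
      rw [div_le_iff₀ s3]
      nlinarith [sq_nonneg (√((n : ℝ) + 1) - √n)]
    push_cast
    linarith

/-- Squaring gives `l^{-1/2}`, whose sum is of order `√n`: the force is concentrated near the edges
and is much smaller in the mean. -/
theorem sum_latForce_sq_le {S : Finset ℝ} {n M : ℕ} {D : ℝ} {v w : ℕ → ℝ} (hv : Profile n M D v)
    (hw : Profile n M D w) (hD : 1 ≤ D) (hM : n ^ 2 ≤ M)
    (hS : ∀ φ : ℝ → ℝ, ∑ u ∈ S, φ u = ∑ k ∈ Finset.range M, (φ (1 + v k) + φ (-1 - w k))) :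
    ∑ r, latForce S n r ^ 2 ≤ 648 * D ^ 4 * ((n : ℝ) + 1) ^ 2 * harm M ^ 2 * √n := by
  set A : ℝ := 9 * D ^ 2 * ((n : ℝ) + 1) * harm M with hA
  have h1 : ∀ r : Fin n, latForce S n r ^ 2 ≤ 2 * A ^ 2 *
      ((((n - (r : ℕ) : ℕ) : ℝ) ^ (-(1 / 4) : ℝ)) ^ 2 +
        ((((r : ℕ) : ℝ) + 1) ^ (-(1 / 4) : ℝ)) ^ 2) := fun r => by
    have h := abs_latForce_le hv hw hD hM hS r
    rw [← hA] at h
    push_cast at h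
    set a := ((n - (r : ℕ) : ℕ) : ℝ) ^ (-(1 / 4) : ℝ)
    set b := (((r : ℕ) : ℝ) + 1) ^ (-(1 / 4) : ℝ)
    have h2 : latForce S n r ^ 2 ≤ (A * (a + b)) ^ 2 := by
      rw [← sq_abs (latForce S n r)]; gcongr
    nlinarith [sq_nonneg (a - b), mul_nonneg (sq_nonneg A) (sq_nonneg (a - b))]
  refine (Finset.sum_le_sum fun r _ => h1 r).trans ?_
  rw [← Finset.mul_sum, Finset.sum_add_distrib]
  have e1 : ∑ r : Fin n, ((((r : ℕ) : ℝ) + 1) ^ (-(1 / 4) : ℝ)) ^ 2 ≤ 2 * √n := by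
    rw [← Finset.sum_range (fun k => (((k : ℝ) + 1) ^ (-(1 / 4) : ℝ)) ^ 2)]
    exact sum_rpow_le n
  have e2 : ∑ r : Fin n, (((n - (r : ℕ) : ℕ) : ℝ) ^ (-(1 / 4) : ℝ)) ^ 2 ≤ 2 * √n := by
    rw [← Finset.sum_range (fun k => (((n - k : ℕ) : ℝ) ^ (-(1 / 4) : ℝ)) ^ 2),
      ← Finset.sum_range_reflect]
    refine (le_of_eq (Finset.sum_congr rfl fun k hk => ?_)).trans (sum_rpow_le n)
    have := Finset.mem_range.1 hk
    have : n - (n - 1 - k) = k + 1 := by omega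
    rw [this]; push_cast; rfl
  have hA0 : 0 ≤ 2 * A ^ 2 := by positivity
  refine (mul_le_mul_of_nonneg_left (add_le_add e2 e1) hA0).trans (le_of_eq ?_)
  rw [hA]; ring

end

section

/-! ### A good ordered configuration with given external points -/

/-- An ordered good global configuration whose external points are given by `y`. -/
structure Config (p : Params) (N L : ℕ) (y : ℤ → ℝ) (lam : Fin N → ℝ) : Prop where
  mono : StrictMono lam
  good : lam ∈ goodGlobal p N
  left : ∀ i : Fin N, (i : ℕ) < L → lam i = y ((i : ℤ) - L)
  right : ∀ i : Fin N, L + p.n N ≤ (i : ℕ) → lam i = y ((i : ℤ) - L - p.n N + 1)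
  pos : 1 ≤ L
  lt : L + p.n N < N
  lower : N * p.kap ^ (3 / 2 : ℝ) ≤ L
  upper : (L : ℝ) ≤ N * (1 - p.kap ^ (3 / 2 : ℝ))
  len_le : len y ≤ p.K * p.n N / N

theorem measurable_glue (N n L : ℕ) (y : ℤ → ℝ) : Measurable (glue N n L y) := by
  refine measurable_pi_iff.2 fun i => ?_
  unfold glue
  split_ifs
  · exact measurable_pi_apply _
  · exact measurable_const
  · exact measurable_const

theorem measurableSet_Xi (N : ℕ) : MeasurableSet (Xi N) := by
  have : Xi N = ⋂ i : Fin N, ⋂ j : Fin N, {lam | i < j → lam i < lam j} := by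
    ext lam
    simp only [Xi, Set.mem_iInter]
    exact ⟨fun h i j hij => h hij, fun h i j hij => h i j hij⟩
  rw [this]
  refine MeasurableSet.iInter fun i => MeasurableSet.iInter fun j => ?_
  by_cases hij : i < j
  · simp only [hij, forall_const]
    exact measurableSet_lt (measurable_pi_apply i) (measurable_pi_apply j)
  · simp [hij]

theorem condEq_notMem_Xi (N n L : ℕ) (y : ℤ → ℝ) :
    condEq N n L y {x | glue N n L y x ∉ Xi N} = 0 := by
  have hm : MeasurableSet {x | glue N n L y x ∉ Xi N} :=
    (measurable_glue N n L y (measurableSet_Xi N)).compl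
  rw [condEq, withDensity_apply _ hm]
  refine (setLIntegral_congr_fun hm fun x hx => ?_).trans lintegral_zero
  have : glue N n L y x ∉ Xi N := hx
  simp [gueDensity, this]

/-- A single good ordered configuration suffices, since it determines the location of the external
points. It exists because the good section has positive conditional probability and the conditional
law charges only ordered points. -/
theorem exists_config {p : Params} {N L : ℕ} {y : ℤ → ℝ} {f : (Fin N → ℝ) → ℝ}
    (hsmall : p.C * Real.exp (-(p.n N : ℝ) ^ (p.gam / 12)) < 1)
    (hL : GoodIndex p N f L) (hy : GoodExternal p N f L y) :
    ∃ lam, Config p N L y lam := by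
  obtain ⟨h1, h2, -, a, b, ha, hb, -⟩ := hL
  obtain ⟨-, hΩ, hlen, -⟩ := hy
  have hpos : 0 < condLaw (p.n N) L f y (goodSection p N L y) :=
    lt_of_lt_of_le (ENNReal.ofReal_pos.2 (by linarith)) hΩ
  obtain ⟨x, hx, hxi⟩ : ∃ x ∈ goodSection p N L y, glue N (p.n N) L y x ∈ Xi N := by
    by_contra! hcon
    refine hpos.ne' (measure_mono_null (t := {x | glue N (p.n N) L y x ∉ Xi N})
      (fun x hx => hcon x hx) ?_)
    exact withDensity_absolutelyContinuous _ _ (condEq_notMem_Xi N (p.n N) L y)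
  refine ⟨glue N (p.n N) L y x, hxi, hx, fun i hi => ?_, fun i hi => ?_, by omega,
    by have := b.isLt; omega, h1, h2, hlen⟩
  · rw [glue, dif_neg (by omega), if_pos hi]
  · rw [glue, dif_neg (by omega), if_neg (by omega)]

variable {p : Params} {N L : ℕ} {y : ℤ → ℝ} {lam : Fin N → ℝ}

theorem count_eq (h : StrictMono lam) {i j : Fin N} (hij : i ≤ j) :
    count lam (lam i) (lam j) = (j : ℕ) + 1 - i := by
  have : (Finset.univ.filter fun k => lam i ≤ lam k ∧ lam k ≤ lam j) = Finset.Icc i j := by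
    ext k; simp [h.le_iff_le]
  rw [count, this, Fin.card_Icc]

theorem Config.y_neg (h : Config p N L y lam) {k : ℕ} (hk : 1 ≤ k) (hkL : k ≤ L) :
    y (-(k : ℤ)) = lam ⟨L - k, by have := h.lt; omega⟩ := by
  rw [h.left _ (by simp only; omega)]
  congr 1
  simp only
  omega

theorem Config.y_pos (h : Config p N L y lam) {k : ℕ} (hk : 1 ≤ k) (hkL : L + p.n N + k ≤ N) :
    y (k : ℤ) = lam ⟨L + p.n N + k - 1, by omega⟩ := by
  rw [h.right _ (by simp only; omega)]
  congr 1
  simp only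
  omega

/-- Both end points are counted besides the `n` internal points. -/
theorem Config.count_mid (h : Config p N L y lam) : count lam (y (-1)) (y 1) = p.n N + 2 := by
  have h1 := h.y_neg (k := 1) le_rfl h.pos
  have h2 := h.y_pos (k := 1) le_rfl (by have := h.lt; omega)
  have := h.pos
  simp only [Nat.cast_one] at h1 h2
  rw [h1, h2, count_eq h.mono (by simp only [Fin.mk_le_mk]; omega)]
  simp only
  omega

theorem Config.len_pos (h : Config p N L y lam) : 0 < len y := by
  have h1 := h.y_neg (k := 1) le_rfl h.pos
  have h2 := h.y_pos (k := 1) le_rfl (by have := h.lt; omega)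
  have := h.pos
  simp only [Nat.cast_one] at h1 h2
  rw [len, h1, h2, sub_pos]
  refine h.mono ?_
  simp only [Fin.mk_lt_mk]
  omega

theorem Config.count_pos (h : Config p N L y lam) {k : ℕ} (hk : 1 ≤ k) (hkL : L + p.n N + k ≤ N) :
    count lam (y 1) (y k) = k ∧ y 1 ≤ y k := by
  have h1 := h.y_pos hk hkL
  have h2 := h.y_pos (k := 1) le_rfl (by omega)
  simp only [Nat.cast_one] at h2
  rw [h1, h2]
  refine ⟨?_, h.mono.monotone (by simp only [Fin.mk_le_mk]; omega)⟩
  rw [count_eq h.mono (by simp only [Fin.mk_le_mk]; omega)]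
  simp only
  omega

theorem Config.count_neg (h : Config p N L y lam) {k : ℕ} (hk : 1 ≤ k) (hkL : k ≤ L) :
    count lam (y (-(k : ℤ))) (y (-1)) = k ∧ y (-(k : ℤ)) ≤ y (-1) := by
  have h1 := h.y_neg hk hkL
  have h2 := h.y_neg (k := 1) le_rfl h.pos
  simp only [Nat.cast_one] at h2
  rw [h1, h2]
  refine ⟨?_, h.mono.monotone (by simp only [Fin.mk_le_mk]; omega)⟩
  rw [count_eq h.mono (by simp only [Fin.mk_le_mk]; omega)]
  simp only
  omega

/-! ### Location of the external points in the bulk of the semicircle -/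

theorem rhoSC_nonneg (x : ℝ) : 0 ≤ rhoSC x := by unfold rhoSC; positivity

theorem continuous_rhoSC : Continuous rhoSC := by unfold rhoSC; fun_prop

theorem rhoSC_le_one (x : ℝ) : rhoSC x ≤ 1 := by
  have h1 : √(4 - x ^ 2) ≤ 2 := Real.sqrt_le_iff.2 ⟨by norm_num, by nlinarith [sq_nonneg x]⟩
  have h2 := Real.pi_gt_three
  unfold rhoSC
  rw [div_mul_eq_mul_div, one_mul, div_le_one (by positivity)]
  linarith

theorem integral_rhoSC : ∫ x in (-2 : ℝ)..2, rhoSC x = 1 := by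
  have h := integral_sqrt_one_sub_sq
  have e : ∀ x : ℝ, rhoSC x = 1 / Real.pi * √(1 - (x / 2) ^ 2) := fun x => by
    have : 4 - x ^ 2 = 2 ^ 2 * (1 - (x / 2) ^ 2) := by ring
    rw [rhoSC, this, Real.sqrt_mul (by norm_num), Real.sqrt_sq (by norm_num)]
    field_simp
  simp_rw [e]
  rw [intervalIntegral.integral_const_mul,
    intervalIntegral.integral_comp_div (fun x => √(1 - x ^ 2)) (by norm_num : (2 : ℝ) ≠ 0)]
  norm_num
  rw [h]
  field_simp

theorem rhoSC_edge_le {s : ℝ} (hs : 0 ≤ s) {x : ℝ} (hx : 2 - s ≤ |x|) :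
    rhoSC x ≤ √s / 3 := by
  have h2 := Real.pi_gt_three
  have h1 : √(4 - x ^ 2) ≤ 2 * √s := by
    rw [Real.sqrt_le_iff]
    refine ⟨by positivity, ?_⟩
    rw [mul_pow, Real.sq_sqrt hs, ← sq_abs x]
    rcases le_total s 2 with h | h
    · nlinarith [abs_nonneg x]
    · nlinarith [sq_nonneg |x|]
  unfold rhoSC
  rw [div_mul_eq_mul_div, one_mul, div_le_div_iff₀ (by positivity) (by norm_num)]
  nlinarith [Real.sqrt_nonneg s]

/-- The number of points in an interval dominates the average of a smoothed count. -/
theorem integral_count_le (lam : Fin N → ℝ) {a b η : ℝ} (hη : 0 ≤ η) (hab : a ≤ b) :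
    ∫ E in a..b, (count lam (E - η / 2) (E + η / 2) : ℝ) ≤
      η * count lam (a - η / 2) (b + η / 2) ∧
    IntervalIntegrable (fun E => (count lam (E - η / 2) (E + η / 2) : ℝ)) volume a b := by
  have e : (fun E => (count lam (E - η / 2) (E + η / 2) : ℝ)) = fun E =>
      ∑ j, (Set.Icc (lam j - η / 2) (lam j + η / 2)).indicator (fun _ => (1 : ℝ)) E := by
    ext E
    rw [count, Finset.card_filter, Nat.cast_sum]
    refine Finset.sum_congr rfl fun j _ => ?_
    by_cases h : E - η / 2 ≤ lam j ∧ lam j ≤ E + η / 2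
    · rw [if_pos h, Set.indicator_of_mem (Set.mem_Icc.2 ⟨by linarith [h.2], by linarith [h.1]⟩)]; simp
    · rw [if_neg h, Set.indicator_of_notMem fun hc =>
        h ⟨by linarith [hc.2], by linarith [hc.1]⟩]; simp
  have hi : ∀ j, IntervalIntegrable (fun E =>
      (Set.Icc (lam j - η / 2) (lam j + η / 2)).indicator (fun _ => (1 : ℝ)) E) volume a b :=
    fun j => by
      rw [intervalIntegrable_iff]
      exact (integrableOn_const (by simp)).indicator measurableSet_Icc
  rw [e]
  refine ⟨?_, by simpa [Finset.sum_fn] using IntervalIntegrable.sum Finset.univ fun j _ => hi j⟩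
  rw [intervalIntegral.integral_finsetSum fun j _ => hi j, count, ← nsmul_eq_mul', ← Finset.sum_const,
    Finset.sum_filter]
  refine Finset.sum_le_sum fun j _ => ?_
  rw [intervalIntegral.integral_of_le hab, setIntegral_indicator measurableSet_Icc,
    setIntegral_const, smul_eq_mul, mul_one]
  split_ifs with h
  · calc _ ≤ volume.real (Set.Icc (lam j - η / 2) (lam j + η / 2)) :=
        measureReal_mono Set.inter_subset_right (by simp)
      _ = η := by rw [Real.volume_real_Icc_of_le (by linarith)]; ring
  · rw [Set.eq_empty_of_forall_notMem (s := Set.Ioc a b ∩ _)]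
    · simp
    · rintro E ⟨hE1, hE2⟩
      exact h ⟨by linarith [hE1.1, hE2.2], by linarith [hE1.2, hE2.1]⟩

end

/-! ### Counting in the bulk of the semicircle -/

section

variable {p : Params} {N L : ℕ} {y : ℤ → ℝ} {lam : Fin N → ℝ}

theorem Params.one_le_n (p : Params) (N : ℕ) : (1 : ℝ) ≤ p.n N := by
  exact_mod_cast Nat.le_add_left 1 _

theorem abs_count_sub_le (hg : lam ∈ goodGlobal p N) (hN : 0 < N) {m : ℕ}
    (hm : (m : ℝ) ≤ Real.log N) {E : ℝ} (hE : |E| ≤ 2 - p.kap / 2) :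
    |(count lam (E - eta p N m / 2) (E + eta p N m / 2) : ℝ) - N * eta p N m * rhoSC E| ≤
      (N * eta p N m) ^ (3 / 4 : ℝ) * (p.n N : ℝ) ^ (p.gam / 12) := by
  have h := hg.1 m hm E hE
  have hn := p.one_le_n N
  have hN' : (0 : ℝ) < N := by exact_mod_cast hN
  have hη : 0 < N * eta p N m := by
    unfold eta
    have : (0 : ℝ) < (p.n N : ℝ) ^ p.gam := Real.rpow_pos_of_pos (by linarith) _
    positivity
  set X := N * eta p N m
  set c : ℝ := (count lam (E - eta p N m / 2) (E + eta p N m / 2) : ℝ)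
  have e : c - X * rhoSC E = X * (c / X - rhoSC E) := by field_simp
  rw [e, abs_mul, abs_of_pos hη]
  refine (mul_le_mul_of_nonneg_left h hη.le).trans (le_of_eq ?_)
  have : X ^ (3 / 4 : ℝ) = X * (1 / X ^ (1 / 4 : ℝ)) := by
    rw [one_div, ← Real.rpow_neg hη.le]
    nth_rw 2 [← Real.rpow_one X]
    rw [← Real.rpow_add hη]; norm_num
  rw [this]; ring

theorem N_mul_eta (p : Params) {N : ℕ} (hN : 0 < N) (m : ℕ) :
    N * eta p N m = 2 ^ m * (p.n N : ℝ) ^ p.gam := by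
  have hN' : (0 : ℝ) < N := by exact_mod_cast hN
  unfold eta; field_simp

/-- Average the local law at the smallest scale over its center. The exponents combine as `3γ/4 +
γ/12 = γ - γ/6`, so the relative error is `n^{-γ/6}`. -/
theorem le_count (hg : lam ∈ goodGlobal p N) (hN : 0 < N) {a b : ℝ} (ha : -(2 - p.kap / 2) ≤ a)
    (hab : a ≤ b) (hb : b ≤ 2 - p.kap / 2) :
    N * ((∫ x in a..b, rhoSC x) - (p.n N : ℝ) ^ (-(p.gam / 6)) * (b - a)) ≤
      count lam (a - eta p N 0 / 2) (b + eta p N 0 / 2) := by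
  have hn := p.one_le_n N
  have hN' : (0 : ℝ) < N := by exact_mod_cast hN
  have hX := N_mul_eta p hN 0
  rw [pow_zero, one_mul] at hX
  have hXp : 0 < N * eta p N 0 := by rw [hX]; exact Real.rpow_pos_of_pos (by linarith) _
  have hη : 0 < eta p N 0 := (pos_iff_pos_of_mul_pos hXp).1 hN'
  obtain ⟨h1, h2⟩ := integral_count_le lam hη.le hab
  have h3 : ∫ E in a..b, (N * eta p N 0 * rhoSC E -
      N * eta p N 0 * (p.n N : ℝ) ^ (-(p.gam / 6))) ≤
      ∫ E in a..b, (count lam (E - eta p N 0 / 2) (E + eta p N 0 / 2) : ℝ) := by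
    refine intervalIntegral.integral_mono_on hab
      (((continuous_rhoSC.const_mul _).sub continuous_const).intervalIntegrable _ _) h2
      fun E hE => ?_
    have h := abs_count_sub_le hg hN (m := 0) (by
      rw [Nat.cast_zero]; exact Real.log_natCast_nonneg N)
      (abs_le.2 ⟨ha.trans hE.1, hE.2.trans hb⟩)
    have e : (N * eta p N 0) ^ (3 / 4 : ℝ) * (p.n N : ℝ) ^ (p.gam / 12) =
        N * eta p N 0 * (p.n N : ℝ) ^ (-(p.gam / 6)) := by
      rw [hX, ← Real.rpow_mul (by linarith), ← Real.rpow_add (by linarith),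
        ← Real.rpow_add (by linarith)]
      congr 1; ring
    rw [e] at h
    have := (abs_le.1 h).1
    linarith
  rw [intervalIntegral.integral_sub ((continuous_rhoSC.const_mul _).intervalIntegrable _ _)
    (by simp), intervalIntegral.integral_const_mul, intervalIntegral.integral_const,
    smul_eq_mul] at h3
  have h4 := h3.trans h1
  refine le_of_mul_le_mul_left (le_trans (le_of_eq ?_) h4) hη
  ring

/-- The density is at most `√k / 3` within distance `k` of an edge, so each of the two layers has
mass at most `k √k / 3`. -/
theorem le_integral_rhoSC {s t k : ℝ} (hs : 0 ≤ s) (ht : 0 ≤ t) (hsk : s ≤ k) (htk : t ≤ k) :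
    1 - 2 / 3 * (k * √k) ≤ ∫ x in (-2 + s)..(2 - t), rhoSC x := by
  have hi : ∀ a b, IntervalIntegrable rhoSC volume a b := continuous_rhoSC.intervalIntegrable
  have e1 := intervalIntegral.integral_add_adjacent_intervals (hi (-2) (-2 + s)) (hi (-2 + s) 2)
  have e2 := intervalIntegral.integral_add_adjacent_intervals (hi (-2 + s) (2 - t)) (hi (2 - t) 2)
  rw [integral_rhoSC] at e1
  have b1 : ∫ x in (-2)..(-2 + s), rhoSC x ≤ k * (√k / 3) := by
    calc _ ≤ ∫ x in (-2)..(-2 + s), √k / 3 := by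
          refine intervalIntegral.integral_mono_on (by linarith) (hi _ _) (by simp) fun x hx => ?_
          refine rhoSC_edge_le (hs.trans hsk) ?_
          have := neg_le_abs x
          linarith [hx.2]
      _ = s * (√k / 3) := by rw [intervalIntegral.integral_const, smul_eq_mul]; ring
      _ ≤ _ := by gcongr
  have b2 : ∫ x in (2 - t)..2, rhoSC x ≤ k * (√k / 3) := by
    calc _ ≤ ∫ x in (2 - t)..2, √k / 3 := by
          refine intervalIntegral.integral_mono_on (by linarith) (hi _ _) (by simp) fun x hx => ?_
          refine rhoSC_edge_le (hs.trans hsk) ?_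
          have := le_abs_self x
          linarith [hx.1]
      _ = t * (√k / 3) := by rw [intervalIntegral.integral_const, smul_eq_mul]; ring
      _ ≤ _ := by gcongr
  linarith

theorem count_le_of_lt (h : StrictMono lam) {i : Fin N} {a b : ℝ} (hi : lam i < a) :
    count lam a b + ((i : ℕ) + 1) ≤ N := by
  have : (Finset.univ.filter fun j => a ≤ lam j ∧ lam j ≤ b) ⊆ Finset.Ioi i := by
    intro j hj
    rw [Finset.mem_Ioi]
    exact h.lt_iff_lt.1 (hi.trans_le (Finset.mem_filter.1 hj).2.1)
  have := Finset.card_le_card this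
  rw [Fin.card_Ioi] at this
  have := i.isLt
  unfold count
  omega

theorem count_le_of_gt (h : StrictMono lam) {i : Fin N} {a b : ℝ} (hi : b < lam i) :
    count lam a b ≤ i := by
  have : (Finset.univ.filter fun j => a ≤ lam j ∧ lam j ≤ b) ⊆ Finset.Iio i := by
    intro j hj
    rw [Finset.mem_Iio]
    exact h.lt_iff_lt.1 ((Finset.mem_filter.1 hj).2.2.trans_lt hi)
  have := Finset.card_le_card this
  rwa [Fin.card_Iio] at this

theorem Config.kap_lt_one (h : Config p N L y lam) : p.kap < 1 := by
  by_contra! hc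
  have h1 : 1 ≤ p.kap ^ (3 / 2 : ℝ) := Real.one_le_rpow hc (by norm_num)
  have h2 := h.upper
  have h3 : (1 : ℝ) ≤ L := by exact_mod_cast h.pos
  have h4 : (0 : ℝ) ≤ N := by positivity
  nlinarith

/-- The interval lies in the bulk. -/
theorem Config.bulk (h : Config p N L y lam) (hk : 0 < p.kap)
    (hsmall : (p.n N : ℝ) / N + 4 * (p.n N : ℝ) ^ (-(p.gam / 6)) < p.kap ^ (3 / 2 : ℝ) / 3)
    (hη : eta p N 0 ≤ p.kap / 4) :
    -2 + 5 / 8 * p.kap ≤ y (-1) ∧ y 1 ≤ 2 - 5 / 8 * p.kap := by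
  have hk1 := h.kap_lt_one
  have hN : 0 < N := by have := h.lt; omega
  have hN' : (0 : ℝ) < N := by exact_mod_cast hN
  have hε : 0 < (p.n N : ℝ) ^ (-(p.gam / 6)) :=
    Real.rpow_pos_of_pos (by linarith [p.one_le_n N]) _
  have e : p.kap * √p.kap = p.kap ^ (3 / 2 : ℝ) := by
    rw [Real.sqrt_eq_rpow]
    nth_rw 1 [← Real.rpow_one p.kap]
    rw [← Real.rpow_add hk]; norm_num
  have hnN : 0 < (p.n N : ℝ) / N := by
    have := p.one_le_n N
    positivity
  set ε := (p.n N : ℝ) ^ (-(p.gam / 6))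
  have y1 := h.y_neg (k := 1) le_rfl h.pos
  have y2 := h.y_pos (k := 1) le_rfl (by have := h.lt; omega)
  simp only [Nat.cast_one] at y1 y2
  constructor
  · by_contra! hc
    -- If the left end were too close to the edge, an interval with semicircle mass at least `1 -
    -- (2/3) κ₀^{3/2}` would miss the `L ≥ N κ₀^{3/2}` points on the left. The other end is
    -- symmetric, with `n / N` as an additional error.
    have h1 := le_count h.good hN (a := -2 + 3 / 4 * p.kap) (b := 2 - p.kap / 2) (by linarith)
      (by linarith) le_rfl
    have h2 := le_integral_rhoSC (s := 3 / 4 * p.kap) (t := p.kap / 2) (k := p.kap)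
      (by linarith) (by linarith) (by linarith) (by linarith)
    rw [e] at h2
    have h3 := count_le_of_lt h.mono (a := -2 + 3 / 4 * p.kap - eta p N 0 / 2)
      (b := 2 - p.kap / 2 + eta p N 0 / 2) (by rw [← y1]; linarith)
    simp only at h3
    have hpos := h.pos
    have h4 : (count lam (-2 + 3 / 4 * p.kap - eta p N 0 / 2)
      (2 - p.kap / 2 + eta p N 0 / 2) : ℝ) + L ≤ N := by
      exact_mod_cast (by omega : count lam (-2 + 3 / 4 * p.kap - eta p N 0 / 2)
        (2 - p.kap / 2 + eta p N 0 / 2) + L ≤ N)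
    have h5 := h.lower
    have h6 : N * (1 - 2 / 3 * p.kap ^ (3 / 2 : ℝ) - 4 * ε) ≤
      count lam (-2 + 3 / 4 * p.kap - eta p N 0 / 2) (2 - p.kap / 2 + eta p N 0 / 2) := by
      refine le_trans (mul_le_mul_of_nonneg_left ?_ hN'.le) h1
      nlinarith
    have h7 : N * (1 - 2 / 3 * p.kap ^ (3 / 2 : ℝ) - 4 * ε) ≤ N * (1 - p.kap ^ (3 / 2 : ℝ)) := by
      linarith
    have := le_of_mul_le_mul_left h7 hN'
    linarith
  · by_contra! hc
    have h1 := le_count h.good hN (a := -2 + p.kap / 2) (b := 2 - 3 / 4 * p.kap) (by linarith)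
      (by linarith) (by linarith)
    have h2 := le_integral_rhoSC (s := p.kap / 2) (t := 3 / 4 * p.kap) (k := p.kap)
      (by linarith) (by linarith) (by linarith) (by linarith)
    rw [e] at h2
    have h3 := count_le_of_gt h.mono (a := -2 + p.kap / 2 - eta p N 0 / 2)
      (b := 2 - 3 / 4 * p.kap + eta p N 0 / 2) (by rw [← y2]; linarith)
    simp only at h3
    have h4 : (count lam (-2 + p.kap / 2 - eta p N 0 / 2)
      (2 - 3 / 4 * p.kap + eta p N 0 / 2) : ℝ) ≤ L + p.n N := by
      exact_mod_cast (by omega : count lam (-2 + p.kap / 2 - eta p N 0 / 2)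
        (2 - 3 / 4 * p.kap + eta p N 0 / 2) ≤ L + p.n N)
    have h5 := h.upper
    have h6 : N * (1 - 2 / 3 * p.kap ^ (3 / 2 : ℝ) - 4 * ε) ≤
      count lam (-2 + p.kap / 2 - eta p N 0 / 2) (2 - 3 / 4 * p.kap + eta p N 0 / 2) := by
      refine le_trans (mul_le_mul_of_nonneg_left ?_ hN'.le) h1
      nlinarith
    have e2 : (p.n N : ℝ) = N * ((p.n N : ℝ) / N) := by field_simp
    have h7 : N * (1 - 2 / 3 * p.kap ^ (3 / 2 : ℝ) - 4 * ε) ≤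
        N * (1 - p.kap ^ (3 / 2 : ℝ) + (p.n N : ℝ) / N) := by
      linarith
    have := le_of_mul_le_mul_left h7 hN'
    linarith

/-! ### Regularity of the semicircle density in the bulk -/

theorem le_rhoSC {k x : ℝ} (hk : 0 < k) (hx : |x| ≤ 2 - k / 2) : √k / 8 ≤ rhoSC x := by
  have hpi := Real.pi_lt_four
  have hpi0 := Real.pi_pos
  have h1 : √k ≤ √(4 - x ^ 2) := by
    refine Real.sqrt_le_sqrt ?_
    rw [← sq_abs]
    nlinarith [abs_nonneg x]
  unfold rhoSC
  rw [div_mul_eq_mul_div, one_mul, div_le_div_iff₀ (by norm_num) (by positivity)]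
  nlinarith [Real.sqrt_nonneg k]

theorem abs_rhoSC_sub_le {k x z : ℝ} (hk : 0 < k) (hx : |x| ≤ 2 - k / 2) (hz : |z| ≤ 2 - k / 2) :
    |rhoSC x - rhoSC z| ≤ 1 / √k * |x - z| := by
  have hpi := Real.pi_gt_three
  have hs : 0 < √k := Real.sqrt_pos.2 hk
  have h1 : ∀ x : ℝ, |x| ≤ 2 - k / 2 → √k ≤ √(4 - x ^ 2) ∧ √(4 - x ^ 2) ^ 2 = 4 - x ^ 2 := by
    intro x hx
    have : k ≤ 4 - x ^ 2 := by rw [← sq_abs]; nlinarith [abs_nonneg x]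
    exact ⟨Real.sqrt_le_sqrt this, Real.sq_sqrt (by linarith)⟩
  obtain ⟨a1, a2⟩ := h1 x hx
  obtain ⟨b1, b2⟩ := h1 z hz
  set A := √(4 - x ^ 2)
  set B := √(4 - z ^ 2)
  have e : rhoSC x - rhoSC z = 1 / (2 * Real.pi) * (A - B) := by
    simp only [rhoSC, A, B]; ring
  have e2 : (A - B) * (A + B) = (z - x) * (x + z) := by nlinarith
  have h2 : |A - B| * (A + B) ≤ |x - z| * 4 := by
    have : |A - B| * (A + B) = |x - z| * |x + z| := by
      rw [← abs_of_pos (by linarith : 0 < A + B), ← abs_mul, e2, abs_mul, abs_sub_comm z x]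
    rw [this]
    gcongr
    exact (abs_add_le x z).trans (by linarith)
  have h3 : |A - B| * (2 * √k) ≤ |x - z| * 4 :=
    (mul_le_mul_of_nonneg_left (by linarith) (abs_nonneg _)).trans h2
  rw [e, abs_mul, abs_of_pos (by positivity), div_mul_eq_mul_div, div_mul_eq_mul_div, one_mul,
    one_mul, div_le_div_iff₀ (by positivity) hs]
  nlinarith [abs_nonneg (A - B), abs_nonneg (x - z)]

end

section

/-! ### Counting points in small intervals -/

variable {p : Params} {N L : ℕ} {y : ℤ → ℝ} {lam : Fin N → ℝ}

theorem count_mono (lam : Fin N → ℝ) {a b a' b' : ℝ} (ha : a' ≤ a) (hb : b ≤ b') :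
    count lam a b ≤ count lam a' b' := by
  refine Finset.card_le_card fun j hj => ?_
  simp only [Finset.mem_filter, Finset.mem_univ, true_and] at hj ⊢
  exact ⟨ha.trans hj.1, hj.2.trans hb⟩

theorem count_split (h : StrictMono lam) {a c b : ℝ} (hac : a ≤ c) (hcb : c ≤ b) :
    count lam a b ≤ count lam a c + count lam c b ∧
      count lam a c + count lam c b ≤ count lam a b + 1 := by
  unfold count
  constructor
  · refine le_trans (Finset.card_le_card fun j hj => ?_) (Finset.card_union_le _ _)
    simp only [Finset.mem_filter, Finset.mem_univ, true_and, Finset.mem_union] at hj ⊢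
    rcases le_total (lam j) c with h1 | h1
    · exact Or.inl ⟨hj.1, h1⟩
    · exact Or.inr ⟨h1, hj.2⟩
  · rw [← Finset.card_union_add_card_inter]
    refine add_le_add (Finset.card_le_card fun j hj => ?_) (Finset.card_le_one.2 fun j hj l hl => ?_)
    · simp only [Finset.mem_filter, Finset.mem_univ, true_and, Finset.mem_union] at hj ⊢
      rcases hj with hj | hj
      · exact ⟨hj.1, hj.2.trans hcb⟩
      · exact ⟨hac.trans hj.1, hj.2⟩
    · simp only [Finset.mem_filter, Finset.mem_univ, true_and, Finset.mem_inter] at hj hl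
      exact h.injective ((le_antisymm hj.1.2 hj.2.1).trans (le_antisymm hl.1.2 hl.2.1).symm)

/-- The hypotheses under which points are counted in the window of radius `w` about `e`. -/
structure Window (p : Params) (N : ℕ) (lam : Fin N → ℝ) (e w R : ℝ) : Prop where
  N_pos : 0 < N
  mono : StrictMono lam
  good : lam ∈ goodGlobal p N
  R_nonneg : 0 ≤ R
  center : |e| ≤ 2 - 5 / 8 * p.kap
  radius : w ≤ p.kap / 8
  lip : 1 / √p.kap * w * (N * (2 * w)) ≤ R
  scales : ∀ m : ℕ, 2 ^ m * (p.n N : ℝ) ^ p.gam ≤ N * (2 * w) → (m : ℝ) ≤ Real.log N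

/-- The local law covers only intervals of dyadic length `η_m`. An interval between `η_m` and
`η_{m+1}` is cut into one of length `η_m` and a rest that is no longer. The errors grow by at least
`3/2` from one scale to the next, so their sum is dominated by the last. -/
theorem Window.abs_count_sub_le_scale {e w R : ℝ} (hW : Window p N lam e w R) (hk : 0 < p.kap)
    (hK : 0 ≤ p.K) (hγ : 0 < p.gam) (m : ℕ) {a b : ℝ} (ha : |a - e| ≤ w) (hb : |b - e| ≤ w)
    (hab : a ≤ b) (hm : b - a ≤ eta p N m) :
    |(count lam a b : ℝ) - N * rhoSC e * (b - a)| ≤ (p.K + 1) * (p.n N : ℝ) ^ p.gam +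
      2 * (2 + R) * ((p.n N : ℝ) ^ (p.gam / 12) * (2 ^ m * (p.n N : ℝ) ^ p.gam) ^ (3 / 4 : ℝ)) := by
  have hn := p.one_le_n N
  have hN' : (0 : ℝ) < N := by exact_mod_cast hW.N_pos
  have hR := hW.R_nonneg
  have hg1 : (1 : ℝ) ≤ (p.n N : ℝ) ^ p.gam := Real.one_le_rpow hn hγ.le
  have hg2 : (1 : ℝ) ≤ (p.n N : ℝ) ^ (p.gam / 12) := Real.one_le_rpow hn (by positivity)
  have hρ0 := rhoSC_nonneg e
  have hρ1 := rhoSC_le_one e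
  set g := (p.n N : ℝ) ^ p.gam
  set g' := (p.n N : ℝ) ^ (p.gam / 12)
  have hη : ∀ m, N * eta p N m = 2 ^ m * g := N_mul_eta p hW.N_pos
  induction m generalizing a b with
  | zero =>
    have h0 := hη 0
    have h1 := hW.good.2.2.1 ((a + b) / 2)
    have h2 : (count lam a b : ℝ) ≤ p.K * g := by
      refine le_trans ?_ (h1.trans (le_of_eq ?_))
      · exact_mod_cast count_mono lam (by linarith) (by linarith)
      · rw [mul_assoc, h0, pow_zero, one_mul]
    have h3 : N * (b - a) ≤ g := by
      have := mul_le_mul_of_nonneg_left hm hN'.le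
      rwa [h0, pow_zero, one_mul] at this
    have h4 : 0 ≤ N * (b - a) := mul_nonneg hN'.le (by linarith)
    have h5 : N * rhoSC e * (b - a) ≤ g := by nlinarith
    have h6 : 0 ≤ N * rhoSC e * (b - a) := by
      have : N * rhoSC e * (b - a) = rhoSC e * (N * (b - a)) := by ring
      rw [this]; positivity
    have h7 : (0 : ℝ) ≤ count lam a b := by positivity
    have h8 : 0 ≤ 2 * (2 + R) * (g' * (2 ^ 0 * g) ^ (3 / 4 : ℝ)) := by positivity
    have h9 : 0 ≤ p.K * g := by positivity
    rw [abs_le]; constructor <;> nlinarith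
  | succ m ih =>
    have hpow : (2 ^ m * g) ^ (3 / 4 : ℝ) ≤ (2 ^ (m + 1) * g) ^ (3 / 4 : ℝ) := by
      refine Real.rpow_le_rpow (by positivity) ?_ (by norm_num)
      rw [pow_succ]; nlinarith [show (0 : ℝ) < 2 ^ m * g by positivity]
    rcases le_or_gt (b - a) (eta p N m) with h | h
    · refine (ih ha hb hab h).trans ?_
      gcongr
    · have hη0 : 0 < eta p N m := by
        have : 0 < N * eta p N m := by rw [hη]; positivity
        exact (pos_iff_pos_of_mul_pos this).1 hN'
      have ha' := abs_le.1 ha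
      have hb' := abs_le.1 hb
      have hmlog : (m : ℝ) ≤ Real.log N := hW.scales m (by
        rw [← hη]; exact mul_le_mul_of_nonneg_left (by linarith) hN'.le)
      set c := a + eta p N m with hc
      have hce : |c - e| ≤ w := abs_le.2 ⟨by linarith, by linarith⟩
      have h2η : eta p N (m + 1) = 2 * eta p N m := by unfold eta; rw [pow_succ]; ring
      have i1 := ih hce hb (by linarith) (by linarith)
      have hctr : |a + eta p N m / 2 - e| ≤ w := abs_le.2 ⟨by linarith, by linarith⟩
      have hrad := hW.radius
      have hcen := abs_le.1 hW.center
      have hctr' := abs_le.1 hctr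
      have hbulk : |a + eta p N m / 2| ≤ 2 - p.kap / 2 := abs_le.2 ⟨by linarith, by linarith⟩
      have i2 := abs_count_sub_le hW.good hW.N_pos hmlog hbulk
      rw [add_sub_cancel_right, add_assoc, add_halves, ← hc, hη] at i2
      have i3 := abs_rhoSC_sub_le hk hbulk (hW.center.trans (by linarith))
      have i4 : |2 ^ m * g * rhoSC (a + eta p N m / 2) - N * rhoSC e * (c - a)| ≤ R := by
        have e1 : 2 ^ m * g * rhoSC (a + eta p N m / 2) - N * rhoSC e * (c - a) =
            N * eta p N m * (rhoSC (a + eta p N m / 2) - rhoSC e) := by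
          rw [hc, ← hη]; ring
        rw [e1, abs_mul, abs_of_nonneg (by positivity)]
        refine le_trans ?_ hW.lip
        rw [mul_comm]
        refine mul_le_mul (i3.trans ?_) (mul_le_mul_of_nonneg_left (by linarith) hN'.le)
          (by positivity) ?_
        · gcongr
        · have : 0 ≤ w := (abs_nonneg _).trans ha
          positivity
      obtain ⟨s1, s2⟩ := count_split hW.mono (a := a) (c := c) (b := b) (by linarith) (by linarith)
      have s1' : (count lam a b : ℝ) ≤ count lam a c + count lam c b := by exact_mod_cast s1
      have s2' : (count lam a c : ℝ) + count lam c b ≤ count lam a b + 1 := by exact_mod_cast s2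
      have hq : 1 ≤ g' * (2 ^ m * g) ^ (3 / 4 : ℝ) :=
        one_le_mul_of_one_le_of_one_le hg2 (Real.one_le_rpow
          (one_le_mul_of_one_le_of_one_le (one_le_pow₀ (by norm_num)) hg1) (by norm_num))
      -- The growth `2^{3/4} ≥ 3/2` closes the induction: the old error and the new one give `3 (2 +
      -- R) Q`, which is at most `2 (2 + R) Q'`.
      have hq2 : 3 / 2 * (g' * (2 ^ m * g) ^ (3 / 4 : ℝ)) ≤
          g' * (2 ^ (m + 1) * g) ^ (3 / 4 : ℝ) := by
        have e1 : (2 ^ (m + 1) * g : ℝ) = 2 * (2 ^ m * g) := by rw [pow_succ]; ring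
        have e2 : (3 / 2 : ℝ) ≤ 2 ^ (3 / 4 : ℝ) := by
          have : (3 / 2 : ℝ) = ((3 / 2) ^ (4 : ℕ)) ^ (1 / 4 : ℝ) := by
            rw [← Real.rpow_natCast, ← Real.rpow_mul (by norm_num)]; norm_num
          have h8 : (2 : ℝ) ^ (3 / 4 : ℝ) = (2 ^ (3 : ℕ)) ^ (1 / 4 : ℝ) := by
            rw [← Real.rpow_natCast, ← Real.rpow_mul (by norm_num)]; norm_num
          rw [this, h8]
          exact Real.rpow_le_rpow (by norm_num) (by norm_num) (by norm_num)
        rw [e1, Real.mul_rpow (x := 2) (y := 2 ^ m * g) (by norm_num) (by positivity),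
          mul_left_comm]
        exact mul_le_mul_of_nonneg_left (mul_le_mul_of_nonneg_right e2 (by positivity))
          (by linarith)
      set Q := g' * (2 ^ m * g) ^ (3 / 4 : ℝ)
      set Q' := g' * (2 ^ (m + 1) * g) ^ (3 / 4 : ℝ)
      have i2' : |(count lam a c : ℝ) - 2 ^ m * g * rhoSC (a + eta p N m / 2)| ≤ Q := by
        refine i2.trans (le_of_eq ?_)
        simp only [Q]; ring
      have j1 := abs_le.1 i1
      have j2 := abs_le.1 i2'
      have j4 := abs_le.1 i4
      have hRQ : R ≤ R * Q := le_mul_of_one_le_right hR hq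
      have hfin : 2 * (2 + R) * Q + Q + R * Q + Q ≤ 2 * (2 + R) * Q' := by
        have := mul_le_mul_of_nonneg_left hq2 (by linarith : 0 ≤ 2 * (2 + R))
        linarith
      have e5 : N * rhoSC e * (b - a) = N * rhoSC e * (b - c) + N * rhoSC e * (c - a) := by ring
      clear_value Q Q'
      rw [abs_le, e5]
      constructor
      · linarith [j1.1, j2.1, j4.1]
      · linarith [j1.2, j2.2, j4.2]

/-- Take the first scale exceeding the length of the interval; unless it is the smallest scale, it
is less than twice that length. -/
theorem Window.abs_count_sub_le {e w R : ℝ} (hW : Window p N lam e w R) (hk : 0 < p.kap)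
    (hK : 0 ≤ p.K) (hγ : 0 < p.gam) {a b : ℝ} (ha : |a - e| ≤ w) (hb : |b - e| ≤ w)
    (hab : a ≤ b) :
    |(count lam a b : ℝ) - rhoSC e * (N * (b - a))| ≤ (p.K + 1 + 4 * (2 + R)) *
      ((p.n N : ℝ) ^ p.gam +
        ((p.n N : ℝ) ^ p.gam) ^ (1 / 12 : ℝ) * (N * (b - a)) ^ (3 / 4 : ℝ)) := by
  have hn := p.one_le_n N
  have hN' : (0 : ℝ) < N := by exact_mod_cast hW.N_pos
  have hR := hW.R_nonneg
  have hg1 : (1 : ℝ) ≤ (p.n N : ℝ) ^ p.gam := Real.one_le_rpow hn hγ.le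
  have key := hW.abs_count_sub_le_scale hk hK hγ
  have eg : (p.n N : ℝ) ^ (p.gam / 12) = ((p.n N : ℝ) ^ p.gam) ^ (1 / 12 : ℝ) := by
    rw [← Real.rpow_mul (by linarith)]; congr 1; ring
  rw [eg] at key
  have hη : ∀ m, N * eta p N m = 2 ^ m * (p.n N : ℝ) ^ p.gam := N_mul_eta p hW.N_pos
  set g := (p.n N : ℝ) ^ p.gam
  have hX : 0 ≤ N * (b - a) := mul_nonneg hN'.le (by linarith)
  have hex : ∃ m : ℕ, b - a ≤ eta p N m := by
    obtain ⟨m, hm⟩ := pow_unbounded_of_one_lt (N * (b - a)) (by norm_num : (1 : ℝ) < 2)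
    refine ⟨m, le_of_mul_le_mul_left ?_ hN'⟩
    rw [hη]
    nlinarith [show (0 : ℝ) < 2 ^ m by positivity]
  classical
  have hm := Nat.find_spec hex
  have hmin := fun k => Nat.find_min hex (m := k)
  set m := Nat.find hex
  have h1 := key m ha hb hab hm
  have e0 : N * rhoSC e * (b - a) = rhoSC e * (N * (b - a)) := by ring
  rw [e0] at h1
  refine h1.trans ?_
  have g12 : 0 < g ^ (1 / 12 : ℝ) := by positivity
  have hlast : 0 ≤ g ^ (1 / 12 : ℝ) * (N * (b - a)) ^ (3 / 4 : ℝ) := by positivity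
  have hmain : g ^ (1 / 12 : ℝ) * (2 ^ m * g) ^ (3 / 4 : ℝ) ≤
      2 * (g + g ^ (1 / 12 : ℝ) * (N * (b - a)) ^ (3 / 4 : ℝ)) := by
    rcases Nat.eq_zero_or_pos m with h0 | h0
    · rw [h0, pow_zero, one_mul, ← Real.rpow_add (by linarith)]
      have : g ^ (1 / 12 + 3 / 4 : ℝ) ≤ g ^ (1 : ℝ) :=
        Real.rpow_le_rpow_of_exponent_le hg1 (by norm_num)
      rw [Real.rpow_one] at this
      linarith
    · have h2 := hmin (m - 1) (by omega)
      rw [not_le] at h2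
      have h3 : 2 ^ m * g ≤ 2 * (N * (b - a)) := by
        have h4 := mul_lt_mul_of_pos_left h2 hN'
        rw [hη] at h4
        have : (2 : ℝ) ^ m = 2 * 2 ^ (m - 1) := by
          rw [← pow_succ']; congr 1; omega
        rw [this]; linarith
      have h5 : (2 ^ m * g) ^ (3 / 4 : ℝ) ≤ 2 * (N * (b - a)) ^ (3 / 4 : ℝ) := by
        refine (Real.rpow_le_rpow (by positivity) h3 (by norm_num)).trans ?_
        rw [Real.mul_rpow (by norm_num) hX]
        have : (2 : ℝ) ^ (3 / 4 : ℝ) ≤ 2 ^ (1 : ℝ) :=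
          Real.rpow_le_rpow_of_exponent_le (by norm_num) (by norm_num)
        rw [Real.rpow_one] at this
        gcongr
      have := mul_le_mul_of_nonneg_left h5 g12.le
      nlinarith
  have h6 := mul_le_mul_of_nonneg_left hmain (by positivity : 0 ≤ 2 * (2 + R))
  have h7 : 0 ≤ (p.K + 1) * (g ^ (1 / 12 : ℝ) * (N * (b - a)) ^ (3 / 4 : ℝ)) := by positivity
  nlinarith

theorem weighted_mean_le {a b : ℝ} (ha : 0 ≤ a) (hb : 0 ≤ b) :
    a ^ (1 / 4 : ℝ) * b ^ (3 / 4 : ℝ) ≤ a + b := by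
  have := Real.geom_mean_le_arith_mean2_weighted (by norm_num : (0 : ℝ) ≤ 1 / 4)
    (by norm_num : (0 : ℝ) ≤ 3 / 4) ha hb (by norm_num)
  linarith

/-- Inverting the counting estimate. -/
theorem exists_count_const {c D : ℝ} (hc : 0 < c) (hD : 1 ≤ D) :
    ∃ D' : ℝ, 1 ≤ D' ∧ ∀ g X k ρ : ℝ, 1 ≤ g → 0 ≤ X → c ≤ ρ → ρ ≤ 1 →
      |k - ρ * X| ≤ D * (g + g ^ (1 / 12 : ℝ) * X ^ (3 / 4 : ℝ)) →
      k ≤ D' * (X + g) ∧ (0 ≤ k → X ≤ D' * (k + g)) ∧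
        (1 ≤ k → |k - ρ * X| ≤ D' * g * k ^ (3 / 4 : ℝ)) := by
  -- With this choice the part `D δ X` of the error is `c X / 2`, which the main term `ρ X ≥ c X`
  -- absorbs.
  set δ := c / (2 * D) with hδ
  have hδ0 : 0 < δ := by positivity
  set D₂ := 2 / c * (1 + D + D / δ ^ 3) with hD2
  have hD20 : 0 < D₂ := by positivity
  refine ⟨1 + 2 * D + D₂ + D * (1 + (1 + 2 * D₂)), by nlinarith, fun g X k ρ hg hX hρ hρ1 h => ?_⟩
  have hg0 : 0 < g := by linarith
  have eg : g ^ (1 / 12 : ℝ) = (g ^ (1 / 3 : ℝ)) ^ (1 / 4 : ℝ) := by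
    rw [← Real.rpow_mul hg0.le]; norm_num
  have hg3 : g ^ (1 / 3 : ℝ) ≤ g := by
    conv_rhs => rw [← Real.rpow_one g]
    exact Real.rpow_le_rpow_of_exponent_le hg (by norm_num)
  have hg30 : 0 < g ^ (1 / 3 : ℝ) := by positivity
  have b1 : g ^ (1 / 12 : ℝ) * X ^ (3 / 4 : ℝ) ≤ g + X := by
    rw [eg]; exact (weighted_mean_le hg30.le hX).trans (by linarith)
  have b2 : g ^ (1 / 12 : ℝ) * X ^ (3 / 4 : ℝ) ≤ g / δ ^ 3 + δ * X := by
    have := weighted_mean_le (a := g ^ (1 / 3 : ℝ) / δ ^ 3) (b := δ * X) (by positivity)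
      (by positivity)
    have e : (g ^ (1 / 3 : ℝ) / δ ^ 3) ^ (1 / 4 : ℝ) * (δ * X) ^ (3 / 4 : ℝ) =
        g ^ (1 / 12 : ℝ) * X ^ (3 / 4 : ℝ) := by
      rw [Real.div_rpow hg30.le (by positivity), ← eg, Real.mul_rpow hδ0.le hX,
        ← Real.rpow_natCast, ← Real.rpow_mul hδ0.le]
      have : ((3 : ℕ) : ℝ) * (1 / 4) = 3 / 4 := by norm_num
      rw [this]
      field_simp
    rw [e] at this
    refine this.trans ?_
    gcongr
  obtain ⟨l1, l2⟩ := abs_le.1 h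
  have hA : k ≤ (1 + D) * X + 2 * D * g := by
    have := mul_le_mul_of_nonneg_left b1 (by linarith : 0 ≤ D)
    nlinarith
  have hB : 0 ≤ k → X ≤ D₂ * (k + g) := fun hk0 => by
    have h1 := mul_le_mul_of_nonneg_left b2 (by linarith : 0 ≤ D)
    have h2 : D * (δ * X) = c / 2 * X := by rw [hδ]; field_simp
    have h3 : D * (g / δ ^ 3) = D / δ ^ 3 * g := by ring
    have h4 : c * X ≤ ρ * X := by gcongr
    have h5 : c / 2 * X ≤ k + (D + D / δ ^ 3) * g := by nlinarith
    have h6 : 0 ≤ (D + D / δ ^ 3) * k := by positivity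
    calc X = 2 / c * (c / 2 * X) := by field_simp
      _ ≤ 2 / c * (k + (D + D / δ ^ 3) * g) := by gcongr
      _ ≤ 2 / c * ((1 + D + D / δ ^ 3) * (k + g)) := by
          gcongr
          linarith
      _ = D₂ * (k + g) := by rw [hD2]; ring
  refine ⟨?_, fun hk0 => (hB hk0).trans ?_, fun hk1 => h.trans ?_⟩
  · nlinarith [mul_pos hD20 hg0, mul_nonneg hD20.le hX]
  · gcongr
    nlinarith
  · have h1 : X ≤ 2 * D₂ * (k * g) := by
      have h4 := hB (by linarith)
      have h5 : k ≤ k * g := le_mul_of_one_le_right (by linarith) hg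
      have h6 : g ≤ k * g := le_mul_of_one_le_left hg0.le hk1
      calc X ≤ D₂ * (k + g) := h4
        _ ≤ D₂ * (k * g + k * g) := by gcongr
        _ = _ := by ring
    have h2 : X ^ (3 / 4 : ℝ) ≤ (1 + 2 * D₂) * (k ^ (3 / 4 : ℝ) * g ^ (3 / 4 : ℝ)) := by
      refine (Real.rpow_le_rpow hX h1 (by norm_num)).trans ?_
      rw [Real.mul_rpow (by positivity) (by positivity), Real.mul_rpow (by linarith) hg0.le]
      have : (2 * D₂) ^ (3 / 4 : ℝ) ≤ 1 + 2 * D₂ := by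
        calc (2 * D₂) ^ (3 / 4 : ℝ) ≤ (1 + 2 * D₂) ^ (3 / 4 : ℝ) :=
              Real.rpow_le_rpow (by positivity) (by linarith) (by norm_num)
          _ ≤ (1 + 2 * D₂) ^ (1 : ℝ) :=
              Real.rpow_le_rpow_of_exponent_le (by linarith) (by norm_num)
          _ = _ := Real.rpow_one _
      gcongr
    have h3 : g ^ (1 / 12 : ℝ) * g ^ (3 / 4 : ℝ) ≤ g := by
      rw [← Real.rpow_add hg0]
      conv_rhs => rw [← Real.rpow_one g]
      exact Real.rpow_le_rpow_of_exponent_le hg (by norm_num)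
    have hk34 : 1 ≤ k ^ (3 / 4 : ℝ) := Real.one_le_rpow hk1 (by norm_num)
    have hD0 : 0 ≤ D := by linarith
    calc D * (g + g ^ (1 / 12 : ℝ) * X ^ (3 / 4 : ℝ))
        ≤ D * (g * k ^ (3 / 4 : ℝ) + g ^ (1 / 12 : ℝ) *
            ((1 + 2 * D₂) * (k ^ (3 / 4 : ℝ) * g ^ (3 / 4 : ℝ)))) := by
          gcongr
          exact le_mul_of_one_le_right hg0.le hk34
      _ = D * (g * k ^ (3 / 4 : ℝ) + (1 + 2 * D₂) * k ^ (3 / 4 : ℝ) *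
            (g ^ (1 / 12 : ℝ) * g ^ (3 / 4 : ℝ))) := by ring
      _ ≤ D * (g * k ^ (3 / 4 : ℝ) + (1 + 2 * D₂) * k ^ (3 / 4 : ℝ) * g) := by gcongr
      _ = D * (1 + (1 + 2 * D₂)) * (g * k ^ (3 / 4 : ℝ)) := by ring
      _ ≤ (1 + 2 * D + D₂ + D * (1 + (1 + 2 * D₂))) * (g * k ^ (3 / 4 : ℝ)) := by
          gcongr
          linarith
      _ = _ := by ring

end

section

/-! ### Rescaled external points are nearly equidistant -/

variable {p : Params} {N L : ℕ} {y : ℤ → ℝ} {lam : Fin N → ℝ}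

/-- The radius of the window containing the external points that are not cut off. -/
def radius (p : Params) (W : ℝ) (N : ℕ) : ℝ := W * (p.n N : ℝ) ^ p.B / N

/-- `N` is so large that the counting estimates are effective. -/
structure Large (p : Params) (W D : ℝ) (N : ℕ) : Prop where
  N_pos : 0 < N
  two_le : 2 ≤ p.n N
  bulk : (p.n N : ℝ) / N + 4 * (p.n N : ℝ) ^ (-(p.gam / 6)) < p.kap ^ (3 / 2 : ℝ) / 3
  eta_le : eta p N 0 ≤ p.kap / 4
  radius_le : radius p W N ≤ p.kap / 8
  lip : 1 / √p.kap * radius p W N * (N * (2 * radius p W N)) ≤ 1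
  scales : ∀ m : ℕ, 2 ^ m * (p.n N : ℝ) ^ p.gam ≤ N * (2 * radius p W N) → (m : ℝ) ≤ Real.log N
  len_le : p.K * p.n N / N ≤ radius p W N
  room : (p.n N : ℝ) ^ p.B + p.n N ≤ N * p.kap ^ (3 / 2 : ℝ)
  theta : (3 * D + 1) * (p.n N : ℝ) ^ p.gam * (p.n N : ℝ) ^ (3 / 4 : ℝ) ≤ (p.n N : ℝ) / 2

theorem Config.window {W D : ℝ} (h : Config p N L y lam) (hN : Large p W D N) (hk : 0 < p.kap) :
    Window p N lam (mid y) (radius p W N) 1 := by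
  obtain ⟨b1, b2⟩ := h.bulk hk hN.bulk hN.eta_le
  have hl := h.len_pos
  unfold len at hl
  refine ⟨hN.N_pos, h.mono, h.good, zero_le_one, ?_, hN.radius_le, hN.lip, hN.scales⟩
  unfold mid
  rw [abs_le]; constructor <;> linarith

/-- The number of external points kept on each side. -/
def numExt (p : Params) (N : ℕ) : ℕ := ⌈(p.n N : ℝ) ^ p.B⌉₊ - 1

/-- The cutoff `|k| < n^B` is strict, so the last admissible index is `⌈n^B⌉ - 1`. -/
theorem lt_numExt_iff {k : ℕ} (hk : 1 ≤ k) : k ≤ numExt p N ↔ (k : ℝ) < (p.n N : ℝ) ^ p.B := by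
  rw [← Nat.lt_ceil, numExt]; omega

theorem Large.room_left {W D : ℝ} (hN : Large p W D N) (h : Config p N L y lam) :
    numExt p N ≤ L := by
  rcases Nat.eq_zero_or_pos (numExt p N) with h0 | h0
  · omega
  have h1 := (lt_numExt_iff (p := p) (N := N) h0).1 le_rfl
  have h2 := hN.room
  have h3 := h.lower
  have : (0 : ℝ) ≤ p.n N := by positivity
  exact_mod_cast (by linarith : (numExt p N : ℝ) ≤ L)

theorem Large.room_right {W D : ℝ} (hN : Large p W D N) (h : Config p N L y lam) :
    L + p.n N + numExt p N ≤ N := by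
  rcases Nat.eq_zero_or_pos (numExt p N) with h0 | h0
  · have := h.lt; omega
  have h1 := (lt_numExt_iff (p := p) (N := N) h0).1 le_rfl
  have h2 := hN.room
  have h3 := h.upper
  have : (L : ℝ) + p.n N + numExt p N ≤ N := by linarith
  exact_mod_cast this

/-- The estimates that follow from counting the points between two points. -/
structure CountBound (D g ρ k X : ℝ) : Prop where
  nonneg : 0 ≤ X
  le : k ≤ D * (X + g)
  ge : X ≤ D * (k + g)
  close : |k - ρ * X| ≤ D * g * k ^ (3 / 4 : ℝ)

theorem exists_countBound (p : Params) (hk : 0 < p.kap) (hK : 0 < p.K) (hγ : 0 < p.gam)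
    (hγ1 : p.gam ≤ 1) (hB : 1 ≤ p.B) :
    ∃ D W : ℝ, 1 ≤ D ∧ 0 < W ∧ ∀ (N L : ℕ) (y : ℤ → ℝ) (lam : Fin N → ℝ), Large p W D N →
      Config p N L y lam →
      CountBound D ((p.n N : ℝ) ^ p.gam) (rhoSC (mid y)) (p.n N + 2) (N * len y) ∧
      (∀ k, 1 ≤ k → k ≤ numExt p N → CountBound D ((p.n N : ℝ) ^ p.gam) (rhoSC (mid y)) k
        (N * (y k - y 1))) ∧
      (∀ k : ℕ, 1 ≤ k → k ≤ numExt p N → CountBound D ((p.n N : ℝ) ^ p.gam) (rhoSC (mid y)) k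
        (N * (y (-1) - y (-(k : ℤ))))) := by
  have hs : 0 < √p.kap := Real.sqrt_pos.2 hk
  obtain ⟨D, hD, key⟩ := exists_count_const (c := √p.kap / 8) (D := p.K + 1 + 4 * (2 + 1))
    (by positivity) (by linarith)
  -- The radius is large enough to contain all points with `|k| < n^B`: otherwise the half-radius
  -- next to the edge would hold at most `n^B` points, whereas its rescaled length `4 D n^B`
  -- requires more.
  refine ⟨D, 8 * D, hD, by linarith, fun N L y lam hN h => ?_⟩
  have hW := h.window hN hk
  have hn := p.one_le_n N
  have hN' : (0 : ℝ) < N := by exact_mod_cast hN.N_pos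
  have hl := h.len_pos
  have hlen := h.len_le.trans hN.len_le
  set r := radius p (8 * D) N with hr
  have hNr : N * r = 8 * D * (p.n N : ℝ) ^ p.B := by rw [hr, radius]; field_simp
  have hg1 : (1 : ℝ) ≤ (p.n N : ℝ) ^ p.gam := Real.one_le_rpow hn hγ.le
  have hgB : (p.n N : ℝ) ^ p.gam ≤ (p.n N : ℝ) ^ p.B :=
    Real.rpow_le_rpow_of_exponent_le hn (hγ1.trans hB)
  have hρc : √p.kap / 8 ≤ rhoSC (mid y) := le_rhoSC hk (hW.center.trans (by linarith))
  have hρ1 := rhoSC_le_one (mid y)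
  set g := (p.n N : ℝ) ^ p.gam
  have e1 : y 1 - mid y = len y / 2 := by unfold len mid; ring
  have e2 : y (-1) - mid y = -(len y / 2) := by unfold len mid; ring
  have w1 : |y 1 - mid y| ≤ r := by rw [e1, abs_of_pos (by linarith)]; linarith
  have w2 : |y (-1) - mid y| ≤ r := by rw [e2, abs_neg, abs_of_pos (by linarith)]; linarith
  have hcount : ∀ {a b : ℝ}, |a - mid y| ≤ r → |b - mid y| ≤ r → a ≤ b →
      (count lam a b : ℝ) ≤ D * (N * (b - a) + g) ∧ N * (b - a) ≤ D * (count lam a b + g) ∧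
      (1 ≤ count lam a b → |count lam a b - rhoSC (mid y) * (N * (b - a))| ≤
        D * g * (count lam a b : ℝ) ^ (3 / 4 : ℝ)) := by
    intro a b ha hb hab
    have h1 := hW.abs_count_sub_le hk hK.le hγ ha hb hab
    obtain ⟨k1, k2, k3⟩ := key g (N * (b - a)) (count lam a b) (rhoSC (mid y)) hg1
      (mul_nonneg hN'.le (by linarith)) hρc hρ1 h1
    exact ⟨k1, k2 (by positivity), fun hc => k3 (by exact_mod_cast hc)⟩
  refine ⟨?_, fun k hk1 hkM => ?_, fun k hk1 hkM => ?_⟩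
  · obtain ⟨k1, k2, k3⟩ := hcount w2 w1 (by unfold len at hl; linarith)
    rw [h.count_mid] at k1 k2 k3
    have ec : ((p.n N + 2 : ℕ) : ℝ) = p.n N + 2 := by rw [Nat.cast_add, Nat.cast_ofNat]
    rw [ec] at k1 k2 k3
    exact ⟨mul_nonneg hN'.le hl.le, k1, k2, k3 (Nat.succ_pos _)⟩
  · obtain ⟨c1, c2⟩ := h.count_pos hk1 (by have := hN.room_right h; omega)
    have hkB := (lt_numExt_iff hk1).1 hkM
    have w3 : |y k - mid y| ≤ r := by
      rw [abs_of_nonneg (by linarith)]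
      by_contra! hc
      have hwin : |y 1 + r / 2 - mid y| ≤ r := by
        rw [abs_of_nonneg (by linarith)]; linarith
      obtain ⟨-, k2, -⟩ := hcount w1 hwin (by linarith)
      have hcnt : count lam (y 1) (y 1 + r / 2) ≤ k := by
        rw [← c1]; exact count_mono lam le_rfl (by linarith)
      have hcnt' : (count lam (y 1) (y 1 + r / 2) : ℝ) ≤ k := by exact_mod_cast hcnt
      have h3 : N * (y 1 + r / 2 - y 1) = 4 * D * (p.n N : ℝ) ^ p.B := by
        linear_combination (1 / 2) * hNr
      rw [h3] at k2
      have h4 : D * (count lam (y 1) (y 1 + r / 2) + g) ≤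
          D * ((p.n N : ℝ) ^ p.B + (p.n N : ℝ) ^ p.B) := by gcongr; linarith
      have h5 : 0 < D * (p.n N : ℝ) ^ p.B := by positivity
      linarith
    obtain ⟨k1, k2, k3⟩ := hcount w1 w3 c2
    rw [c1] at k1 k2 k3
    exact ⟨mul_nonneg hN'.le (by linarith), k1, k2, k3 hk1⟩
  · obtain ⟨c1, c2⟩ := h.count_neg hk1 (hkM.trans (hN.room_left h))
    have hkB := (lt_numExt_iff hk1).1 hkM
    have w3 : |y (-(k : ℤ)) - mid y| ≤ r := by
      rw [abs_of_nonpos (by linarith)]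
      by_contra! hc
      have hwin : |y (-1) - r / 2 - mid y| ≤ r := by
        rw [abs_of_nonpos (by linarith)]; linarith
      obtain ⟨-, k2, -⟩ := hcount hwin w2 (by linarith)
      have hcnt : count lam (y (-1) - r / 2) (y (-1)) ≤ k := by
        rw [← c1]; exact count_mono lam (by linarith) le_rfl
      have hcnt' : (count lam (y (-1) - r / 2) (y (-1)) : ℝ) ≤ k := by exact_mod_cast hcnt
      have h3 : N * (y (-1) - (y (-1) - r / 2)) = 4 * D * (p.n N : ℝ) ^ p.B := by
        linear_combination (1 / 2) * hNr
      rw [h3] at k2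
      have h4 : D * (count lam (y (-1) - r / 2) (y (-1)) + g) ≤
          D * ((p.n N : ℝ) ^ p.B + (p.n N : ℝ) ^ p.B) := by gcongr; linarith
      have h5 : 0 < D * (p.n N : ℝ) ^ p.B := by positivity
      linarith
    obtain ⟨k1, k2, k3⟩ := hcount w3 w2 c2
    rw [c1] at k1 k2 k3
    exact ⟨mul_nonneg hN'.le (by linarith), k1, k2, k3 hk1⟩

/-- The ratio of the expected number of points in the interval to the actual one. -/
def theta (N : ℕ) (y : ℤ → ℝ) : ℝ := rhoSC (mid y) * (N * len y)

/-- The count between the end points is `n + 2`; the difference from `n + 1` is absorbed by the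
extra `1` in the constant. -/
theorem abs_theta_sub_le {D W : ℝ} (hN : Large p W D N) (hγ : 0 < p.gam) (hD : 1 ≤ D)
    (h : CountBound D ((p.n N : ℝ) ^ p.gam) (rhoSC (mid y)) (p.n N + 2) (N * len y)) :
    |theta N y - (p.n N + 1)| ≤
      (3 * D + 1) * (p.n N : ℝ) ^ p.gam * (p.n N : ℝ) ^ (3 / 4 : ℝ) ∧
    ((p.n N : ℝ) + 1) / 2 ≤ theta N y ∧ theta N y ≤ 2 * ((p.n N : ℝ) + 1) := by
  have hn := p.one_le_n N
  have hg1 : (1 : ℝ) ≤ (p.n N : ℝ) ^ p.gam := Real.one_le_rpow hn hγ.le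
  have hn34 : (1 : ℝ) ≤ (p.n N : ℝ) ^ (3 / 4 : ℝ) := Real.one_le_rpow hn (by norm_num)
  have h1 : |theta N y - (p.n N + 1)| ≤
      (3 * D + 1) * (p.n N : ℝ) ^ p.gam * (p.n N : ℝ) ^ (3 / 4 : ℝ) := by
    have hc := h.close
    rw [abs_sub_comm] at hc
    have h2 : ((p.n N : ℝ) + 2) ^ (3 / 4 : ℝ) ≤ 3 * (p.n N : ℝ) ^ (3 / 4 : ℝ) := by
      calc ((p.n N : ℝ) + 2) ^ (3 / 4 : ℝ) ≤ (3 * (p.n N : ℝ)) ^ (3 / 4 : ℝ) :=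
            Real.rpow_le_rpow (by positivity) (by linarith) (by norm_num)
        _ = 3 ^ (3 / 4 : ℝ) * (p.n N : ℝ) ^ (3 / 4 : ℝ) := Real.mul_rpow (by norm_num) (by linarith)
        _ ≤ 3 ^ (1 : ℝ) * (p.n N : ℝ) ^ (3 / 4 : ℝ) := by gcongr <;> norm_num
        _ = _ := by rw [Real.rpow_one]
    have h3 : D * (p.n N : ℝ) ^ p.gam * ((p.n N : ℝ) + 2) ^ (3 / 4 : ℝ) ≤
        D * (p.n N : ℝ) ^ p.gam * (3 * (p.n N : ℝ) ^ (3 / 4 : ℝ)) := by gcongr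
    have h4 : 1 ≤ (p.n N : ℝ) ^ p.gam * (p.n N : ℝ) ^ (3 / 4 : ℝ) :=
      one_le_mul_of_one_le_of_one_le hg1 hn34
    have h5 := abs_le.1 (hc.trans h3)
    rw [theta, abs_le]
    constructor <;> nlinarith [h5.1, h5.2]
  refine ⟨h1, ?_⟩
  have h2 := abs_le.1 (h1.trans hN.theta)
  constructor <;> linarith [h2.1, h2.2]

/-- Three errors separate the rescaled position from the lattice site: the fluctuation of the count,
of relative size `k^{-1/4}`; the error of `θ` against `n + 1`, of relative size `n^{-1/4}`; and a
shift by one site, because counting includes the first point. -/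
theorem profile_step {c ρ θ n g D D₁ X k : ℝ} (hc : 0 < c) (hcρ : c ≤ ρ)
    (hn : 1 ≤ n) (hg : 1 ≤ g) (hD : 1 ≤ D) (hD₁ : 0 ≤ D₁)
    (hθ : |θ - (n + 1)| ≤ D₁ * g * n ^ (3 / 4 : ℝ)) (hθ1 : (n + 1) / 2 ≤ θ)
    (hθ2 : θ ≤ 2 * (n + 1)) (hk : 1 ≤ k) (h : CountBound D g ρ k X) :
    |2 * (ρ * X) / θ - 2 / (n + 1) * (k - 1)| ≤
      ((2 * D + 1 + 2 * D₁ + D * (2 / c + 1)) * g) * (2 / (n + 1)) *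
        (k ^ (3 / 4 : ℝ) + k * n ^ (-(1 / 4) : ℝ)) ∧
    2 / (n + 1) * k ≤ ((2 * D + 1 + 2 * D₁ + D * (2 / c + 1)) * g) *
      (2 * (ρ * X) / θ + 2 / (n + 1)) := by
  have hθ0 : 0 < θ := by linarith
  have hn0 : 0 < n := by linarith
  have hk34 : 1 ≤ k ^ (3 / 4 : ℝ) := Real.one_le_rpow hk (by norm_num)
  have hX := h.nonneg
  set h' : ℝ := 2 / (n + 1) with hh
  have hpos : 0 < h' := by positivity
  have hinv : 2 / θ ≤ 2 * h' := by
    rw [hh, ← mul_div_assoc, div_le_div_iff₀ hθ0 (by positivity)]; linarith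
  have hn14 : n ^ (3 / 4 : ℝ) / (n + 1) ≤ n ^ (-(1 / 4) : ℝ) := by
    rw [div_le_iff₀ (by positivity)]
    calc n ^ (3 / 4 : ℝ) = n ^ (-(1 / 4) : ℝ) * n ^ (1 : ℝ) := by
          rw [← Real.rpow_add hn0]; norm_num
      _ ≤ n ^ (-(1 / 4) : ℝ) * (n + 1) := by rw [Real.rpow_one]; gcongr; linarith
  constructor
  · have t1 : |2 * (ρ * X) / θ - 2 * k / θ| ≤ 2 * h' * (D * g * k ^ (3 / 4 : ℝ)) := by
      have : 2 * (ρ * X) / θ - 2 * k / θ = -(2 / θ * (k - ρ * X)) := by ring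
      rw [this, abs_neg, abs_mul, abs_of_pos (by positivity)]
      exact mul_le_mul hinv h.close (abs_nonneg _) (by positivity)
    have t2 : |2 * k / θ - h' * k| ≤ h' * k * (2 * D₁ * g * n ^ (-(1 / 4) : ℝ)) := by
      have : 2 * k / θ - h' * k = -(h' * k * ((θ - (n + 1)) / θ)) := by
        rw [hh]; field_simp; ring
      rw [this, abs_neg, abs_mul, abs_of_pos (by positivity), abs_div, abs_of_pos hθ0]
      gcongr
      calc |θ - (n + 1)| / θ ≤ (D₁ * g * n ^ (3 / 4 : ℝ)) / ((n + 1) / 2) := by gcongr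
        _ = 2 * D₁ * g * (n ^ (3 / 4 : ℝ) / (n + 1)) := by field_simp
        _ ≤ _ := by gcongr
    have t3 : 2 * (ρ * X) / θ - h' * (k - 1) =
        (2 * (ρ * X) / θ - 2 * k / θ) + (2 * k / θ - h' * k) + h' := by ring
    rw [t3]
    refine (abs_add_three _ _ _).trans ?_
    rw [abs_of_pos hpos]
    have q0 : 0 ≤ n ^ (-(1 / 4) : ℝ) := by positivity
    set q := n ^ (-(1 / 4) : ℝ)
    set Q := k ^ (3 / 4 : ℝ)
    have hc2 : 0 ≤ D * (2 / c + 1) := by positivity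
    have u1 : h' ≤ h' * (g * Q) :=
      le_mul_of_one_le_right hpos.le (one_le_mul_of_one_le_of_one_le hg hk34)
    have u2 : 0 ≤ h' * g * Q := by positivity
    have u3 : 0 ≤ h' * g * (k * q) := by positivity
    have e : ((2 * D + 1 + 2 * D₁ + D * (2 / c + 1)) * g) * h' * (Q + k * q) =
        (2 * D + 1 + 2 * D₁ + D * (2 / c + 1)) * (h' * g * Q) +
        (2 * D + 1 + 2 * D₁ + D * (2 / c + 1)) * (h' * g * (k * q)) := by ring
    rw [e]
    have u4 : (2 * D + 1) * (h' * g * Q) ≤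
        (2 * D + 1 + 2 * D₁ + D * (2 / c + 1)) * (h' * g * Q) := mul_le_mul_of_nonneg_right (by linarith) u2
    have u5 : (2 * D₁) * (h' * g * (k * q)) ≤
        (2 * D + 1 + 2 * D₁ + D * (2 / c + 1)) * (h' * g * (k * q)) :=
      mul_le_mul_of_nonneg_right (by linarith) u3
    have e1 : 2 * h' * (D * g * Q) = 2 * D * (h' * g * Q) := by ring
    have e2 : h' * k * (2 * D₁ * g * q) = 2 * D₁ * (h' * g * (k * q)) := by ring
    linarith
  · have hv : c / 2 * (h' * X) ≤ 2 * (ρ * X) / θ := by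
      rw [le_div_iff₀ hθ0]
      have : h' * θ ≤ 4 := by
        rw [hh, div_mul_eq_mul_div, div_le_iff₀ (by positivity)]; linarith
      calc c / 2 * (h' * X) * θ = c / 2 * X * (h' * θ) := by ring
        _ ≤ c / 2 * X * 4 := by gcongr
        _ = 2 * (c * X) := by ring
        _ ≤ 2 * (ρ * X) := by gcongr
    set v := 2 * (ρ * X) / θ
    have hv0 : 0 ≤ v := le_trans (by positivity) hv
    have h1 : h' * X ≤ 2 / c * v := by
      calc h' * X = 2 / c * (c / 2 * (h' * X)) := by field_simp
        _ ≤ _ := by gcongr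
    calc h' * k ≤ h' * (D * (X + g)) := by gcongr; exact h.le
      _ = D * (h' * X + g * h') := by ring
      _ ≤ D * (2 / c * v + g * h') := by gcongr
      _ ≤ D * ((2 / c + 1) * (g * v) + (2 / c + 1) * (g * h')) := by
          have hc0 : 0 < 2 / c := by positivity
          have a1 : v ≤ g * v := le_mul_of_one_le_left hv0 hg
          have a2 : 2 / c * v ≤ (2 / c + 1) * (g * v) :=
            mul_le_mul (by linarith) a1 hv0 (by positivity)
          have a3 : g * h' ≤ (2 / c + 1) * (g * h') :=
            le_mul_of_one_le_left (by positivity) (by linarith)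
          exact mul_le_mul_of_nonneg_left (add_le_add a2 a3) (by linarith)
      _ = (D * (2 / c + 1)) * g * (v + h') := by ring
      _ ≤ _ := by gcongr; linarith

end

section

/-! ### The set of rescaled external points -/

variable {p : Params} {N L : ℕ} {y : ℤ → ℝ} {lam : Fin N → ℝ}

/-- The rescaled external points close to the interval. -/
def extSet (p : Params) (N L : ℕ) (y : ℤ → ℝ) : Finset ℝ := (nearIdx p N L).image (resc y)

/-- The distance of the `k + 1`-st rescaled external point on the right from the edge. -/
def rightGap (y : ℤ → ℝ) (k : ℕ) : ℝ := resc y ((k + 1 : ℕ) : ℤ) - 1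

/-- The distance of the `k + 1`-st rescaled external point on the left from the edge. -/
def leftGap (y : ℤ → ℝ) (k : ℕ) : ℝ := -1 - resc y (-((k + 1 : ℕ) : ℤ))

theorem resc_one (h : 0 < len y) : resc y 1 = 1 := by
  unfold resc mid; rw [div_eq_one_iff_eq h.ne']; unfold len; ring

theorem resc_neg_one (h : 0 < len y) : resc y (-1) = -1 := by
  unfold resc mid; rw [div_eq_iff h.ne']; unfold len; ring

theorem resc_sub_one (h : 0 < len y) (k : ℤ) : resc y k - 1 = 2 * (y k - y 1) / len y := by
  rw [eq_div_iff h.ne', sub_mul, resc, div_mul_cancel₀ _ h.ne']; unfold mid len; ring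

theorem neg_one_sub_resc (h : 0 < len y) (k : ℤ) :
    -1 - resc y k = 2 * (y (-1) - y k) / len y := by
  rw [eq_div_iff h.ne', sub_mul, resc, div_mul_cancel₀ _ h.ne']; unfold mid len; ring

theorem resc_lt_resc (h : 0 < len y) {j k : ℤ} (hjk : y j < y k) : resc y j < resc y k := by
  unfold resc
  exact div_lt_div_of_pos_right (by linarith) h

theorem mem_JL {n : ℕ} {k : ℤ} : k ∈ JL N n L ↔ k ≠ 0 ∧ -(L : ℤ) ≤ k ∧ k ≤ (N : ℤ) - L - n := by
  simp [JL]

theorem nearIdx_eq (h1 : numExt p N ≤ L) (h2 : L + p.n N + numExt p N ≤ N) :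
    nearIdx p N L = (Finset.range (numExt p N)).image (fun k => ((k + 1 : ℕ) : ℤ)) ∪
      (Finset.range (numExt p N)).image (fun k => -((k + 1 : ℕ) : ℤ)) := by
  ext k
  have habs : |(k : ℝ)| = (k.natAbs : ℝ) := by
    rw [← Int.cast_abs, ← Int.natCast_natAbs, Int.cast_natCast]
  simp only [nearIdx, Finset.mem_filter, mem_JL, Finset.mem_union, Finset.mem_image,
    Finset.mem_range, habs]
  constructor
  · rintro ⟨⟨h0, -, -⟩, hB⟩
    have := (lt_numExt_iff (p := p) (N := N) (k := k.natAbs) (by omega)).2 hB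
    rcases lt_or_gt_of_ne h0 with h | h
    · exact Or.inr ⟨k.natAbs - 1, by omega, by omega⟩
    · exact Or.inl ⟨k.natAbs - 1, by omega, by omega⟩
  · rintro (⟨j, hj, rfl⟩ | ⟨j, hj, rfl⟩)
    · refine ⟨⟨by omega, by omega, by omega⟩, ?_⟩
      exact (lt_numExt_iff (by omega)).1 (by omega)
    · refine ⟨⟨by omega, by omega, by omega⟩, ?_⟩
      exact (lt_numExt_iff (by omega)).1 (by omega)

theorem resc_injOn (hl : 0 < len y) (hy : StrictMonoOn y (JL N (p.n N) L)) :
    Set.InjOn (resc y) (nearIdx p N L) := by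
  intro a ha b hb hab
  have ha' : a ∈ (JL N (p.n N) L : Set ℤ) := (Finset.mem_filter.1 ha).1
  have hb' : b ∈ (JL N (p.n N) L : Set ℤ) := (Finset.mem_filter.1 hb).1
  rcases lt_trichotomy a b with h | h | h
  · exact absurd hab (resc_lt_resc hl (hy ha' hb' h)).ne
  · exact h
  · exact absurd hab (resc_lt_resc hl (hy hb' ha' h)).ne'

theorem sum_extSet (hl : 0 < len y) (hy : StrictMonoOn y (JL N (p.n N) L)) (φ : ℝ → ℝ) :
    ∑ u ∈ extSet p N L y, φ u = ∑ k ∈ nearIdx p N L, φ (resc y k) :=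
  Finset.sum_image fun _ ha _ hb hab => resc_injOn hl hy ha hb hab

theorem sum_extSet_eq (hl : 0 < len y) (hy : StrictMonoOn y (JL N (p.n N) L))
    (h1 : numExt p N ≤ L) (h2 : L + p.n N + numExt p N ≤ N) (φ : ℝ → ℝ) :
    ∑ u ∈ extSet p N L y, φ u =
      ∑ k ∈ Finset.range (numExt p N), (φ (1 + rightGap y k) + φ (-1 - leftGap y k)) := by
  rw [sum_extSet hl hy, nearIdx_eq h1 h2, Finset.sum_union, Finset.sum_image, Finset.sum_image,
    Finset.sum_add_distrib]
  · congr 1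
    · refine Finset.sum_congr rfl fun k _ => ?_
      rw [rightGap]; congr 1; ring
    · refine Finset.sum_congr rfl fun k _ => ?_
      rw [leftGap]; congr 1; ring
  · intro a _ b _ hab; simpa using hab
  · intro a _ b _ hab; simpa using hab
  · rw [Finset.disjoint_left]
    intro a ha hb
    simp only [Finset.mem_image] at ha hb
    obtain ⟨j, -, rfl⟩ := ha
    obtain ⟨i, -, hi⟩ := hb
    omega

theorem isExt_extSet (hl : 0 < len y) (hy : StrictMonoOn y (JL N (p.n N) L))
    (h0 : 1 ≤ numExt p N) (h1 : numExt p N ≤ L) (h2 : L + p.n N + numExt p N ≤ N) :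
    IsExt (extSet p N L y) := by
  have m1 : (1 : ℤ) ∈ nearIdx p N L := by
    rw [nearIdx_eq h1 h2]
    exact Finset.mem_union_left _ (Finset.mem_image.2 ⟨0, Finset.mem_range.2 h0, by simp⟩)
  have m2 : (-1 : ℤ) ∈ nearIdx p N L := by
    rw [nearIdx_eq h1 h2]
    exact Finset.mem_union_right _ (Finset.mem_image.2 ⟨0, Finset.mem_range.2 h0, by simp⟩)
  refine ⟨Finset.mem_image.2 ⟨1, m1, resc_one hl⟩, Finset.mem_image.2 ⟨-1, m2, resc_neg_one hl⟩,
    fun u hu => ?_⟩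
  obtain ⟨k, hk, rfl⟩ := Finset.mem_image.1 hu
  have hJ : ∀ {k}, k ∈ nearIdx p N L → k ∈ (JL N (p.n N) L : Set ℤ) := fun h =>
    (Finset.mem_filter.1 h).1
  have hk0 := (mem_JL.1 (Finset.mem_coe.1 (hJ hk))).1
  rcases lt_or_gt_of_ne hk0 with h | h
  · have : y k ≤ y (-1) := hy.monotoneOn (hJ hk) (hJ m2) (by omega)
    have h3 := neg_one_sub_resc hl k
    have h4 : 0 ≤ 2 * (y (-1) - y k) / len y := div_nonneg (by linarith) hl.le
    rw [abs_of_nonpos (by linarith)]; linarith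
  · have : y 1 ≤ y k := hy.monotoneOn (hJ m1) (hJ hk) (by omega)
    have h3 := resc_sub_one hl k
    have h4 : 0 ≤ 2 * (y k - y 1) / len y := div_nonneg (by linarith) hl.le
    exact (by linarith : 1 ≤ resc y k).trans (le_abs_self _)

/-- At a point of the set itself `log 0 = 0` would replace a vanishing factor by one, so those
points are excluded. -/
theorem exp_potU (hl : 0 < len y) (hy : StrictMonoOn y (JL N (p.n N) L)) {t : ℝ}
    (ht : t ∉ extSet p N L y) : wgt p N L y t = wt (extSet p N L y) t := by
  have hn : (p.n N : ℝ) ≠ 0 := by have := p.one_le_n N; linarith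
  have e : -(p.n N : ℝ) * potU p N L y t = ∑ k ∈ nearIdx p N L, 2 * Real.log |t - resc y k| := by
    rw [potU, ← Finset.mul_sum]; field_simp
  rw [wgt, e, Real.exp_sum, wt, extSet, Finset.prod_image fun _ ha _ hb hab =>
    resc_injOn hl hy ha hb hab]
  refine Finset.prod_congr rfl fun k hk => ?_
  have hne : t - resc y k ≠ 0 := fun h =>
    ht (Finset.mem_image.2 ⟨k, hk, by linarith⟩)
  rw [two_mul, Real.exp_add, Real.exp_log (abs_pos.2 hne), abs_mul_abs_self, sq]

/-- For a point outside the interval `|u| - 1` is the distance to the nearer of `±1`, so one of the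
two terms of the hypothesis suffices. -/
theorem sum_inv_extSet_le (hl : 0 < len y) (hy : StrictMonoOn y (JL N (p.n N) L))
    (hb : ExternalBound p N L y) :
    ∑ u ∈ (extSet p N L y).filter (fun u => 1 < |u|), 1 / (|u| - 1) ≤
      p.C * (p.n N : ℝ) ^ (1 + 3 * p.gam) := by
  refine le_trans ?_ hb
  rw [Finset.sum_filter, sum_extSet hl hy, ← Finset.sum_filter]
  refine (Finset.sum_le_sum fun k hk => ?_).trans (Finset.sum_le_sum_of_subset_of_nonneg
    (fun k hk => ?_) fun k _ _ => by positivity)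
  · have h1 := (Finset.mem_filter.1 hk).2
    rw [resc_one hl, resc_neg_one hl]
    rcases le_total 0 (resc y k) with h | h
    · rw [abs_of_nonneg h] at h1 ⊢
      rw [abs_of_pos (by linarith : 0 < resc y k - 1)]
      have : 0 ≤ 1 / |resc y k - -1| := by positivity
      linarith
    · rw [abs_of_nonpos h] at h1 ⊢
      have e : |resc y k - -1| = -resc y k - 1 := by rw [abs_of_neg (by linarith)]; ring
      rw [e]
      have : 0 ≤ 1 / |resc y k - 1| := by positivity
      linarith
  · have h1 := (Finset.mem_filter.1 hk).2
    have hk' := (Finset.mem_filter.1 hk).1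
    refine Finset.mem_filter.2 ⟨hk', ?_⟩
    have hk0 := (mem_JL.1 (Finset.mem_filter.1 hk').1).1
    by_contra! hc
    have : k = 1 ∨ k = -1 := by
      rw [abs_le] at hc; omega
    rcases this with rfl | rfl
    · rw [resc_one hl, abs_one] at h1; exact lt_irrefl _ h1
    · rw [resc_neg_one hl, abs_neg, abs_one] at h1; exact lt_irrefl _ h1

/-! ### Consequences of the counting estimates -/

theorem rightGap_eq (hl : 0 < len y) (hN : 0 < N) {ρ : ℝ} (hρ : 0 < ρ) (k : ℕ) :
    rightGap y k = 2 * (ρ * (N * (y ((k + 1 : ℕ) : ℤ) - y 1))) / (ρ * (N * len y)) := by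
  have hN' : (0 : ℝ) < N := by exact_mod_cast hN
  rw [rightGap, resc_sub_one hl]; field_simp

theorem leftGap_eq (hl : 0 < len y) (hN : 0 < N) {ρ : ℝ} (hρ : 0 < ρ) (k : ℕ) :
    leftGap y k = 2 * (ρ * (N * (y (-1) - y (-((k + 1 : ℕ) : ℤ))))) / (ρ * (N * len y)) := by
  have hN' : (0 : ℝ) < N := by exact_mod_cast hN
  rw [leftGap, neg_one_sub_resc hl]; field_simp

theorem profile_of_countBound {c ρ θ g D D₁ : ℝ} {n M : ℕ} {v X : ℕ → ℝ} (hc : 0 < c)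
    (hcρ : c ≤ ρ) (hn : 1 ≤ (n : ℝ)) (hg : 1 ≤ g) (hD : 1 ≤ D) (hD₁ : 0 ≤ D₁)
    (hθ : |θ - (n + 1)| ≤ D₁ * g * (n : ℝ) ^ (3 / 4 : ℝ)) (hθ1 : ((n : ℝ) + 1) / 2 ≤ θ)
    (hθ2 : θ ≤ 2 * (n + 1)) (hX : ∀ k < M, CountBound D g ρ (k + 1) (X k))
    (hv : ∀ k, v k = 2 * (ρ * X k) / θ) :
    Profile n M ((2 * D + 1 + 2 * D₁ + D * (2 / c + 1)) * g) v := by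
  have h := fun k (hk : k < M) => profile_step (k := (k : ℝ) + 1) hc hcρ hn hg hD hD₁ hθ hθ1 hθ2
    (by have : (0 : ℝ) ≤ k := by positivity
        linarith) (hX k hk)
  refine ⟨fun k hk => ?_, fun k hk => ?_, fun k hk => ?_⟩
  · rw [hv]
    have := (hX k hk).nonneg
    have : 0 < θ := by linarith
    have : 0 < ρ := by linarith
    positivity
  · have := (h k hk).1
    rw [add_sub_cancel_right] at this
    rw [hv]; exact this
  · rw [hv]; exact (h k hk).2

theorem gap_le {ρ θ g D X : ℝ} {n k : ℕ} (hρ : ρ ≤ 1) (hn : 1 ≤ (n : ℝ))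
    (hgn : g ≤ n) (hD : 1 ≤ D) (hθ1 : ((n : ℝ) + 1) / 2 ≤ θ) (hk : (k : ℝ) + 1 ≤ n)
    (hX : CountBound D g ρ (k + 1) X) : 2 * (ρ * X) / θ ≤ 8 * D := by
  have hθ : 0 < θ := by linarith
  have h0 := hX.nonneg
  rw [div_le_iff₀ hθ]
  have h1 : X ≤ D * (n + n) := hX.ge.trans (by gcongr)
  have h2 : ρ * X ≤ X := mul_le_of_le_one_left h0 hρ
  nlinarith

/-- The first `n` points on the right lie within a bounded distance, and each contributes a fixed
amount to the convexity. -/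
theorem le_convexity {S : Finset ℝ} {n M : ℕ} {D : ℝ} {v w : ℕ → ℝ} (hD : 1 ≤ D) (hnM : n ≤ M)
    (hS : ∀ φ : ℝ → ℝ, ∑ u ∈ S, φ u = ∑ k ∈ Finset.range M, (φ (1 + v k) + φ (-1 - w k)))
    (hv0 : ∀ k < n, 0 ≤ v k) (hv : ∀ k < n, v k ≤ 8 * D) :
    (n : ℝ) * (2 / (10 * D) ^ 2) ≤ convexity S := by
  rw [convexity, hS fun u => 2 / (1 + |u|) ^ 2]
  calc (n : ℝ) * (2 / (10 * D) ^ 2) = ∑ k ∈ Finset.range n, 2 / (10 * D) ^ 2 := by simp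
    _ ≤ ∑ k ∈ Finset.range n, (2 / (1 + |1 + v k|) ^ 2 + 2 / (1 + |-1 - w k|) ^ 2) := by
        refine Finset.sum_le_sum fun k hk => ?_
        have hk' := Finset.mem_range.1 hk
        have h0 := hv0 k hk'
        have h1 := hv k hk'
        have h2 : 2 / (10 * D) ^ 2 ≤ 2 / (1 + |1 + v k|) ^ 2 := by
          rw [abs_of_pos (by linarith)]
          gcongr
          linarith
        have h3 : 0 ≤ 2 / (1 + |-1 - w k|) ^ 2 := by positivity
        linarith
    _ ≤ _ := Finset.sum_le_sum_of_subset_of_nonneg (Finset.range_mono hnM)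
        fun k _ _ => by positivity

end

section

/-! ### Rigidity at the scale `n ^ (-1 / 8)` -/

variable {p : Params} {N L : ℕ} {y : ℤ → ℝ} {lam : Fin N → ℝ}

theorem harm_le_one_add_log (M : ℕ) : harm M ≤ 1 + Real.log M := by
  refine le_trans (le_of_eq ?_) (harmonic_le_one_add_log M)
  rw [harm, harmonic]
  push_cast
  exact Finset.sum_congr rfl fun k _ => by rw [one_div]

/-- What is needed of the external points of good configurations. -/
structure ExtBound (p : Params) (E : ℝ) (N : ℕ) (S : Finset ℝ) : Prop where
  isExt : IsExt S
  convexity_ge : (p.n N : ℝ) / E ≤ convexity S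
  force : ∑ r, latForce S (p.n N) r ^ 2 ≤
    E * ((p.n N : ℝ) ^ p.gam) ^ 4 * (p.n N : ℝ) ^ 2 * harm (numExt p N) ^ 2 * √(p.n N)

theorem exists_extBound (p : Params) (hk : 0 < p.kap) (hK : 0 < p.K) (hγ : 0 < p.gam)
    (hγ1 : p.gam ≤ 1) (hB : 20 ≤ p.B) :
    ∃ D W E : ℝ, 1 ≤ D ∧ 0 < W ∧ 0 < E ∧ ∀ (N L : ℕ) (y : ℤ → ℝ) (lam : Fin N → ℝ),
      Large p W D N → Config p N L y lam → StrictMonoOn y (JL N (p.n N) L) →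
      ExtBound p E N (extSet p N L y) ∧
      |theta N y - (p.n N + 1)| ≤ E * (p.n N : ℝ) ^ p.gam * (p.n N : ℝ) ^ (3 / 4 : ℝ) ∧
      ((p.n N : ℝ) + 1) / 2 ≤ theta N y := by
  obtain ⟨D, W, hD, hW, key⟩ := exists_countBound p hk hK hγ hγ1 (by linarith)
  set c : ℝ := √p.kap / 8 with hc
  have hc0 : 0 < c := by have := Real.sqrt_pos.2 hk; positivity
  set D₁ : ℝ := 3 * D + 1 with hD₁
  set Q : ℝ := 2 * D + 1 + 2 * D₁ + D * (2 / c + 1) with hQ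
  have hQ1 : 1 ≤ Q := by
    have : 0 < D * (2 / c + 1) := by positivity
    linarith
  -- The summands serve the force (`648 · 4`), the convexity (`(10 D)² / 2`) and the error of
  -- `theta`.
  refine ⟨D, W, 2592 * Q ^ 4 + 50 * D ^ 2 + D₁, hD, hW, by positivity,
    fun N L y lam hN h hy => ?_⟩
  obtain ⟨k0, k1, k2⟩ := key N L y lam hN h
  have hn := p.one_le_n N
  have hg1 : (1 : ℝ) ≤ (p.n N : ℝ) ^ p.gam := Real.one_le_rpow hn hγ.le
  have hgn : (p.n N : ℝ) ^ p.gam ≤ p.n N := by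
    conv_rhs => rw [← Real.rpow_one (p.n N : ℝ)]
    exact Real.rpow_le_rpow_of_exponent_le hn hγ1
  have hcen := (h.window hN hk).center
  have hρc : c ≤ rhoSC (mid y) := le_rhoSC hk (hcen.trans (by linarith))
  have hρ1 := rhoSC_le_one (mid y)
  have hl := h.len_pos
  obtain ⟨t1, t2, t3⟩ := abs_theta_sub_le hN hγ hD k0
  rw [← hD₁] at t1
  have r1 := hN.room_left h
  have r2 := hN.room_right h
  have h2 : 2 ≤ p.n N := hN.two_le
  -- The cutoff exponent exceeds `2`, so truncating the external points is harmless for the lattice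
  -- force.
  have hM : p.n N ^ 2 ≤ numExt p N := by
    rw [lt_numExt_iff (Nat.one_le_pow _ _ (by omega))]
    have : (1 : ℝ) < p.n N := by exact_mod_cast h2
    calc ((p.n N ^ 2 : ℕ) : ℝ) = (p.n N : ℝ) ^ (2 : ℝ) := by
          rw [Nat.cast_pow]; norm_cast
      _ < (p.n N : ℝ) ^ p.B := Real.rpow_lt_rpow_of_exponent_lt this (by linarith)
  have hnM : p.n N ≤ numExt p N := le_trans (Nat.le_self_pow (by norm_num) _) hM
  have hD₁0 : 0 ≤ D₁ := by positivity
  have hρ0 : 0 < rhoSC (mid y) := hc0.trans_le hρc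
  have cR : ∀ k < numExt p N, CountBound D ((p.n N : ℝ) ^ p.gam) (rhoSC (mid y)) ((k : ℝ) + 1)
      (N * (y ((k + 1 : ℕ) : ℤ) - y 1)) := fun k hk' => by
    have := k1 (k + 1) (by omega) (by omega)
    rwa [Nat.cast_add_one (R := ℝ) k] at this
  have cL : ∀ k < numExt p N, CountBound D ((p.n N : ℝ) ^ p.gam) (rhoSC (mid y)) ((k : ℝ) + 1)
      (N * (y (-1) - y (-((k + 1 : ℕ) : ℤ)))) := fun k hk' => by
    have := k2 (k + 1) (by omega) (by omega)
    rwa [Nat.cast_add_one (R := ℝ) k] at this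
  have pR := profile_of_countBound (M := numExt p N) hc0 hρc hn hg1 hD hD₁0 t1 t2 t3 cR
    (rightGap_eq hl hN.N_pos hρ0)
  have pL := profile_of_countBound (M := numExt p N) hc0 hρc hn hg1 hD hD₁0 t1 t2 t3 cL
    (leftGap_eq hl hN.N_pos hρ0)
  rw [← hQ] at pR pL
  have hS := sum_extSet_eq hl hy r1 r2
  refine ⟨⟨isExt_extSet hl hy (by omega) r1 r2, ?_, ?_⟩, ?_, t2⟩
  · refine le_trans ?_ (le_convexity hD hnM hS (fun k hk' => pR.nonneg k (by omega))
      fun k hk' => ?_)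
    · rw [div_eq_mul_inv]
      refine mul_le_mul_of_nonneg_left ?_ (by linarith)
      rw [inv_eq_one_div, div_le_div_iff₀ (by positivity) (by positivity)]
      have : 0 < 2592 * Q ^ 4 := by positivity
      nlinarith
    · rw [rightGap_eq hl hN.N_pos hρ0]
      exact gap_le hρ1 hn hgn hD t2 (by exact_mod_cast hk') (cR k (by omega))
  · refine (sum_latForce_sq_le pR pL (one_le_mul_of_one_le_of_one_le hQ1 hg1) hM hS).trans ?_
    have h4 : ((p.n N : ℝ) + 1) ^ 2 ≤ 4 * (p.n N : ℝ) ^ 2 := by nlinarith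
    calc 648 * (Q * (p.n N : ℝ) ^ p.gam) ^ 4 * ((p.n N : ℝ) + 1) ^ 2 * harm (numExt p N) ^ 2 *
          √(p.n N)
        ≤ 648 * (Q * (p.n N : ℝ) ^ p.gam) ^ 4 * (4 * (p.n N : ℝ) ^ 2) * harm (numExt p N) ^ 2 *
          √(p.n N) := by gcongr
      _ = (2592 * Q ^ 4) * ((p.n N : ℝ) ^ p.gam) ^ 4 * (p.n N : ℝ) ^ 2 *
          harm (numExt p N) ^ 2 * √(p.n N) := by ring
      _ ≤ _ := by gcongr; linarith [show 0 ≤ 50 * D ^ 2 by positivity]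
  · refine t1.trans ?_
    gcongr
    linarith [show 0 ≤ 50 * D ^ 2 by positivity, show 0 ≤ 2592 * Q ^ 4 by positivity]

/-- The mean square displacement summed over all particles is at most of order `n^{1/2+6γ}`.
Tolerating displacements up to `s = n^{-1/8-γ/3}` costs `s n` particles at the ends and `n^{1/2+6γ}
/ s²` by Chebyshev; both are `O(n^{7/8-γ/3})` because `7γ ≤ 1/8`. -/
theorem ExtBound.abs_integral_dens_sub_le {E : ℝ} {S : Finset ℝ} {P : ℕ → ℝ[X]} {m : ℕ}
    (hE : 0 < E) (h : ExtBound p E N S) (hm : p.n N = m + 1)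
    (hP : IsOrthonormalPolys (wt S) P) (hγ : 0 < p.gam) (hγ' : p.gam < 1 / 150)
    (hlog : 1 + Real.log ((p.n N : ℝ) ^ p.B) ≤ (p.n N : ℝ) ^ p.gam)
    {a b : ℝ} (ha : -1 ≤ a) (hab : a ≤ b) (hb : b ≤ 1) :
    |(∫ t in a..b, dens S P (m + 1) t) - (b - a) * ((p.n N : ℝ) + 1) / 2| ≤
      (3 + 2 * E + E ^ 3) * (p.n N : ℝ) ^ (7 / 8 - p.gam / 3) := by
  have hn := p.one_le_n N
  set x : ℝ := (p.n N : ℝ) with hx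
  have hx0 : 0 < x := by linarith
  have hxm : (m : ℝ) + 1 = x := by rw [hx, hm]; push_cast; ring
  have hxm2 : (m : ℝ) + 2 = x + 1 := by linarith
  have hpow : ∀ {s t : ℝ}, s ≤ t → x ^ s ≤ x ^ t := fun h =>
    Real.rpow_le_rpow_of_exponent_le hn h
  have hs : 0 < x ^ (-(1 / 8) - p.gam / 3) := by positivity
  have h1 := abs_integral_kern_sub_le h.isExt hP m ha hab hb hs
  have hfor := h.force
  have hcon := h.convexity_ge
  have hc0 := convexity_pos h.isExt
  rw [hxm2, hxm] at h1
  refine h1.trans ?_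
  have hM : harm (numExt p N) ≤ x ^ p.gam := by
    refine (harm_le_one_add_log _).trans ?_
    rcases Nat.eq_zero_or_pos (numExt p N) with h0 | h0
    · rw [h0, Nat.cast_zero, Real.log_zero, add_zero]
      exact Real.one_le_rpow hn hγ.le
    · have := ((lt_numExt_iff (p := p) (N := N) h0).1 le_rfl).le
      have h3 : (0 : ℝ) < numExt p N := by exact_mod_cast h0
      linarith [Real.log_le_log h3 this]
  have hh0 : 0 ≤ harm (numExt p N) := Finset.sum_nonneg fun k _ => by positivity
  have hΦ : ∑ r, latForce S (m + 1) r ^ 2 ≤ E * x ^ (5 / 2 + 6 * p.gam) := by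
    rw [← hm]
    refine hfor.trans ?_
    calc E * (x ^ p.gam) ^ 4 * x ^ 2 * harm (numExt p N) ^ 2 * √x
        ≤ E * (x ^ p.gam) ^ 4 * x ^ 2 * (x ^ p.gam) ^ 2 * √x := by gcongr
      _ = E * ((x ^ p.gam) ^ (4 : ℝ) * x ^ (2 : ℝ) * (x ^ p.gam) ^ (2 : ℝ) * x ^ (1 / 2 : ℝ)) := by
          rw [Real.sqrt_eq_rpow]; norm_cast; ring
      _ = _ := by
          rw [← Real.rpow_mul hx0.le, ← Real.rpow_mul hx0.le, ← Real.rpow_add hx0,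
            ← Real.rpow_add hx0, ← Real.rpow_add hx0]
          congr 2; ring
  have hc1 : (convexity S)⁻¹ ≤ E / x := by
    rw [← inv_div]
    exact inv_anti₀ (by positivity) hcon
  have hΔ : 2 * x / convexity S + (∑ r, latForce S (m + 1) r ^ 2) / convexity S ^ 2 ≤
      (2 * E + E ^ 3) * x ^ (1 / 2 + 6 * p.gam) := by
    have e1 : 2 * x / convexity S ≤ 2 * E * x ^ (1 / 2 + 6 * p.gam) := by
      calc 2 * x / convexity S = 2 * x * (convexity S)⁻¹ := by ring
        _ ≤ 2 * x * (E / x) := by gcongr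
        _ = 2 * E * 1 := by field_simp
        _ ≤ _ := by
            gcongr
            exact Real.one_le_rpow hn (by linarith)
    have e2 : (∑ r, latForce S (m + 1) r ^ 2) / convexity S ^ 2 ≤
        E ^ 3 * x ^ (1 / 2 + 6 * p.gam) := by
      calc _ = (∑ r, latForce S (m + 1) r ^ 2) * (convexity S)⁻¹ ^ 2 := by
            rw [inv_pow]; rfl
        _ ≤ (E * x ^ (5 / 2 + 6 * p.gam)) * (E / x) ^ 2 := by gcongr
        _ = E ^ 3 * (x ^ (5 / 2 + 6 * p.gam) * x ^ (-2 : ℝ)) := by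
            rw [Real.rpow_neg hx0.le]; norm_cast; field_simp
        _ = _ := by rw [← Real.rpow_add hx0]; congr 2; ring
    linarith
  have t1 : x ^ (-(1 / 8) - p.gam / 3) * (x + 1) ≤ 2 * x ^ (7 / 8 - p.gam / 3) := by
    calc x ^ (-(1 / 8) - p.gam / 3) * (x + 1) ≤ x ^ (-(1 / 8) - p.gam / 3) * (2 * x ^ (1 : ℝ)) := by
          rw [Real.rpow_one]; gcongr; linarith
      _ = 2 * (x ^ (-(1 / 8) - p.gam / 3) * x ^ (1 : ℝ)) := by ring
      _ = _ := by rw [← Real.rpow_add hx0]; congr 2; ring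
  have t2 : 1 ≤ x ^ (7 / 8 - p.gam / 3) := Real.one_le_rpow hn (by linarith)
  have t3 : (2 * x / convexity S + (∑ r, latForce S (m + 1) r ^ 2) / convexity S ^ 2) /
      (x ^ (-(1 / 8) - p.gam / 3)) ^ 2 ≤ (2 * E + E ^ 3) * x ^ (7 / 8 - p.gam / 3) := by
    rw [div_le_iff₀ (by positivity)]
    refine hΔ.trans ?_
    rw [mul_assoc]
    refine mul_le_mul_of_nonneg_left ?_ (by positivity)
    have : (x ^ (-(1 / 8) - p.gam / 3)) ^ 2 = x ^ (-(1 / 4) - 2 * p.gam / 3) := by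
      rw [← Real.rpow_natCast, ← Real.rpow_mul hx0.le]
      congr 1; push_cast; ring
    rw [this, ← Real.rpow_add hx0]
    exact hpow (by linarith)
  linarith

end

section

/-! ### Bulk estimates -/

variable {p : Params} {N : ℕ} {S : Finset ℝ} {P : ℕ → ℝ[X]} {m : ℕ}

/-- The points `±1` add at most `2 / δ` to the sum of inverse distances; `sum_extMoment_le` for the
indices `m` and `m + 1` gives the moments. -/
theorem bulkBound_of_abs_le (hS : IsExt S) (hP : IsOrthonormalPolys (wt S) P) {D δ t : ℝ}
    (hδ : 0 < δ) (hD : ∑ u ∈ S.filter (fun u => 1 < |u|), 1 / (|u| - 1) ≤ D) (ht : |t| ≤ 1 - δ) :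
    BulkBound S P m (4 * D + 2 * m + 6 + 2 / δ) δ t := by
  have hdist : ∀ u ∈ S, δ ≤ |t - u| := fun u hu => by
    have h1 := hS.one_le u hu
    have h2 := abs_sub_abs_le_abs_sub u t
    rw [abs_sub_comm]; linarith
  have hD0 : 0 ≤ D := le_trans (Finset.sum_nonneg fun u hu => by
    have := (Finset.mem_filter.1 hu).2
    exact div_nonneg zero_le_one (by linarith)) hD
  refine ⟨hδ, hdist, ?_, ?_⟩
  · rw [← Finset.sum_filter_add_sum_filter_not S (fun u => 1 < |u|)]
    have h1 : ∑ u ∈ S.filter (fun u => 1 < |u|), 1 / |t - u| ≤ D := by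
      refine (Finset.sum_le_sum fun u hu => ?_).trans hD
      have h3 := (Finset.mem_filter.1 hu).2
      have h2 := abs_sub_abs_le_abs_sub u t
      refine one_div_le_one_div_of_le (by linarith) ?_
      rw [abs_sub_comm]; linarith
    have h2 : ∑ u ∈ S.filter (fun u => ¬1 < |u|), 1 / |t - u| ≤ 2 / δ := by
      have hc : (S.filter (fun u => ¬1 < |u|)).card ≤ 2 := by
        refine (Finset.card_le_card (t := {1, -1}) fun u hu => ?_).trans Finset.card_le_two
        obtain ⟨h3, h4⟩ := Finset.mem_filter.1 hu
        have h5 : |u| = 1 := le_antisymm (not_lt.1 h4) (hS.one_le u h3)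
        rcases abs_eq (zero_le_one' ℝ) |>.1 h5 with rfl | rfl <;> simp
      calc _ ≤ ∑ u ∈ S.filter (fun u => ¬1 < |u|), 1 / δ := Finset.sum_le_sum fun u hu =>
            one_div_le_one_div_of_le hδ (hdist u (Finset.mem_filter.1 hu).1)
        _ = ((S.filter (fun u => ¬1 < |u|)).card : ℝ) * (1 / δ) := by
            rw [Finset.sum_const, nsmul_eq_mul]
        _ ≤ 2 * (1 / δ) := by gcongr; exact_mod_cast hc
        _ = _ := by ring
    have hm : (0 : ℝ) ≤ m := by positivity
    linarith
  · rw [Finset.sum_add_distrib]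
    have h1 := sum_extMoment_le hS hP m hD
    have h2 := sum_extMoment_le hS hP (m + 1) hD
    push_cast at h2
    have : 0 < 2 / δ := by positivity
    linarith

/-- `N` is so large that the windows of width `n ^ (-1 / 8)` are useful. -/
structure LargeWindow (p : Params) (E κ : ℝ) (N : ℕ) : Prop where
  log_le : 1 + Real.log ((p.n N : ℝ) ^ p.B) ≤ (p.n N : ℝ) ^ p.gam
  width_le : (p.n N : ℝ) ^ (-(1 / 8) : ℝ) ≤ κ / 2
  error_le : (3 + 2 * E + E ^ 3) * (p.n N : ℝ) ^ (-(p.gam / 3)) ≤ 1 / 2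
  le_mass : 24 ≤ (p.n N : ℝ) ^ (7 / 8 : ℝ)

-- All bulk estimates combined. The window of half-width `n^{-1/8}` holds at least `n^{7/8} / 2`
-- particles, so the two top functions have mass `O(n^{-1/8+3γ})` there. Multiplying by the rate
-- `n^{1+3γ}` gives both their pointwise size and the oscillation of the density.
set_option maxHeartbeats 800000 in
theorem exists_bulk_const (p : Params) {E κ : ℝ} (hE : 0 < E) (hκ : 0 < κ) (hγ : 0 < p.gam)
    (hγ' : p.gam < 1 / 150) (hC : 0 < p.C) :
    ∃ C : ℝ, 0 < C ∧ ∀ (N m : ℕ) (S : Finset ℝ) (P : ℕ → ℝ[X]), p.n N = m + 1 →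
      LargeWindow p E κ N → ExtBound p E N S → IsOrthonormalPolys (wt S) P →
      ∑ u ∈ S.filter (fun u => 1 < |u|), 1 / (|u| - 1) ≤ p.C * (p.n N : ℝ) ^ (1 + 3 * p.gam) →
      ∀ t : ℝ, |t| ≤ 1 - κ →
        (∃ D, HasDerivAt (dens S P (m + 1)) D t ∧
          |D| ≤ C * (p.n N : ℝ) ^ (1 + 3 * p.gam) * pairSq S P m t) ∧
        pairSq S P m t ≤ C * (p.n N : ℝ) ^ (7 / 8 + 6 * p.gam) ∧
        |dens S P (m + 1) t - ((p.n N : ℝ) + 1) / 2| ≤ C * (p.n N : ℝ) ^ (1 - p.gam / 3) := by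
  -- Half of `κ` is left for the window, which thus stays at distance `δ` from all external points.
  set δ : ℝ := κ / 2 with hδ
  have hδ0 : 0 < δ := by positivity
  set T₀ : ℝ := 4 * p.C + 8 + 2 / δ with hT₀
  have hT₀0 : 1 ≤ T₀ := by
    have : 0 < 2 / δ := by positivity
    linarith
  set c₁ : ℝ := T₀ * (1 / δ + 2 / δ ^ 2) with hc₁
  set c₂ : ℝ := 64 * T₀ / δ with hc₂
  set c₃ : ℝ := 30 * T₀ * (1 + 1 / δ) with hc₃
  have hc₁0 : 0 < c₁ := by positivity
  have hc₂0 : 0 < c₂ := by positivity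
  have hc₃0 : 0 < c₃ := by positivity
  set F : ℝ := 3 + 2 * E + E ^ 3 with hF
  have hF0 : 0 < F := by positivity
  refine ⟨c₁ + c₃ * c₂ + (c₁ * c₂ + F), by positivity,
    fun N m S P hm hW hX hP hD t ht => ?_⟩
  have hn := p.one_le_n N
  have hrig := fun {a b : ℝ} => hX.abs_integral_dens_sub_le (P := P) (a := a) (b := b) hE hm hP
    hγ hγ' hW.log_le
  obtain ⟨-, hw, herr, hmass⟩ := hW
  set x : ℝ := (p.n N : ℝ) with hx
  have hx0 : 0 < x := by linarith
  have hxm : (m : ℝ) + 1 = x := by rw [hx, hm]; push_cast; ring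
  have hpow : ∀ {s t : ℝ}, s ≤ t → x ^ s ≤ x ^ t := fun h =>
    Real.rpow_le_rpow_of_exponent_le hn h
  set T : ℝ := T₀ * x ^ (1 + 3 * p.gam) with hT
  have hTx : x ≤ x ^ (1 + 3 * p.gam) := by
    conv_lhs => rw [← Real.rpow_one x]
    exact hpow (by linarith)
  have hTle : 4 * (p.C * x ^ (1 + 3 * p.gam)) + 2 * m + 6 + 2 / δ ≤ T := by
    have h1 : 2 / δ ≤ 2 / δ * x ^ (1 + 3 * p.gam) :=
      le_mul_of_one_le_right (by positivity) (hn.trans hTx)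
    rw [hT, hT₀]
    nlinarith
  have hT0 : 0 < T := by positivity
  have hb : ∀ s : ℝ, |s| ≤ 1 - δ → BulkBound S P m T δ s := fun s hs => by
    have := bulkBound_of_abs_le (m := m) hX.isExt hP hδ0 hD hs
    exact ⟨this.delta_pos, this.dist_le, this.sum_inv_le.trans hTle, this.moment_le.trans hTle⟩
  set η : ℝ := x ^ (-(1 / 8) : ℝ) with hη
  have hη0 : 0 < η := by positivity
  have hηx : η * x = x ^ (7 / 8 : ℝ) := by
    calc η * x = x ^ (-(1 / 8) : ℝ) * x ^ (1 : ℝ) := by rw [Real.rpow_one]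
      _ = _ := by rw [← Real.rpow_add hx0]; norm_num
  have ht' := abs_le.1 ht
  have hbt : ∀ s, |s - t| ≤ η → BulkBound S P m T δ s := fun s hs => hb s (by
    have := abs_le.1 hs
    rw [abs_le]; constructor <;> linarith)
  have hbtt := hbt t (by simpa using hη0.le)
  have hrt := hrig (a := t - η) (b := t + η) (by linarith) (by linarith) (by linarith)
  have e1 : (t + η - (t - η)) * (x + 1) / 2 = η * (x + 1) := by ring
  rw [e1] at hrt
  have hFx : F * x ^ (7 / 8 - p.gam / 3) ≤ x ^ (7 / 8 : ℝ) / 2 := by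
    have : x ^ (7 / 8 - p.gam / 3) = x ^ (-(p.gam / 3)) * x ^ (7 / 8 : ℝ) := by
      rw [← Real.rpow_add hx0]; congr 1; ring
    rw [this, ← mul_assoc]
    refine (mul_le_mul_of_nonneg_right herr (by positivity)).trans (le_of_eq (by ring))
  have hmass1 : x ^ (7 / 8 : ℝ) / 2 ≤ ∫ s in (t - η)..(t + η), dens S P (m + 1) s := by
    have h1 := (abs_le.1 hrt).1
    have : η * (x + 1) = x ^ (7 / 8 : ℝ) + η := by rw [mul_add, hηx, mul_one]
    linarith
  have hpair := integral_pairSq_le hX.isExt hP m hη0 hδ0 hbtt.dist_le (by linarith) (by linarith)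
    hbtt.moment_le (by linarith) hmass1
  have hpair' : ∫ s in (t - η)..(t + η), pairSq S P m s ≤ c₂ * x ^ (-(1 / 8) + 3 * p.gam) := by
    refine hpair.trans (le_of_eq ?_)
    have e2 : η ^ 2 * x ^ (1 + 3 * p.gam) = x ^ (-(1 / 8) + 3 * p.gam) * x ^ (7 / 8 : ℝ) := by
      rw [hη, ← Real.rpow_natCast, ← Real.rpow_mul hx0.le, ← Real.rpow_add hx0,
        ← Real.rpow_add hx0]
      congr 1; push_cast; ring
    have hδ1 : 64 * T₀ / δ * δ = 64 * T₀ := div_mul_cancel₀ _ hδ0.ne'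
    rw [hT, hc₂, div_eq_iff (by positivity)]
    linear_combination 32 * T₀ * e2 -
      (x ^ (-(1 / 8) + 3 * p.gam) * x ^ (7 / 8 : ℝ) / 2) * hδ1
  have hpair0 : 0 ≤ ∫ s in (t - η)..(t + η), pairSq S P m s :=
    intervalIntegral.integral_nonneg (by linarith) fun s _ => pairSq_nonneg _ _ _ _
  have hTc : T * (1 / δ + 2 / δ ^ 2) = c₁ * x ^ (1 + 3 * p.gam) := by rw [hT, hc₁]; ring
  have hfin1 : c₁ ≤ c₁ + c₃ * c₂ + (c₁ * c₂ + F) := by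
    have : 0 < c₃ * c₂ := by positivity
    have : 0 < c₁ * c₂ := by positivity
    linarith
  have hfin2 : c₃ * c₂ ≤ c₁ + c₃ * c₂ + (c₁ * c₂ + F) := by
    have : 0 < c₁ * c₂ := by positivity
    linarith
  have hfin3 : c₁ * c₂ + F ≤ c₁ + c₃ * c₂ + (c₁ * c₂ + F) := by
    have : 0 < c₃ * c₂ := by positivity
    linarith
  rw [← hF] at hrt
  clear_value δ T₀ c₁ c₂ c₃ F T η x
  refine ⟨?_, ?_, ?_⟩
  · obtain ⟨D, hD1, hD2⟩ := exists_hasDerivAt_kern_self hX.isExt hP hbtt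
    refine ⟨D, hD1, hD2.trans ?_⟩
    rw [hTc]
    have := pairSq_nonneg S P m t
    gcongr
  · have hLη : 1 / (10 * T * (1 + 1 / δ)) ≤ η := by
      rw [div_le_iff₀ (by positivity)]
      have h1 : 1 ≤ x ^ (7 / 8 : ℝ) := by linarith
      have h2 : x ≤ 10 * T * (1 + 1 / δ) := by
        have h3 : x ≤ T := hTx.trans (by
          rw [hT]; exact le_mul_of_one_le_left (by positivity) hT₀0)
        have h4 : 0 ≤ T * (1 / δ) := by positivity
        have h5 : 10 * T * (1 + 1 / δ) = 10 * T + 10 * (T * (1 / δ)) := by ring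
        linarith
      calc 1 ≤ η * x := by rw [hηx]; exact h1
        _ ≤ _ := by gcongr
    have h1 := le_integral_of_abs_deriv_le (continuous_pairSq S P m) (pairSq_nonneg S P m)
      (x := t) (l := η) (L := 10 * T * (1 + 1 / δ)) (by positivity) hLη
      fun s hs => exists_hasDerivAt_pairSq hX.isExt hP (hbt s hs)
    refine h1.trans ?_
    calc 3 * (10 * T * (1 + 1 / δ)) * ∫ s in (t - η)..(t + η), pairSq S P m s
        ≤ 3 * (10 * T * (1 + 1 / δ)) * (c₂ * x ^ (-(1 / 8) + 3 * p.gam)) := by gcongr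
      _ = c₃ * c₂ * (x ^ (1 + 3 * p.gam) * x ^ (-(1 / 8) + 3 * p.gam)) := by
          rw [hT, hc₃]; ring
      _ = c₃ * c₂ * x ^ (7 / 8 + 6 * p.gam) := by
          rw [← Real.rpow_add hx0]; congr 2; ring
      _ ≤ _ := by gcongr
  · have h1 := abs_dens_sub_mean_le hX.isExt hP hη0 hbt
    rw [hTc] at h1
    have h2 : 2 * η * (c₁ * x ^ (1 + 3 * p.gam) * ∫ s in (t - η)..(t + η), pairSq S P m s) ≤
        2 * η * (c₁ * c₂ * x ^ (1 - p.gam / 3)) := by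
      -- The oscillation is of order `n^{7/8+6γ}`, below the target `n^{1-γ/3}` because `γ < 1/150`.
      have e3 : x ^ (1 + 3 * p.gam) * x ^ (-(1 / 8) + 3 * p.gam) ≤ x ^ (1 - p.gam / 3) := by
        rw [← Real.rpow_add hx0]; exact hpow (by linarith)
      calc _ ≤ 2 * η * (c₁ * x ^ (1 + 3 * p.gam) * (c₂ * x ^ (-(1 / 8) + 3 * p.gam))) := by gcongr
        _ = 2 * η * (c₁ * c₂ * (x ^ (1 + 3 * p.gam) * x ^ (-(1 / 8) + 3 * p.gam))) := by ring
        _ ≤ _ := by gcongr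
    have h3 : F * x ^ (7 / 8 - p.gam / 3) = η * (F * x ^ (1 - p.gam / 3)) := by
      have : x ^ (7 / 8 - p.gam / 3) = η * x ^ (1 - p.gam / 3) := by
        rw [hη, ← Real.rpow_add hx0]; congr 1; ring
      rw [this]; ring
    rw [h3] at hrt
    set I := ∫ s in (t - η)..(t + η), dens S P (m + 1) s
    set X := x ^ (1 - p.gam / 3)
    have hX0 : 0 < X := by positivity
    have h4 : |2 * η * dens S P (m + 1) t - η * (x + 1)| ≤
        2 * η * (c₁ * c₂ * X) + η * (F * X) := by
      have := abs_add_le (2 * η * dens S P (m + 1) t - I) (I - η * (x + 1))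
      rw [sub_add_sub_cancel] at this
      linarith
    have h5 : 2 * η * dens S P (m + 1) t - η * (x + 1) =
        2 * η * (dens S P (m + 1) t - (x + 1) / 2) := by ring
    rw [h5, abs_mul, abs_of_pos (by positivity)] at h4
    have h6 : 2 * η * |dens S P (m + 1) t - (x + 1) / 2| ≤ 2 * η * ((c₁ * c₂ + F) * X) := by
      have : 0 ≤ η * (F * X) := by positivity
      linarith
    refine (le_of_mul_le_mul_left h6 (by positivity)).trans ?_
    gcongr

end

section

/-! ### All conditions hold for large `N` -/

open Filter Topology

theorem Params.n_le (p : Params) (heps : 0 < p.eps) {N : ℕ} (hN : 1 ≤ N) :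
    (p.n N : ℝ) ≤ 2 * (N : ℝ) ^ p.eps := by
  have h1 : (1 : ℝ) ≤ (N : ℝ) ^ p.eps := Real.one_le_rpow (by exact_mod_cast hN) heps.le
  have h2 := Nat.floor_le (by positivity : 0 ≤ (N : ℝ) ^ p.eps / 2)
  unfold Params.n
  push_cast
  linarith

theorem Params.le_n (p : Params) (N : ℕ) : (N : ℝ) ^ p.eps - 1 ≤ p.n N := by
  have h2 := Nat.lt_floor_add_one ((N : ℝ) ^ p.eps / 2)
  unfold Params.n
  push_cast
  linarith

theorem Params.tendsto_n (p : Params) (heps : 0 < p.eps) :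
    Tendsto (fun N => (p.n N : ℝ)) atTop atTop := by
  refine tendsto_atTop_mono (p.le_n) ?_
  exact tendsto_atTop_add_const_right _ _
    ((tendsto_rpow_atTop heps).comp tendsto_natCast_atTop_atTop)

/-- Since `n ≤ 2 N^ε`, this is the assumption `B ε < 1/2`. It makes the physical window so short
that the variation of the semicircle density displaces only a bounded number of points. -/
theorem Params.tendsto_pow_div (p : Params) (heps : 0 < p.eps) (hB : 0 < p.B)
    (hBeps : p.B * p.eps < 1 / 2) :
    Tendsto (fun N : ℕ => (p.n N : ℝ) ^ (2 * p.B) / N) atTop (𝓝 0) := by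
  have h0 : Tendsto (fun N : ℕ => 2 ^ (2 * p.B) * (N : ℝ) ^ (-(1 - 2 * p.B * p.eps))) atTop
      (𝓝 (2 ^ (2 * p.B) * 0)) :=
    ((tendsto_rpow_neg_atTop (by linarith)).comp tendsto_natCast_atTop_atTop).const_mul _
  rw [mul_zero] at h0
  refine tendsto_of_tendsto_of_tendsto_of_le_of_le' tendsto_const_nhds h0
    (Eventually.of_forall fun N => by positivity) ?_
  filter_upwards [eventually_ge_atTop 1] with N hN
  have hN' : (0 : ℝ) < N := by exact_mod_cast hN
  have hn := p.one_le_n N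
  rw [div_le_iff₀ hN']
  calc (p.n N : ℝ) ^ (2 * p.B) ≤ (2 * (N : ℝ) ^ p.eps) ^ (2 * p.B) :=
        Real.rpow_le_rpow (by linarith) (p.n_le heps hN) (by positivity)
    _ = 2 ^ (2 * p.B) * (N : ℝ) ^ (p.eps * (2 * p.B)) := by
        rw [Real.mul_rpow (by norm_num) (by positivity), ← Real.rpow_mul hN'.le]
    _ = 2 ^ (2 * p.B) * ((N : ℝ) ^ (-(1 - 2 * p.B * p.eps)) * (N : ℝ) ^ (1 : ℝ)) := by
        rw [← Real.rpow_add hN']; congr 2; ring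
    _ = _ := by rw [Real.rpow_one]; ring

theorem eventually_rpow_neg_le {s c : ℝ} (hs : 0 < s) (hc : 0 < c) :
    ∀ᶠ x : ℝ in atTop, x ^ (-s) ≤ c :=
  ((tendsto_rpow_neg_atTop hs).eventually (gt_mem_nhds hc)).mono fun _ h => h.le

theorem eventually_le_rpow {s : ℝ} (hs : 0 < s) (c : ℝ) : ∀ᶠ x : ℝ in atTop, c ≤ x ^ s :=
  (tendsto_rpow_atTop hs).eventually (eventually_ge_atTop c)

theorem eventually_largeWindow (p : Params) {E κ : ℝ} (heps : 0 < p.eps) (hγ : 0 < p.gam)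
    (hB : 0 < p.B) (hE : 0 < E) (hκ : 0 < κ) : ∀ᶠ N in atTop, LargeWindow p E κ N := by
  have hF : 0 < 3 + 2 * E + E ^ 3 := by positivity
  have h1 : ∀ᶠ x : ℝ in atTop, 1 + Real.log (x ^ p.B) ≤ x ^ p.gam := by
    have h := (isLittleO_log_rpow_atTop hγ).bound (by positivity : 0 < 1 / (2 * p.B))
    filter_upwards [h, eventually_le_rpow hγ 2, eventually_ge_atTop 1] with x hx hx2 hx1
    rw [Real.log_rpow (by linarith)]
    rw [Real.norm_of_nonneg (Real.log_nonneg hx1), Real.norm_of_nonneg (by positivity),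
      div_mul_eq_mul_div, one_mul, le_div_iff₀ (by positivity)] at hx
    linarith
  filter_upwards [(p.tendsto_n heps).eventually h1,
    (p.tendsto_n heps).eventually
      (eventually_rpow_neg_le (by norm_num : (0 : ℝ) < 1 / 8) (by positivity : 0 < κ / 2)),
    (p.tendsto_n heps).eventually (eventually_rpow_neg_le (by positivity : 0 < p.gam / 3)
      (by positivity : 0 < 1 / (2 * (3 + 2 * E + E ^ 3)))),
    (p.tendsto_n heps).eventually (eventually_le_rpow (by norm_num : (0 : ℝ) < 7 / 8) 24)]
    with N a b c d
  refine ⟨a, b, ?_, d⟩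
  calc _ ≤ (3 + 2 * E + E ^ 3) * (1 / (2 * (3 + 2 * E + E ^ 3))) := by gcongr
    _ = 1 / 2 := by field_simp

theorem eventually_exp_small (p : Params) (heps : 0 < p.eps) (hγ : 0 < p.gam) :
    ∀ᶠ N in atTop, p.C * Real.exp (-(p.n N : ℝ) ^ (p.gam / 12)) < 1 := by
  have h : Tendsto (fun N => p.C * Real.exp (-(p.n N : ℝ) ^ (p.gam / 12))) atTop
      (𝓝 (p.C * 0)) :=
    (Real.tendsto_exp_neg_atTop_nhds_zero.comp ((tendsto_rpow_atTop (by positivity)).comp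
      (p.tendsto_n heps))).const_mul _
  rw [mul_zero] at h
  exact h.eventually (gt_mem_nhds one_pos)

theorem eventually_large (p : Params) {W D : ℝ} (heps : 0 < p.eps) (hγ : 0 < p.gam)
    (hγ' : p.gam < 1 / 150) (hk : 0 < p.kap) (hB : 20 ≤ p.B) (hBeps : p.B * p.eps < 1 / 2)
    (hW : 0 < W) (hD : 1 ≤ D) : ∀ᶠ N in atTop, Large p W D N := by
  have hn := p.tendsto_n heps
  have hk32 : 0 < p.kap ^ (3 / 2 : ℝ) := by positivity
  have hs : 0 < √p.kap := Real.sqrt_pos.2 hk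
  have hq := p.tendsto_pow_div heps (by linarith) hBeps
  have hq' : ∀ {c : ℝ}, 0 < c → ∀ᶠ N : ℕ in atTop, (p.n N : ℝ) ^ (2 * p.B) / N < c :=
    fun hc => hq.eventually (gt_mem_nhds hc)
  filter_upwards [eventually_ge_atTop 1, hn.eventually (eventually_ge_atTop 2),
    hn.eventually (eventually_rpow_neg_le (by positivity : 0 < p.gam / 6)
      (by positivity : 0 < p.kap ^ (3 / 2 : ℝ) / 48)),
    hn.eventually (eventually_rpow_neg_le (by linarith : 0 < 1 / 4 - p.gam)
      (by positivity : 0 < 1 / (2 * (3 * D + 1)))),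
    hn.eventually (eventually_le_rpow (by linarith : 0 < p.B - 1) (p.K / W)),
    hq' (by positivity : 0 < p.kap ^ (3 / 2 : ℝ) / 6), hq' (by positivity : 0 < p.kap / 4),
    hq' (by positivity : 0 < p.kap / 8 / W), hq' (by positivity : 0 < √p.kap / (2 * W ^ 2)),
    hq' one_pos,
    (tendsto_natCast_atTop_atTop (R := ℝ)).eventually
      (eventually_le_rpow (by norm_num : (0 : ℝ) < 1 / 6) (2 * W))]
    with N hN h2 h3 h4 h5 q1 q2 q3 q4 q5 h6
  have hN' : (0 : ℝ) < N := by exact_mod_cast hN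
  have hx1 := p.one_le_n N
  set x : ℝ := (p.n N : ℝ) with hx
  have hx0 : 0 < x := by linarith
  have hpow : ∀ {s t : ℝ}, s ≤ t → x ^ s ≤ x ^ t := fun h =>
    Real.rpow_le_rpow_of_exponent_le hx1 h
  have hxB : x ≤ x ^ (2 * p.B) := by
    conv_lhs => rw [← Real.rpow_one x]
    exact hpow (by linarith)
  have hBB : x ^ p.B ≤ x ^ (2 * p.B) := hpow (by linarith)
  have hB2 : (x ^ p.B) ^ 2 = x ^ (2 * p.B) := by
    rw [← Real.rpow_natCast, ← Real.rpow_mul hx0.le]; congr 1; push_cast; ring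
  have hr : radius p W N = W * x ^ p.B / N := rfl
  have hNr : N * (2 * radius p W N) = 2 * W * x ^ p.B := by rw [hr]; field_simp
  refine ⟨hN, (Nat.cast_le (α := ℝ)).1 (by simpa only [Nat.cast_ofNat] using h2), ?_, ?_, ?_, ?_, ?_, ?_, ?_, ?_⟩
  · have : x / N ≤ x ^ (2 * p.B) / N := by gcongr
    linarith
  · have : eta p N 0 ≤ x ^ (2 * p.B) / N := by
      rw [eta, pow_zero, one_mul]
      exact div_le_div_of_nonneg_right (hpow (by linarith)) hN'.le
    linarith
  · rw [hr]
    calc W * x ^ p.B / N ≤ W * (x ^ (2 * p.B) / N) := by rw [mul_div_assoc]; gcongr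
      _ ≤ W * (p.kap / 8 / W) := by gcongr
      _ = _ := by field_simp
  · rw [hNr, hr]
    calc 1 / √p.kap * (W * x ^ p.B / N) * (2 * W * x ^ p.B)
        = 2 * W ^ 2 / √p.kap * ((x ^ p.B) ^ 2 / N) := by ring
      _ ≤ 2 * W ^ 2 / √p.kap * (√p.kap / (2 * W ^ 2)) := by rw [hB2]; gcongr
      _ = 1 := by field_simp
  · intro m hm
    rw [hNr] at hm
    have hg1 : (1 : ℝ) ≤ x ^ p.gam := Real.one_le_rpow hx1 hγ.le
    have hsq : x ^ p.B ≤ (N : ℝ) ^ (1 / 2 : ℝ) := by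
      rw [← Real.sqrt_eq_rpow]
      refine Real.le_sqrt_of_sq_le ?_
      rw [hB2]
      rw [div_lt_iff₀ hN', one_mul] at q5
      exact q5.le
    -- Any exponent below `log 2` would do: `2^m ≤ N^{2/3}` and `log 2 > 2/3` give `m ≤ log N`.
    have h7 : (2 : ℝ) ^ m ≤ (N : ℝ) ^ (2 / 3 : ℝ) := by
      calc (2 : ℝ) ^ m ≤ 2 ^ m * x ^ p.gam := le_mul_of_one_le_right (by positivity) hg1
        _ ≤ 2 * W * x ^ p.B := hm
        _ ≤ (N : ℝ) ^ (1 / 6 : ℝ) * (N : ℝ) ^ (1 / 2 : ℝ) := by gcongr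
        _ = _ := by rw [← Real.rpow_add hN']; norm_num
    have h8 := Real.log_le_log (by positivity) h7
    rw [Real.log_pow, Real.log_rpow hN'] at h8
    have h9 := Real.log_two_gt_d9
    have h10 : 0 ≤ Real.log N := Real.log_natCast_nonneg N
    have h11 : (0 : ℝ) ≤ m := by positivity
    nlinarith
  · rw [hr]
    refine div_le_div_of_nonneg_right ?_ hN'.le
    calc p.K * x = W * (p.K / W) * x := by field_simp
      _ ≤ W * x ^ (p.B - 1) * x := by gcongr
      _ = W * (x ^ (p.B - 1) * x ^ (1 : ℝ)) := by rw [Real.rpow_one]; ring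
      _ = _ := by rw [← Real.rpow_add hx0]; congr 2; ring
  · have a1 : x ^ (2 * p.B) ≤ p.kap ^ (3 / 2 : ℝ) / 6 * N := by
      rw [div_lt_iff₀ hN'] at q1; exact q1.le
    have : 0 < N * p.kap ^ (3 / 2 : ℝ) := by positivity
    linarith
  · have e : x ^ p.gam * x ^ (3 / 4 : ℝ) = x ^ (-(1 / 4 - p.gam)) * x := by
      nth_rw 4 [← Real.rpow_one x]
      rw [← Real.rpow_add hx0, ← Real.rpow_add hx0]; congr 1; ring
    calc (3 * D + 1) * x ^ p.gam * x ^ (3 / 4 : ℝ)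
        = (3 * D + 1) * (x ^ (-(1 / 4 - p.gam)) * x) := by rw [← e]; ring
      _ ≤ (3 * D + 1) * (1 / (2 * (3 * D + 1)) * x) := by gcongr
      _ = x / 2 := by field_simp

end

section

/-! ### The one-point density of the rescaled local equilibrium measure -/

variable {p : Params} {N L : ℕ} {y : ℤ → ℝ} {P : ℕ → ℝ[X]}

/-- The two weights differ only on a finite set, so they have the same orthonormal polynomials. -/
theorem isOrthonormalPolys_wgt_iff (hl : 0 < len y) (hy : StrictMonoOn y (JL N (p.n N) L)) :
    IsOrthonormalPolys (wgt p N L y) P ↔ IsOrthonormalPolys (wt (extSet p N L y)) P := by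
  have h : ∀ j k, ∫ x in (-1 : ℝ)..1, (P j).eval x * (P k).eval x * wgt p N L y x =
      ∫ x in (-1 : ℝ)..1, (P j).eval x * (P k).eval x * wt (extSet p N L y) x := fun j k => by
    refine intervalIntegral.integral_congr_ae ?_
    filter_upwards [compl_mem_ae_iff.2 ((extSet p N L y).finite_toSet.measure_zero volume)]
      with x hx _
    rw [exp_potU hl hy (by simpa using hx)]
  simp only [IsOrthonormalPolys, h]

theorem rho_eq (hl : 0 < len y) (hy : StrictMonoOn y (JL N (p.n N) L)) {m : ℕ}
    (hm : p.n N = m + 1) (hP : IsOrthonormalPolys (wt (extSet p N L y)) P) {t : ℝ}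
    (ht : t ∉ extSet p N L y) : rho p N L y t = dens (extSet p N L y) P (m + 1) t / p.n N := by
  have hm' : p.n N - 1 = m := by rw [hm]; rfl
  have hn : (p.n N : ℝ) = m + 1 := by rw [hm]; push_cast; rfl
  rw [rho, hm', onePoint_eq hP (fun s hs => ?_) ht, hn]
  · rfl
  · rw [← exp_potU hl hy hs, wgt, hm]

theorem rho_eventuallyEq (hl : 0 < len y) (hy : StrictMonoOn y (JL N (p.n N) L)) {m : ℕ}
    (hm : p.n N = m + 1) (hP : IsOrthonormalPolys (wt (extSet p N L y)) P) {t : ℝ}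
    (ht : t ∉ extSet p N L y) :
    rho p N L y =ᶠ[nhds t] fun s => dens (extSet p N L y) P (m + 1) s / p.n N := by
  have : ((extSet p N L y : Set ℝ))ᶜ ∈ nhds t :=
    (extSet p N L y).finite_toSet.isClosed.isOpen_compl.mem_nhds (by simpa using ht)
  filter_upwards [this] with s hs
  exact rho_eq hl hy hm hP (by simpa using hs)

theorem psiSq_add_psiSq (hl : 0 < len y) (hy : StrictMonoOn y (JL N (p.n N) L)) {m : ℕ}
    (hm : p.n N = m + 1) {t : ℝ} (ht : t ∉ extSet p N L y) :
    psiSq (wgt p N L y) P (p.n N - 1) t + psiSq (wgt p N L y) P (p.n N) t =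
      pairSq (extSet p N L y) P m t := by
  have hm' : p.n N - 1 = m := by rw [hm]; rfl
  rw [psiSq, psiSq, exp_potU hl hy ht, hm', hm, pairSq]
  ring

/-- The bound on the density in the original units. -/
theorem abs_density_sub_le {ρ x ℓ d Λ C E γ : ℝ} (hρ : 0 ≤ ρ) (hρ1 : ρ ≤ 1) (hx : 1 ≤ x)
    (hγ : 0 < γ) (hγ1 : γ < 1 / 150) (hC : 0 ≤ C) (hE : 0 ≤ E) (hΛ : Λ = ρ * ℓ)
    (hΛx : (x + 1) / 2 ≤ Λ) (hd : |d - (x + 1) / 2| ≤ C * x ^ (1 - γ / 3))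
    (hθ : |Λ - (x + 1)| ≤ E * x ^ γ * x ^ (3 / 4 : ℝ)) :
    |2 * x / ℓ * (d / x) - ρ| ≤ (4 * C + 2 * E) * x ^ (-(γ / 12)) := by
  have hx0 : 0 < x := by linarith
  have hΛ0 : 0 < Λ := by linarith
  have hρ0 : ρ ≠ 0 := by rintro rfl; simp [hΛ] at hΛ0
  have hℓ0 : ℓ ≠ 0 := by rintro rfl; simp [hΛ] at hΛ0
  -- The leading parts `(x + 1) / 2` of `d` and `x + 1` of `Λ` cancel, leaving the two errors
  -- divided by `Λ`, which is of order `x`.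
  have e : 2 * x / ℓ * (d / x) - ρ = ρ * (2 * (d - (x + 1) / 2) - (Λ - (x + 1))) / Λ := by
    rw [hΛ]; field_simp; ring
  have h1 : |2 * (d - (x + 1) / 2) - (Λ - (x + 1))| ≤
      2 * (C * x ^ (1 - γ / 3)) + E * x ^ γ * x ^ (3 / 4 : ℝ) := by
    refine (abs_sub _ _).trans (add_le_add ?_ hθ)
    rw [abs_mul, abs_two]
    gcongr
  have h2 : x ^ (1 - γ / 3) ≤ x ^ (-(γ / 12)) * x := by
    calc x ^ (1 - γ / 3) ≤ x ^ (-(γ / 12) + 1) :=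
          Real.rpow_le_rpow_of_exponent_le hx (by linarith)
      _ = _ := by rw [Real.rpow_add hx0, Real.rpow_one]
  have h3 : x ^ γ * x ^ (3 / 4 : ℝ) ≤ x ^ (-(γ / 12)) * x := by
    calc x ^ γ * x ^ (3 / 4 : ℝ) ≤ x ^ (-(γ / 12) + 1) := by
          rw [← Real.rpow_add hx0]
          exact Real.rpow_le_rpow_of_exponent_le hx (by linarith)
      _ = _ := by rw [Real.rpow_add hx0, Real.rpow_one]
  rw [e, abs_div, abs_mul, abs_of_nonneg hρ, abs_of_pos hΛ0, div_le_iff₀ hΛ0]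
  set q := x ^ (-(γ / 12))
  have hq : 0 < q := by positivity
  calc ρ * |2 * (d - (x + 1) / 2) - (Λ - (x + 1))|
      ≤ 1 * (2 * (C * x ^ (1 - γ / 3)) + E * x ^ γ * x ^ (3 / 4 : ℝ)) := by gcongr
    _ = 2 * C * x ^ (1 - γ / 3) + E * (x ^ γ * x ^ (3 / 4 : ℝ)) := by ring
    _ ≤ 2 * C * (q * x) + E * (q * x) := by gcongr
    _ = (4 * C + 2 * E) * q * (x / 2) := by ring
    _ ≤ (4 * C + 2 * E) * q * Λ := by gcongr; linarith

end

end LocalEq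

end

/-! ### Assembling the estimates -/

theorem lemma10p1 (p : LocalEq.Params)
    (heps : 0 < p.eps) (heps' : p.eps ≤ 1 / 10)
    (hgam : 0 < p.gam) (hgam' : p.gam < 1 / 150)
    (hkap : 0 < p.kap) (halp : 1 / 4 < p.alp)
    (hB : 20 ≤ p.B) (hBeps : p.B * p.eps < 1 / 2) (hA : 60 * p.B ≤ p.A)
    (hbet : (4 * p.A + 8) * p.eps + p.alp ≤ p.bet)
    (hC : 0 < p.C) (hK : 0 < p.K)
    (κ : ℝ) (hκ : 0 < κ) :
    ∃ C : ℝ, 0 < C ∧ ∃ N₀ : ℕ, ∀ N : ℕ, N₀ ≤ N →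
      ∀ ν₀ ν₁ : MeasureTheory.Measure ℝ,
      MeasureTheory.IsProbabilityMeasure ν₀ → MeasureTheory.IsProbabilityMeasure ν₁ →
      ∫ x, x ∂ν₀ = 0 → ∫ x, x ^ 2 ∂ν₀ = 1 / 2 →
      ∫ x, x ∂ν₁ = 0 → ∫ x, x ^ 2 ∂ν₁ = 1 →
      ∀ f : (Fin N → ℝ) → ℝ, LocalEq.IsEigenvalueDensity N (p.time N) ν₀ ν₁ f →
      ∀ L : ℕ, LocalEq.GoodIndex p N f L →
      ∀ y : ℤ → ℝ, LocalEq.GoodExternal p N f L y →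
      LocalEq.ExternalBound p N L y → LocalEq.EdgeBound p N L y →
        (∀ x : ℝ, |x| ≤ 1 - κ →
          DifferentiableAt ℝ (LocalEq.rho p N L y) x ∧
          |deriv (LocalEq.rho p N L y) x| ≤ C * (p.n N : ℝ) ^ (1 - 1 / 8 + 14 * p.gam) ∧
          ∀ P : ℕ → Polynomial ℝ, LocalEq.IsOrthonormalPolys (LocalEq.wgt p N L y) P →
            |deriv (LocalEq.rho p N L y) x|
              ≤ C * (p.n N : ℝ) ^ (3 * p.gam) *
                  (LocalEq.psiSq (LocalEq.wgt p N L y) P (p.n N - 1) x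
                    + LocalEq.psiSq (LocalEq.wgt p N L y) P (p.n N) x + 1) ∧
            (p.n N : ℝ) ^ (3 * p.gam) *
                  (LocalEq.psiSq (LocalEq.wgt p N L y) P (p.n N - 1) x
                    + LocalEq.psiSq (LocalEq.wgt p N L y) P (p.n N) x + 1)
              ≤ C * (p.n N : ℝ) ^ (1 - 1 / 8 + 14 * p.gam)) ∧
        (∀ x : ℝ, |x| ≤ 1 - 2 * κ →
          |2 * (p.n N : ℝ) / (N * LocalEq.len y) * LocalEq.rho p N L y x
              - LocalEq.rhoSC (LocalEq.mid y)|
            ≤ C * (p.n N : ℝ) ^ (-(p.gam / 12))) := by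
  classical
  have hB1 : 0 < p.B := by linarith
  obtain ⟨D, W, E, hD, hW, hE, hext⟩ :=
    LocalEq.exists_extBound p hkap hK hgam (by linarith) hB
  obtain ⟨C, hC0, hbulk⟩ := LocalEq.exists_bulk_const p hE hκ hgam hgam' hC
  have hev := (LocalEq.eventually_large p heps hgam hgam' hkap hB hBeps hW hD).and
    ((LocalEq.eventually_largeWindow p heps hgam hB1 hE hκ).and
      (LocalEq.eventually_exp_small p heps hgam))
  obtain ⟨N₀, hN₀⟩ := Filter.eventually_atTop.1 hev
  -- Each summand dominates the constant of one of the four bounds.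
  refine ⟨C + (C + 1) + C * (C + 1) + (4 * C + 2 * E), by positivity, N₀,
    fun N hN ν₀ ν₁ _ _ _ _ _ _ f _ L hL y hy hextb _ => ?_⟩
  obtain ⟨hlarge, hwin, hsmall⟩ := hN₀ N hN
  obtain ⟨lam, hcfg⟩ := LocalEq.exists_config hsmall hL hy
  have hmono := hy.1
  have hlen := hcfg.len_pos
  obtain ⟨hX, hθ, hθ2⟩ := hext N L y lam hlarge hcfg hmono
  have hsum := LocalEq.sum_inv_extSet_le hlen hmono hextb
  obtain ⟨m, hm⟩ : ∃ m, p.n N = m + 1 := ⟨_, rfl⟩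
  have hx := p.one_le_n N
  have hx0 : (0 : ℝ) < p.n N := by linarith
  -- Points of the bulk avoid the exceptional set where the logarithmic and the polynomial form of
  -- the weight differ.
  have hmem : ∀ t : ℝ, |t| ≤ 1 - κ → t ∉ LocalEq.extSet p N L y := fun t ht h => by
    have := hX.isExt.one_le t h
    linarith
  have key : ∀ P : ℕ → Polynomial ℝ,
      LocalEq.IsOrthonormalPolys (LocalEq.wt (LocalEq.extSet p N L y)) P → ∀ t : ℝ, |t| ≤ 1 - κ →
      DifferentiableAt ℝ (LocalEq.rho p N L y) t ∧
      |deriv (LocalEq.rho p N L y) t| ≤ C * (p.n N : ℝ) ^ (3 * p.gam) *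
        LocalEq.pairSq (LocalEq.extSet p N L y) P m t ∧
      (p.n N : ℝ) ^ (3 * p.gam) * (LocalEq.pairSq (LocalEq.extSet p N L y) P m t + 1) ≤
        (C + 1) * (p.n N : ℝ) ^ (1 - 1 / 8 + 14 * p.gam) := by
    intro P hP t ht
    obtain ⟨⟨D', hD', hle⟩, hpair, -⟩ :=
      hbulk N m _ P hm hwin hX hP hsum t ht
    -- Dividing the kernel by `n` turns the factor `n^{1+3γ}` of the derivative bound into `n^{3γ}`.
    have hd := (hD'.div_const (p.n N : ℝ)).congr_of_eventuallyEq
      (LocalEq.rho_eventuallyEq hlen hmono hm hP (hmem t ht))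
    refine ⟨hd.differentiableAt, ?_, ?_⟩
    · rw [hd.deriv, abs_div, abs_of_pos hx0, div_le_iff₀ hx0]
      refine hle.trans (le_of_eq ?_)
      rw [Real.rpow_add hx0, Real.rpow_one]
      ring
    · have h1 : (p.n N : ℝ) ^ (3 * p.gam) * (p.n N : ℝ) ^ (7 / 8 + 6 * p.gam) ≤
          (p.n N : ℝ) ^ (1 - 1 / 8 + 14 * p.gam) := by
        rw [← Real.rpow_add hx0]
        exact Real.rpow_le_rpow_of_exponent_le hx (by linarith)
      have h2 : (p.n N : ℝ) ^ (3 * p.gam) ≤ (p.n N : ℝ) ^ (1 - 1 / 8 + 14 * p.gam) :=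
        Real.rpow_le_rpow_of_exponent_le hx (by linarith)
      calc (p.n N : ℝ) ^ (3 * p.gam) * (LocalEq.pairSq (LocalEq.extSet p N L y) P m t + 1)
          ≤ (p.n N : ℝ) ^ (3 * p.gam) * (C * (p.n N : ℝ) ^ (7 / 8 + 6 * p.gam) + 1) := by gcongr
        _ = C * ((p.n N : ℝ) ^ (3 * p.gam) * (p.n N : ℝ) ^ (7 / 8 + 6 * p.gam)) +
            (p.n N : ℝ) ^ (3 * p.gam) := by ring
        _ ≤ C * (p.n N : ℝ) ^ (1 - 1 / 8 + 14 * p.gam) +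
            (p.n N : ℝ) ^ (1 - 1 / 8 + 14 * p.gam) := by gcongr
        _ = _ := by ring
  have hP₀ := LocalEq.isOrthonormalPolys_gsPoly (LocalEq.extSet p N L y)
  set C' : ℝ := C + (C + 1) + C * (C + 1) + (4 * C + 2 * E) with hC'
  have c1 : C ≤ C' := by
    have : 0 < C * (C + 1) := by positivity
    linarith
  have c2 : C + 1 ≤ C' := by
    have : 0 < C * (C + 1) := by positivity
    linarith
  have c3 : C * (C + 1) ≤ C' := by linarith
  have c4 : 4 * C + 2 * E ≤ C' := by
    have : 0 < C * (C + 1) := by positivity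
    linarith
  refine ⟨fun t ht => ?_, fun t ht => ?_⟩
  · obtain ⟨k1, k2, k3⟩ := key _ hP₀ t ht
    refine ⟨k1, ?_, fun P hP => ?_⟩
    · calc _ ≤ C * ((p.n N : ℝ) ^ (3 * p.gam) * (LocalEq.pairSq (LocalEq.extSet p N L y) _ m t + 1)) := by
            refine k2.trans ?_
            have : 0 ≤ C * (p.n N : ℝ) ^ (3 * p.gam) := by positivity
            linarith
        _ ≤ C * ((C + 1) * (p.n N : ℝ) ^ (1 - 1 / 8 + 14 * p.gam)) := by gcongr
        _ = C * (C + 1) * (p.n N : ℝ) ^ (1 - 1 / 8 + 14 * p.gam) := by ring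
        _ ≤ _ := by gcongr
    · obtain ⟨-, j2, j3⟩ :=
        key P ((LocalEq.isOrthonormalPolys_wgt_iff hlen hmono).1 hP) t ht
      rw [LocalEq.psiSq_add_psiSq hlen hmono hm (hmem t ht)]
      have h0 := LocalEq.pairSq_nonneg (LocalEq.extSet p N L y) P m t
      refine ⟨j2.trans ?_, j3.trans ?_⟩
      · gcongr
        linarith
      · gcongr
  · have ht' : |t| ≤ 1 - κ := by linarith
    obtain ⟨-, -, hdens⟩ := hbulk N m _ _ hm hwin hX hP₀ hsum t ht'
    rw [LocalEq.rho_eq hlen hmono hm hP₀ (hmem t ht')]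
    have h := LocalEq.abs_density_sub_le (ℓ := N * LocalEq.len y)
      (LocalEq.rhoSC_nonneg (LocalEq.mid y)) (LocalEq.rhoSC_le_one (LocalEq.mid y)) hx hgam hgam'
      hC0.le hE.le rfl hθ2 hdens hθ
    refine h.trans ?_
    gcongr
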